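/- **Conventions.** Let $k$ be a commutative ring. Operators are written on the right, and $(x\otimes y)(f\otimes g)=(-1)^{|y||f|}xf\otimes yg$. A graded $k$-quiver $s\mathcal A$ has a set of objects and graded $k$-modules $s\mathcal A(X,Y)$; $T^ns\mathcal A(X,Y)=\bigoplus s\mathcal A(X,X_1)\otimes\dots\otimes s\mathcal A(X_{n-1},Y)$ (with $T^0s\mathcal A(X,X)=k$ and $T^0s\mathcal A(X,Y)=0$ for $X\ne Y$), $Ts\mathcal A=\bigoplus_{n\ge0}T^ns\mathcal A$, $T^+s\mathcal A=\bigoplus_{n\ge1}T^ns\mathcal A$; $Ts\mathcal A$ carries the cut comultiplication. An $A_\infty$-category $\mathcal A$ is a quiver with a degree 1 coderivation $b$ of $Ts\mathcal A$ with components $b_n:T^ns\mathcal A\to s\mathcal A$, $b_0=0$, $b^2=0$. An $A_\infty$-functor $f:\mathcal A\to\mathcal B$ is a degree 0 homomorphism of augmented graded cocategories $Ts\mathcal A\to Ts\mathcal B$ (so $f_0=0$) with $fb=bf$. An $A_\infty$-transformation $r\in sA_\infty(\mathcal A,\mathcal B)(f,g)$ of degree $d$ is an $(f,g)$-coderivation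 of degree $d$, i.e. an arbitrary family of degree $d$ components $r_n:T^ns\mathcal A(X,Y)\to s\mathcal B(Xf,Yg)$, $n\ge0$. Put $rB_1=rb-(-1)^{d}br$. For $r:f\to g$ and $p:g\to h$ let $(r\otimes p)\theta=\sum f_{a_1}\otimes\dots\otimes f_{a_\alpha}\otimes r_i\otimes g_{c_1}\otimes\dots\otimes g_{c_\beta}\otimes p_t\otimes h_{e_1}\otimes\dots\otimes h_{e_\gamma}:Ts\mathcal A\to Ts\mathcal B$, and let $(r\otimes p)B_2$ be the coderivation with components $(r\otimes p)\theta b$ followed by the projection to $s\mathcal B$. **Strict $\mathcal K$-2-functors.** Let $\mathcal K$ be the category of complexes of $k$-modules and homotopy classes of chain maps. The non-2-unital $\mathcal K$-2-category $\mathcal KA_\infty$ has $A_\infty$-categories as objects, $A_\infty$-functors as 1-morphisms, the complexes $(A_\infty(\mathcal A,\mathcal B)(f,g),m_1)$, whose suspension is $(sA_\infty(\mathcal A,\mathcal B)(f,g),B_1)$, as complexes of 2-morphisms, vertical composition $m_2=(s\otimes s)B_2s^{-1}$, and actions $r\mapsto rh$, $r\mapsto er$ of 1-morphisms $h$, $e$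 given by composition of maps. In $\mathcal KA'_\infty$ the objects are pairs $(\mathcal A,\mathcal A')$ of an $A_\infty$-category and a full $A_\infty$-subcategory, the 1-morphisms $(\mathcal A,\mathcal A')\to(\mathcal B,\mathcal B')$ are the $A_\infty$-functors $f:\mathcal A\to\mathcal B$ with $(\mathrm{Ob}\,\mathcal A')f\subset\mathrm{Ob}\,\mathcal B'$, and the complexes of 2-morphisms and all operations are those of $\mathcal KA_\infty$. A strict $\mathcal K$-2-functor is a map on objects and 1-morphisms, together with chain maps on complexes of 2-morphisms, which strictly preserves identities and composition of 1-morphisms, and preserves the vertical composition and both actions as morphisms of $\mathcal K$, that is, up to chain homotopy. Passing to $H^0$ of the complexes of 2-morphisms yields the non-2-unital 2-categories $A_\infty$ and $A'_\infty$. **The constructions.** For an $A_\infty$-category $\mathcal A$ let $\underline{\mathcal A}$ be the $A_\infty$-category with $s\underline{\mathcal A}=T^+s\mathcal A$ and $\underline b_1=b|_{T^+s\mathcal A}$, $\underline b_n=0$ for $n\ne1$. For an $A_\infty$-functor $f$ let $\underline f$ be the functor with $\underline f_1=f|_{T^+s\mathcal A}$, $\underline f_n=0$ for $n\ne1$; for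 a transformation $r$ let $\underline r$ be the $(\underline f,\underline g)$-coderivation with $\underline r_0=r_0$, $\underline r_1=r|_{T^+s\mathcal A}$ followed by the projection to $T^+s\mathcal B$, $\underline r_n=0$ for $n>1$. Let $\mathbf m$ be the automorphism of the graded cocategory $T(T^+s\mathcal A)$ with components the multiplications $\mu^{(n)}:(T^+s\mathcal A)^{\otimes n}\to T^+s\mathcal A$, $n\ge1$; its inverse has the components $(-1)^{n-1}\mu^{(n)}$. Put $\overline b=\mathbf m\underline b\mathbf m^{-1}$, $\overline f=\mathbf m\underline f\mathbf m^{-1}$, $\overline r=\mathbf m\underline r\mathbf m^{-1}$, and $\overline{\mathcal A}=(T^+s\mathcal A,\overline b)$. For a full subcategory $\mathcal B\subset\mathcal C$ let $\mathsf D(\mathcal C|\mathcal B)$ have the objects of $\mathcal C$ and $$s\mathsf D(\mathcal C|\mathcal B)(X,Y)=\bigoplus_{n\ge1}\ \bigoplus_{C_1,\dots,C_{n-1}\in\mathcal B}s\mathcal C(X,C_1)\otimes s\mathcal C(C_1,C_2)\otimes\dots\otimes s\mathcal C(C_{n-1},Y)\subset T^+s\mathcal C(X,Y).$$ For $r:f\to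 g$ and $p:g\to h$ let $(r\otimes p)H$ be the $(\underline f,\underline h)$-coderivation with components $[(r\otimes p)H]_0=(r\otimes p)\theta|_{T^0}$ (that is, $r_0\otimes p_0$), $[(r\otimes p)H]_1=(r\otimes p)\theta|_{T^+s\mathcal A}$, and $0$ otherwise; let $(\underline r\otimes\underline p\mid\mathbf m^{-1})M_{20}=(\underline r\otimes\underline p)\theta$ followed by the components $(-1)^{n-1}\mu^{(n)}$ of $\mathbf m^{-1}$, and put $$(r\otimes p)R=\mathbf m\,(r\otimes p)H\,\mathbf m^{-1}+\mathbf m\,(\underline r\otimes\underline p\mid\mathbf m^{-1})M_{20},$$ an $(\overline f,\overline h)$-coderivation. **Theorem.** 1. $\overline{\mathcal A}$ is an $A_\infty$-category, $\overline f:\overline{\mathcal A}\to\overline{\mathcal B}$ is an $A_\infty$-functor, and $\overline r$ is an $(\overline f,\overline g)$-transformation of the same degree as $r$. For every full subcategory $\mathcal A'\subset\mathcal A$ the components of $\overline b$ restrict to $\mathsf D(\mathcal A|\mathcal A')$. If $\mathcal A'\subset\mathcal A$ and $\mathcal B'\subset\mathcal B$ are full subcategories, those of $\overline f$ restrict to maps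 $T^ns\mathsf D(\mathcal A|\mathcal A')\to s\mathsf D(\mathcal B|\mathcal B')$ if $f$ maps $\mathrm{Ob}\,\mathcal A'$ into $\mathrm{Ob}\,\mathcal B'$, and those of $\overline r$ if $f$ and $g$ do. 2. The assignment $(\mathcal A,\mathcal A')\mapsto\mathsf D(\mathcal A|\mathcal A')$, $f\mapsto\overline f$, $r\mapsto\overline r$ (restricted as in 1) is a well-defined strict $\mathcal K$-2-functor $\mathsf D:\mathcal KA'_\infty\to\mathcal KA_\infty$. Taking $H^0$, it gives a strict 2-functor $\mathsf D:A'_\infty\to A_\infty$ of non-2-unital 2-categories. 3. Let $f,g,h:\mathcal A\to\mathcal B$ be $A_\infty$-functors, $r:f\to g$ and $p:g\to h$ homogeneous $A_\infty$-transformations. Then $(r\otimes p)R$ has degree $|r|+|p|$; $[(r\otimes p)R]_0=0$; and for $n\ge1$ and $k_1,\dots,k_n\ge1$ the restriction of $[(r\otimes p)R]_n$ to $T^{k_1}s\mathcal A\otimes\dots\otimes T^{k_n}s\mathcal A$ is $$\mu^{(n)}\sum(f_{a_1}\otimes\dots\otimes f_{a_\alpha}\otimes r_i\otimes g_{c_1}\otimes\dots\otimes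 g_{c_\beta}\otimes p_t\otimes h_{e_1}\otimes\dots\otimes h_{e_\gamma})\in T^+s\mathcal B,$$ summed over the set $Q(k_1,\dots,k_n)$ of all sequences $(l_1,\dots,l_{\alpha+\beta+\gamma+2})=(a_1,\dots,a_\alpha;i;c_1,\dots,c_\beta;t;e_1,\dots,e_\gamma)$ with $\alpha,\beta,\gamma\ge0$, $a_j,c_j,e_j>0$, $i,t\ge0$, such that for all $1\le q\le\alpha+\beta+\gamma+2$ and $0\le s\le n$ one has $l_1+\dots+l_q=k_1+\dots+k_s$ if and only if $q=\alpha+\beta+\gamma+2$ and $s=n$. Moreover $$\overline{(r\otimes p)B_2}-(\overline r\otimes\overline p)\overline B_2=(r\otimes p)R\,\overline B_1-[(r\otimes p)(1\otimes B_1+B_1\otimes1)]R.$$ If $\mathcal A'\subset\mathcal A$ and $\mathcal B'\subset\mathcal B$ are full subcategories and $f,g,h$ map $\mathrm{Ob}\,\mathcal A'$ into $\mathrm{Ob}\,\mathcal B'$, then the components of $(r\otimes p)R$ restrict to maps $T^ns\mathsf D(\mathcal A|\mathcal A')(X,Y)\to s\mathsf D(\mathcal B|\mathcal B')(Xf,Yh)$,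 which are the components of an $A_\infty$-transformation between the restricted functors $\overline f,\overline h:\mathsf D(\mathcal A|\mathcal A')\to\mathsf D(\mathcal B|\mathcal B')$, and the displayed equation holds for the restrictions as well. -/

import Mathlib

noncomputable section

universe u

namespace AInf

open scoped TensorProduct DirectSum

/-- A `ℤ`-graded `k`-linear quiver. For an A∞-category `𝒜` the quiver recorded here is always the
suspended one, `s𝒜`, so that `hom X Y = s𝒜(X,Y)` and `gr X Y d` is its part of degree `d`,
which is `𝒜(X,Y)` in degree `d + 1`. -/
structure GQuiver (k : Type u) [CommRing k] where
  Ob : Type u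
  hom : Ob → Ob → Type u
  [addCommGroup : ∀ X Y, AddCommGroup (hom X Y)]
  [module : ∀ X Y, Module k (hom X Y)]
  gr : ∀ X Y, ℤ → Submodule k (hom X Y)
  isInternal : ∀ X Y, DirectSum.IsInternal (gr X Y)

attribute [instance] GQuiver.addCommGroup GQuiver.module

/-- `Chain Y X`: a sequence of objects `X = X₀, X₁, …, Xₙ = Y` with `n ≥ 0`. -/
inductive Chain {S : Type u} (Y : S) : S → Type u
  | nil : Chain Y Y
  | cons (X : S) {Z : S} (p : Chain Y Z) : Chain Y X

namespace Chain

/-- the number `n` of steps of `X₀, …, Xₙ` -/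
def length {S : Type u} {Y : S} : ∀ {X : S}, Chain Y X → ℕ
  | _, nil => 0
  | _, cons _ p => p.length + 1

/-- `n ≥ 1` and the inner objects `X₁, …, Xₙ₋₁` lie in `B` -/
def Good {S : Type u} (B : Set S) {Y : S} : ∀ {X : S}, Chain Y X → Prop
  | _, nil => False
  | _, cons _ nil => True
  | _, cons _ (cons Z p) => Z ∈ B ∧ (cons Z p).Good B

end Chain

instance instDecidableEqChain {S : Type u} (Y X : S) : DecidableEq (Chain Y X) :=
  Classical.decEq _

namespace GQuiver

variable {k : Type u} [CommRing k] (Q : GQuiver k)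

/-- `hom X₀ X₁ ⊗ (hom X₁ X₂ ⊗ (⋯ ⊗ k))` along a chain -/
def tens {Y : Q.Ob} : ∀ {X : Q.Ob}, Chain Y X → ModuleCat.{u} k
  | _, .nil => ModuleCat.of k k
  | _, .cons (Z := Z) X p => ModuleCat.of k (Q.hom X Z ⊗[k] tens p)

/-- the tensor cocategory `TQ(X,Y) = ⨁ₙ TⁿQ(X,Y)`, with `T⁰Q(X,X) = k`, `T⁰Q(X,Y) = 0` for `X ≠ Y` -/
def T (X Y : Q.Ob) : Type u := ⨁ p : Chain Y X, Q.tens p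

instance (X Y : Q.Ob) : AddCommGroup (Q.T X Y) :=
  inferInstanceAs (AddCommGroup (⨁ p : Chain Y X, Q.tens p))

instance (X Y : Q.Ob) : Module k (Q.T X Y) :=
  inferInstanceAs (Module k (⨁ p : Chain Y X, Q.tens p))

/-- linear map out of `TQ(X,Y)` given on each summand -/
def lift {Q : GQuiver k} {X Y : Q.Ob} {M : Type u} [AddCommGroup M] [Module k M]
    (φ : ∀ p : Chain Y X, Q.tens p →ₗ[k] M) : Q.T X Y →ₗ[k] M :=
  DirectSum.toModule k _ _ φ

/-- inclusion of a summand -/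
def inj {X Y : Q.Ob} (p : Chain Y X) : Q.tens p →ₗ[k] Q.T X Y :=
  DirectSum.lof k (Chain Y X) (fun p => Q.tens p) p

def tensNil (Y : Q.Ob) : k ≃ₗ[k] Q.tens (Chain.nil (Y := Y)) :=
  LinearEquiv.refl k k

def tensCons (X : Q.Ob) {Z Y : Q.Ob} (p : Chain Y Z) :
    Q.hom X Z ⊗[k] Q.tens p ≃ₗ[k] Q.tens (Chain.cons X p) :=
  LinearEquiv.refl k _

/-- the generator of `T⁰Q(X,X) = k` -/
def one (X : Q.Ob) : Q.T X X := Q.inj Chain.nil (Q.tensNil X 1)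

/-- `v ⊗ w` with `v ∈ Q(X,Z)`, `w ∈ TQ(Z,Y)` -/
def cons (X Z Y : Q.Ob) : Q.hom X Z →ₗ[k] Q.T Z Y →ₗ[k] Q.T X Y :=
  LinearMap.flip (lift
    (fun p => LinearMap.flip ((TensorProduct.mk k (Q.hom X Z) (Q.tens p)).compr₂
      (Q.inj (Chain.cons X p) ∘ₗ (Q.tensCons X p).toLinearMap))))

@[simp] theorem lift_inj {X Y : Q.Ob} {M : Type u} [AddCommGroup M] [Module k M]
    (φ : ∀ p : Chain Y X, Q.tens p →ₗ[k] M) (p : Chain Y X) (t : Q.tens p) :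
    lift φ (Q.inj p t) = φ p t :=
  DirectSum.toModule_lof (N := M) k (ι := Chain Y X) (M := fun p => Q.tens p) (φ := φ) p t

theorem inj_induction {Q : GQuiver k} {X Y : Q.Ob} {motive : Q.T X Y → Prop} (zero : motive 0)
    (add : ∀ a b, motive a → motive b → motive (a + b))
    (inj : ∀ p t, motive (Q.inj p t)) (t : Q.T X Y) : motive t :=
  DirectSum.induction_on t zero (fun p t => inj p t) add

theorem cons_inj {X Z Y : Q.Ob} (v : Q.hom X Z) (p : Chain Y Z) (w : Q.tens p) :
    Q.cons X Z Y v (Q.inj p w) = Q.inj (Chain.cons X p) (Q.tensCons X p (v ⊗ₜ w)) := by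
  simp [cons]

def foldAux {Y : Q.Ob} {M : Q.Ob → Type u} [∀ X, AddCommGroup (M X)] [∀ X, Module k (M X)]
    (base : M Y) (step : ∀ X Z, Q.hom X Z →ₗ[k] M Z →ₗ[k] M X) :
    ∀ {X : Q.Ob} (p : Chain Y X), Q.tens p →ₗ[k] M X
  | _, .nil => LinearMap.toSpanSingleton k (M Y) base ∘ₗ (Q.tensNil Y).symm.toLinearMap
  | _, .cons (Z := Z) X p =>
    TensorProduct.lift ((step X Z).compl₂ (foldAux base step p)) ∘ₗ
      (Q.tensCons X p).symm.toLinearMap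

/-- the maps `U` out of `TQ(-,Y)` with `U (one) = base` and `U (v ⊗ w) = step v (U w)` -/
def fold {Y : Q.Ob} {M : Q.Ob → Type u} [∀ X, AddCommGroup (M X)] [∀ X, Module k (M X)]
    (base : M Y) (step : ∀ X Z, Q.hom X Z →ₗ[k] M Z →ₗ[k] M X) (X : Q.Ob) :
    Q.T X Y →ₗ[k] M X :=
  lift (fun p => Q.foldAux base step p)

variable {Q}

theorem induction_on {Y : Q.Ob} {motive : ∀ X, Q.T X Y → Prop}
    (zero : ∀ X, motive X 0) (add : ∀ X w w', motive X w → motive X w' → motive X (w + w'))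
    (one : ∀ c : k, motive Y (c • Q.one Y))
    (cons : ∀ X Z v w, motive Z w → motive X (Q.cons X Z Y v w)) {X : Q.Ob} (w : Q.T X Y) :
    motive X w := by
  have key : ∀ {X : Q.Ob} (p : Chain Y X) (t : Q.tens p), motive X (Q.inj p t) := by
    intro X p
    induction p with
    | nil =>
      intro t
      obtain ⟨c, rfl⟩ := (Q.tensNil Y).surjective t
      have := one c
      rwa [GQuiver.one, ← map_smul, ← map_smul, smul_eq_mul, mul_one] at this
    | cons X p ih =>
      intro t
      obtain ⟨t, rfl⟩ := (Q.tensCons X p).surjective t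
      induction t using TensorProduct.induction_on with
      | zero => simpa using zero X
      | tmul v t =>
        have := cons _ _ v _ (ih t)
        rwa [Q.cons_inj] at this
      | add a b ha hb =>
        have := add _ _ _ ha hb
        rwa [← map_add, ← map_add] at this
  exact inj_induction (motive := motive X) (zero X) (fun a b => add X a b) (fun p t => key p t) w

theorem ext_on {Y : Q.Ob} {M : Q.Ob → Type u} [∀ X, AddCommGroup (M X)] [∀ X, Module k (M X)]
    {U V : ∀ X, Q.T X Y →ₗ[k] M X} (h1 : U Y (Q.one Y) = V Y (Q.one Y))
    (h2 : ∀ X Z v w, U Z w = V Z w → U X (Q.cons X Z Y v w) = V X (Q.cons X Z Y v w))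
    (X : Q.Ob) : U X = V X := by
  ext1 w
  refine induction_on (motive := fun X w => U X w = V X w) (by simp) (by simp +contextual) ?_ h2 _
  intro c
  simp [h1]

section
variable {Y : Q.Ob} {M : Q.Ob → Type u} [∀ X, AddCommGroup (M X)] [∀ X, Module k (M X)]
    (base : M Y) (step : ∀ X Z, Q.hom X Z →ₗ[k] M Z →ₗ[k] M X)

@[simp] theorem fold_inj {X : Q.Ob} (p : Chain Y X) (t : Q.tens p) :
    Q.fold base step X (Q.inj p t) = Q.foldAux base step p t := by
  simp [fold]

@[simp] theorem fold_one : Q.fold base step Y (Q.one Y) = base := by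
  rw [one, fold_inj, foldAux]
  simp

@[simp] theorem fold_cons (X Z : Q.Ob) (v : Q.hom X Z) (w : Q.T Z Y) :
    Q.fold base step X (Q.cons X Z Y v w) = step X Z v (Q.fold base step Z w) := by
  induction w using inj_induction with
  | zero => simp
  | inj p t =>
    rw [cons_inj, fold_inj, fold_inj, foldAux]
    simp
  | add a b ha hb => simp [ha, hb]
end

end GQuiver
end AInf

end

noncomputable section

universe u

namespace AInf

open scoped TensorProduct DirectSum

namespace GQuiver

variable {k : Type u} [CommRing k] (Q : GQuiver k)

instance : DecidableEq Q.Ob := Classical.decEq Q.Ob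

/-- `(TQ ⊗ TQ)(X,Y) = ⨁_Z TQ(X,Z) ⊗ TQ(Z,Y)` -/
def T2 (X Y : Q.Ob) : Type u := ⨁ Z : Q.Ob, Q.T X Z ⊗[k] Q.T Z Y

instance (X Y : Q.Ob) : AddCommGroup (Q.T2 X Y) :=
  inferInstanceAs (AddCommGroup (⨁ Z : Q.Ob, Q.T X Z ⊗[k] Q.T Z Y))

instance (X Y : Q.Ob) : Module k (Q.T2 X Y) :=
  inferInstanceAs (Module k (⨁ Z : Q.Ob, Q.T X Z ⊗[k] Q.T Z Y))

def inj₂ (X Z Y : Q.Ob) : Q.T X Z ⊗[k] Q.T Z Y →ₗ[k] Q.T2 X Y :=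
  DirectSum.lof k Q.Ob (fun Z => Q.T X Z ⊗[k] Q.T Z Y) Z

def tmul₂ (X Z Y : Q.Ob) : Q.T X Z →ₗ[k] Q.T Z Y →ₗ[k] Q.T2 X Y :=
  (TensorProduct.mk k (Q.T X Z) (Q.T Z Y)).compr₂ (Q.inj₂ X Z Y)

/-- map out of `TQ ⊗ TQ` given by bilinear maps -/
def elim₂ {Q : GQuiver k} {X Y : Q.Ob} {P : Type u} [AddCommGroup P] [Module k P]
    (β : ∀ Z, Q.T X Z →ₗ[k] Q.T Z Y →ₗ[k] P) : Q.T2 X Y →ₗ[k] P :=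
  DirectSum.toModule k _ _ (fun Z => TensorProduct.lift (β Z))

def cons₂ (X Z Y : Q.Ob) : Q.hom X Z →ₗ[k] Q.T2 Z Y →ₗ[k] Q.T2 X Y :=
  LinearMap.flip (elim₂ (fun W => LinearMap.mk₂ k
    (fun a b => (Q.tmul₂ X W Y).flip b ∘ₗ (Q.cons X Z W).flip a)
    (fun _ _ _ => by ext; simp) (fun _ _ _ => by ext; simp)
    (fun _ _ _ => by ext; simp) (fun _ _ _ => by ext; simp)))

def cutAux {Y : Q.Ob} : ∀ {X : Q.Ob} (p : Chain Y X), Q.tens p →ₗ[k] Q.T2 X Y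
  | _, .nil =>
    LinearMap.toSpanSingleton k _ (Q.tmul₂ Y Y Y (Q.one Y) (Q.one Y)) ∘ₗ
      (Q.tensNil Y).symm.toLinearMap
  | _, .cons (Z := Z) X p =>
    Q.tmul₂ X X Y (Q.one X) ∘ₗ Q.inj (Chain.cons X p) +
      TensorProduct.lift ((Q.cons₂ X Z Y).compl₂ (cutAux p)) ∘ₗ
        (Q.tensCons X p).symm.toLinearMap

/-- the cut comultiplication `TQ → TQ ⊗ TQ` -/
def cut (X Y : Q.Ob) : Q.T X Y →ₗ[k] Q.T2 X Y :=
  lift (fun p => Q.cutAux p)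

variable {Q}

section elim
variable {X Y : Q.Ob} {P : Type u} [AddCommGroup P] [Module k P]
    (β : ∀ Z, Q.T X Z →ₗ[k] Q.T Z Y →ₗ[k] P)

@[simp] theorem elim₂_tmul₂ (Z : Q.Ob) (a : Q.T X Z) (b : Q.T Z Y) :
    elim₂ β (Q.tmul₂ X Z Y a b) = β Z a b := by
  have := DirectSum.toModule_lof (N := P) k (ι := Q.Ob) (M := fun Z => Q.T X Z ⊗[k] Q.T Z Y)
    (φ := fun Z => TensorProduct.lift (β Z)) Z (a ⊗ₜ b)
  exact this.trans (by simp)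

theorem induction₂ {motive : Q.T2 X Y → Prop} (zero : motive 0)
    (add : ∀ a b, motive a → motive b → motive (a + b))
    (tmul : ∀ Z a b, motive (Q.tmul₂ X Z Y a b)) (t : Q.T2 X Y) : motive t := by
  have key : ∀ Z t, motive (Q.inj₂ X Z Y t) := by
    intro Z t
    induction t using TensorProduct.induction_on with
    | zero => simpa using zero
    | tmul a b => exact tmul Z a b
    | add a b ha hb => rw [map_add]; exact add _ _ ha hb
  exact DirectSum.induction_on t zero (fun Z t => key Z t) add

theorem ext₂ {φ ψ : Q.T2 X Y →ₗ[k] P}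
    (h : ∀ Z a b, φ (Q.tmul₂ X Z Y a b) = ψ (Q.tmul₂ X Z Y a b)) : φ = ψ := by
  ext t
  induction t using induction₂ with
  | zero => simp
  | add a b ha hb => simp [ha, hb]
  | tmul Z a b => exact h Z a b

theorem elim₂_add (β γ : ∀ Z, Q.T X Z →ₗ[k] Q.T Z Y →ₗ[k] P) (t : Q.T2 X Y) :
    elim₂ (fun Z => β Z + γ Z) t = elim₂ β t + elim₂ γ t := by
  induction t using induction₂ with
  | zero => simp
  | add a b ha hb => simp only [map_add, ha, hb]; abel
  | tmul W a b => simp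

theorem map_elim₂ {P' : Type u} [AddCommGroup P'] [Module k P'] (φ : P →ₗ[k] P')
    (t : Q.T2 X Y) : φ (elim₂ β t) = elim₂ (fun Z => (β Z).compr₂ φ) t := by
  induction t using induction₂ with
  | zero => simp
  | add a b ha hb => simp [ha, hb]
  | tmul W a b => simp

end elim

@[simp] theorem cons₂_tmul₂ (X Z W Y : Q.Ob) (v : Q.hom X Z) (a : Q.T Z W) (b : Q.T W Y) :
    Q.cons₂ X Z Y v (Q.tmul₂ Z W Y a b) = Q.tmul₂ X W Y (Q.cons X Z W v a) b := by
  simp [cons₂]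

@[simp] theorem cut_inj {X Y : Q.Ob} (p : Chain Y X) (t : Q.tens p) :
    Q.cut X Y (Q.inj p t) = Q.cutAux p t := by
  simp [cut]

@[simp] theorem cut_one (Y : Q.Ob) :
    Q.cut Y Y (Q.one Y) = Q.tmul₂ Y Y Y (Q.one Y) (Q.one Y) := by
  have h : Q.cut Y Y (Q.inj Chain.nil (Q.tensNil Y 1)) =
      Q.tmul₂ Y Y Y (Q.one Y) (Q.one Y) := by
    rw [cut_inj, cutAux]
    simp
  exact h

@[simp] theorem cut_cons (X Z Y : Q.Ob) (v : Q.hom X Z) (w : Q.T Z Y) :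
    Q.cut X Y (Q.cons X Z Y v w) =
      Q.tmul₂ X X Y (Q.one X) (Q.cons X Z Y v w) + Q.cons₂ X Z Y v (Q.cut Z Y w) := by
  induction w using inj_induction with
  | zero => simp
  | inj p t =>
    rw [cons_inj, cut_inj, cut_inj, cutAux]
    simp
  | add a b ha hb =>
    simp only [map_add, ha, hb]; abel

theorem elim₂_cons₂ {X Z Y : Q.Ob} {P : Type u} [AddCommGroup P] [Module k P]
    (β : ∀ W, Q.T X W →ₗ[k] Q.T W Y →ₗ[k] P) (v : Q.hom X Z) (t : Q.T2 Z Y) :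
    elim₂ β (Q.cons₂ X Z Y v t) = elim₂ (fun W => (β W).comp (Q.cons X Z W v)) t := by
  induction t using induction₂ with
  | zero => simp
  | add a b ha hb => simp [ha, hb]
  | tmul W a b => simp

theorem cut_sum_cons {X Z Y : Q.Ob} {P : Type u} [AddCommGroup P] [Module k P]
    (β : ∀ W, Q.T X W →ₗ[k] Q.T W Y →ₗ[k] P) (v : Q.hom X Z) (w : Q.T Z Y) :
    elim₂ β (Q.cut X Y (Q.cons X Z Y v w)) = β X (Q.one X) (Q.cons X Z Y v w) +
      elim₂ (fun W => (β W).comp (Q.cons X Z W v)) (Q.cut Z Y w) := by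
  simp [elim₂_cons₂]

/-- coassociativity, in summed form -/
theorem coassoc {X Y : Q.Ob} {P : Type u} [AddCommGroup P] [Module k P]
    (γ : ∀ V W, Q.T X V →ₗ[k] Q.T V W →ₗ[k] Q.T W Y →ₗ[k] P)
    (β : ∀ Z, Q.T X Z →ₗ[k] Q.T Z Y →ₗ[k] P)
    (hβ : ∀ V a b, β V a b = elim₂ (fun W => γ V W a) (Q.cut V Y b))
    (w : Q.T X Y) : elim₂ β (Q.cut X Y w) =
      elim₂ (fun W => elim₂ (fun V => γ V W) ∘ₗ Q.cut X W) (Q.cut X Y w) := by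
  revert γ β
  refine induction_on (motive := fun X w =>
    ∀ (γ : ∀ V W, Q.T X V →ₗ[k] Q.T V W →ₗ[k] Q.T W Y →ₗ[k] P)
    (β : ∀ Z, Q.T X Z →ₗ[k] Q.T Z Y →ₗ[k] P)
    (_ : ∀ V a b, β V a b = elim₂ (fun W => γ V W a) (Q.cut V Y b)),
     elim₂ β (Q.cut X Y w) =
      elim₂ (fun W => elim₂ (fun V => γ V W) ∘ₗ Q.cut X W) (Q.cut X Y w)) ?_ ?_ ?_ ?_ w
  · intros; simp
  · intro X w w' h h' γ β hβ
    rw [map_add, map_add, map_add, h γ β hβ, h' γ β hβ]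
  · intro c γ β hβ
    simp [hβ]
  · intro X Z v w ih γ β hβ
    rw [cut_sum_cons, cut_sum_cons, hβ, cut_sum_cons]
    rw [ih (fun V W => (γ V W).comp (Q.cons X Z V v)) (fun W => (β W).comp (Q.cons X Z W v))
      (by intro V a b; simp [hβ])]
    have : (fun W => (elim₂ (fun V => γ V W) ∘ₗ Q.cut X W) ∘ₗ Q.cons X Z W v) =
        (fun W => (γ X W (Q.one X)).comp (Q.cons X Z W v) +
          (elim₂ (fun V => (γ V W).comp (Q.cons X Z V v)) ∘ₗ Q.cut Z W)) := by
      funext W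
      ext a : 1
      simp [elim₂_cons₂]
    rw [this, elim₂_add]
    simp [add_assoc]

end GQuiver
end AInf

end

noncomputable section

universe u

namespace AInf

open scoped TensorProduct DirectSum

section internal
variable {k : Type u} [CommRing k] {M N : Type u} [AddCommGroup M] [Module k M]
  [AddCommGroup N] [Module k N]

def decomp (G : ℤ → Submodule k M) (h : DirectSum.IsInternal G) : (⨁ e, G e) ≃ₗ[k] M :=
  LinearEquiv.ofBijective (DirectSum.coeLinearMap G) h

theorem decomp_symm (G : ℤ → Submodule k M) (h : DirectSum.IsInternal G) {e : ℤ} {x : M}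
    (hx : x ∈ G e) : (decomp G h).symm x = DirectSum.lof k ℤ (fun e => G e) e ⟨x, hx⟩ := by
  rw [LinearEquiv.symm_apply_eq]
  exact (DirectSum.coeLinearMap_lof G e ⟨x, hx⟩).symm

theorem isInternal_iff_delta (G : ℤ → Submodule k M) : DirectSum.IsInternal G ↔
    (∃ δ : M →ₗ[k] ℤ →₀ M, ∀ e, ∀ x ∈ G e, δ x = Finsupp.single e x) ∧ (⊤ : Submodule k M) ≤ ⨆ e, G e := by
  constructor
  · intro h
    refine ⟨⟨DirectSum.toModule k ℤ _ (fun e => Finsupp.lsingle e ∘ₗ (G e).subtype) ∘ₗ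
      (decomp G h).symm.toLinearMap, fun e x hx => ?_⟩, ?_⟩
    · simp only [LinearMap.comp_apply, LinearEquiv.coe_coe, decomp_symm G h hx, DirectSum.toModule_lof]
      simp
    · exact (DirectSum.IsInternal.submodule_iSup_eq_top h).ge
  · rintro ⟨⟨δ, hδ⟩, htop⟩
    constructor
    · rw [injective_iff_map_eq_zero]
      intro x hx
      have key : ∀ x : ⨁ e, G e, ∀ e, δ (DirectSum.coeLinearMap G x) e = (x e : M) := by
        intro x e
        induction x using DirectSum.induction_on with
        | zero => simp
        | of i x =>
          have h1 : DirectSum.coeLinearMap G (DirectSum.of (fun e => G e) i x) = x := by simp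
          rw [h1, hδ i x x.2]
          by_cases h : i = e
          · subst h; simp
          · rw [Finsupp.single_eq_of_ne' h, DirectSum.of_eq_of_ne _ _ _ (Ne.symm h)]; rfl
        | add a b ha hb => simp [ha, hb]
      have hx' : DirectSum.coeLinearMap G x = 0 := hx
      ext e
      rw [← key, hx']
      simp
    · have h2 : LinearMap.range (DirectSum.coeLinearMap G) = ⊤ := by
        rw [eq_top_iff]
        refine htop.trans (iSup_le fun e x hx => ⟨DirectSum.lof k ℤ (fun e => G e) e ⟨x, hx⟩, by simp⟩)
      exact LinearMap.range_eq_top.mp h2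

def deltaTensor : (ℤ →₀ M) →ₗ[k] (ℤ →₀ N) →ₗ[k] (ℤ →₀ M ⊗[k] N) :=
  Finsupp.lsum k fun i => LinearMap.flip (Finsupp.lsum k fun j =>
    LinearMap.flip ((TensorProduct.mk k M N).compr₂ (Finsupp.lsingle (i + j))))

theorem isInternal_tensor (G : ℤ → Submodule k M) (H : ℤ → Submodule k N)
    (hG : DirectSum.IsInternal G) (hH : DirectSum.IsInternal H) :
    DirectSum.IsInternal (fun e => ⨆ i : ℤ, Submodule.map₂ (TensorProduct.mk k M N) (G i) (H (e - i))) := by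
  rw [isInternal_iff_delta] at *
  obtain ⟨⟨δ, hδ⟩, hG⟩ := hG
  obtain ⟨⟨δ', hδ'⟩, hH⟩ := hH
  refine ⟨⟨TensorProduct.lift (deltaTensor.compl₁₂ δ δ'), fun e => ?_⟩, ?_⟩
  · change (_ : Submodule k (M ⊗[k] N)) ≤ LinearMap.eqLocus (TensorProduct.lift (deltaTensor.compl₁₂ δ δ')) (Finsupp.lsingle e)
    refine iSup_le fun i => Submodule.map₂_le.mpr fun v hv w hw => ?_
    simp only [LinearMap.mem_eqLocus]
    simp [hδ i v hv, hδ' _ w hw, deltaTensor]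
  · rw [← TensorProduct.map₂_mk_top_top_eq_top, ← eq_top_iff.mpr hG, ← eq_top_iff.mpr hH,
      Submodule.map₂_iSup_left]
    refine iSup_le fun i => ?_
    rw [Submodule.map₂_iSup_right]
    refine iSup_le fun j => ?_
    refine le_trans ?_ (le_iSup _ (i + j))
    refine le_trans ?_ (le_iSup _ i)
    simp

theorem isInternal_sum {ι : Type u} [DecidableEq ι] {M : ι → Type u} [∀ i, AddCommGroup (M i)]
    [∀ i, Module k (M i)] (G : ∀ i, ℤ → Submodule k (M i))
    (hG : ∀ i, DirectSum.IsInternal (G i)) :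
    DirectSum.IsInternal (fun e => ⨆ i, (G i e).map (DirectSum.lof k ι M i)) := by
  simp only [isInternal_iff_delta] at *
  choose hδ htop using hG
  choose δ hδ using hδ
  refine ⟨⟨DirectSum.toModule k ι _ (fun i =>
    Finsupp.mapRange.linearMap (DirectSum.lof k ι M i) ∘ₗ δ i), fun e => ?_⟩, ?_⟩
  · change _ ≤ LinearMap.eqLocus (DirectSum.toModule k ι _ (fun i =>
      Finsupp.mapRange.linearMap (DirectSum.lof k ι M i) ∘ₗ δ i)) (Finsupp.lsingle e)
    refine iSup_le fun i => Submodule.map_le_iff_le_comap.mpr fun v hv => ?_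
    simp [hδ i e v hv]
  · rintro x -
    induction x using DirectSum.induction_on with
    | zero => simp
    | of i x =>
      have h1 : (⊤ : Submodule k (M i)).map (DirectSum.lof k ι M i) ≤
          (⨆ e, G i e).map (DirectSum.lof k ι M i) := Submodule.map_mono (htop i)
      have h2 := h1 (Submodule.mem_map_of_mem (f := DirectSum.lof k ι M i) (Submodule.mem_top (x := x)))
      rw [Submodule.map_iSup] at h2
      exact (iSup_mono fun e => le_iSup (fun i => (G i e).map (DirectSum.lof k ι M i)) i :
        (⨆ e, (G i e).map (DirectSum.lof k ι M i)) ≤ _) h2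
    | add a b ha hb => exact Submodule.add_mem _ ha hb

theorem isInternal_unit : DirectSum.IsInternal
    (fun e : ℤ => if e = 0 then (⊤ : Submodule k M) else ⊥) := by
  rw [isInternal_iff_delta]
  refine ⟨⟨Finsupp.lsingle 0, fun e x hx => ?_⟩, ?_⟩
  · split_ifs at hx with h
    · subst h; rfl
    · simp at hx; subst hx; simp
  · refine le_trans ?_ (le_iSup _ 0)
    simp

theorem isInternal_map (G : ℤ → Submodule k M) (f : M ≃ₗ[k] N) (h : DirectSum.IsInternal G) :
    DirectSum.IsInternal (fun e => (G e).map f.toLinearMap) := by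
  rw [isInternal_iff_delta] at *
  obtain ⟨⟨δ, hδ⟩, hG⟩ := h
  refine ⟨⟨Finsupp.mapRange.linearMap f.toLinearMap ∘ₗ δ ∘ₗ f.symm.toLinearMap, ?_⟩, ?_⟩
  · rintro e _ ⟨x, hx, rfl⟩
    simp [hδ e x hx]
  · rw [← Submodule.map_iSup, top_le_iff.mp hG]
    simp

end internal

namespace GQuiver

variable {k : Type u} [CommRing k] (Q : GQuiver k)

/-- `v ↦ (-1)^{d |v|} v` -/
def sgnHom (d : ℤ) (X Y : Q.Ob) : Q.hom X Y →ₗ[k] Q.hom X Y :=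
  DirectSum.toModule k ℤ _ (fun e => ((d * e).negOnePow : ℤ) • (Q.gr X Y e).subtype) ∘ₗ
    (decomp (Q.gr X Y) (Q.isInternal X Y)).symm.toLinearMap

theorem sgnHom_of_mem {d e : ℤ} {X Y : Q.Ob} {v : Q.hom X Y} (hv : v ∈ Q.gr X Y e) :
    Q.sgnHom d X Y v = ((d * e).negOnePow : ℤ) • v := by
  simp only [sgnHom, LinearMap.comp_apply, LinearEquiv.coe_coe,
    decomp_symm _ (Q.isInternal X Y) hv, DirectSum.toModule_lof]
  simp

/-- `w ↦ (-1)^{d |w|} w` on `TQ` -/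
def sgn (d : ℤ) (X Y : Q.Ob) : Q.T X Y →ₗ[k] Q.T X Y :=
  Q.fold (M := fun X => Q.T X Y) (Q.one Y) (fun X Z => (Q.cons X Z Y) ∘ₗ Q.sgnHom d X Z) X

def tensGr {Y : Q.Ob} : ∀ {X : Q.Ob} (p : Chain Y X), ℤ → Submodule k (Q.tens p)
  | _, .nil => fun e => (if e = 0 then ⊤ else ⊥ : Submodule k k).map (Q.tensNil Y).toLinearMap
  | _, .cons (Z := Z) X p => fun e =>
    (⨆ i : ℤ, Submodule.map₂ (TensorProduct.mk k (Q.hom X Z) (Q.tens p))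
      (Q.gr X Z i) (tensGr p (e - i))).map (Q.tensCons X p).toLinearMap

/-- the degree `e` part of `TQ(X,Y)` -/
def Tgr (X Y : Q.Ob) (e : ℤ) : Submodule k (Q.T X Y) :=
  ⨆ p : Chain Y X, (Q.tensGr p e).map (Q.inj p)

theorem tensGr_isInternal {Y : Q.Ob} : ∀ {X : Q.Ob} (p : Chain Y X),
    DirectSum.IsInternal (Q.tensGr p)
  | _, .nil => isInternal_map _ _ isInternal_unit
  | _, .cons (Z := Z) X p =>
    isInternal_map _ _ (isInternal_tensor _ _ (Q.isInternal X Z) (tensGr_isInternal p))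

/-- The quiver with the same objects and `hom X Y = ⨁ Q(X,X₁) ⊗ ⋯ ⊗ Q(Xₙ₋₁,Y)`, the sum over `n ≥ 1` and
`X₁, …, Xₙ₋₁ ∈ B`. For `Q = s𝒞` it is `sD(𝒞|B)`; for `B` everything it is `T⁺s𝒞`. -/
@[reducible] def barQuiver (B : Set Q.Ob) : GQuiver k where
  Ob := Q.Ob
  hom X Y := ⨁ p : {p : Chain Y X // p.Good B}, Q.tens p.1
  gr X Y e := ⨆ p : {p : Chain Y X // p.Good B},
    (Q.tensGr p.1 e).map (DirectSum.lof k _ (fun p : {p : Chain Y X // p.Good B} => Q.tens p.1) p)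
  isInternal _ _ := isInternal_sum _ (fun p => Q.tensGr_isInternal p.1)
end GQuiver
end AInf

end

noncomputable section

universe u

namespace AInf

open scoped TensorProduct DirectSum

namespace GQuiver

variable {k : Type u} [CommRing k] {A B : GQuiver k}

/-! degrees -/

theorem one_mem (X : A.Ob) : A.one X ∈ A.Tgr X X 0 := by
  refine Submodule.mem_iSup_of_mem Chain.nil ⟨_, ⟨1, ?_, rfl⟩, rfl⟩
  simp

theorem cons_mem {X Z Y : A.Ob} {v : A.hom X Z} {w : A.T Z Y} {i j : ℤ} (hv : v ∈ A.gr X Z i)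
    (hw : w ∈ A.Tgr Z Y j) : A.cons X Z Y v w ∈ A.Tgr X Y (i + j) := by
  have : A.Tgr Z Y j ≤ (A.Tgr X Y (i + j)).comap (A.cons X Z Y v) := by
    refine iSup_le fun p => ?_
    rintro _ ⟨t, ht, rfl⟩
    rw [Submodule.mem_comap, cons_inj]
    refine Submodule.mem_iSup_of_mem (Chain.cons X p) ⟨_, ⟨_, ?_, rfl⟩, rfl⟩
    refine Submodule.mem_iSup_of_mem i (Submodule.apply_mem_map₂ _ hv ?_)
    simpa using ht
  exact this hw

theorem Tgr_le {Y : A.Ob} (N : ∀ X, ℤ → Submodule k (A.T X Y)) (h1 : A.one Y ∈ N Y 0)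
    (h2 : ∀ X Z i j, ∀ v ∈ A.gr X Z i, ∀ w ∈ N Z j, A.cons X Z Y v w ∈ N X (i + j))
    (X : A.Ob) (e : ℤ) : A.Tgr X Y e ≤ N X e := by
  refine iSup_le fun p => ?_
  rw [Submodule.map_le_iff_le_comap]
  induction p generalizing e with
  | nil =>
    rw [tensGr, Submodule.map_le_iff_le_comap]
    split_ifs with h
    · subst h
      rintro c -
      have : A.inj Chain.nil (A.tensNil Y c) = c • A.one Y := by
        rw [one, ← map_smul, ← map_smul, smul_eq_mul, mul_one]
      simp only [Submodule.mem_comap, LinearEquiv.coe_coe, this]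
      exact Submodule.smul_mem _ _ h1
    · exact bot_le
  | cons X p ih =>
    rw [tensGr, Submodule.map_le_iff_le_comap]
    refine iSup_le fun i => Submodule.map₂_le.mpr fun v hv w hw => ?_
    simp only [Submodule.mem_comap, LinearEquiv.coe_coe, TensorProduct.mk_apply, ← cons_inj]
    have := h2 _ _ _ _ v hv _ (ih _ hw)
    simpa using this

theorem cut_mem {X Y : A.Ob} {P : Type u} [AddCommGroup P] [Module k P] (G : ℤ → Submodule k P)
    (d : ℤ) (β : ∀ Z, A.T X Z →ₗ[k] A.T Z Y →ₗ[k] P)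
    (hβ : ∀ Z i j, ∀ a ∈ A.Tgr X Z i, ∀ b ∈ A.Tgr Z Y j, β Z a b ∈ G (i + j + d))
    {e : ℤ} {w : A.T X Y} (hw : w ∈ A.Tgr X Y e) : elim₂ β (A.cut X Y w) ∈ G (e + d) := by
  let N : ∀ X, ℤ → Submodule k (A.T X Y) := fun X e => A.Tgr X Y e ⊓
    ⨅ (d : ℤ) (β : ∀ Z, A.T X Z →ₗ[k] A.T Z Y →ₗ[k] P) (_ : ∀ Z i j, ∀ a ∈ A.Tgr X Z i,
      ∀ b ∈ A.Tgr Z Y j, β Z a b ∈ G (i + j + d)), (G (e + d)).comap (elim₂ β ∘ₗ A.cut X Y)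
  have := Tgr_le N ?_ ?_ X e hw
  · simp only [N, Submodule.mem_inf, Submodule.mem_iInf] at this
    exact this.2 d β hβ
  · simp only [N, Submodule.mem_inf, Submodule.mem_iInf]
    refine ⟨one_mem Y, fun d β hβ => ?_⟩
    have := hβ Y 0 0 _ (one_mem Y) _ (one_mem Y)
    simpa using this
  · simp only [N, Submodule.mem_inf, Submodule.mem_iInf]
    rintro X Z i j v hv w ⟨hw, ih⟩
    refine ⟨cons_mem hv hw, fun d β hβ => ?_⟩
    simp only [Submodule.mem_comap, LinearMap.comp_apply, cut_sum_cons]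
    refine Submodule.add_mem _ ?_ ?_
    · have := hβ X 0 (i + j) _ (one_mem X) _ (cons_mem hv hw)
      simpa using this
    · have := ih (i + d) (fun W => (β W).comp (A.cons X Z W v)) ?_
      · simp only [Submodule.mem_comap, LinearMap.comp_apply] at this
        convert this using 2; ring
      · intro W i' j' a ha b hb
        have := hβ W _ _ _ (cons_mem hv ha) b hb
        simp only [LinearMap.comp_apply]
        convert this using 2; ring

/-! coextension -/

section conv
variable {N : B.Ob → Type u} [∀ x, AddCommGroup (N x)] [∀ x, Module k (N x)]
  (act : ∀ x z, B.hom x z →ₗ[k] N z →ₗ[k] N x)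

/-- `w ↦ ∑ act (φ w₁) (ψ w₂)`, the sum over all cuts `w₁ ⊗ w₂` of `w` -/
def conv {X Y : A.Ob} {x : B.Ob} {o : A.Ob → B.Ob} (φ : ∀ Z, A.T X Z →ₗ[k] B.hom x (o Z))
    (ψ : ∀ Z, A.T Z Y →ₗ[k] N (o Z)) : A.T X Y →ₗ[k] N x :=
  elim₂ (fun Z => (act x (o Z)).compl₁₂ (φ Z) (ψ Z)) ∘ₗ A.cut X Y

variable {o : A.Ob → B.Ob} (f : ∀ X Z, A.T X Z →ₗ[k] B.hom (o X) (o Z)) {Y : A.Ob}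
  (s : ∀ X, A.T X Y →ₗ[k] N (o X))

/-- `n`-th approximation to `coext` -/
def coextN : ℕ → ∀ X, A.T X Y →ₗ[k] N (o X)
  | 0 => s
  | n + 1 => fun X => s X + conv act (f X) (coextN n)

/-- The solution `U` of `U w = s w + ∑ act (f w₁) (U w₂)` (sum over cuts, for `f` vanishing on `T⁰`). -/
def coext (X : A.Ob) : A.T X Y →ₗ[k] N (o X) :=
  lift (fun p => coextN act f s p.length X ∘ₗ A.inj p)

theorem cut_zero_of_le {P : Type u} [AddCommGroup P] [Module k P] (n : ℕ) {X : A.Ob}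
    (p : Chain Y X) (hp : p.length ≤ n) (t : A.tens p) (β : ∀ Z, A.T X Z →ₗ[k] A.T Z Y →ₗ[k] P)
    (hβ : ∀ W a (q : Chain Y W) (b : A.tens q), q.length ≤ n → β W a (A.inj q b) = 0) :
    elim₂ β (A.cut X Y (A.inj p t)) = 0 := by
  induction p with
  | nil =>
    obtain ⟨c, rfl⟩ := (A.tensNil Y).surjective t
    have h := hβ Y (A.one Y) Chain.nil (A.tensNil Y 1) (Nat.zero_le _)
    have : A.inj Chain.nil (A.tensNil Y c) = c • A.one Y := by
      rw [one, ← map_smul, ← map_smul, smul_eq_mul, mul_one]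
    rw [this, map_smul, map_smul, cut_one, elim₂_tmul₂]
    simp only [one] at h ⊢
    rw [h, smul_zero]
  | cons X p ih =>
    obtain ⟨t, rfl⟩ := (A.tensCons X p).surjective t
    induction t using TensorProduct.induction_on with
    | zero => simp
    | add a b ha hb => simp only [map_add, ha, hb, add_zero]
    | tmul v t =>
      rw [← cons_inj, cut_sum_cons, cons_inj, hβ _ _ _ _ hp, zero_add]
      refine ih ?_ t _ ?_
      · simp [Chain.length] at hp; omega
      · intro W a q b hq
        exact hβ _ _ _ _ hq

theorem cut_zero_of_lt {P : Type u} [AddCommGroup P] [Module k P] {X : A.Ob}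
    (p : Chain Y X) (t : A.tens p) (β : ∀ Z, A.T X Z →ₗ[k] A.T Z Y →ₗ[k] P)
    (h1 : β X (A.one X) = 0)
    (hβ : ∀ W a (q : Chain Y W) (b : A.tens q), q.length < p.length → β W a (A.inj q b) = 0) :
    elim₂ β (A.cut X Y (A.inj p t)) = 0 := by
  cases p with
  | nil =>
    obtain ⟨c, rfl⟩ := (A.tensNil Y).surjective t
    have : A.inj Chain.nil (A.tensNil Y c) = c • A.one Y := by
      rw [one, ← map_smul, ← map_smul, smul_eq_mul, mul_one]
    rw [this, map_smul, map_smul, cut_one, elim₂_tmul₂, h1]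
    simp
  | cons X p =>
    obtain ⟨t, rfl⟩ := (A.tensCons X p).surjective t
    induction t using TensorProduct.induction_on with
    | zero => simp
    | add a b ha hb => simp only [map_add, ha, hb, add_zero]
    | tmul v t =>
      rw [← cons_inj, cut_sum_cons, h1, LinearMap.zero_apply, zero_add]
      refine cut_zero_of_le p.length p le_rfl t _ ?_
      intro W a q b hq
      exact hβ _ _ _ _ (by simp [Chain.length]; omega)

variable {act}

theorem conv_congr {X : A.Ob} {x : B.Ob} {o : A.Ob → B.Ob} {φ : ∀ Z, A.T X Z →ₗ[k] B.hom x (o Z)}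
    (h1 : φ X (A.one X) = 0) {ψ ψ' : ∀ Z, A.T Z Y →ₗ[k] N (o Z)} (p : Chain Y X) (t : A.tens p)
    (h : ∀ W (q : Chain Y W) (b : A.tens q), q.length < p.length → ψ W (A.inj q b) = ψ' W (A.inj q b)) :
    conv act φ ψ (A.inj p t) = conv act φ ψ' (A.inj p t) := by
  have : conv act φ ψ (A.inj p t) = conv act φ ψ' (A.inj p t) +
      elim₂ (fun Z => (act x (o Z)).compl₁₂ (φ Z) (ψ Z - ψ' Z)) (A.cut X Y (A.inj p t)) := by
    simp only [conv, LinearMap.comp_apply, ← elim₂_add]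
    congr 2
    funext Z
    ext a b
    simp
  rw [this, cut_zero_of_lt p t, add_zero]
  · ext b; simp [h1]
  · intro W a q b hq
    simp [h W q b hq]

theorem coext_unique (h1 : ∀ X, f X X (A.one X) = 0) {U V : ∀ X, A.T X Y →ₗ[k] N (o X)}
    (hU : ∀ X w, U X w = s X w + conv act (f X) U w)
    (hV : ∀ X w, V X w = s X w + conv act (f X) V w) (X : A.Ob) (w : A.T X Y) : U X w = V X w := by
  have key : ∀ n, ∀ X (p : Chain Y X) t, p.length = n → U X (A.inj p t) = V X (A.inj p t) := by
    intro n
    induction n using Nat.strong_induction_on with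
    | _ n ih =>
      intro X p t hp
      rw [hU, hV, conv_congr (h1 X) p t]
      intro W q b hq
      exact ih _ (hp ▸ hq) W q b rfl
  induction w using inj_induction with
  | zero => simp
  | add a b ha hb => simp [ha, hb]
  | inj p t => exact key _ X p t rfl

theorem coextN_succ (h1 : ∀ X, f X X (A.one X) = 0) (n : ℕ) : ∀ X (p : Chain Y X) t,
    p.length ≤ n → coextN act f s (n + 1) X (A.inj p t) = coextN act f s n X (A.inj p t) := by
  induction n with
  | zero =>
    intro X p t hp
    change s X _ + conv act (f X) s _ = s X _
    rw [add_eq_left]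
    have : conv act (f X) s (A.inj p t) = conv act (f X) (fun Z => (0 : A.T Z Y →ₗ[k] N (o Z))) (A.inj p t) := by
      apply conv_congr (h1 X)
      intro W q b hq
      omega
    rw [this]
    simp only [conv, LinearMap.comp_apply]
    have : (fun Z => (act (o X) (o Z)).compl₁₂ (f X Z) (0 : A.T Z Y →ₗ[k] N (o Z))) = 0 := by
      funext Z; ext; simp
    rw [this]
    generalize A.cut X Y (A.inj p t) = w
    induction w using induction₂ with
    | zero => simp
    | add a b ha hb => simp [ha, hb]
    | tmul Z a b => simp
  | succ n ih =>
    intro X p t hp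
    rw [coextN, coextN, LinearMap.add_apply, LinearMap.add_apply]
    congr 1
    apply conv_congr (h1 X)
    intro W q b hq
    exact ih W q b (by omega)

theorem coextN_eq (h1 : ∀ X, f X X (A.one X) = 0) {X : A.Ob} (p : Chain Y X) (t : A.tens p) (n : ℕ)
    (hn : p.length ≤ n) :
    coextN act f s n X (A.inj p t) = coext act f s X (A.inj p t) := by
  induction n, hn using Nat.le_induction with
  | base => simp [coext]
  | succ n hn ih => rw [coextN_succ f s h1 n X p t hn, ih]

theorem coext_eq (h1 : ∀ X, f X X (A.one X) = 0) (X : A.Ob) (w : A.T X Y) :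
    coext act f s X w = s X w + conv act (f X) (coext act f s) w := by
  induction w using inj_induction with
  | zero => simp
  | add a b ha hb => rw [map_add, map_add, map_add, ha, hb]; abel
  | inj p t =>
    rw [← coextN_eq f s h1 p t (p.length + 1) (by omega), coextN, LinearMap.add_apply]
    congr 1
    apply conv_congr (h1 X)
    intro W q b hq
    exact coextN_eq f s h1 q b _ hq.le

end conv

end GQuiver
end AInf

end

noncomputable section

universe u

namespace AInf

open scoped TensorProduct DirectSum

namespace GQuiver

variable {k : Type u} [CommRing k] {A B C : GQuiver k}

theorem counit_left {X Y : A.Ob} {P : Type u} [AddCommGroup P] [Module k P]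
    (β : ∀ Z, A.T X Z →ₗ[k] A.T Z Y →ₗ[k] P)
    (hβ : ∀ W Z v a b, β W (A.cons X Z W v a) b = 0) (w : A.T X Y) :
    elim₂ β (A.cut X Y w) = β X (A.one X) w := by
  revert β
  refine induction_on (motive := fun X w => ∀ (β : ∀ Z, A.T X Z →ₗ[k] A.T Z Y →ₗ[k] P)
    (_ : ∀ W Z v a b, β W (A.cons X Z W v a) b = 0),
    elim₂ β (A.cut X Y w) = β X (A.one X) w) ?_ ?_ ?_ ?_ w
  · intros; simp
  · intro X w w' h h' β hβ
    simp only [map_add, h β hβ, h' β hβ]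
  · intro c β hβ
    simp
  · intro X Z v w ih β hβ
    rw [cut_sum_cons, ih]
    · simp [hβ]
    · intro W Z' v' a b; simp [hβ]

theorem counit_right {X Y : A.Ob} {P : Type u} [AddCommGroup P] [Module k P]
    (β : ∀ Z, A.T X Z →ₗ[k] A.T Z Y →ₗ[k] P)
    (hβ : ∀ W Z a v b, β W a (A.cons W Z Y v b) = 0) (w : A.T X Y) :
    elim₂ β (A.cut X Y w) = β Y w (A.one Y) := by
  revert β
  refine induction_on (motive := fun X w => ∀ (β : ∀ Z, A.T X Z →ₗ[k] A.T Z Y →ₗ[k] P)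
    (_ : ∀ W Z a v b, β W a (A.cons W Z Y v b) = 0),
    elim₂ β (A.cut X Y w) = β Y w (A.one Y)) ?_ ?_ ?_ ?_ w
  · intros; simp
  · intro X w w' h h' β hβ
    simp only [map_add, h β hβ, h' β hβ, LinearMap.add_apply]
  · intro c β hβ
    simp
  · intro X Z v w ih β hβ
    rw [cut_sum_cons, ih]
    · simp [hβ]
    · intro W Z' v' a b; simp [hβ]

theorem gr_ext {X Y : A.Ob} {M : Type u} [AddCommGroup M] [Module k M] {φ ψ : A.T X Y →ₗ[k] M}
    (h : ∀ e, ∀ w ∈ A.Tgr X Y e, φ w = ψ w) : φ = ψ := by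
  ext w
  induction w using inj_induction with
  | zero => simp
  | add a b ha hb => simp [ha, hb]
  | inj p t =>
    have h1 : (⊤ : Submodule k (A.tens p)) ≤ (⨆ e, A.tensGr p e) :=
      ((isInternal_iff_delta _).mp (A.tensGr_isInternal p)).2
    have h2 : (⨆ e, A.tensGr p e) ≤ LinearMap.eqLocus (φ ∘ₗ A.inj p) (ψ ∘ₗ A.inj p) := by
      refine iSup_le fun e t ht => ?_
      exact h e _ (Submodule.mem_iSup_of_mem p ⟨t, ht, rfl⟩)
    exact h2 (h1 (Submodule.mem_top (x := t)))

@[simp] theorem sgn_one (d : ℤ) (Y : A.Ob) : A.sgn d Y Y (A.one Y) = A.one Y := by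
  simp [sgn]

@[simp] theorem sgn_cons (d : ℤ) (X Z Y : A.Ob) (v : A.hom X Z) (w : A.T Z Y) :
    A.sgn d X Y (A.cons X Z Y v w) = A.cons X Z Y (A.sgnHom d X Z v) (A.sgn d Z Y w) := by
  simp [sgn]

theorem sgn_of_mem (d : ℤ) {e : ℤ} {X Y : A.Ob} {w : A.T X Y} (hw : w ∈ A.Tgr X Y e) :
    A.sgn d X Y w = ((d * e).negOnePow : ℤ) • w := by
  have := Tgr_le (fun X e => LinearMap.eqLocus (A.sgn d X Y) (((d * e).negOnePow : ℤ) • LinearMap.id))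
    ?_ ?_ X e hw
  · simpa only [LinearMap.mem_eqLocus, LinearMap.smul_apply, LinearMap.id_apply] using this
  · simp
  · intro X Z i j v hv w hw
    simp only [LinearMap.mem_eqLocus, LinearMap.smul_apply, LinearMap.id_apply] at hw ⊢
    rw [sgn_cons, hw, A.sgnHom_of_mem hv]
    simp [mul_add, Int.negOnePow_add, smul_smul]

theorem sgn_mem (d : ℤ) {e : ℤ} {X Y : A.Ob} {w : A.T X Y} (hw : w ∈ A.Tgr X Y e) :
    A.sgn d X Y w ∈ A.Tgr X Y e := by
  rw [sgn_of_mem d hw]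
  exact zsmul_mem hw _

theorem sgn_sgn (d d' : ℤ) {X Y : A.Ob} (w : A.T X Y) :
    A.sgn d X Y (A.sgn d' X Y w) = A.sgn (d + d') X Y w := by
  have : A.sgn d X Y ∘ₗ A.sgn d' X Y = A.sgn (d + d') X Y := gr_ext fun e w hw => by
    rw [LinearMap.comp_apply, sgn_of_mem d' hw, map_zsmul, sgn_of_mem d hw, sgn_of_mem _ hw,
      smul_smul, add_mul, Int.negOnePow_add, mul_comm, Units.val_mul]
  exact LinearMap.congr_fun this w

theorem sgn_hom {d e : ℤ} {o o' : A.Ob → B.Ob} {X Y : A.Ob} {R : A.T X Y →ₗ[k] B.T (o X) (o' Y)}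
    (hR : ∀ i, ∀ w ∈ A.Tgr X Y i, R w ∈ B.Tgr (o X) (o' Y) (i + e)) (w : A.T X Y) :
    B.sgn d _ _ (R w) = ((d * e).negOnePow : ℤ) • R (A.sgn d X Y w) := by
  have : B.sgn d _ _ ∘ₗ R = ((d * e).negOnePow : ℤ) • (R ∘ₗ A.sgn d X Y) := gr_ext fun i w hw => by
    rw [LinearMap.comp_apply, sgn_of_mem d (hR i w hw), LinearMap.smul_apply, LinearMap.comp_apply,
      sgn_of_mem d hw, map_zsmul, smul_smul, mul_add, Int.negOnePow_add, mul_comm, Units.val_mul]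
  exact LinearMap.congr_fun this w

/-! the counit and the projection to `T¹` -/

/-- the map that is `one ↦ one` on `T⁰` and zero on `Tⁿ`, `n ≥ 1` -/
def eps (o : A.Ob → B.Ob) {Y : A.Ob} (X : A.Ob) : A.T X Y →ₗ[k] B.T (o X) (o Y) :=
  A.fold (M := fun X => B.T (o X) (o Y)) (B.one (o Y)) (fun _ _ => 0) X

@[simp] theorem eps_one (o : A.Ob → B.Ob) (Y : A.Ob) : eps (B := B) o Y (A.one Y) = B.one (o Y) := by
  simp [eps]
@[simp] theorem eps_cons (o : A.Ob → B.Ob) (X Z Y : A.Ob) (v w) :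
    eps (B := B) o X (A.cons X Z Y v w) = 0 := by
  simp [eps]

def lowAux (A : GQuiver k) {M : A.Ob → Type u} [∀ X, AddCommGroup (M X)] [∀ X, Module k (M X)] {Y : A.Ob}
    (z : M Y) (f : ∀ X, A.hom X Y →ₗ[k] M X) :
    ∀ {X : A.Ob} (p : Chain Y X), A.tens p →ₗ[k] M X
  | _, .nil => LinearMap.toSpanSingleton k (M Y) z ∘ₗ (A.tensNil Y).symm.toLinearMap
  | _, .cons X .nil =>
    TensorProduct.lift (((LinearMap.lsmul k (M X)).flip.comp (f X)).compl₂
      (A.tensNil Y).symm.toLinearMap) ∘ₗ (A.tensCons X _).symm.toLinearMap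
  | _, .cons _ (.cons _ _) => 0

/-- the map with value `z` on `one ∈ T⁰`, equal to `f` on `T¹` and zero on `Tⁿ`, `n ≥ 2` -/
def low {M : A.Ob → Type u} [∀ X, AddCommGroup (M X)] [∀ X, Module k (M X)] {Y : A.Ob}
    (z : M Y) (f : ∀ X, A.hom X Y →ₗ[k] M X) (X : A.Ob) : A.T X Y →ₗ[k] M X :=
  lift (fun p => A.lowAux z f p)

section low
variable {M : A.Ob → Type u} [∀ X, AddCommGroup (M X)] [∀ X, Module k (M X)] {Y : A.Ob}
    (z : M Y) (f : ∀ X, A.hom X Y →ₗ[k] M X)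

@[simp] theorem low_one : low z f Y (A.one Y) = z := by
  have h : low z f Y (A.inj Chain.nil (A.tensNil Y 1)) = z := by
    rw [low, lift_inj, lowAux]; simp
  exact h

@[simp] theorem low_cons_one (X : A.Ob) (v : A.hom X Y) :
    low z f X (A.cons X Y Y v (A.one Y)) = f X v := by
  have h : low z f X (A.cons X Y Y v (A.inj Chain.nil (A.tensNil Y 1))) = f X v := by
    rw [cons_inj, low, lift_inj, lowAux]; simp
  exact h

@[simp] theorem low_cons_cons (X Z W : A.Ob) (v : A.hom X Z) (v' : A.hom Z W) (w : A.T W Y) :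
    low z f X (A.cons X Z Y v (A.cons Z W Y v' w)) = 0 := by
  induction w using inj_induction with
  | zero => simp
  | add a b ha hb => simp [ha, hb]
  | inj p t => rw [cons_inj, cons_inj, low, lift_inj, lowAux]; simp

end low

/-- the projection `pr₁ : TA → A` -/
def proj (A : GQuiver k) (X Y : A.Ob) : A.T X Y →ₗ[k] A.hom X Y :=
  low (M := fun X => A.hom X Y) 0 (fun _ => LinearMap.id) X

@[simp] theorem proj_one (Y : A.Ob) : A.proj Y Y (A.one Y) = 0 := by simp [proj]
@[simp] theorem proj_cons_one (X Y : A.Ob) (v) : A.proj X Y (A.cons X Y Y v (A.one Y)) = v := by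
  simp [proj]
@[simp] theorem proj_cons_cons (X Z W Y : A.Ob) (v v' w) :
    A.proj X Y (A.cons X Z Y v (A.cons Z W Y v' w)) = 0 := by
  simp [proj]

/-! convolutions -/

/-- `cons` with the last object first -/
def consL (A : GQuiver k) (Y : A.Ob) : ∀ X Z, A.hom X Z →ₗ[k] A.T Z Y →ₗ[k] A.T X Y :=
  fun X Z => A.cons X Z Y

/-- tensor two families along the cut -/
def dconv {X Y : A.Ob} {x y : B.Ob} {o : A.Ob → B.Ob} (φ : ∀ Z, A.T X Z →ₗ[k] B.T x (o Z))
    (ψ : ∀ Z, A.T Z Y →ₗ[k] B.T (o Z) y) : A.T X Y →ₗ[k] B.T2 x y :=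
  elim₂ (fun Z => (B.tmul₂ x (o Z) y).compl₁₂ (φ Z) (ψ Z)) ∘ₗ A.cut X Y

/-- `w ↦ ∑ φ w₁ ⊗ ψ w₂` -/
abbrev tconv {X Y : A.Ob} {x y : B.Ob} {o : A.Ob → B.Ob} (φ : ∀ Z, A.T X Z →ₗ[k] B.hom x (o Z))
    (ψ : ∀ Z, A.T Z Y →ₗ[k] B.T (o Z) y) : A.T X Y →ₗ[k] B.T x y :=
  conv (consL B y) φ ψ

section
variable {X Y : A.Ob} {x y : B.Ob} {o : A.Ob → B.Ob}

theorem cut_tconv (φ : ∀ Z, A.T X Z →ₗ[k] B.hom x (o Z)) (ψ : ∀ Z, A.T Z Y →ₗ[k] B.T (o Z) y)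
    (w : A.T X Y) : B.cut x y (tconv φ ψ w) = B.tmul₂ x x y (B.one x) (tconv φ ψ w) +
      conv (fun x z => B.cons₂ x z y) φ (fun Z => B.cut (o Z) y ∘ₗ ψ Z) w := by
  simp only [conv, LinearMap.comp_apply]
  generalize A.cut X Y w = t
  induction t using induction₂ with
  | zero => simp
  | add a b ha hb => simp only [map_add, ha, hb]; abel
  | tmul Z a b => simp [consL]

theorem dconv_dconv {o' : A.Ob → B.Ob} (φ : ∀ Z, A.T X Z →ₗ[k] B.hom x (o Z))
    (ψ : ∀ Z W, A.T Z W →ₗ[k] B.T (o Z) (o' W)) (χ : ∀ W, A.T W Y →ₗ[k] B.T (o' W) y) (w : A.T X Y) :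
    dconv (fun W => tconv φ (fun Z => ψ Z W)) χ w =
      conv (fun x z => B.cons₂ x z y) φ (fun Z => dconv (ψ Z) χ) w := by
  refine ((coassoc (fun V W => LinearMap.mk₂ k (fun a b => B.cons₂ x (o V) y (φ V a) ∘ₗ
    B.tmul₂ (o V) (o' W) y (ψ V W b) ∘ₗ χ W) ?_ ?_ ?_ ?_) _ ?_ w).trans ?_).symm
  · intros; ext; simp
  · intros; ext; simp
  · intros; ext; simp
  · intros; ext; simp
  · intro V a b
    simp only [LinearMap.compl₁₂_apply, dconv, LinearMap.comp_apply]
    generalize A.cut V Y b = t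
    induction t using induction₂ with
    | zero => simp
    | add a b ha hb => simp only [map_add, ha, hb]
    | tmul Z a b => simp
  · simp only [dconv, LinearMap.comp_apply]
    congr 2
    funext W
    ext a b
    simp only [conv, LinearMap.compl₁₂_apply, LinearMap.comp_apply]
    generalize A.cut X W a = t
    induction t using induction₂ with
    | zero => simp
    | add a b ha hb => simp only [map_add, LinearMap.add_apply, ha, hb]
    | tmul Z a b => simp [consL]

theorem dconv_add_left (φ φ' : ∀ Z, A.T X Z →ₗ[k] B.T x (o Z)) (ψ : ∀ Z, A.T Z Y →ₗ[k] B.T (o Z) y) :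
    dconv (fun Z => φ Z + φ' Z) ψ = dconv φ ψ + dconv φ' ψ := by
  ext w
  simp only [dconv, LinearMap.comp_apply, LinearMap.add_apply, ← elim₂_add]
  congr 2
  funext Z
  ext a b
  simp

theorem dconv_eps (o : A.Ob → B.Ob) (ψ : ∀ Z, A.T Z Y →ₗ[k] B.T (o Z) y) (w : A.T X Y) :
    dconv (fun _ => eps o X) ψ w = B.tmul₂ (o X) (o X) y (B.one (o X)) (ψ X w) := by
  rw [dconv, LinearMap.comp_apply, counit_left]
  · simp
  · intros; simp

end
end GQuiver
end AInf

end

noncomputable section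

universe u

namespace AInf

open scoped TensorProduct DirectSum

open GQuiver

variable {k : Type u} [CommRing k] 

/-- An object map with components `TA(X,Y) → B(Xf,Yf)`. -/
structure FunData (A B : GQuiver k) where
  obj : A.Ob → B.Ob
  comp : ∀ X Y, A.T X Y →ₗ[k] B.hom (obj X) (obj Y)

variable {A B C : GQuiver k}

/-- the cocategory homomorphism `TA → TB` with components `f`, that is `∑ f_{a₁} ⊗ ⋯ ⊗ f_{aₙ}` -/
def hat (f : FunData A B) (X Y : A.Ob) : A.T X Y →ₗ[k] B.T (f.obj X) (f.obj Y) :=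
  coext (consL B (f.obj Y)) f.comp (fun X => eps f.obj X) X

/-- families of components `TA(X,Y) → B(X o, Y o')` (on `T⁰`, `T¹`, … together) -/
abbrev Fam (A B : GQuiver k) (o o' : A.Ob → B.Ob) : Type u :=
  ∀ X Y, A.T X Y →ₗ[k] B.hom (o X) (o' Y)

/-- `∑ f_{a₁} ⊗ ⋯ ⊗ f_{aₙ} ⊗ r_k ⊗ W` with `r` of degree `d`; the sign of `(x ⊗ y)(r ⊗ W) = (-1)^{|y| |r|} xr ⊗ yW`
is put on the argument of `W`. -/
def lead (f : FunData A B) {g : A.Ob → B.Ob} (r : Fam A B f.obj g) (d : ℤ) {Y : A.Ob} {y : B.Ob}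
    (W : ∀ Z, A.T Z Y →ₗ[k] B.T (g Z) y) (X : A.Ob) : A.T X Y →ₗ[k] B.T (f.obj X) y :=
  coext (consL B y) f.comp (fun X => tconv (r X) (fun Z => W Z ∘ₗ A.sgn d Z Y)) X

/-- the `(f,g)`-coderivation of degree `d` with components `r`: `∑ f ⊗ ⋯ ⊗ f ⊗ r ⊗ g ⊗ ⋯ ⊗ g` -/
def coder (f g : FunData A B) (d : ℤ) (r : Fam A B f.obj g.obj) (X Y : A.Ob) :
    A.T X Y →ₗ[k] B.T (f.obj X) (g.obj Y) :=
  lead f r d (fun Z => hat g Z Y) X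

/-- `(r ⊗ p)θ = ∑ f ⊗ ⋯ ⊗ f ⊗ r ⊗ g ⊗ ⋯ ⊗ g ⊗ p ⊗ h ⊗ ⋯ ⊗ h`, for `r`, `p` of degree `d`, `e` -/
def theta (f g h : FunData A B) (d e : ℤ) (r : Fam A B f.obj g.obj) (p : Fam A B g.obj h.obj)
    (X Y : A.Ob) : A.T X Y →ₗ[k] B.T (f.obj X) (h.obj Y) :=
  lead f r d (fun Z => coder g h e p Z Y) X

/-- the component on `T⁰` vanishes -/
def FunData.Unital0 (f : FunData A B) : Prop := ∀ X, f.comp X X (A.one X) = 0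

section convlemmas
variable {X Y : A.Ob} {x : B.Ob} {o : A.Ob → B.Ob} 
variable {N N' : B.Ob → Type u} [∀ x, AddCommGroup (N x)] [∀ x, Module k (N x)]
  [∀ x, AddCommGroup (N' x)] [∀ x, Module k (N' x)]
  (act : ∀ x z, B.hom x z →ₗ[k] N z →ₗ[k] N x) (act' : ∀ x z, B.hom x z →ₗ[k] N' z →ₗ[k] N' x)

theorem conv_add_right (φ : ∀ Z, A.T X Z →ₗ[k] B.hom x (o Z)) (ψ ψ' : ∀ Z, A.T Z Y →ₗ[k] N (o Z)) :
    conv act φ (fun Z => ψ Z + ψ' Z) = conv act φ ψ + conv act φ ψ' := by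
  ext w
  simp only [conv, LinearMap.comp_apply, LinearMap.add_apply, ← elim₂_add]
  congr 2
  funext Z
  ext a b
  simp

theorem conv_add_left (φ φ' : ∀ Z, A.T X Z →ₗ[k] B.hom x (o Z)) (ψ : ∀ Z, A.T Z Y →ₗ[k] N (o Z)) :
    conv act (fun Z => φ Z + φ' Z) ψ = conv act φ ψ + conv act φ' ψ := by
  ext w
  simp only [conv, LinearMap.comp_apply, LinearMap.add_apply, ← elim₂_add]
  congr 2
  funext Z
  ext a b
  simp

theorem dconv_add_right {y : B.Ob} (φ : ∀ Z, A.T X Z →ₗ[k] B.T x (o Z)) (ψ ψ' : ∀ Z, A.T Z Y →ₗ[k] B.T (o Z) y) :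
    dconv φ (fun Z => ψ Z + ψ' Z) = dconv φ ψ + dconv φ ψ' := by
  ext w
  simp only [dconv, LinearMap.comp_apply, LinearMap.add_apply, ← elim₂_add]
  congr 2
  funext Z
  ext a b
  simp

theorem dconv_zsmul_right {y : B.Ob} (φ : ∀ Z, A.T X Z →ₗ[k] B.T x (o Z)) (ψ : ∀ Z, A.T Z Y →ₗ[k] B.T (o Z) y)
    (n : ℤ) : dconv φ (fun Z => n • ψ Z) = n • dconv φ ψ := by
  ext w
  simp only [dconv, LinearMap.comp_apply, LinearMap.smul_apply]
  generalize A.cut X Y w = t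
  induction t using induction₂ with
  | zero => simp
  | add a b ha hb => simp only [map_add, ha, hb, smul_add]
  | tmul Z a b => simp

theorem dconv_zsmul_left {y : B.Ob} (φ : ∀ Z, A.T X Z →ₗ[k] B.T x (o Z)) (ψ : ∀ Z, A.T Z Y →ₗ[k] B.T (o Z) y)
    (n : ℤ) : dconv (fun Z => n • φ Z) ψ = n • dconv φ ψ := by
  ext w
  simp only [dconv, LinearMap.comp_apply, LinearMap.smul_apply]
  generalize A.cut X Y w = t
  induction t using induction₂ with
  | zero => simp
  | add a b ha hb => simp only [map_add, ha, hb, smul_add]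
  | tmul Z a b => simp

/-- composing a tensor product of families with a map that splits along the cut -/
theorem dconv_comp {c : C.Ob} {y : C.Ob} {b : B.Ob} {u : B.Ob → C.Ob}
    (φ : ∀ Z, B.T x Z →ₗ[k] C.T c (u Z)) (ψ : ∀ Z, B.T Z b →ₗ[k] C.T (u Z) y)
    (α : ∀ Z, A.T X Z →ₗ[k] B.T x (o Z)) (β : ∀ Z, A.T Z Y →ₗ[k] B.T (o Z) b) (w : A.T X Y) :
    elim₂ (fun Z => (C.tmul₂ c (u Z) y).compl₁₂ (φ Z) (ψ Z)) (dconv α β w) =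
      dconv (o := fun Z => u (o Z)) (fun Z => φ (o Z) ∘ₗ α Z) (fun Z => ψ (o Z) ∘ₗ β Z) w := by
  simp only [dconv, LinearMap.comp_apply]
  generalize A.cut X Y w = t
  induction t using induction₂ with
  | zero => simp
  | add a b ha hb => simp only [map_add, ha, hb]
  | tmul Z a b => simp
end convlemmas

section lead
variable {f : FunData A B} {g : A.Ob → B.Ob} {Y : A.Ob} {y : B.Ob}

theorem lead_eq (hf : f.Unital0) (r : Fam A B f.obj g) (d : ℤ)
    (W : ∀ Z, A.T Z Y →ₗ[k] B.T (g Z) y) (X : A.Ob) : lead f r d W X =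
    tconv (r X) (fun Z => W Z ∘ₗ A.sgn d Z Y) + tconv (f.comp X) (lead f r d W) := by
  ext w
  exact coext_eq _ _ hf X w

theorem hat_eq (hf : f.Unital0) (X : A.Ob) : hat f X Y = eps f.obj X + tconv (f.comp X) (fun Z => hat f Z Y) := by
  ext w
  exact coext_eq _ _ hf X w

theorem cut_lead (hf : f.Unital0) (r : Fam A B f.obj g) (d : ℤ)
    (W : ∀ Z, A.T Z Y →ₗ[k] B.T (g Z) y) (X : A.Ob) (w : A.T X Y) : B.cut _ _ (lead f r d W X w) =
    B.tmul₂ _ _ _ (B.one (f.obj X)) (lead f r d W X w) +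
    conv (fun x z => B.cons₂ x z y) (r X) (fun Z => B.cut (g Z) y ∘ₗ W Z ∘ₗ A.sgn d Z Y) w +
    conv (fun x z => B.cons₂ x z y) (f.comp X) (fun Z => B.cut (f.obj Z) y ∘ₗ lead f r d W Z) w := by
  conv_lhs => rw [lead_eq hf]
  conv_rhs => enter [1, 1]; rw [lead_eq hf]
  rw [LinearMap.add_apply, map_add, map_add, cut_tconv, cut_tconv]
  abel

theorem cut_hat (hf : f.Unital0) (X : A.Ob) (w : A.T X Y) : B.cut _ _ (hat f X Y w) =
    dconv (fun Z => hat f X Z) (fun Z => hat f Z Y) w := by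
  refine coext_unique (N := fun z => B.T2 z (f.obj Y)) (act := fun x z => B.cons₂ x z (f.obj Y)) f.comp
    (fun X => B.tmul₂ _ _ _ (B.one (f.obj X)) ∘ₗ hat f X Y) hf
    (U := fun X => B.cut _ _ ∘ₗ hat f X Y)
    (V := fun X => dconv (fun Z => hat f X Z) (fun Z => hat f Z Y)) ?_ ?_ X w
  · intro X w
    have h0 : B.cut _ _ (eps (B := B) f.obj X w) = B.tmul₂ _ _ _ (B.one (f.obj X)) (eps (B := B) f.obj X w) := by
      refine induction_on (motive := fun X w => B.cut _ _ (eps (B := B) f.obj X w) = B.tmul₂ _ _ _ (B.one (f.obj X)) (eps (B := B) f.obj X w)) ?_ ?_ ?_ ?_ w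
      · simp
      · intro X a b ha hb; simp [ha, hb]
      · intro c; simp
      · intros; simp
    simp only [LinearMap.comp_apply]
    conv_lhs => rw [hat_eq hf]
    conv_rhs => enter [1]; rw [hat_eq hf]
    rw [LinearMap.add_apply, map_add, map_add, cut_tconv, h0]
    abel
  · intro X w
    have : (fun Z => hat f X Z) = fun Z => (eps f.obj X : A.T X Z →ₗ[k] B.T _ (f.obj Z)) +
        tconv (f.comp X) (fun V => hat f V Z) := by
      funext Z; exact hat_eq hf X
    rw [this, dconv_add_left, LinearMap.add_apply, dconv_eps, dconv_dconv (ψ := fun Z W => hat f Z W)]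
    rfl

end lead
end AInf

end

noncomputable section

universe u

namespace AInf

open scoped TensorProduct DirectSum

open GQuiver

variable {k : Type u} [CommRing k] {A B C : GQuiver k}

theorem elim₂_cut_sgn (d : ℤ) {X Y : A.Ob} {P : Type u} [AddCommGroup P] [Module k P]
    (β : ∀ Z, A.T X Z →ₗ[k] A.T Z Y →ₗ[k] P) (w : A.T X Y) :
    elim₂ β (A.cut X Y (A.sgn d X Y w)) =
      elim₂ (fun Z => (β Z).compl₁₂ (A.sgn d X Z) (A.sgn d Z Y)) (A.cut X Y w) := by
  revert β
  refine induction_on (motive := fun X w => ∀ (β : ∀ Z, A.T X Z →ₗ[k] A.T Z Y →ₗ[k] P),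
    elim₂ β (A.cut X Y (A.sgn d X Y w)) =
      elim₂ (fun Z => (β Z).compl₁₂ (A.sgn d X Z) (A.sgn d Z Y)) (A.cut X Y w)) ?_ ?_ ?_ ?_ w
  · intros; simp
  · intro X w w' h h' β
    simp only [map_add, h β, h' β]
  · intro c β
    simp
  · intro X Z v w ih β
    rw [sgn_cons, cut_sum_cons, cut_sum_cons, ih]
    congr 1
    · simp
    · congr 2
      funext W
      ext a b
      simp

theorem dconv_sgn (d : ℤ) {X Y : A.Ob} {x y : B.Ob} {o : A.Ob → B.Ob} (φ : ∀ Z, A.T X Z →ₗ[k] B.T x (o Z))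
    (ψ : ∀ Z, A.T Z Y →ₗ[k] B.T (o Z) y) (w : A.T X Y) :
    dconv φ ψ (A.sgn d X Y w) =
      dconv (fun Z => φ Z ∘ₗ A.sgn d X Z) (fun Z => ψ Z ∘ₗ A.sgn d Z Y) w := by
  simp only [dconv, LinearMap.comp_apply, elim₂_cut_sgn]
  rfl

section
variable {f g h : FunData A B}
  {d e : ℤ} {r : Fam A B f.obj g.obj} {p : Fam A B g.obj h.obj} {X Y : A.Ob}

theorem cut_coder (hf : f.Unital0) (hg : g.Unital0) (w : A.T X Y) : B.cut _ _ (coder f g d r X Y w) =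
    dconv (fun Z => hat f X Z) (fun Z => coder f g d r Z Y) w +
      dconv (fun Z => coder f g d r X Z) (fun Z => hat g Z Y ∘ₗ A.sgn d Z Y) w := by
  refine coext_unique (N := fun z => B.T2 z (g.obj Y)) (act := fun x z => B.cons₂ x z (g.obj Y)) f.comp
    (fun X => B.tmul₂ _ _ _ (B.one (f.obj X)) ∘ₗ coder f g d r X Y +
      conv (fun x z => B.cons₂ x z (g.obj Y)) (r X)
        (fun Z => dconv (fun V => hat g Z V ∘ₗ A.sgn d Z V) (fun V => hat g V Y ∘ₗ A.sgn d V Y))) hf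
    (U := fun X => B.cut _ _ ∘ₗ coder f g d r X Y)
    (V := fun X => dconv (fun Z => hat f X Z) (fun Z => coder f g d r Z Y) +
      dconv (fun Z => coder f g d r X Z) (fun Z => hat g Z Y ∘ₗ A.sgn d Z Y)) ?_ ?_ X w
  · intro X w
    rw [LinearMap.comp_apply, coder, cut_lead hf]
    simp only [LinearMap.add_apply, LinearMap.comp_apply]
    congr 3
    congr 1
    funext Z
    ext w
    simp only [LinearMap.comp_apply]
    rw [cut_hat hg, dconv_sgn]
  · intro X w
    have h1 : (fun Z => hat f X Z) = fun Z => (eps f.obj X : A.T X Z →ₗ[k] B.T _ (f.obj Z)) +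
        tconv (f.comp X) (fun V => hat f V Z) := by
      funext Z; exact hat_eq hf X
    have h2 : (fun Z => coder f g d r X Z) = fun Z => tconv (r X) (fun V => hat g V Z ∘ₗ A.sgn d V Z) +
        tconv (f.comp X) (fun V => coder f g d r V Z) := by
      funext Z; exact lead_eq hf _ _ _ X
    rw [h1, h2, dconv_add_left, dconv_add_left, conv_add_right]
    simp only [LinearMap.add_apply]
    rw [dconv_eps, dconv_dconv (ψ := fun Z W => hat f Z W), dconv_dconv (ψ := fun Z W => coder f g d r Z W),
      dconv_dconv (ψ := fun Z W => hat g Z W ∘ₗ A.sgn d Z W)]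
    simp only [LinearMap.comp_apply]
    abel

theorem cut_theta (hf : f.Unital0) (hg : g.Unital0) (hh : h.Unital0) (w : A.T X Y) : B.cut _ _ (theta f g h d e r p X Y w) =
    dconv (fun Z => hat f X Z) (fun Z => theta f g h d e r p Z Y) w +
      dconv (fun Z => coder f g d r X Z) (fun Z => coder g h e p Z Y ∘ₗ A.sgn d Z Y) w +
      dconv (fun Z => theta f g h d e r p X Z) (fun Z => hat h Z Y ∘ₗ A.sgn (d + e) Z Y) w := by
  refine coext_unique (N := fun z => B.T2 z (h.obj Y)) (act := fun x z => B.cons₂ x z (h.obj Y)) f.comp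
    (fun X => B.tmul₂ _ _ _ (B.one (f.obj X)) ∘ₗ theta f g h d e r p X Y +
      conv (fun x z => B.cons₂ x z (h.obj Y)) (r X)
        (fun Z => dconv (fun V => hat g Z V ∘ₗ A.sgn d Z V) (fun V => coder g h e p V Y ∘ₗ A.sgn d V Y) +
          dconv (fun V => coder g h e p Z V ∘ₗ A.sgn d Z V) (fun V => hat h V Y ∘ₗ A.sgn (d + e) V Y))) hf
    (U := fun X => B.cut _ _ ∘ₗ theta f g h d e r p X Y)
    (V := fun X => dconv (fun Z => hat f X Z) (fun Z => theta f g h d e r p Z Y) +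
      dconv (fun Z => coder f g d r X Z) (fun Z => coder g h e p Z Y ∘ₗ A.sgn d Z Y) +
      dconv (fun Z => theta f g h d e r p X Z) (fun Z => hat h Z Y ∘ₗ A.sgn (d + e) Z Y)) ?_ ?_ X w
  · intro X w
    rw [LinearMap.comp_apply, theta, cut_lead hf]
    simp only [LinearMap.add_apply, LinearMap.comp_apply]
    congr 3
    congr 1
    funext Z
    ext w
    simp only [LinearMap.comp_apply, LinearMap.add_apply]
    rw [cut_coder hg hh, dconv_sgn, dconv_sgn]
    congr 3
    funext V
    ext w
    simp only [LinearMap.comp_apply, sgn_sgn, add_comm]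
  · intro X w
    have h1 : (fun Z => hat f X Z) = fun Z => (eps f.obj X : A.T X Z →ₗ[k] B.T _ (f.obj Z)) +
        tconv (f.comp X) (fun V => hat f V Z) := by
      funext Z; exact hat_eq hf X
    have h2 : (fun Z => coder f g d r X Z) = fun Z => tconv (r X) (fun V => hat g V Z ∘ₗ A.sgn d V Z) +
        tconv (f.comp X) (fun V => coder f g d r V Z) := by
      funext Z; exact lead_eq hf _ _ _ X
    have h3 : (fun Z => theta f g h d e r p X Z) = fun Z => tconv (r X) (fun V => coder g h e p V Z ∘ₗ A.sgn d V Z) +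
        tconv (f.comp X) (fun V => theta f g h d e r p V Z) := by
      funext Z; exact lead_eq hf _ _ _ X
    rw [h1, h2, h3, dconv_add_left, dconv_add_left, dconv_add_left, conv_add_right, conv_add_right, conv_add_right]
    simp only [LinearMap.add_apply]
    rw [dconv_eps, dconv_dconv (ψ := fun Z W => hat f Z W), dconv_dconv (ψ := fun Z W => coder f g d r Z W),
      dconv_dconv (ψ := fun Z W => hat g Z W ∘ₗ A.sgn d Z W), dconv_dconv (ψ := fun Z W => theta f g h d e r p Z W),
      dconv_dconv (ψ := fun Z W => coder g h e p Z W ∘ₗ A.sgn d Z W)]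
    simp only [LinearMap.comp_apply]
    abel
end

/-! counits, projections -/

section
variable {X Y : A.Ob} {x y : B.Ob} {o : A.Ob → B.Ob}

/-- projection to `T⁰` -/
def epsI (A : GQuiver k) (X Y : A.Ob) : A.T X Y →ₗ[k] A.T X Y :=
  A.fold (M := fun X => A.T X Y) (A.one Y) (fun _ _ => 0) X

@[simp] theorem epsI_one (Y : A.Ob) : epsI A Y Y (A.one Y) = A.one Y := by simp [epsI]
@[simp] theorem epsI_cons (X Z Y : A.Ob) (v w) : epsI A X Y (A.cons X Z Y v w) = 0 := by simp [epsI]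

theorem eps_id_tconv (φ : ∀ Z, A.T X Z →ₗ[k] B.hom x (o Z)) (ψ : ∀ Z, A.T Z Y →ₗ[k] B.T (o Z) y)
    (w : A.T X Y) : epsI B x y (tconv φ ψ w) = 0 := by
  simp only [conv, LinearMap.comp_apply]
  generalize A.cut X Y w = t
  induction t using induction₂ with
  | zero => simp
  | add a b ha hb => simp only [map_add, ha, hb, add_zero]
  | tmul Z a b => simp [consL]

theorem proj_tconv_tconv {o' : A.Ob → B.Ob} (φ : ∀ Z, A.T X Z →ₗ[k] B.hom x (o Z))
    (φ' : ∀ Z V, A.T Z V →ₗ[k] B.hom (o Z) (o' V))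
    (ψ : ∀ Z, A.T Z Y →ₗ[k] B.T (o' Z) y)
    (w : A.T X Y) : B.proj x y (tconv φ (fun Z => tconv (φ' Z) ψ) w) = 0 := by
  simp only [conv, LinearMap.comp_apply]
  generalize A.cut X Y w = t
  induction t using induction₂ with
  | zero => simp
  | add a b ha hb => simp only [map_add, ha, hb, add_zero]
  | tmul Z a b =>
    simp only [elim₂_tmul₂, LinearMap.compl₁₂_apply, LinearMap.comp_apply]
    generalize A.cut Z Y b = t
    induction t using induction₂ with
    | zero => simp
    | add a b ha hb => simp only [map_add, ha, hb, add_zero]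
    | tmul Z a b => simp [consL]

theorem tconv_sgn (d : ℤ) (φ : ∀ Z, A.T X Z →ₗ[k] B.hom x (o Z)) (ψ : ∀ Z, A.T Z Y →ₗ[k] B.T (o Z) y)
    (w : A.T X Y) : tconv φ ψ (A.sgn d X Y w) =
      tconv (fun Z => φ Z ∘ₗ A.sgn d X Z) (fun Z => ψ Z ∘ₗ A.sgn d Z Y) w := by
  simp only [conv, LinearMap.comp_apply, elim₂_cut_sgn]
  rfl

theorem proj_tconv_eps (φ : ∀ Z, A.T X Z →ₗ[k] B.hom x (o Z)) (w : A.T X Y) :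
    B.proj x (o Y) (tconv φ (fun Z => eps o Z) w) = φ Y w := by
  unfold tconv conv
  rw [LinearMap.comp_apply, counit_right]
  · simp [consL]
  · intros; simp

end

section
variable {f g h : FunData A B}
  {d e : ℤ} {r : Fam A B f.obj g.obj} {p : Fam A B g.obj h.obj} {X Y : A.Ob}

theorem eps_sgn (o : A.Ob → B.Ob) (w : A.T X Y) : eps (B := B) o X (A.sgn d X Y w) = eps o X w := by
  refine induction_on (motive := fun X w => eps (B := B) o X (A.sgn d X Y w) = eps o X w) ?_ ?_ ?_ ?_ w
  · simp
  · intro X a b ha hb; simp [ha, hb]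
  · intro c; simp
  · intros; simp

theorem eps_eps (o : A.Ob → B.Ob) (w : A.T X Y) : epsI B _ _ (eps (B := B) o X w) = eps o X w := by
  refine induction_on (motive := fun X w => epsI B _ _ (eps (B := B) o X w) = eps o X w) ?_ ?_ ?_ ?_ w
  · simp
  · intro X a b ha hb; simp only [map_add, ha, hb]
  · intro c; simp
  · intros; simp

theorem proj_eps (o : A.Ob → B.Ob) (w : A.T X Y) : B.proj _ _ (eps (B := B) o X w) = 0 := by
  refine induction_on (motive := fun X w => B.proj _ _ (eps (B := B) o X w) = 0) ?_ ?_ ?_ ?_ w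
  · simp
  · intro X a b ha hb; simp [ha, hb]
  · intro c; simp
  · intros; simp

theorem eps_hat (hf : f.Unital0) (w : A.T X Y) : epsI B _ _ (hat f X Y w) = eps f.obj X w := by
  rw [hat_eq hf, LinearMap.add_apply, map_add, eps_id_tconv, add_zero]
  exact eps_eps f.obj w

theorem eps_lead (hf : f.Unital0) {y : B.Ob} (W : ∀ Z, A.T Z Y →ₗ[k] B.T (g.obj Z) y) (w : A.T X Y) :
    epsI B _ _ (lead f r d W X w) = 0 := by
  rw [lead_eq hf, LinearMap.add_apply, map_add, eps_id_tconv, eps_id_tconv, add_zero]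

theorem proj_hat (hf : f.Unital0) (w : A.T X Y) : B.proj _ _ (hat f X Y w) = f.comp X Y w := by
  have h : hat f X Y = eps f.obj X + (tconv (f.comp X) (fun Z => eps f.obj Z) +
      tconv (f.comp X) (fun Z => tconv (f.comp Z) (fun V => hat f V Y))) := by
    rw [← conv_add_right, hat_eq hf]
    congr 2
    funext Z; exact hat_eq hf Z
  rw [h, LinearMap.add_apply, LinearMap.add_apply, map_add, map_add, proj_eps, proj_tconv_eps,
    proj_tconv_tconv]
  simp

theorem proj_coder (hf : f.Unital0) (hg : g.Unital0) (w : A.T X Y) : B.proj _ _ (coder f g d r X Y w) = r X Y w := by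
  have h : coder f g d r X Y = (tconv (r X) (fun Z => eps g.obj Z) +
      tconv (r X) (fun Z => tconv (fun V => g.comp Z V ∘ₗ A.sgn d Z V) (fun V => hat g V Y ∘ₗ A.sgn d V Y))) +
      (tconv (f.comp X) (fun Z => tconv (r Z) (fun V => hat g V Y ∘ₗ A.sgn d V Y)) +
      tconv (f.comp X) (fun Z => tconv (f.comp Z) (fun V => coder f g d r V Y))) := by
    rw [← conv_add_right, ← conv_add_right, coder, lead_eq hf]
    congr 2
    · funext Z
      ext w
      rw [LinearMap.comp_apply, hat_eq hg, LinearMap.add_apply, LinearMap.add_apply, eps_sgn, tconv_sgn]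
    · funext Z
      exact lead_eq hf _ _ _ Z
  rw [h, LinearMap.add_apply, LinearMap.add_apply, LinearMap.add_apply, map_add, map_add, map_add,
    proj_tconv_eps, proj_tconv_tconv (φ' := fun Z V => g.comp Z V ∘ₗ A.sgn d Z V), proj_tconv_tconv, proj_tconv_tconv]
  simp

theorem proj_theta (hf : f.Unital0) (hg : g.Unital0) (w : A.T X Y) : B.proj _ _ (theta f g h d e r p X Y w) = 0 := by
  have h : theta f g h d e r p X Y = (tconv (r X) (fun Z => tconv (fun V => p Z V ∘ₗ A.sgn d Z V) (fun V => hat h V Y ∘ₗ A.sgn e V Y ∘ₗ A.sgn d V Y)) +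
      tconv (r X) (fun Z => tconv (fun V => g.comp Z V ∘ₗ A.sgn d Z V) (fun V => coder g h e p V Y ∘ₗ A.sgn d V Y))) +
      (tconv (f.comp X) (fun Z => tconv (r Z) (fun V => coder g h e p V Y ∘ₗ A.sgn d V Y)) +
      tconv (f.comp X) (fun Z => tconv (f.comp Z) (fun V => theta f g h d e r p V Y))) := by
    rw [← conv_add_right, ← conv_add_right, theta, lead_eq hf]
    congr 2
    · funext Z
      ext w
      rw [LinearMap.comp_apply, coder, lead_eq hg, LinearMap.add_apply, LinearMap.add_apply, tconv_sgn, tconv_sgn]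
      rfl
    · funext Z
      exact lead_eq hf _ _ _ Z
  rw [h, LinearMap.add_apply, LinearMap.add_apply, LinearMap.add_apply, map_add, map_add, map_add,
    proj_tconv_tconv (φ' := fun Z V => p Z V ∘ₗ A.sgn d Z V), proj_tconv_tconv (φ' := fun Z V => g.comp Z V ∘ₗ A.sgn d Z V), proj_tconv_tconv, proj_tconv_tconv]
  simp

/-- reconstruction of a tensor from its cuts -/
theorem recon (t : A.T X Y) : t = epsI A X Y t + elim₂ (fun Z => (A.cons X Z Y).comp (A.proj X Z)) (A.cut X Y t) := by
  refine induction_on (motive := fun X t => t = epsI A X Y t +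
    elim₂ (fun Z => (A.cons X Z Y).comp (A.proj X Z)) (A.cut X Y t)) ?_ ?_ ?_ ?_ t
  · simp
  · intro X a b ha hb
    conv_lhs => rw [ha, hb]
    simp only [map_add]; abel
  · intro c
    simp
  · intro X Z v w _
    rw [epsI_cons, zero_add, cut_sum_cons, counit_left]
    · simp
    · intro W Z' v' a b; simp

theorem hat_unique {F : ∀ X Y, A.T X Y →ₗ[k] B.T (f.obj X) (f.obj Y)}
    (hf : f.Unital0)
    (h1 : ∀ X Y w, B.proj _ _ (F X Y w) = f.comp X Y w)
    (h2 : ∀ X Y w, B.cut _ _ (F X Y w) = dconv (fun Z => F X Z) (fun Z => F Z Y) w)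
    (h3 : ∀ X Y w, epsI B _ _ (F X Y w) = eps f.obj X w) (X Y : A.Ob) (w : A.T X Y) :
    F X Y w = hat f X Y w := by
  refine coext_unique (N := fun z => B.T z (f.obj Y)) (act := consL B (f.obj Y)) f.comp
    (fun X => eps f.obj X) hf (U := fun X => F X Y) (V := fun X => hat f X Y) ?_ ?_ X w
  · intro X w
    conv_lhs => rw [recon (F X Y w), h2, h3]
    simp only [dconv, conv, LinearMap.comp_apply]
    congr 1
    generalize A.cut X Y w = t
    induction t using induction₂ with
    | zero => simp
    | add a b ha hb => simp only [map_add, ha, hb]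
    | tmul Z a b => simp [h1, consL]
  · intro X w
    exact LinearMap.congr_fun (hat_eq hf X) w

theorem coder_unique {R : ∀ X Y, A.T X Y →ₗ[k] B.T (f.obj X) (g.obj Y)}
    (hf : f.Unital0)
    (h1 : ∀ X Y w, B.proj _ _ (R X Y w) = r X Y w)
    (h2 : ∀ X Y w, B.cut _ _ (R X Y w) = dconv (fun Z => hat f X Z) (fun Z => R Z Y) w +
      dconv (fun Z => R X Z) (fun Z => hat g Z Y ∘ₗ A.sgn d Z Y) w)
    (h3 : ∀ X Y w, epsI B _ _ (R X Y w) = 0) (X Y : A.Ob) (w : A.T X Y) :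
    R X Y w = coder f g d r X Y w := by
  refine coext_unique (N := fun z => B.T z (g.obj Y)) (act := consL B (g.obj Y)) f.comp
    (fun X => tconv (r X) (fun Z => hat g Z Y ∘ₗ A.sgn d Z Y)) hf (U := fun X => R X Y)
    (V := fun X => coder f g d r X Y) ?_ ?_ X w
  · intro X w
    conv_lhs => rw [recon (R X Y w), h2, h3, zero_add, map_add]
    simp only [dconv, conv, LinearMap.comp_apply]
    rw [add_comm]
    congr 1
    all_goals
      generalize A.cut X Y w = t
      induction t using induction₂ with
      | zero => simp
      | add a b ha hb => simp only [map_add, ha, hb]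
      | tmul Z a b => simp [h1, consL, proj_hat hf]
  · intro X w
    exact LinearMap.congr_fun (lead_eq hf _ _ _ X) w
end
end AInf

end

noncomputable section

universe u

namespace AInf

open scoped TensorProduct DirectSum

open GQuiver

variable {k : Type u} [CommRing k] {A B C : GQuiver k}

/-- homogeneous of degree `d` -/
def Homog {o o' : A.Ob → B.Ob} (d : ℤ) (r : Fam A B o o') : Prop :=
  ∀ X Y e, ∀ w ∈ A.Tgr X Y e, r X Y w ∈ B.gr (o X) (o' Y) (e + d)

section degree
variable {X Y : A.Ob} {x y : B.Ob} {o : A.Ob → B.Ob}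

theorem tconv_mem (d e : ℤ) {φ : ∀ Z, A.T X Z →ₗ[k] B.hom x (o Z)} {ψ : ∀ Z, A.T Z Y →ₗ[k] B.T (o Z) y}
    (hφ : ∀ Z i, ∀ w ∈ A.Tgr X Z i, φ Z w ∈ B.gr x (o Z) (i + d))
    (hψ : ∀ Z i, ∀ w ∈ A.Tgr Z Y i, ψ Z w ∈ B.Tgr (o Z) y (i + e)) {i : ℤ} {w : A.T X Y}
    (hw : w ∈ A.Tgr X Y i) : tconv φ ψ w ∈ B.Tgr x y (i + (d + e)) := by
  refine cut_mem (B.Tgr x y) (d + e) _ ?_ hw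
  intro Z i j a ha b hb
  have := cons_mem (hφ Z i a ha) (hψ Z j b hb)
  simp only [consL, LinearMap.compl₁₂_apply]
  convert this using 2; ring

theorem coext_mem {f : Fam A B o o} (hf : Homog 0 f) (e : ℤ) {s : ∀ X, A.T X Y →ₗ[k] B.T (o X) y}
    (hs : ∀ Z i, ∀ w ∈ A.Tgr Z Y i, s Z w ∈ B.Tgr (o Z) y (i + e)) {i : ℤ} {w : A.T X Y}
    (hw : w ∈ A.Tgr X Y i) : coext (consL B y) f s X w ∈ B.Tgr (o X) y (i + e) := by
  have key : ∀ n Z i, ∀ w ∈ A.Tgr Z Y i, coextN (consL B y) f s n Z w ∈ B.Tgr (o Z) y (i + e) := by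
    intro n
    induction n with
    | zero => exact hs
    | succ n ih =>
      intro Z i w hw
      have := tconv_mem 0 e (φ := f Z) (fun V i w hw => hf Z V i w hw) ih hw
      rw [zero_add] at this
      exact add_mem (hs Z i w hw) this
  have : A.Tgr X Y i ≤ (B.Tgr (o X) y (i + e)).comap (coext (consL B y) f s X) := by
    refine iSup_le fun p => ?_
    rintro _ ⟨t, ht, rfl⟩
    simp only [Submodule.mem_comap, coext, lift_inj, LinearMap.comp_apply]
    exact key _ _ _ _ (Submodule.mem_iSup_of_mem p ⟨t, ht, rfl⟩)
  exact this hw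

theorem eps_mem (o : A.Ob → B.Ob) {i : ℤ} {w : A.T X Y} (hw : w ∈ A.Tgr X Y i) :
    eps (B := B) o X w ∈ B.Tgr (o X) (o Y) i := by
  refine Tgr_le (fun X i => (B.Tgr (o X) (o Y) i).comap (eps o X)) ?_ ?_ X i hw
  · simpa using one_mem (o Y)
  · intro X Z i j v hv w hw
    simp

theorem low_mem {M : A.Ob → Type u} [∀ X, AddCommGroup (M X)] [∀ X, Module k (M X)]
    (G : ∀ X, ℤ → Submodule k (M X)) {z : M Y} {f : ∀ X, A.hom X Y →ₗ[k] M X} (d : ℤ)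
    (hz : z ∈ G Y d) (hf : ∀ X i, ∀ v ∈ A.gr X Y i, f X v ∈ G X (i + d)) {i : ℤ} {w : A.T X Y}
    (hw : w ∈ A.Tgr X Y i) : low z f X w ∈ G X (i + d) := by
  have : A.Tgr X Y i ≤ (G X (i + d)).comap (low z f X) := by
    refine iSup_le fun p => ?_
    rw [Submodule.map_le_iff_le_comap]
    match X, p with
    | _, .nil =>
      rw [tensGr, Submodule.map_le_iff_le_comap]
      split_ifs with h
      · subst h
        rintro c -
        have : A.inj Chain.nil (A.tensNil Y c) = c • A.one Y := by
          rw [one, ← map_smul, ← map_smul, smul_eq_mul, mul_one]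
        simp only [Submodule.mem_comap, LinearEquiv.coe_coe, this, map_smul, low_one, zero_add]
        exact Submodule.smul_mem _ _ hz
      · exact bot_le
    | _, .cons X .nil =>
      rw [tensGr, Submodule.map_le_iff_le_comap]
      refine iSup_le fun j => Submodule.map₂_le.mpr fun v hv w hw => ?_
      obtain ⟨c, hc, rfl⟩ := hw
      have : A.inj Chain.nil (A.tensNil Y c) = c • A.one Y := by
          rw [one, ← map_smul, ← map_smul, smul_eq_mul, mul_one]
      simp only [Submodule.mem_comap, LinearEquiv.coe_coe, TensorProduct.mk_apply, ← cons_inj, this,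
        map_smul, low_cons_one]
      split_ifs at hc with h
      · obtain rfl : i = j := by omega
        exact Submodule.smul_mem _ _ (hf _ _ _ hv)
      · rw [show c = 0 from hc]; simp
    | _, .cons X (.cons Z p) =>
      rintro t -
      simp [low, lowAux]
  exact this hw

theorem proj_mem {i : ℤ} {w : A.T X Y} (hw : w ∈ A.Tgr X Y i) : A.proj X Y w ∈ A.gr X Y i := by
  have := low_mem (M := fun X => A.hom X Y) (fun X => A.gr X Y) (z := 0)
    (f := fun _ => LinearMap.id) 0 (zero_mem _) (by intro X i v hv; simpa using hv) hw
  rwa [add_zero] at this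

theorem hat_mem {f : FunData A B} (hf : Homog 0 f.comp) {i : ℤ} {w : A.T X Y}
    (hw : w ∈ A.Tgr X Y i) : hat f X Y w ∈ B.Tgr _ _ i := by
  have := coext_mem hf 0 (s := fun X => eps f.obj X) (y := f.obj Y)
    (by intro Z i w hw; simpa using eps_mem f.obj hw) hw
  rwa [add_zero] at this

theorem lead_mem {f : FunData A B} (hf : Homog 0 f.comp) {g : A.Ob → B.Ob} {r : Fam A B f.obj g}
    {d e : ℤ} (hr : Homog d r) {W : ∀ Z, A.T Z Y →ₗ[k] B.T (g Z) y}
    (hW : ∀ Z i, ∀ w ∈ A.Tgr Z Y i, W Z w ∈ B.Tgr (g Z) y (i + e)) {i : ℤ} {w : A.T X Y}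
    (hw : w ∈ A.Tgr X Y i) : lead f r d W X w ∈ B.Tgr _ _ (i + (d + e)) := by
  refine coext_mem hf (d + e) ?_ hw
  intro Z i w hw
  refine tconv_mem (o := g) d e (φ := r Z) (ψ := fun Z => W Z ∘ₗ A.sgn d Z Y) ?_ ?_ hw
  · intro V i w hw
    exact hr Z V i w hw
  · intro V i w hw
    exact hW V i _ (sgn_mem d hw)

variable {f g h : FunData A B}
  {d e : ℤ} {r : Fam A B f.obj g.obj} {p : Fam A B g.obj h.obj}

theorem coder_mem (hf : Homog 0 f.comp) (hg : Homog 0 g.comp) (hr : Homog d r) {i : ℤ} {w : A.T X Y}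
    (hw : w ∈ A.Tgr X Y i) : coder f g d r X Y w ∈ B.Tgr _ _ (i + d) := by
  have := lead_mem hf hr (e := 0) (W := fun Z => hat g Z Y)
    (by intro Z i w hw; simpa using hat_mem hg hw) hw
  rwa [add_zero] at this

theorem theta_mem (hf : Homog 0 f.comp) (hg : Homog 0 g.comp) (hh : Homog 0 h.comp) (hr : Homog d r) (hp : Homog e p) {i : ℤ} {w : A.T X Y}
    (hw : w ∈ A.Tgr X Y i) : theta f g h d e r p X Y w ∈ B.Tgr _ _ (i + (d + e)) :=
  lead_mem hf hr (W := fun Z => coder g h e p Z Y) (fun _ _ _ hw => coder_mem hg hh hp hw) hw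

theorem sgn_coder (hf : Homog 0 f.comp) (hg : Homog 0 g.comp) (hr : Homog d r) (c : ℤ) (w : A.T X Y) : B.sgn c _ _ (coder f g d r X Y w) =
    ((c * d).negOnePow : ℤ) • coder f g d r X Y (A.sgn c X Y w) :=
  sgn_hom (fun _ _ hw => coder_mem hf hg hr hw) w

theorem sgn_hat (hf : Homog 0 f.comp) (c : ℤ) (w : A.T X Y) : B.sgn c _ _ (hat f X Y w) = hat f X Y (A.sgn c X Y w) := by
  have := sgn_hom (d := c) (e := 0) (R := hat f X Y) (o := f.obj) (o' := f.obj)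
    (by intro i w hw; simpa using hat_mem hf hw) w
  simpa using this

theorem sgn_theta (hf : Homog 0 f.comp) (hg : Homog 0 g.comp) (hh : Homog 0 h.comp) (hr : Homog d r) (hp : Homog e p) (c : ℤ) (w : A.T X Y) : B.sgn c _ _ (theta f g h d e r p X Y w) =
    ((c * (d + e)).negOnePow : ℤ) • theta f g h d e r p X Y (A.sgn c X Y w) :=
  sgn_hom (fun _ _ hw => theta_mem hf hg hh hr hp hw) w
end degree

/-! linearity -/
section linear
variable {f g h : FunData A B} {Y : A.Ob} {y : B.Ob}
  {o : A.Ob → B.Ob}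

theorem conv_smul_right {X : A.Ob} {x : B.Ob} (c : k) (φ : ∀ Z, A.T X Z →ₗ[k] B.hom x (o Z))
    (ψ : ∀ Z, A.T Z Y →ₗ[k] B.T (o Z) y) :
    tconv φ (fun Z => c • ψ Z) = c • tconv φ ψ := by
  ext w
  simp only [conv, LinearMap.comp_apply, LinearMap.smul_apply]
  generalize A.cut X Y w = t
  induction t using induction₂ with
  | zero => simp
  | add a b ha hb => simp only [map_add, ha, hb, smul_add]
  | tmul Z a b => simp

theorem conv_smul_left {X : A.Ob} {x : B.Ob} (c : k) (φ : ∀ Z, A.T X Z →ₗ[k] B.hom x (o Z))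
    (ψ : ∀ Z, A.T Z Y →ₗ[k] B.T (o Z) y) :
    tconv (fun Z => c • φ Z) ψ = c • tconv φ ψ := by
  ext w
  simp only [conv, LinearMap.comp_apply, LinearMap.smul_apply]
  generalize A.cut X Y w = t
  induction t using induction₂ with
  | zero => simp
  | add a b ha hb => simp only [map_add, ha, hb, smul_add]
  | tmul Z a b => simp

theorem lead_add_left (hf : f.Unital0) (r r' : Fam A B f.obj o) (d : ℤ) (W : ∀ Z, A.T Z Y →ₗ[k] B.T (o Z) y) (X : A.Ob) :
    lead f (r + r') d W X = lead f r d W X + lead f r' d W X := by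
  ext w
  refine coext_unique (N := fun z => B.T z y) (act := consL B y) f.comp
    (fun X => tconv ((r + r') X) (fun Z => W Z ∘ₗ A.sgn d Z Y)) hf (U := lead f (r + r') d W)
    (V := fun X => lead f r d W X + lead f r' d W X) ?_ ?_ X w
  · intro X w; exact LinearMap.congr_fun (lead_eq hf _ _ _ X) w
  · intro X w
    rw [conv_add_right]
    have : tconv ((r + r') X) (fun Z => W Z ∘ₗ A.sgn d Z Y) = _ :=
      conv_add_left (consL B y) (r X) (r' X) (fun Z => W Z ∘ₗ A.sgn d Z Y)
    rw [this]
    conv_lhs => rw [lead_eq hf r, lead_eq hf r']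
    simp only [LinearMap.add_apply]
    abel

theorem lead_smul_left (hf : f.Unital0) (c : k) (r : Fam A B f.obj o) (d : ℤ) (W : ∀ Z, A.T Z Y →ₗ[k] B.T (o Z) y) (X : A.Ob) :
    lead f (c • r) d W X = c • lead f r d W X := by
  ext w
  refine coext_unique (N := fun z => B.T z y) (act := consL B y) f.comp
    (fun X => tconv ((c • r) X) (fun Z => W Z ∘ₗ A.sgn d Z Y)) hf (U := lead f (c • r) d W)
    (V := fun X => c • lead f r d W X) ?_ ?_ X w
  · intro X w; exact LinearMap.congr_fun (lead_eq hf _ _ _ X) w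
  · intro X w
    have h2 : conv (consL B y) (f.comp X) (fun X => c • lead f r d W X) = _ :=
      conv_smul_right c (f.comp X) (fun Z => lead f r d W Z)
    rw [h2]
    have : tconv ((c • r) X) (fun Z => W Z ∘ₗ A.sgn d Z Y) = _ :=
      conv_smul_left c (r X) (fun Z => W Z ∘ₗ A.sgn d Z Y)
    rw [this]
    conv_lhs => rw [lead_eq hf r]
    simp only [LinearMap.add_apply, LinearMap.smul_apply, smul_add]

theorem lead_add_right (hf : f.Unital0) (r : Fam A B f.obj o) (d : ℤ) (W W' : ∀ Z, A.T Z Y →ₗ[k] B.T (o Z) y) (X : A.Ob) :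
    lead f r d (fun Z => W Z + W' Z) X = lead f r d W X + lead f r d W' X := by
  ext w
  refine coext_unique (N := fun z => B.T z y) (act := consL B y) f.comp
    (fun X => tconv (r X) (fun Z => (W Z + W' Z) ∘ₗ A.sgn d Z Y)) hf (U := lead f r d (fun Z => W Z + W' Z))
    (V := fun X => lead f r d W X + lead f r d W' X) ?_ ?_ X w
  · intro X w; exact LinearMap.congr_fun (lead_eq hf _ _ _ X) w
  · intro X w
    rw [conv_add_right]
    have : tconv (r X) (fun Z => (W Z + W' Z) ∘ₗ A.sgn d Z Y) = _ :=
      conv_add_right (consL B y) (r X) (fun Z => W Z ∘ₗ A.sgn d Z Y) (fun Z => W' Z ∘ₗ A.sgn d Z Y)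
    rw [this]
    conv_lhs => rw [lead_eq hf r, lead_eq hf r]
    simp only [LinearMap.add_apply]
    abel

theorem lead_smul_right (hf : f.Unital0) (c : k) (r : Fam A B f.obj o) (d : ℤ) (W : ∀ Z, A.T Z Y →ₗ[k] B.T (o Z) y) (X : A.Ob) :
    lead f r d (fun Z => c • W Z) X = c • lead f r d W X := by
  ext w
  refine coext_unique (N := fun z => B.T z y) (act := consL B y) f.comp
    (fun X => tconv (r X) (fun Z => (c • W Z) ∘ₗ A.sgn d Z Y)) hf (U := lead f r d (fun Z => c • W Z))
    (V := fun X => c • lead f r d W X) ?_ ?_ X w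
  · intro X w; exact LinearMap.congr_fun (lead_eq hf _ _ _ X) w
  · intro X w
    have h2 : conv (consL B y) (f.comp X) (fun X => c • lead f r d W X) = _ :=
      conv_smul_right c (f.comp X) (fun Z => lead f r d W Z)
    rw [h2]
    have : tconv (r X) (fun Z => (c • W Z) ∘ₗ A.sgn d Z Y) = _ :=
      conv_smul_right c (r X) (fun Z => W Z ∘ₗ A.sgn d Z Y)
    rw [this]
    conv_lhs => rw [lead_eq hf r]
    simp only [LinearMap.add_apply, LinearMap.smul_apply, smul_add]

end linear
end AInf

end

noncomputable section

universe u

namespace AInf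

open scoped TensorProduct DirectSum

open GQuiver

variable {k : Type u} [CommRing k]

/-- identity functor: components `pr₁` -/
abbrev idFun (A : GQuiver k) : FunData A A := ⟨fun X => X, A.proj⟩

theorem idFun_unital (A : GQuiver k) : (idFun A).Unital0 := fun X => A.proj_one X

theorem hat_idFun {A : GQuiver k} {X Y : A.Ob} (w : A.T X Y) : hat (idFun A) X Y w = w := by
  symm
  refine hat_unique (f := idFun A) (F := fun X Y => LinearMap.id) (idFun_unital A) ?_ ?_ ?_ X Y w
  · intros; rfl
  · intro X Y w
    simp only [dconv, LinearMap.comp_apply, LinearMap.id_apply]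
    generalize A.cut X Y w = t
    induction t using induction₂ with
    | zero => simp
    | add a b ha hb => 
      rw [map_add, ← ha, ← hb]
    | tmul Z a b => simp
  · intros; rfl

/-- A (suspended) graded quiver with components `b = (bₙ) : Ts𝒜 → s𝒜`. -/
structure Ops (k : Type u) [CommRing k] extends GQuiver k where
  b : ∀ X Y, toGQuiver.T X Y →ₗ[k] hom X Y

/-- the coderivation `b : Ts𝒜 → Ts𝒜` with the given components -/
def Ops.hatb (A : Ops k) (X Y : A.Ob) : A.T X Y →ₗ[k] A.T X Y :=
  coder (idFun A.toGQuiver) (idFun A.toGQuiver) 1 A.b X Y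

/-- A∞-category: `b₀ = 0`, `b` has degree `1` and `b² = 0`. -/
structure Ops.IsAInf (A : Ops k) : Prop where
  b_one : ∀ X, A.b X X (A.one X) = 0
  homog : Homog (A := A.toGQuiver) (B := A.toGQuiver) (o := fun X => X) (o' := fun X => X) 1 A.b
  sq : ∀ X Y w, A.hatb X Y (A.hatb X Y w) = 0

section
variable {A B C : GQuiver k} {X Y : A.Ob}

theorem dconv_of_cut {x y : B.Ob} {v v' : C.Ob} {u : B.Ob → C.Ob} {o o' : A.Ob → B.Ob}
    {t : B.T x y} {w : A.T X Y}
    {α : ∀ Z, A.T X Z →ₗ[k] B.T x (o Z)} {β : ∀ Z, A.T Z Y →ₗ[k] B.T (o Z) y}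
    {α' : ∀ Z, A.T X Z →ₗ[k] B.T x (o' Z)} {β' : ∀ Z, A.T Z Y →ₗ[k] B.T (o' Z) y}
    (h : B.cut x y t = dconv α β w + dconv α' β' w)
    (φ : ∀ Z, B.T x Z →ₗ[k] C.T v (u Z)) (ψ : ∀ Z, B.T Z y →ₗ[k] C.T (u Z) v') :
    dconv φ ψ t = dconv (o := fun Z => u (o Z)) (fun Z => φ (o Z) ∘ₗ α Z) (fun Z => ψ (o Z) ∘ₗ β Z) w +
      dconv (o := fun Z => u (o' Z)) (fun Z => φ (o' Z) ∘ₗ α' Z) (fun Z => ψ (o' Z) ∘ₗ β' Z) w := by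
  rw [dconv, LinearMap.comp_apply, h, map_add, dconv_comp, dconv_comp]

theorem dconv_of_cut₁ {x y : B.Ob} {v v' : C.Ob} {u : B.Ob → C.Ob} {o : A.Ob → B.Ob}
    {t : B.T x y} {w : A.T X Y}
    {α : ∀ Z, A.T X Z →ₗ[k] B.T x (o Z)} {β : ∀ Z, A.T Z Y →ₗ[k] B.T (o Z) y}
    (h : B.cut x y t = dconv α β w)
    (φ : ∀ Z, B.T x Z →ₗ[k] C.T v (u Z)) (ψ : ∀ Z, B.T Z y →ₗ[k] C.T (u Z) v') :
    dconv φ ψ t = dconv (o := fun Z => u (o Z)) (fun Z => φ (o Z) ∘ₗ α Z) (fun Z => ψ (o Z) ∘ₗ β Z) w := by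
  rw [dconv, LinearMap.comp_apply, h, dconv_comp]

theorem dconv_of_cut₃ {x y : B.Ob} {v v' : C.Ob} {u : B.Ob → C.Ob} {o o' o'' : A.Ob → B.Ob}
    {t : B.T x y} {w : A.T X Y}
    {α : ∀ Z, A.T X Z →ₗ[k] B.T x (o Z)} {β : ∀ Z, A.T Z Y →ₗ[k] B.T (o Z) y}
    {α' : ∀ Z, A.T X Z →ₗ[k] B.T x (o' Z)} {β' : ∀ Z, A.T Z Y →ₗ[k] B.T (o' Z) y}
    {α'' : ∀ Z, A.T X Z →ₗ[k] B.T x (o'' Z)} {β'' : ∀ Z, A.T Z Y →ₗ[k] B.T (o'' Z) y}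
    (h : B.cut x y t = dconv α β w + dconv α' β' w + dconv α'' β'' w)
    (φ : ∀ Z, B.T x Z →ₗ[k] C.T v (u Z)) (ψ : ∀ Z, B.T Z y →ₗ[k] C.T (u Z) v') :
    dconv φ ψ t = dconv (o := fun Z => u (o Z)) (fun Z => φ (o Z) ∘ₗ α Z) (fun Z => ψ (o Z) ∘ₗ β Z) w +
      dconv (o := fun Z => u (o' Z)) (fun Z => φ (o' Z) ∘ₗ α' Z) (fun Z => ψ (o' Z) ∘ₗ β' Z) w +
      dconv (o := fun Z => u (o'' Z)) (fun Z => φ (o'' Z) ∘ₗ α'' Z) (fun Z => ψ (o'' Z) ∘ₗ β'' Z) w := by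
  rw [dconv, LinearMap.comp_apply, h, map_add, map_add, dconv_comp, dconv_comp, dconv_comp]
end

section
variable {A : Ops k}

theorem cut_hatb {X Y : A.Ob} (w : A.T X Y) : A.cut _ _ (A.hatb X Y w) =
    dconv (o := fun Z => Z) (fun _ => LinearMap.id) (fun Z => A.hatb Z Y) w +
      dconv (o := fun Z => Z) (fun Z => A.hatb X Z) (fun Z => A.sgn 1 Z Y) w := by
  have h : ∀ X Y, hat (idFun A.toGQuiver) X Y = LinearMap.id := fun X Y => LinearMap.ext hat_idFun
  rw [Ops.hatb, cut_coder (idFun_unital _) (idFun_unital _)]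
  simp only [h]
  rfl

theorem proj_hatb {X Y : A.Ob} (w : A.T X Y) : A.proj _ _ (A.hatb X Y w) = A.b X Y w :=
  proj_coder (idFun_unital _) (idFun_unital _) w

theorem eps_hatb {X Y : A.Ob} (w : A.T X Y) : epsI A.toGQuiver _ _ (A.hatb X Y w) = 0 :=
  eps_lead (idFun_unital _) _ w

theorem hatb_mem (hA : A.IsAInf) {X Y : A.Ob} {i : ℤ} {w : A.T X Y} (hw : w ∈ A.Tgr X Y i) :
    A.hatb X Y w ∈ A.Tgr X Y (i + 1) :=
  coder_mem (f := idFun A.toGQuiver) (g := idFun A.toGQuiver)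
    (fun X Y e w hw => by simpa using proj_mem hw) (fun X Y e w hw => by simpa using proj_mem hw) hA.homog hw

theorem sgn_hatb (hA : A.IsAInf) {X Y : A.Ob} (c : ℤ) (w : A.T X Y) :
    A.sgn c X Y (A.hatb X Y w) = (c.negOnePow : ℤ) • A.hatb X Y (A.sgn c X Y w) := by
  have := sgn_hom (d := c) (e := 1) (R := A.hatb X Y) (o := fun X : A.Ob => (X : A.toGQuiver.Ob)) (o' := fun X => X)
    (fun i w hw => hatb_mem hA hw) w
  rwa [mul_one] at this

theorem b_hatb (hA : A.IsAInf) {X Y : A.Ob} (w : A.T X Y) : A.b X Y (A.hatb X Y w) = 0 := by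
  rw [← proj_hatb, hA.sq, map_zero]

end

/-- A∞-functor: `f₀ = 0`, degree `0`, `f b = b f` on `Ts𝒜`. -/
structure IsAInfFun {A B : Ops k} (f : FunData A.toGQuiver B.toGQuiver) : Prop where
  comp_one : ∀ X, f.comp X X (A.one X) = 0
  homog : Homog 0 f.comp
  comm : ∀ X Y w, B.hatb _ _ (hat f X Y w) = hat f X Y (A.hatb X Y w)

/-- composition: first `f`, then `g` -/
abbrev FunData.andThen {A B C : GQuiver k} (f : FunData A B) (g : FunData B C) : FunData A C where
  obj X := g.obj (f.obj X)
  comp X Y := g.comp (f.obj X) (f.obj Y) ∘ₗ hat f X Y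

section
variable {A B C : GQuiver k} {f f' f'' : FunData A B} {g g' : FunData B C}

theorem comp_unital (hf : f.Unital0) (hg : g.Unital0) : (f.andThen g).Unital0 := by
  intro X
  change g.comp _ _ (hat f X X (A.one X)) = 0
  rw [hat_eq hf]
  have : tconv (f.comp X) (fun Z => hat f Z X) (A.one X) = 0 := by
    simp [conv, cut_one, consL, hf X]
  rw [LinearMap.add_apply, this, add_zero, eps_one, hg]

theorem eps_comp (f : FunData A B) (g : FunData B C) {X Y : A.Ob} (w : A.T X Y) :
    eps (B := C) g.obj (f.obj X) (eps (B := B) f.obj X w) = eps (B := C) (fun X => g.obj (f.obj X)) X w := by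
  refine induction_on (motive := fun X w => eps (B := C) g.obj (f.obj X) (eps (B := B) f.obj X w) = 
    eps (B := C) (fun X => g.obj (f.obj X)) X w) ?_ ?_ ?_ ?_ w
  · simp
  · intro X a b ha hb; simp [ha, hb]
  · intro c; simp
  · intros; simp

theorem eps_epsI (o : B.Ob → C.Ob) {X Y : B.Ob} (w : B.T X Y) :
    eps (B := C) o X w = eps (B := C) o X (epsI B X Y w) := by
  refine induction_on (motive := fun X w => eps (B := C) o X w = eps (B := C) o X (epsI B X Y w)) ?_ ?_ ?_ ?_ w
  · simp
  · intro X a b ha hb; simp [ha, hb]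
  · intro c; simp
  · intros; simp

theorem hat_comp (hf : f.Unital0) (hg : g.Unital0) {X Y : A.Ob} (w : A.T X Y) :
    hat (f.andThen g) X Y w = hat g _ _ (hat f X Y w) := by
  symm
  refine hat_unique (f := f.andThen g) (F := fun X Y => hat g _ _ ∘ₗ hat f X Y) (comp_unital hf hg) ?_ ?_ ?_ X Y w
  · intro X Y w
    exact proj_hat hg _
  · intro X Y w
    change C.cut _ _ (hat g _ _ (hat f X Y w)) = _
    rw [cut_hat hg]
    exact dconv_of_cut₁ (cut_hat hf _ _) _ _
  · intro X Y w
    change epsI C _ _ (hat g _ _ (hat f X Y w)) = _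
    rw [eps_hat hg, eps_epsI, eps_hat hf, eps_comp]

theorem coder_whR {d : ℤ} {r : Fam A B f.obj f'.obj} (hf : f.Unital0) (hf' : f'.Unital0) (hg : g.Unital0)
    {X Y : A.Ob} (w : A.T X Y) :
    coder (f.andThen g) (f'.andThen g) d (fun X Y => g.comp _ _ ∘ₗ coder f f' d r X Y) X Y w =
      hat g _ _ (coder f f' d r X Y w) := by
  symm
  refine coder_unique (f := f.andThen g) (g := f'.andThen g) (R := fun X Y => hat g _ _ ∘ₗ coder f f' d r X Y)
    (comp_unital hf hg) ?_ ?_ ?_ X Y w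
  · intro X Y w
    exact proj_hat hg _
  · intro X Y w
    have h1 : ∀ X Y, hat (f.andThen g) X Y = hat g _ _ ∘ₗ hat f X Y := fun X Y => LinearMap.ext (hat_comp hf hg)
    have h2 : ∀ X Y, hat (f'.andThen g) X Y = hat g _ _ ∘ₗ hat f' X Y := fun X Y => LinearMap.ext (hat_comp hf' hg)
    change C.cut _ _ (hat g _ _ (coder f f' d r X Y w)) = _
    rw [cut_hat hg, dconv_of_cut (cut_coder hf hf' w)]
    simp only [h1, h2]; rfl
  · intro X Y w
    change epsI C _ _ (hat g _ _ (coder f f' d r X Y w)) = _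
    rw [eps_hat hg, eps_epsI, coder, eps_lead hf, map_zero]

theorem coder_whL {d : ℤ} {r : Fam B C g.obj g'.obj} (hf : f.Unital0) (hf' : Homog 0 f.comp) (hg : g.Unital0)
    (hg' : g'.Unital0) {X Y : A.Ob} (w : A.T X Y) :
    coder (f.andThen g) (f.andThen g') d (fun X Y => r _ _ ∘ₗ hat f X Y) X Y w =
      coder g g' d r _ _ (hat f X Y w) := by
  symm
  refine coder_unique (f := f.andThen g) (g := f.andThen g') (R := fun X Y => coder g g' d r _ _ ∘ₗ hat f X Y)
    (comp_unital hf hg) ?_ ?_ ?_ X Y w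
  · intro X Y w
    exact proj_coder hg hg' _
  · intro X Y w
    have h1 : ∀ X Y, hat (f.andThen g) X Y = hat g _ _ ∘ₗ hat f X Y := fun X Y => LinearMap.ext (hat_comp hf hg)
    have h2 : ∀ X Y, hat (f.andThen g') X Y = hat g' _ _ ∘ₗ hat f X Y := fun X Y => LinearMap.ext (hat_comp hf hg')
    change C.cut _ _ (coder g g' d r _ _ (hat f X Y w)) = _
    rw [cut_coder hg hg', dconv_of_cut₁ (cut_hat hf X w), dconv_of_cut₁ (cut_hat hf X w)]
    simp only [h1, h2]
    congr 3
    funext Z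
    ext w
    simp only [LinearMap.comp_apply, sgn_hat hf']
  · intro X Y w
    exact eps_lead hg _ _
end

end AInf

end

noncomputable section

universe u

namespace AInf

open scoped TensorProduct DirectSum

open GQuiver

variable {k : Type u} [CommRing k] {A B C : Ops k}

theorem hatb_hatbHom (hB : B.IsAInf) {x y : B.Ob} (t : B.T x y) : B.b _ _ (B.hatb _ _ t) = 0 := b_hatb hB t

section
variable {f g h : FunData A.toGQuiver B.toGQuiver}

/-- components of the graded commutator `r B₁ = r b - (-1)^d b r` for `r` of degree `d` (right operators: `r b` is
first `r`, then `b`) -/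
def B1 (f g : FunData A.toGQuiver B.toGQuiver) (d : ℤ) (r : Fam A.toGQuiver B.toGQuiver f.obj g.obj) :
    Fam A.toGQuiver B.toGQuiver f.obj g.obj :=
  fun X Y => B.b _ _ ∘ₗ coder f g d r X Y - (d.negOnePow : ℤ) • r X Y ∘ₗ A.hatb X Y

/-- components of `(r ⊗ p) B₂ = (r ⊗ p)θ b` -/
def B2 (f g h : FunData A.toGQuiver B.toGQuiver) (d e : ℤ) (r : Fam A.toGQuiver B.toGQuiver f.obj g.obj)
    (p : Fam A.toGQuiver B.toGQuiver g.obj h.obj) : Fam A.toGQuiver B.toGQuiver f.obj h.obj :=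
  fun X Y => B.b _ _ ∘ₗ theta f g h d e r p X Y

theorem dconv_add_zsmul_comp {X Y : A.Ob} {x y : B.Ob} {o : A.Ob → B.Ob} (φ φ' : ∀ Z, A.T X Z →ₗ[k] B.T x (o Z))
    (ψ : ∀ Z, A.T Z Y →ₗ[k] B.T (o Z) y) (n : ℤ) (w : A.T X Y) :
    dconv (A := A.toGQuiver) (B := B.toGQuiver) (fun Z => φ Z + n • φ' Z) ψ w =
      dconv (A := A.toGQuiver) (B := B.toGQuiver) φ ψ w + n • dconv (A := A.toGQuiver) (B := B.toGQuiver) φ' ψ w := by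
  rw [dconv_add_left, dconv_zsmul_left]; rfl

theorem dconv_sub_left {A B : GQuiver k} {X Y : A.Ob} {x y : B.Ob} {o : A.Ob → B.Ob} (φ φ' : ∀ Z, A.T X Z →ₗ[k] B.T x (o Z))
    (ψ : ∀ Z, A.T Z Y →ₗ[k] B.T (o Z) y) (w : A.T X Y) :
    dconv (fun Z => φ Z - φ' Z) ψ w = dconv φ ψ w - dconv φ' ψ w := by
  have : (fun Z => φ Z - φ' Z) = fun Z => φ Z + (-1 : ℤ) • φ' Z := by
    funext Z; rw [neg_one_zsmul, sub_eq_add_neg]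
  rw [this, dconv_add_left, dconv_zsmul_left, neg_one_zsmul, sub_eq_add_neg]; rfl

theorem dconv_sub_right {A B : GQuiver k} {X Y : A.Ob} {x y : B.Ob} {o : A.Ob → B.Ob} (φ : ∀ Z, A.T X Z →ₗ[k] B.T x (o Z))
    (ψ ψ' : ∀ Z, A.T Z Y →ₗ[k] B.T (o Z) y) (w : A.T X Y) :
    dconv φ (fun Z => ψ Z - ψ' Z) w = dconv φ ψ w - dconv φ ψ' w := by
  have : (fun Z => ψ Z - ψ' Z) = fun Z => ψ Z + (-1 : ℤ) • ψ' Z := by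
    funext Z; rw [neg_one_zsmul, sub_eq_add_neg]
  rw [this, dconv_add_right, dconv_zsmul_right, neg_one_zsmul, sub_eq_add_neg]; rfl

theorem negOnePow_mul_self (d : ℤ) : ((d.negOnePow : ℤ)) * (d.negOnePow : ℤ) = 1 := by
  rw [← Units.val_mul, ← Int.negOnePow_add, Int.negOnePow_even _ ⟨d, rfl⟩]; rfl

/-- the coderivation of `B1 r` is the graded commutator -/
theorem coder_B1 (hA : A.IsAInf) (hB : B.IsAInf) (hf : IsAInfFun f) (hg : IsAInfFun g) {d : ℤ}
    {r : Fam A.toGQuiver B.toGQuiver f.obj g.obj} (hr : Homog d r) {X Y : A.Ob} (w : A.T X Y) :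
    coder f g (d + 1) (B1 f g d r) X Y w =
      B.hatb _ _ (coder f g d r X Y w) - (d.negOnePow : ℤ) • coder f g d r X Y (A.hatb X Y w) := by
  symm
  refine coder_unique (f := f) (g := g) (r := B1 f g d r) (d := d + 1)
    (R := fun X Y => B.hatb _ _ ∘ₗ coder f g d r X Y - (d.negOnePow : ℤ) • coder f g d r X Y ∘ₗ A.hatb X Y)
    hf.comp_one ?_ ?_ ?_ X Y w
  · intro X Y w
    simp only [LinearMap.sub_apply, LinearMap.smul_apply, LinearMap.comp_apply, map_sub, map_zsmul, proj_hatb,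
      proj_coder hf.comp_one hg.comp_one, B1]
  · intro X Y w
    have hs : ∀ Z, (A.sgn (d+1) Z Y) = A.sgn d Z Y ∘ₗ A.sgn 1 Z Y := fun Z => by
      ext w; rw [LinearMap.comp_apply, sgn_sgn]
    have e1 : B.cut _ _ (B.hatb _ _ (coder f g d r X Y w)) =
      (dconv (fun Z => hat f X Z) (fun Z => B.hatb _ _ ∘ₗ coder f g d r Z Y) w +
        (d.negOnePow : ℤ) • dconv (fun Z => coder f g d r X Z) (fun Z => hat g Z Y ∘ₗ A.sgn d Z Y ∘ₗ A.hatb Z Y) w) +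
      ((d.negOnePow : ℤ) • dconv (fun Z => hat f X Z ∘ₗ A.hatb X Z) (fun Z => coder f g d r Z Y ∘ₗ A.sgn 1 Z Y) w +
        dconv (fun Z => B.hatb _ _ ∘ₗ coder f g d r X Z) (fun Z => hat g Z Y ∘ₗ A.sgn (d+1) Z Y) w) := by
      rw [cut_hatb, dconv_of_cut (cut_coder hf.comp_one hg.comp_one w),
        dconv_of_cut (cut_coder hf.comp_one hg.comp_one w)]
      rw [← LinearMap.smul_apply, ← LinearMap.smul_apply, ← dconv_zsmul_right, ← dconv_zsmul_right]
      congr 4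
      · funext Z
        ext w
        simp only [LinearMap.comp_apply, LinearMap.smul_apply, hg.comm, sgn_hatb hA, map_zsmul, smul_smul,
          negOnePow_mul_self, one_smul]
      · funext Z
        ext w
        simp only [LinearMap.comp_apply, hf.comm]
      · funext Z
        ext w
        simp only [LinearMap.comp_apply, LinearMap.smul_apply]
        rw [sgn_coder hf.homog hg.homog hr, one_mul]
      · funext Z
        ext w
        simp only [LinearMap.comp_apply]
        rw [sgn_hat hg.homog, sgn_sgn, add_comm]
    have e2 : B.cut _ _ (coder f g d r X Y (A.hatb X Y w)) =
      (dconv (fun Z => hat f X Z) (fun Z => coder f g d r Z Y ∘ₗ A.hatb Z Y) w +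
        dconv (fun Z => hat f X Z ∘ₗ A.hatb X Z) (fun Z => coder f g d r Z Y ∘ₗ A.sgn 1 Z Y) w) +
      (dconv (fun Z => coder f g d r X Z) (fun Z => hat g Z Y ∘ₗ A.sgn d Z Y ∘ₗ A.hatb Z Y) w +
        dconv (fun Z => coder f g d r X Z ∘ₗ A.hatb X Z) (fun Z => hat g Z Y ∘ₗ A.sgn (d+1) Z Y) w) := by
      rw [cut_coder hf.comp_one hg.comp_one, dconv_of_cut (cut_hatb w), dconv_of_cut (cut_hatb w)]
      simp only [hs]
      rfl
    rw [LinearMap.sub_apply, LinearMap.smul_apply, LinearMap.comp_apply, LinearMap.comp_apply, map_sub,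
      map_zsmul, e1, e2]
    simp only [sub_eq_add_neg, ← neg_smul]
    rw [dconv_add_zsmul_comp, dconv_add_right, dconv_zsmul_right]
    simp only [LinearMap.add_apply, LinearMap.smul_apply, LinearMap.neg_apply, smul_add, neg_smul]
    abel
  · intro X Y w
    simp only [LinearMap.sub_apply, LinearMap.smul_apply, LinearMap.comp_apply, map_sub, map_zsmul, eps_hatb]
    rw [coder, eps_lead hf.comp_one]
    simp

theorem B1_mem (hA : A.IsAInf) (hB : B.IsAInf) (hf : IsAInfFun f) (hg : IsAInfFun g) {d : ℤ}
    {r : Fam A.toGQuiver B.toGQuiver f.obj g.obj} (hr : Homog d r) : Homog (d + 1) (B1 f g d r) := by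
  intro X Y e w hw
  refine Submodule.sub_mem _ ?_ (zsmul_mem ?_ _)
  · have := hB.homog _ _ _ _ (coder_mem hf.homog hg.homog hr hw)
    rwa [add_assoc] at this
  · have := hr X Y _ _ (hatb_mem hA hw)
    rwa [add_assoc, add_comm 1 d] at this

theorem B2_mem (hB : B.IsAInf) (hf : IsAInfFun f) (hg : IsAInfFun g) (hh : IsAInfFun h) {d e : ℤ}
    {r : Fam A.toGQuiver B.toGQuiver f.obj g.obj} (hr : Homog d r)
    {p : Fam A.toGQuiver B.toGQuiver g.obj h.obj} (hp : Homog e p) : Homog (d + e + 1) (B2 f g h d e r p) := by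
  intro X Y i w hw
  have := hB.homog _ _ _ _ (theta_mem hf.homog hg.homog hh.homog hr hp hw)
  rwa [add_assoc] at this

theorem B1_B1 (hA : A.IsAInf) (hB : B.IsAInf) (hf : IsAInfFun f) (hg : IsAInfFun g) {d : ℤ}
    {r : Fam A.toGQuiver B.toGQuiver f.obj g.obj} (hr : Homog d r) : B1 f g (d + 1) (B1 f g d r) = 0 := by
  funext X Y
  ext w
  have : B1 f g (d + 1) (B1 f g d r) X Y w = B.b _ _ (coder f g (d + 1) (B1 f g d r) X Y w) -
    ((d+1).negOnePow : ℤ) • (B.b _ _ (coder f g d r X Y (A.hatb X Y w)) -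
      (d.negOnePow : ℤ) • r X Y (A.hatb X Y (A.hatb X Y w))) := rfl
  rw [this, coder_B1 hA hB hf hg hr, hA.sq, map_sub, b_hatb hB, map_zsmul, Int.negOnePow_succ]
  simp

theorem cut_hatb_theta
    (hA : A.IsAInf) (hf : IsAInfFun f) (hg : IsAInfFun g) (hh : IsAInfFun h) {d e : ℤ}
    {r : Fam A.toGQuiver B.toGQuiver f.obj g.obj} (hr : Homog d r)
    {p : Fam A.toGQuiver B.toGQuiver g.obj h.obj} (hp : Homog e p) {X Y : A.Ob} (w : A.T X Y) :
  B.cut _ _ (B.hatb _ _ (theta f g h d e r p X Y w)) =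
    (dconv (fun Z => hat f X Z) (fun Z => B.hatb _ _ ∘ₗ theta f g h d e r p Z Y) w +
      dconv (fun Z => coder f g d r X Z) (fun Z => (B.hatb _ _ ∘ₗ coder g h e p Z Y) ∘ₗ A.sgn d Z Y) w +
      ((d+e).negOnePow : ℤ) • dconv (fun Z => theta f g h d e r p X Z) (fun Z => hat h Z Y ∘ₗ A.sgn (d + e) Z Y ∘ₗ A.hatb Z Y) w) +
    (((d+e).negOnePow : ℤ) • dconv (fun Z => hat f X Z ∘ₗ A.hatb X Z) (fun Z => theta f g h d e r p Z Y ∘ₗ A.sgn 1 Z Y) w +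
      (e.negOnePow : ℤ) • dconv (fun Z => B.hatb _ _ ∘ₗ coder f g d r X Z) (fun Z => coder g h e p Z Y ∘ₗ A.sgn (d+1) Z Y) w +
      dconv (fun Z => B.hatb _ _ ∘ₗ theta f g h d e r p X Z) (fun Z => hat h Z Y ∘ₗ A.sgn (d+e+1) Z Y) w) := by
    rw [cut_hatb, dconv_of_cut₃ (cut_theta hf.comp_one hg.comp_one hh.comp_one w),
      dconv_of_cut₃ (cut_theta hf.comp_one hg.comp_one hh.comp_one w)]
    simp only [← LinearMap.smul_apply, ← dconv_zsmul_right]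
    congr 4
    · funext Z
      ext w
      simp only [LinearMap.comp_apply, LinearMap.smul_apply, hh.comm, sgn_hatb hA, map_zsmul, smul_smul,
        negOnePow_mul_self, one_smul]
    · congr 2
      · funext Z
        ext w
        simp only [LinearMap.comp_apply, hf.comm]
      · funext Z
        ext w
        simp only [LinearMap.comp_apply, LinearMap.smul_apply]
        rw [sgn_theta hf.homog hg.homog hh.homog hr hp, one_mul]
    · congr 1
      funext Z
      ext w
      simp only [LinearMap.comp_apply, LinearMap.smul_apply]
      rw [sgn_coder hg.homog hh.homog hp, one_mul, sgn_sgn, add_comm]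
    · funext Z
      ext w
      simp only [LinearMap.comp_apply]
      rw [sgn_hat hh.homog, sgn_sgn, add_comm]

theorem cut_theta_hatb
    (hA : A.IsAInf) (hf : IsAInfFun f) (hg : IsAInfFun g) (hh : IsAInfFun h) {d e : ℤ}
    {r : Fam A.toGQuiver B.toGQuiver f.obj g.obj}
    {p : Fam A.toGQuiver B.toGQuiver g.obj h.obj} {X Y : A.Ob} (w : A.T X Y) :
  B.cut _ _ (theta f g h d e r p X Y (A.hatb X Y w)) =
    (dconv (fun Z => hat f X Z) (fun Z => theta f g h d e r p Z Y ∘ₗ A.hatb Z Y) w +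
      dconv (fun Z => hat f X Z ∘ₗ A.hatb X Z) (fun Z => theta f g h d e r p Z Y ∘ₗ A.sgn 1 Z Y) w) +
    ((d.negOnePow : ℤ) • dconv (fun Z => coder f g d r X Z) (fun Z => (coder g h e p Z Y ∘ₗ A.hatb Z Y) ∘ₗ A.sgn d Z Y) w +
      dconv (fun Z => coder f g d r X Z ∘ₗ A.hatb X Z) (fun Z => coder g h e p Z Y ∘ₗ A.sgn (d+1) Z Y) w) +
    (dconv (fun Z => theta f g h d e r p X Z) (fun Z => hat h Z Y ∘ₗ A.sgn (d+e) Z Y ∘ₗ A.hatb Z Y) w +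
      dconv (fun Z => theta f g h d e r p X Z ∘ₗ A.hatb X Z) (fun Z => hat h Z Y ∘ₗ A.sgn (d+e+1) Z Y) w) := by
    have hs : ∀ c Z, (A.sgn (c+1) Z Y) = A.sgn c Z Y ∘ₗ A.sgn 1 Z Y := fun c Z => by
      ext w; rw [LinearMap.comp_apply, sgn_sgn]
    rw [cut_theta hf.comp_one hg.comp_one hh.comp_one, dconv_of_cut (cut_hatb w), dconv_of_cut (cut_hatb w),
      dconv_of_cut (cut_hatb w)]
    simp only [hs, ← LinearMap.smul_apply, ← dconv_zsmul_right]
    congr 4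
    congr 1
    funext Z
    ext w
    simp only [LinearMap.comp_apply, LinearMap.smul_apply, sgn_hatb hA, map_zsmul]

theorem B2_aux {M : Type u} [AddCommGroup M] (δ ε de : ℤ) (hδ : δ * δ = 1) (hde : de = δ * ε)
    (a1 a2 a3 a4 a5 a6 c1 c2 c5 c6 f1 f3 g1 g3 : M) :
    (a1 + a2 + de • a3) + (de • a4 + ε • a5 + a6) - de • ((c1 + a4) + (δ • c2 + c5) + (a3 + c6)) -
      (f1 + (a2 + (-ε) • c2) + f3) - ε • (g1 + (a5 + (-δ) • c5) + g3) =
    (a1 - de • c1 - f1 - ε • g1) + (a6 - de • c6 - f3 - ε • g3) := by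
  have h1 : de • δ • c2 = ε • c2 := by
    rw [smul_smul, hde, mul_right_comm, hδ, one_mul]
  have h2 : ε • δ • c5 = de • c5 := by rw [smul_smul, hde, mul_comm]
  simp only [smul_add, neg_smul, smul_neg, h1, h2]
  abel

set_option maxHeartbeats 1000000 in
theorem coder_B2 (hA : A.IsAInf) (hB : B.IsAInf) (hf : IsAInfFun f) (hg : IsAInfFun g) (hh : IsAInfFun h) {d e : ℤ}
    {r : Fam A.toGQuiver B.toGQuiver f.obj g.obj} (hr : Homog d r)
    {p : Fam A.toGQuiver B.toGQuiver g.obj h.obj} (hp : Homog e p) {X Y : A.Ob} (w : A.T X Y) :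
    coder f h (d + e + 1) (B2 f g h d e r p) X Y w =
      B.hatb _ _ (theta f g h d e r p X Y w) - ((d+e).negOnePow : ℤ) • theta f g h d e r p X Y (A.hatb X Y w)
      - theta f g h d (e + 1) r (B1 g h e p) X Y w
      - (e.negOnePow : ℤ) • theta f g h (d + 1) e (B1 f g d r) p X Y w := by
  symm
  refine coder_unique (f := f) (g := h) (r := B2 f g h d e r p) (d := d + e + 1)
    (R := fun X Y => B.hatb _ _ ∘ₗ theta f g h d e r p X Y
      - ((d+e).negOnePow : ℤ) • theta f g h d e r p X Y ∘ₗ A.hatb X Y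
      - theta f g h d (e + 1) r (B1 g h e p) X Y
      - (e.negOnePow : ℤ) • theta f g h (d + 1) e (B1 f g d r) p X Y)
    hf.comp_one ?_ ?_ ?_ X Y w
  · intro X Y w
    simp only [LinearMap.sub_apply, LinearMap.smul_apply, LinearMap.comp_apply, map_sub, map_zsmul, proj_hatb,
      proj_theta hf.comp_one hg.comp_one, B2, smul_zero, sub_zero]
  · intro X Y w
    have e3 := cut_theta (d := d) (e := e + 1) (r := r) (p := B1 g h e p) hf.comp_one hg.comp_one hh.comp_one w
    have e4 := cut_theta (d := d + 1) (e := e) (r := B1 f g d r) (p := p) hf.comp_one hg.comp_one hh.comp_one w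
    have h3 : ∀ Z, coder g h (e+1) (B1 g h e p) Z Y ∘ₗ A.sgn d Z Y = (B.hatb _ _ ∘ₗ coder g h e p Z Y) ∘ₗ A.sgn d Z Y +
      (-(e.negOnePow : ℤ)) • ((coder g h e p Z Y ∘ₗ A.hatb Z Y) ∘ₗ A.sgn d Z Y) := by
      intro Z; ext w
      simp only [LinearMap.comp_apply, coder_B1 hA hB hg hh hp, LinearMap.add_apply, LinearMap.smul_apply, LinearMap.neg_apply, neg_smul,
        sub_eq_add_neg]
    have h4 : ∀ Z, coder f g (d+1) (B1 f g d r) X Z = B.hatb _ _ ∘ₗ coder f g d r X Z +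
      (-(d.negOnePow : ℤ)) • (coder f g d r X Z ∘ₗ A.hatb X Z) := by
      intro Z; ext w
      simp only [LinearMap.comp_apply, coder_B1 hA hB hf hg hr, LinearMap.add_apply, LinearMap.smul_apply, LinearMap.neg_apply, neg_smul,
        sub_eq_add_neg]
    have n3 : d + (e + 1) = d + e + 1 := by ring
    have n4 : d + 1 + e = d + e + 1 := by ring
    simp only [h3, n3] at e3
    simp only [h4, n4] at e4
    rw [dconv_add_right, dconv_zsmul_right, LinearMap.add_apply, LinearMap.smul_apply] at e3
    rw [dconv_add_zsmul_comp] at e4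
    simp only [LinearMap.sub_apply, LinearMap.smul_apply, LinearMap.comp_apply, map_sub,
      map_zsmul]
    rw [cut_hatb_theta hA hf hg hh hr hp, cut_theta_hatb hA hf hg hh, e3, e4]
    rw [B2_aux _ _ _ (negOnePow_mul_self d) (by rw [Int.negOnePow_add]; rfl)]
    congr 1
    · rw [dconv_sub_right, dconv_sub_right, dconv_sub_right, dconv_zsmul_right, dconv_zsmul_right]
      rfl
    · rw [dconv_sub_left, dconv_sub_left, dconv_sub_left, dconv_zsmul_left, dconv_zsmul_left]
      rfl
  · intro X Y w
    simp only [LinearMap.sub_apply, LinearMap.smul_apply, LinearMap.comp_apply, map_sub, map_zsmul, eps_hatb]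
    simp only [theta, eps_lead hf.comp_one]
    simp
end
end AInf

end

noncomputable section

universe u

namespace AInf

open GQuiver

variable {k : Type u} [CommRing k]

section
variable {A B C : Ops k} {f g h : FunData A.toGQuiver B.toGQuiver}

theorem B1_B2 (hA : A.IsAInf) (hB : B.IsAInf) (hf : IsAInfFun f) (hg : IsAInfFun g) (hh : IsAInfFun h) {d e : ℤ}
    {r : Fam A.toGQuiver B.toGQuiver f.obj g.obj} (hr : Homog d r)
    {p : Fam A.toGQuiver B.toGQuiver g.obj h.obj} (hp : Homog e p) :
    B1 f h (d + e + 1) (B2 f g h d e r p) =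
      - B2 f g h d (e + 1) r (B1 g h e p) - (e.negOnePow : ℤ) • B2 f g h (d + 1) e (B1 f g d r) p := by
  funext X Y
  ext w
  have : B1 f h (d + e + 1) (B2 f g h d e r p) X Y w = B.b _ _ (coder f h (d + e + 1) (B2 f g h d e r p) X Y w) -
    ((d+e+1).negOnePow : ℤ) • (B.b _ _ (theta f g h d e r p X Y (A.hatb X Y w))) := rfl
  rw [this, coder_B2 hA hB hf hg hh hr hp, map_sub, map_sub, map_sub, b_hatb hB, map_zsmul, map_zsmul,
    Int.negOnePow_succ]
  have : (- B2 f g h d (e + 1) r (B1 g h e p) - (e.negOnePow : ℤ) • B2 f g h (d + 1) e (B1 f g d r) p) X Y w =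
    - B.b _ _ (theta f g h d (e + 1) r (B1 g h e p) X Y w) -
      (e.negOnePow : ℤ) • B.b _ _ (theta f g h (d + 1) e (B1 f g d r) p X Y w) := rfl
  rw [this]
  simp only [Units.val_neg, neg_smul]
  abel

/-- right action `r h` of a functor `h` on a transformation -/
def whR (f g : FunData A.toGQuiver B.toGQuiver) (h : FunData B.toGQuiver C.toGQuiver) (d : ℤ)
    (r : Fam A.toGQuiver B.toGQuiver f.obj g.obj) :
    Fam A.toGQuiver C.toGQuiver (f.andThen h).obj (g.andThen h).obj :=
  fun X Y => h.comp _ _ ∘ₗ coder f g d r X Y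

/-- left action `e r` of a functor `e` on a transformation -/
def whL (e : FunData A.toGQuiver B.toGQuiver) (f g : FunData B.toGQuiver C.toGQuiver)
    (r : Fam B.toGQuiver C.toGQuiver f.obj g.obj) :
    Fam A.toGQuiver C.toGQuiver (e.andThen f).obj (e.andThen g).obj :=
  fun X Y => r _ _ ∘ₗ hat e X Y

theorem whR_B1 {h : FunData B.toGQuiver C.toGQuiver} (hA : A.IsAInf) (hB : B.IsAInf)
    (hf : IsAInfFun f) (hg : IsAInfFun g) (hh : IsAInfFun h) {d : ℤ}
    {r : Fam A.toGQuiver B.toGQuiver f.obj g.obj} (hr : Homog d r) :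
    whR f g h (d + 1) (B1 f g d r) = B1 (f.andThen h) (g.andThen h) d (whR f g h d r) := by
  funext X Y
  ext w
  have e1 : B1 (f.andThen h) (g.andThen h) d (whR f g h d r) X Y w =
    C.b _ _ (coder (f.andThen h) (g.andThen h) d (whR f g h d r) X Y w) -
      (d.negOnePow : ℤ) • h.comp _ _ (coder f g d r X Y (A.hatb X Y w)) := rfl
  have e2 : whR f g h (d + 1) (B1 f g d r) X Y w = h.comp _ _ (coder f g (d + 1) (B1 f g d r) X Y w) := rfl
  rw [e1, e2, coder_B1 hA hB hf hg hr, map_sub, map_zsmul]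
  congr 1
  refine Eq.trans ?_ (congrArg (C.b _ _) (coder_whR (f := f) (f' := g) (g := h) (r := r) hf.comp_one hg.comp_one hh.comp_one w).symm)
  rw [← proj_hatb, hh.comm, proj_hat hh.comp_one]

theorem whL_B1 {e : FunData A.toGQuiver B.toGQuiver} {f g : FunData B.toGQuiver C.toGQuiver}
    (he : IsAInfFun e) (hf : IsAInfFun f) (hg : IsAInfFun g) {d : ℤ}
    {r : Fam B.toGQuiver C.toGQuiver f.obj g.obj} :
    whL e f g (B1 f g d r) = B1 (e.andThen f) (e.andThen g) d (whL e f g r) := by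
  funext X Y
  ext w
  have e1 : B1 (e.andThen f) (e.andThen g) d (whL e f g r) X Y w =
    C.b _ _ (coder (e.andThen f) (e.andThen g) d (whL e f g r) X Y w) -
      (d.negOnePow : ℤ) • r _ _ (hat e X Y (A.hatb X Y w)) := rfl
  have e2 : whL e f g (B1 f g d r) X Y w = C.b _ _ (coder f g d r _ _ (hat e X Y w)) -
      (d.negOnePow : ℤ) • r _ _ (B.hatb _ _ (hat e X Y w)) := rfl
  rw [e1, e2, he.comm]
  congr 1
  exact (congrArg (C.b _ _) (coder_whL (f := e) (g := f) (g' := g) (r := r) he.comp_one he.homog hf.comp_one hg.comp_one w).symm)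

theorem whR_mem {h : FunData B.toGQuiver C.toGQuiver} 
    (hf : IsAInfFun f) (hg : IsAInfFun g) (hh : IsAInfFun h) {d : ℤ}
    {r : Fam A.toGQuiver B.toGQuiver f.obj g.obj} (hr : Homog d r) : Homog d (whR f g h d r) := by
  intro X Y i w hw
  have := hh.homog _ _ _ _ (coder_mem hf.homog hg.homog hr hw)
  rwa [add_zero] at this

theorem whL_mem {e : FunData A.toGQuiver B.toGQuiver} {f g : FunData B.toGQuiver C.toGQuiver}
    (he : IsAInfFun e) {d : ℤ}
    {r : Fam B.toGQuiver C.toGQuiver f.obj g.obj} (hr : Homog d r) : Homog d (whL e f g r) :=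
  fun _ _ _ _ hw => hr _ _ _ _ (hat_mem he.homog hw)

/-! linearity -/

theorem coder_add (hf : f.Unital0) (d : ℤ) (r r' : Fam A.toGQuiver B.toGQuiver f.obj g.obj) (X Y : A.Ob) :
    coder f g d (r + r') X Y = coder f g d r X Y + coder f g d r' X Y := lead_add_left hf _ _ _ _ _

theorem coder_smul (hf : f.Unital0) (d : ℤ) (c : k) (r : Fam A.toGQuiver B.toGQuiver f.obj g.obj) (X Y : A.Ob) :
    coder f g d (c • r) X Y = c • coder f g d r X Y := lead_smul_left hf _ _ _ _ _

/-- `B1` as a linear map -/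
def B1ₗ (hf : f.Unital0) (d : ℤ) :
    Fam A.toGQuiver B.toGQuiver f.obj g.obj →ₗ[k] Fam A.toGQuiver B.toGQuiver f.obj g.obj where
  toFun := B1 f g d
  map_add' r r' := by
    funext X Y; ext w
    simp only [B1, coder_add hf, LinearMap.sub_apply, LinearMap.comp_apply, LinearMap.smul_apply,
      LinearMap.add_apply, Pi.add_apply, map_add, smul_add]
    abel
  map_smul' c r := by
    funext X Y; ext w
    simp only [B1, coder_smul hf, LinearMap.sub_apply, LinearMap.comp_apply, LinearMap.smul_apply,
      Pi.smul_apply, map_smul, RingHom.id_apply, smul_sub]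
    rw [smul_comm]

/-- `B2` as a bilinear map -/
def B2ₗ (hf : f.Unital0) (hg : g.Unital0) (d e : ℤ) :
    Fam A.toGQuiver B.toGQuiver f.obj g.obj →ₗ[k] Fam A.toGQuiver B.toGQuiver g.obj h.obj →ₗ[k]
      Fam A.toGQuiver B.toGQuiver f.obj h.obj :=
  LinearMap.mk₂ k (B2 f g h d e)
    (fun r r' p => by
      funext X Y; ext w
      have : theta f g h d e (r + r') p X Y = theta f g h d e r p X Y + theta f g h d e r' p X Y :=
        lead_add_left hf _ _ _ _ _
      simp [B2, this])
    (fun c r p => by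
      funext X Y; ext w
      have : theta f g h d e (c • r) p X Y = c • theta f g h d e r p X Y := lead_smul_left hf _ _ _ _ _
      simp [B2, this])
    (fun r p p' => by
      funext X Y; ext w
      have : theta f g h d e r (p + p') X Y = theta f g h d e r p X Y + theta f g h d e r p' X Y := by
        refine Eq.trans ?_ (lead_add_right hf _ _ _ _ _)
        simp only [theta, coder_add hg]
      simp [B2, this])
    (fun c r p => by
      funext X Y; ext w
      have : theta f g h d e r (c • p) X Y = c • theta f g h d e r p X Y := by
        refine Eq.trans ?_ (lead_smul_right hf _ _ _ _ _)
        simp only [theta, coder_smul hg]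
      simp [B2, this])

/-- `whR` as a linear map -/
def whRₗ (hf : f.Unital0) (h : FunData B.toGQuiver C.toGQuiver) (d : ℤ) :
    Fam A.toGQuiver B.toGQuiver f.obj g.obj →ₗ[k]
      Fam A.toGQuiver C.toGQuiver (f.andThen h).obj (g.andThen h).obj where
  toFun := whR f g h d
  map_add' r r' := by
    funext X Y
    rw [whR, coder_add hf, LinearMap.comp_add]; rfl
  map_smul' c r := by
    funext X Y
    rw [whR, coder_smul hf, LinearMap.comp_smul]; rfl

/-- `whL` as a linear map -/
def whLₗ (e : FunData A.toGQuiver B.toGQuiver) (f g : FunData B.toGQuiver C.toGQuiver) :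
    Fam B.toGQuiver C.toGQuiver f.obj g.obj →ₗ[k]
      Fam A.toGQuiver C.toGQuiver (e.andThen f).obj (e.andThen g).obj where
  toFun := whL e f g
  map_add' r r' := by
    funext X Y
    rw [whL, Pi.add_apply, Pi.add_apply, LinearMap.add_comp]; rfl
  map_smul' c r := by
    funext X Y
    rw [whL, Pi.smul_apply, Pi.smul_apply, LinearMap.smul_comp]; rfl

end

/-! bundled -/

/-- A∞-categories over `k` -/
structure AInfCat (k : Type u) [CommRing k] extends Ops k where
  isAInf : toOps.IsAInf

/-- A∞-functors -/
structure AInfFun (A B : AInfCat k) extends FunData A.toGQuiver B.toGQuiver where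
  isFun : IsAInfFun (A := A.toOps) (B := B.toOps) toFunData

theorem idFun_isFun {A : Ops k} : IsAInfFun (A := A) (B := A) (idFun A.toGQuiver) where
  comp_one := idFun_unital _
  homog X Y e w hw := by simpa using proj_mem hw
  comm X Y w := (congrArg (A.hatb X Y) (hat_idFun w)).trans (hat_idFun _).symm

theorem andThen_isFun {A B C : Ops k} {f : FunData A.toGQuiver B.toGQuiver} {g : FunData B.toGQuiver C.toGQuiver}
    (hf : IsAInfFun f) (hg : IsAInfFun g) : IsAInfFun (A := A) (B := C) (f.andThen g) where
  comp_one := comp_unital hf.comp_one hg.comp_one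
  homog X Y e w hw := hg.homog _ _ _ _ (by have := hat_mem hf.homog hw; exact this)
  comm X Y w := (congrArg (C.hatb _ _) (hat_comp hf.comp_one hg.comp_one w)).trans
    (((hg.comm _ _ _).trans (congrArg _ (hf.comm _ _ _))).trans (hat_comp hf.comp_one hg.comp_one _).symm)

def AInfFun.id (A : AInfCat k) : AInfFun A A := ⟨idFun A.toGQuiver, idFun_isFun⟩

def AInfFun.seq {A B C : AInfCat k} (f : AInfFun A B) (g : AInfFun B C) : AInfFun A C :=
  ⟨f.toFunData.andThen g.toFunData, andThen_isFun f.isFun g.isFun⟩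

theorem AInfFun.id_comp {A B : AInfCat k} (f : AInfFun A B) : (AInfFun.id A).seq f = f := by
  obtain ⟨⟨o, c⟩, hf⟩ := f
  simp only [AInfFun.id, AInfFun.seq, AInfFun.mk.injEq, FunData.mk.injEq, heq_eq_eq, true_and]
  funext X Y
  ext w
  exact congrArg (c X Y) (hat_idFun w)

theorem AInfFun.comp_id {A B : AInfCat k} (f : AInfFun A B) : f.seq (AInfFun.id B) = f := by
  obtain ⟨⟨o, c⟩, hf⟩ := f
  simp only [AInfFun.id, AInfFun.seq, AInfFun.mk.injEq, FunData.mk.injEq, heq_eq_eq, true_and]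
  funext X Y
  ext w
  exact proj_hat hf.comp_one w

theorem AInfFun.assoc {A B C D : AInfCat k} (f : AInfFun A B) (g : AInfFun B C) (h : AInfFun C D) :
    (f.seq g).seq h = f.seq (g.seq h) := by
  simp only [AInfFun.seq, AInfFun.mk.injEq, FunData.mk.injEq, heq_eq_eq, true_and]
  funext X Y
  ext w
  exact congrArg (h.toFunData.comp _ _) (hat_comp f.isFun.comp_one g.isFun.comp_one w)

/-- `[s A∞(A,B)(f,g)]ⁿ`: A∞-transformations whose (suspended) degree is `n` -/
def Trans {A B : AInfCat k} (f g : AInfFun A B) (n : ℤ) :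
    Submodule k (Fam A.toGQuiver B.toGQuiver f.obj g.obj) where
  carrier := {r | Homog n r}
  add_mem' hr hp _ _ _ _ hw := Submodule.add_mem _ (hr _ _ _ _ hw) (hp _ _ _ _ hw)
  zero_mem' _ _ _ _ _ := Submodule.zero_mem _
  smul_mem' c _ hr _ _ _ _ hw := Submodule.smul_mem _ c (hr _ _ _ _ hw)

end AInf

end

noncomputable section

universe u

namespace AInf

/-- The objects, 1-morphisms, complexes of 2-morphisms and operations of a 1-unital, non-2-unital 𝒦-2-category, where
𝒦 is the homotopy category of complexes of `k`-modules. `Hom2 f g n` is the degree `n` part of the complex of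
2-morphisms, `d` its differential, `m` the vertical composition, `actR`, `actL` the actions of 1-morphisms; all
operations are chain maps (signs are those of right operators: `(x ⊗ y) d = x ⊗ yd + (-1)^{|y|} xd ⊗ y`). -/
structure K2Cat (k : Type u) [CommRing k] where
  Obj : Type (u + 1)
  Hom : Obj → Obj → Type u
  id : ∀ P, Hom P P
  comp : ∀ {P Q R}, Hom P Q → Hom Q R → Hom P R
  id_comp : ∀ {P Q} (f : Hom P Q), comp (id P) f = f
  comp_id : ∀ {P Q} (f : Hom P Q), comp f (id Q) = f
  assoc : ∀ {P Q R S} (f : Hom P Q) (g : Hom Q R) (h : Hom R S), comp (comp f g) h = comp f (comp g h)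
  Hom2 : ∀ {P Q}, Hom P Q → Hom P Q → ℤ → Type u
  [grp : ∀ {P Q} (f g : Hom P Q) n, AddCommGroup (Hom2 f g n)]
  [mod : ∀ {P Q} (f g : Hom P Q) n, Module k (Hom2 f g n)]
  d : ∀ {P Q} {f g : Hom P Q} {n n' : ℤ}, n + 1 = n' → Hom2 f g n →ₗ[k] Hom2 f g n'
  m : ∀ {P Q} {f g h : Hom P Q} {i j l : ℤ}, i + j = l → Hom2 f g i →ₗ[k] Hom2 g h j →ₗ[k] Hom2 f h l
  actR : ∀ {P Q R} {f g : Hom P Q} {n : ℤ} (h : Hom Q R), Hom2 f g n →ₗ[k] Hom2 (comp f h) (comp g h) n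
  actL : ∀ {P Q R} {f g : Hom Q R} {n : ℤ} (e : Hom P Q), Hom2 f g n →ₗ[k] Hom2 (comp e f) (comp e g) n
  d_d : ∀ {P Q} {f g : Hom P Q} {n n' n'' : ℤ} (h : n + 1 = n') (h' : n' + 1 = n'') (x : Hom2 f g n),
    d h' (d h x) = 0
  d_m : ∀ {P Q} {f g h : Hom P Q} {i i' j j' l l' : ℤ} (hi : i + 1 = i') (hj : j + 1 = j') (hl : l + 1 = l')
    (h0 : i + j = l) (h1 : i' + j = l') (h2 : i + j' = l') (x : Hom2 f g i) (y : Hom2 g h j),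
    d hl (m h0 x y) = m h2 x (d hj y) + (j.negOnePow : ℤ) • m h1 (d hi x) y
  d_actR : ∀ {P Q R} {f g : Hom P Q} {n n' : ℤ} (hn : n + 1 = n') (h : Hom Q R) (x : Hom2 f g n),
    d hn (actR h x) = actR h (d hn x)
  d_actL : ∀ {P Q R} {f g : Hom Q R} {n n' : ℤ} (hn : n + 1 = n') (e : Hom P Q) (x : Hom2 f g n),
    d hn (actL e x) = actL e (d hn x)

attribute [instance] K2Cat.grp K2Cat.mod

namespace K2Cat
variable {k : Type u} [CommRing k]

/-- transport of a 2-morphism along equalities of 1-morphisms -/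
def cast2 {C : K2Cat k} {P Q : C.Obj} {f f' g g' : C.Hom P Q} (hf : f = f') (hg : g = g') {n : ℤ}
    (x : C.Hom2 f g n) : C.Hom2 f' g' n :=
  cast (by rw [hf, hg]) x
end K2Cat

/-- a map of objects, of 1-morphisms and of 2-morphisms -/
structure K2Map {k : Type u} [CommRing k] (C D : K2Cat k) where
  obj : C.Obj → D.Obj
  map : ∀ {P Q}, C.Hom P Q → D.Hom (obj P) (obj Q)
  map2 : ∀ {P Q} {f g : C.Hom P Q} {n : ℤ}, C.Hom2 f g n → D.Hom2 (map f) (map g) n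

/-- Strict 𝒦-2-functor: chain maps on 2-morphisms, preserving all operations. Preservation of the operations with
2-morphisms is an equation in 𝒦, i.e. an equation between chain maps up to a chain homotopy. -/
structure K2Map.IsStrict {k : Type u} [CommRing k] {C D : K2Cat k} (F : K2Map C D) : Prop where
  map_id : ∀ P, F.map (C.id P) = D.id (F.obj P)
  map_comp : ∀ {P Q R} (f : C.Hom P Q) (g : C.Hom Q R), F.map (C.comp f g) = D.comp (F.map f) (F.map g)
  map2_add : ∀ {P Q} {f g : C.Hom P Q} {n : ℤ} (x y : C.Hom2 f g n), F.map2 (x + y) = F.map2 x + F.map2 y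
  map2_smul : ∀ {P Q} {f g : C.Hom P Q} {n : ℤ} (c : k) (x : C.Hom2 f g n), F.map2 (c • x) = c • F.map2 x
  map2_d : ∀ {P Q} {f g : C.Hom P Q} {n n' : ℤ} (h : n + 1 = n') (x : C.Hom2 f g n),
    F.map2 (C.d h x) = D.d h (F.map2 x)
  map2_m : ∀ {P Q} (f g h : C.Hom P Q),
    ∃ K : ∀ {i j l : ℤ}, i + j = l + 1 → C.Hom2 f g i →ₗ[k] C.Hom2 g h j →ₗ[k] D.Hom2 (F.map f) (F.map h) l,
      ∀ {i i' j j' l l' : ℤ} (hi : i + 1 = i') (hj : j + 1 = j') (hl : l + 1 = l') (h0 : i + j = l')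
        (h1 : i' + j = l' + 1) (h2 : i + j' = l' + 1)
        (x : C.Hom2 f g i) (y : C.Hom2 g h j),
        F.map2 (C.m h0 x y) - D.m h0 (F.map2 x) (F.map2 y) =
          D.d hl (K (h0.trans hl.symm) x y) + (K h2 x (C.d hj y) + (j.negOnePow : ℤ) • K h1 (C.d hi x) y)
  map2_actR : ∀ {P Q R} (f g : C.Hom P Q) (h : C.Hom Q R),
    ∃ K : ∀ {n n' : ℤ}, n + 1 = n' → C.Hom2 f g n' →ₗ[k] D.Hom2 (D.comp (F.map f) (F.map h)) (D.comp (F.map g) (F.map h)) n,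
      ∀ {n n' n'' : ℤ} (hn : n + 1 = n') (hn' : n' + 1 = n'') (x : C.Hom2 f g n'),
        K2Cat.cast2 (map_comp f h) (map_comp g h) (F.map2 (C.actR h x)) - D.actR (F.map h) (F.map2 x) =
          D.d hn (K hn x) + K hn' (C.d hn' x)
  map2_actL : ∀ {P Q R} (e : C.Hom P Q) (f g : C.Hom Q R),
    ∃ K : ∀ {n n' : ℤ}, n + 1 = n' → C.Hom2 f g n' →ₗ[k] D.Hom2 (D.comp (F.map e) (F.map f)) (D.comp (F.map e) (F.map g)) n,
      ∀ {n n' n'' : ℤ} (hn : n + 1 = n') (hn' : n' + 1 = n'') (x : C.Hom2 f g n'),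
        K2Cat.cast2 (map_comp e f) (map_comp e g) (F.map2 (C.actL e x)) - D.actL (F.map e) (F.map2 x) =
          D.d hn (K hn x) + K hn' (C.d hn' x)

/-- The objects, 1-morphisms, modules of 2-morphisms and operations of a `k`-linear non-2-unital 2-category. -/
structure TwoCat (k : Type u) [CommRing k] where
  Obj : Type (u + 1)
  Hom : Obj → Obj → Type u
  id : ∀ P, Hom P P
  comp : ∀ {P Q R}, Hom P Q → Hom Q R → Hom P R
  id_comp : ∀ {P Q} (f : Hom P Q), comp (id P) f = f
  comp_id : ∀ {P Q} (f : Hom P Q), comp f (id Q) = f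
  assoc : ∀ {P Q R S} (f : Hom P Q) (g : Hom Q R) (h : Hom R S), comp (comp f g) h = comp f (comp g h)
  Hom2 : ∀ {P Q}, Hom P Q → Hom P Q → Type u
  [grp : ∀ {P Q} (f g : Hom P Q), AddCommGroup (Hom2 f g)]
  [mod : ∀ {P Q} (f g : Hom P Q), Module k (Hom2 f g)]
  m : ∀ {P Q} {f g h : Hom P Q}, Hom2 f g →ₗ[k] Hom2 g h →ₗ[k] Hom2 f h
  actR : ∀ {P Q R} {f g : Hom P Q} (h : Hom Q R), Hom2 f g →ₗ[k] Hom2 (comp f h) (comp g h)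
  actL : ∀ {P Q R} {f g : Hom Q R} (e : Hom P Q), Hom2 f g →ₗ[k] Hom2 (comp e f) (comp e g)

attribute [instance] TwoCat.grp TwoCat.mod

/-- transport of a 2-morphism along equalities of 1-morphisms -/
def TwoCat.cast2 {k : Type u} [CommRing k] {C : TwoCat k} {P Q : C.Obj} {f f' g g' : C.Hom P Q}
    (hf : f = f') (hg : g = g') (x : C.Hom2 f g) : C.Hom2 f' g' :=
  cast (by rw [hf, hg]) x

/-- a map of objects, of 1-morphisms and of 2-morphisms -/
structure TwoMap {k : Type u} [CommRing k] (C D : TwoCat k) where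
  obj : C.Obj → D.Obj
  map : ∀ {P Q}, C.Hom P Q → D.Hom (obj P) (obj Q)
  map2 : ∀ {P Q} {f g : C.Hom P Q}, C.Hom2 f g → D.Hom2 (map f) (map g)

/-- Strict 2-functor: all operations are preserved. -/
structure TwoMap.IsStrict {k : Type u} [CommRing k] {C D : TwoCat k} (F : TwoMap C D) : Prop where
  map_id : ∀ P, F.map (C.id P) = D.id (F.obj P)
  map_comp : ∀ {P Q R} (f : C.Hom P Q) (g : C.Hom Q R), F.map (C.comp f g) = D.comp (F.map f) (F.map g)
  map2_add : ∀ {P Q} {f g : C.Hom P Q} (x y : C.Hom2 f g), F.map2 (x + y) = F.map2 x + F.map2 y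
  map2_smul : ∀ {P Q} {f g : C.Hom P Q} (c : k) (x : C.Hom2 f g), F.map2 (c • x) = c • F.map2 x
  map2_m : ∀ {P Q} {f g h : C.Hom P Q} (x : C.Hom2 f g) (y : C.Hom2 g h),
    F.map2 (C.m x y) = D.m (F.map2 x) (F.map2 y)
  map2_actR : ∀ {P Q R} {f g : C.Hom P Q} (h : C.Hom Q R) (x : C.Hom2 f g),
    TwoCat.cast2 (map_comp f h) (map_comp g h) (F.map2 (C.actR h x)) = D.actR (F.map h) (F.map2 x)
  map2_actL : ∀ {P Q R} {f g : C.Hom Q R} (e : C.Hom P Q) (x : C.Hom2 f g),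
    TwoCat.cast2 (map_comp e f) (map_comp e g) (F.map2 (C.actL e x)) = D.actL (F.map e) (F.map2 x)

namespace K2Cat
variable {k : Type u} [CommRing k] (C : K2Cat k)

/-- degree zero cocycles -/
def Z0 {P Q : C.Obj} (f g : C.Hom P Q) : Submodule k (C.Hom2 f g 0) :=
  LinearMap.ker (C.d (f := f) (g := g) (show (0:ℤ) + 1 = 1 by norm_num))

/-- degree zero coboundaries -/
def Bd0 {P Q : C.Obj} (f g : C.Hom P Q) : Submodule k (C.Z0 f g) :=
  (LinearMap.range (C.d (f := f) (g := g) (show (-1:ℤ) + 1 = 0 by norm_num))).submoduleOf (C.Z0 f g)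

/-- `H⁰` of the complex of 2-morphisms -/
abbrev H0Hom {P Q : C.Obj} (f g : C.Hom P Q) : Type u := C.Z0 f g ⧸ C.Bd0 f g

section
variable {C} {P Q R : C.Obj} {f g h : C.Hom P Q}

theorem mem_Z0 {x : C.Hom2 f g 0} : x ∈ C.Z0 f g ↔ C.d (show (0:ℤ) + 1 = 1 by norm_num) x = 0 := Iff.rfl

def zm (x : C.Z0 f g) (y : C.Z0 g h) : C.Z0 f h :=
  ⟨C.m (add_zero 0) x.1 y.1, by
    rw [mem_Z0, C.d_m (i' := 1) (j' := 1) (by norm_num) (by norm_num) _ _ (by norm_num) (by norm_num),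
      mem_Z0.mp x.2, mem_Z0.mp y.2]
    simp⟩

def zmk : C.Z0 f g →ₗ[k] C.Z0 g h →ₗ[k] C.H0Hom f h :=
  LinearMap.mk₂ k (fun x y => (C.Bd0 f h).mkQ (zm x y))
    (fun x x' y => by rw [← map_add]; congr 1; ext; simp [zm])
    (fun c x y => by rw [← map_smul]; congr 1; ext; simp [zm])
    (fun x y y' => by rw [← map_add]; congr 1; ext; simp [zm])
    (fun c x y => by rw [← map_smul]; congr 1; ext; simp [zm])

theorem zmk_left (x : C.Z0 f g) (hx : x ∈ C.Bd0 f g) (y : C.Z0 g h) : zmk x y = 0 := by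
  obtain ⟨t, ht⟩ := hx
  refine (Submodule.Quotient.mk_eq_zero _).mpr ⟨C.m (add_zero (-1)) t y.1, ?_⟩
  rw [C.d_m (i' := 0) (j' := 1) (by norm_num) (by norm_num) _ _ (by norm_num) (by norm_num), mem_Z0.mp y.2, ht]
  simp [zm]

theorem zmk_right (x : C.Z0 f g) (y : C.Z0 g h) (hy : y ∈ C.Bd0 g h) : zmk x y = 0 := by
  obtain ⟨t, ht⟩ := hy
  refine (Submodule.Quotient.mk_eq_zero _).mpr ⟨C.m (zero_add (-1)) x.1 t, ?_⟩
  rw [C.d_m (i' := 1) (j' := 0) (by norm_num) (by norm_num) _ _ (by norm_num) (by norm_num), mem_Z0.mp x.2, ht]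
  simp [zm]

def zR (h : C.Hom Q R) : C.Z0 f g →ₗ[k] C.Z0 (C.comp f h) (C.comp g h) :=
  (C.actR h).restrict fun x hx => by rw [mem_Z0, C.d_actR, mem_Z0.mp hx, map_zero]

def zL {P' : C.Obj} (e : C.Hom P' P) : C.Z0 f g →ₗ[k] C.Z0 (C.comp e f) (C.comp e g) :=
  (C.actL e).restrict fun x hx => by rw [mem_Z0, C.d_actL, mem_Z0.mp hx, map_zero]

end

/-- `H⁰` of a 𝒦-2-category: 2-morphisms are replaced by their zeroth cohomology, with the induced operations. -/
def H0 : TwoCat k where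
  Obj := C.Obj
  Hom := C.Hom
  id := C.id
  comp := C.comp
  id_comp := C.id_comp
  comp_id := C.comp_id
  assoc := C.assoc
  Hom2 f g := C.H0Hom f g
  m {P Q f g h} := (C.Bd0 f g).liftQ
    (LinearMap.flip ((C.Bd0 g h).liftQ (LinearMap.flip zmk)
      (fun y hy => by ext x; exact zmk_right x y hy)))
    (fun x hx => by
      ext y
      exact zmk_left x hx y)
  actR {P Q R f g} h := (C.Bd0 f g).mapQ (C.Bd0 _ _) (zR h) (by
    rintro x ⟨t, ht⟩
    exact ⟨C.actR h t, by rw [C.d_actR, ht]; rfl⟩)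
  actL {P Q R f g} e := (C.Bd0 f g).mapQ (C.Bd0 _ _) (zL e) (by
    rintro x ⟨t, ht⟩
    exact ⟨C.actL e t, by rw [C.d_actL, ht]; rfl⟩)

end K2Cat

def K2Map.zmap {k : Type u} [CommRing k] {C D : K2Cat k} {F : K2Map C D} (hF : F.IsStrict) {P Q : C.Obj} (f g : C.Hom P Q) :
    C.Z0 f g →ₗ[k] D.Z0 (F.map f) (F.map g) where
  toFun x := ⟨F.map2 x.1, by
    rw [K2Cat.mem_Z0, ← hF.map2_d, K2Cat.mem_Z0.mp x.2]
    simpa using hF.map2_smul (0 : k) (0 : C.Hom2 f g 1)⟩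
  map_add' x y := Subtype.ext (hF.map2_add _ _)
  map_smul' c x := Subtype.ext (hF.map2_smul _ _)

/-- the map induced on `H⁰` by a strict 𝒦-2-functor -/
def K2Map.H0 {k : Type u} [CommRing k] {C D : K2Cat k} {F : K2Map C D} (hF : F.IsStrict) : TwoMap C.H0 D.H0 where
  obj := F.obj
  map := F.map
  map2 {P Q f g} := (C.Bd0 f g).mapQ (D.Bd0 (F.map f) (F.map g)) (K2Map.zmap hF f g) (by
    rintro x ⟨t, ht⟩
    exact ⟨F.map2 t, (hF.map2_d _ t).symm.trans (congrArg F.map2 ht)⟩)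

end AInf

end

noncomputable section

universe u

namespace AInf

open GQuiver

variable {k : Type u} [CommRing k]

section
variable {A B C : AInfCat k}

/-- the differential `m₁ = s B₁ s⁻¹` -/
def Trans.d {f g : AInfFun A B} {n n' : ℤ} (hn : n + 1 = n') : Trans f g (n - 1) →ₗ[k] Trans f g (n' - 1) :=
  (B1ₗ (f := f.toFunData) (g := g.toFunData) f.isFun.comp_one (n - 1)).restrict fun r hr => by
    have := B1_mem A.isAInf B.isAInf f.isFun g.isFun hr
    have e : n - 1 + 1 = n' - 1 := by omega
    rw [e] at this
    exact this

/-- the vertical composition `m₂ = (s ⊗ s) B₂ s⁻¹`, so `m₂(r,p) = (-1)^j (r s ⊗ p s) B₂ s⁻¹` for `p` of degree `j` -/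
def Trans.m {f g h : AInfFun A B} {i j l : ℤ} (hl : i + j = l) :
    Trans f g (i - 1) →ₗ[k] Trans g h (j - 1) →ₗ[k] Trans f h (l - 1) :=
  LinearMap.mk₂ k (fun r p => ⟨(j.negOnePow : ℤ) • B2 f.toFunData g.toFunData h.toFunData (i - 1) (j - 1) r.1 p.1, by
      have := B2_mem B.isAInf f.isFun g.isFun h.isFun r.2 p.2
      have e : i - 1 + (j - 1) + 1 = l - 1 := by omega
      rw [e] at this
      have h2 : _ ∈ Trans f h (l - 1) := this
      exact zsmul_mem h2 _⟩)
    (fun r r' p => Subtype.ext <| (congrArg (fun x => (j.negOnePow : ℤ) • x)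
      (LinearMap.map_add₂ (B2ₗ f.isFun.comp_one g.isFun.comp_one (i - 1) (j - 1)) r.1 r'.1 p.1)).trans (smul_add _ _ _))
    (fun c r p => Subtype.ext <| (congrArg (fun x => (j.negOnePow : ℤ) • x)
      (LinearMap.map_smul₂ (B2ₗ f.isFun.comp_one g.isFun.comp_one (i - 1) (j - 1)) c r.1 p.1)).trans (smul_comm _ _ _))
    (fun r p p' => Subtype.ext <| (congrArg (fun x => (j.negOnePow : ℤ) • x)
      (map_add (B2ₗ f.isFun.comp_one g.isFun.comp_one (i - 1) (j - 1) r.1) p.1 p'.1)).trans (smul_add _ _ _))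
    (fun c r p => Subtype.ext <| (congrArg (fun x => (j.negOnePow : ℤ) • x)
      (map_smul (B2ₗ f.isFun.comp_one g.isFun.comp_one (i - 1) (j - 1) r.1) c p.1)).trans (smul_comm _ _ _))

/-- right action of a functor -/
def Trans.actR {f g : AInfFun A B} {n : ℤ} (h : AInfFun B C) :
    Trans f g n →ₗ[k] Trans (f.seq h) (g.seq h) n :=
  (whRₗ (f := f.toFunData) (g := g.toFunData) f.isFun.comp_one h.toFunData n).restrict fun _ hr =>
    whR_mem f.isFun g.isFun h.isFun hr

/-- left action of a functor -/
def Trans.actL {f g : AInfFun B C} {n : ℤ} (e : AInfFun A B) :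
    Trans f g n →ₗ[k] Trans (e.seq f) (e.seq g) n :=
  (whLₗ e.toFunData f.toFunData g.toFunData).restrict fun _ hr => whL_mem e.isFun hr

end

/-- A pair (A∞-category, full A∞-subcategory); the latter is given by its set of objects. -/
structure AInfPair (k : Type u) [CommRing k] where
  cat : AInfCat k
  sub : Set cat.Ob

/-- A∞-functors that map the first subcategory into the second on objects -/
@[ext] structure PairFun (P Q : AInfPair k) where
  fn : AInfFun P.cat Q.cat
  maps : ∀ X ∈ P.sub, fn.obj X ∈ Q.sub

theorem Trans.d_d {A B : AInfCat k} {f g : AInfFun A B} {n n' n'' : ℤ} (h : n + 1 = n') (h' : n' + 1 = n'')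
    (x : Trans f g (n - 1)) : Trans.d h' (Trans.d h x) = 0 := by
  obtain rfl : n' = n + 1 := h.symm
  refine Subtype.ext ?_
  have := B1_B1 A.isAInf B.isAInf f.isFun g.isFun x.2
  have e : n - 1 + 1 = n + 1 - 1 := by ring
  rw [e] at this
  exact this

theorem Trans.d_m {A B : AInfCat k} {f g h : AInfFun A B} {i i' j j' l l' : ℤ} (hi : i + 1 = i') (hj : j + 1 = j') (hl : l + 1 = l')
    (h0 : i + j = l) (h1 : i' + j = l') (h2 : i + j' = l') (x : Trans f g (i - 1)) (y : Trans g h (j - 1)) :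
    Trans.d hl (Trans.m h0 x y) = Trans.m h2 x (Trans.d hj y) + (j.negOnePow : ℤ) • Trans.m h1 (Trans.d hi x) y := by
  subst hi hj h0 hl
  refine Subtype.ext ?_
  have := B1_B2 A.isAInf B.isAInf f.isFun g.isFun h.isFun x.2 y.2
  have e1 : i - 1 + (j - 1) + 1 = i + j - 1 := by ring
  have e2 : j - 1 + 1 = j + 1 - 1 := by ring
  have e3 : i - 1 + 1 = i + 1 - 1 := by ring
  rw [e1, e2, e3] at this
  have h1 : ((Trans.d (rfl : i + j + 1 = i + j + 1) (Trans.m rfl x y)).1) = (j.negOnePow : ℤ) •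
      B1 f.toFunData h.toFunData (i + j - 1) (B2 f.toFunData g.toFunData h.toFunData (i - 1) (j - 1) x.1 y.1) :=
    map_zsmul (B1ₗ (f := f.toFunData) (g := h.toFunData) f.isFun.comp_one (i + j - 1)) _ _
  rw [h1, this]
  have h3 : ((Trans.m h2 x (Trans.d (rfl : j + 1 = j + 1) y) +
      (j.negOnePow : ℤ) • Trans.m ‹_› (Trans.d (rfl : i + 1 = i + 1) x) y : Trans f h (i + j + 1 - 1)) : Fam _ _ _ _) =
     ((j+1).negOnePow : ℤ) • B2 f.toFunData g.toFunData h.toFunData (i - 1) (j + 1 - 1) x.1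
      (B1 g.toFunData h.toFunData (j - 1) y.1) +
     (j.negOnePow : ℤ) • (j.negOnePow : ℤ) • B2 f.toFunData g.toFunData h.toFunData (i + 1 - 1) (j - 1)
       (B1 f.toFunData g.toFunData (i - 1) x.1) y.1 := rfl
  rw [h3, Int.negOnePow_succ, Int.negOnePow_sub, Int.negOnePow_one, mul_neg_one]
  simp only [Units.val_neg, neg_smul, smul_sub, smul_neg]
  abel

theorem Trans.d_actR {A B C : AInfCat k} {f g : AInfFun A B} {n n' : ℤ} (hn : n + 1 = n') (h : AInfFun B C)
    (x : Trans f g (n - 1)) : Trans.d hn (Trans.actR h x) = Trans.actR h (Trans.d hn x) := by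
  subst hn
  refine Subtype.ext ?_
  have := whR_B1 A.isAInf B.isAInf f.isFun g.isFun h.isFun x.2
  have e : n - 1 + 1 = n + 1 - 1 := by ring
  rw [e] at this
  exact this.symm

theorem Trans.d_actL {A B C : AInfCat k} {f g : AInfFun B C} {n n' : ℤ} (hn : n + 1 = n') (e : AInfFun A B)
    (x : Trans f g (n - 1)) : Trans.d hn (Trans.actL e x) = Trans.actL e (Trans.d hn x) := by
  subst hn
  exact Subtype.ext (whL_B1 e.isFun f.isFun g.isFun).symm

/-- `𝒦A∞'`: pairs; 2-morphisms are all A∞-transformations, `A∞(A,B)(f,g)ⁿ = [s A∞(A,B)(f,g)]ⁿ⁻¹` -/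
def KAInfPair (k : Type u) [CommRing k] : K2Cat k where
  Obj := AInfPair k
  Hom := PairFun
  id P := ⟨AInfFun.id P.cat, fun _ h => h⟩
  comp f g := ⟨f.fn.seq g.fn, fun X h => g.maps _ (f.maps X h)⟩
  id_comp f := PairFun.ext (AInfFun.id_comp f.fn)
  comp_id f := PairFun.ext (AInfFun.comp_id f.fn)
  assoc f g h := PairFun.ext (AInfFun.assoc f.fn g.fn h.fn)
  Hom2 f g n := Trans f.fn g.fn (n - 1)
  d := Trans.d
  m := Trans.m
  actR h := Trans.actR h.fn
  actL e := Trans.actL e.fn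
  d_d := Trans.d_d
  d_m := Trans.d_m
  d_actR hn h x := Trans.d_actR hn h.fn x
  d_actL hn e x := Trans.d_actL hn e.fn x

/-- `𝒦A∞`: A∞-categories, A∞-functors and the complexes `(A∞(A,B)(f,g), m₁)` -/
def KAInf (k : Type u) [CommRing k] : K2Cat k where
  Obj := AInfCat k
  Hom := AInfFun
  id := AInfFun.id
  comp := AInfFun.seq
  id_comp := AInfFun.id_comp
  comp_id := AInfFun.comp_id
  assoc := AInfFun.assoc
  Hom2 f g n := Trans f g (n - 1)
  d := Trans.d
  m := Trans.m
  actR h := Trans.actR h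
  actL e := Trans.actL e
  d_d := Trans.d_d
  d_m := Trans.d_m
  d_actR := Trans.d_actR
  d_actL := Trans.d_actL

end AInf

end

noncomputable section

universe u

namespace AInf

open GQuiver

variable {k : Type u} [CommRing k]

section
variable (A : GQuiver k)

/-- `T⁺A` -/
abbrev plus : GQuiver k := A.barQuiver Set.univ

/-- embedding of `sD(𝒞|S)`, in particular of `T⁺s𝒞`, into `Ts𝒞` -/
def toT (S : Set A.Ob) (X Y : A.Ob) : (A.barQuiver S).hom X Y →ₗ[k] A.T X Y :=
  DirectSum.toModule k _ _ (fun p : {p : Chain Y X // p.Good S} => A.inj p.1)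

open scoped Classical in
/-- projection of `Ts𝒞` onto the direct summand `sD(𝒞|S)` -/
def ofT (S : Set A.Ob) (X Y : A.Ob) : A.T X Y →ₗ[k] (A.barQuiver S).hom X Y :=
  lift (fun p => if h : p.Good S then
    DirectSum.lof k _ (fun p : {p : Chain Y X // p.Good S} => A.tens p.1) ⟨p, h⟩ else 0)

/-- multiplication of the tensor algebra -/
def concat (X Z Y : A.Ob) : A.T X Z →ₗ[k] A.T Z Y →ₗ[k] A.T X Y :=
  A.fold (M := fun X => A.T Z Y →ₗ[k] A.T X Y) LinearMap.id
    (fun X W => LinearMap.mk₂ k (fun v φ => A.cons X W Y v ∘ₗ φ)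
      (fun _ _ _ => by ext; simp) (fun _ _ _ => by ext; simp)
      (fun _ _ _ => by ext; simp) (fun _ _ _ => by ext; simp)) X

/-- `μ⁽ⁿ⁾ : Tⁿ(T⁺A) → TA` for all `n` -/
def mulAll (X Y : A.Ob) : (plus A).T X Y →ₗ[k] A.T X Y :=
  (plus A).fold (M := fun X => A.T X Y) (A.one Y) (fun X Z => concat A X Z Y ∘ₗ toT A Set.univ X Z) X

/-- `(-1)ⁿ` on `Tⁿ` -/
def lenSgn (X Y : A.Ob) : A.T X Y →ₗ[k] A.T X Y :=
  A.fold (M := fun X => A.T X Y) (A.one Y) (fun X Z => - A.cons X Z Y) X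

/-- `𝐦`, with components `μ⁽ⁿ⁾`, `n ≥ 1` -/
def mFun : FunData (plus A) (plus A) := ⟨fun X => X, fun X Y => ofT A Set.univ X Y ∘ₗ mulAll A X Y⟩

/-- the components `(-1)ⁿ⁻¹ μ⁽ⁿ⁾`, `n ≥ 1`, of `𝐦⁻¹` -/
def mInv (X Y : A.Ob) : (plus A).T X Y →ₗ[k] (plus A).hom X Y :=
  - (mFun A).comp X Y ∘ₗ lenSgn (plus A) X Y
end

section
variable {A B : GQuiver k}

/-- the underline construction applied to a map `F : TA → TB`: component `F` on `T⁺A`, on `T⁰` the image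
of `one` under `F`, zero on `Tⁿ(T⁺A)`, `n ≥ 2` -/
def under {o o' : A.Ob → B.Ob} (F : ∀ X Y, A.T X Y →ₗ[k] B.T (o X) (o' Y)) :
    Fam (plus A) (plus B) o o' := fun X Y =>
  low (A := plus A) (M := fun X => (plus B).hom (o X) (o' Y)) (ofT B Set.univ _ _ (F Y Y (A.one Y)))
    (fun X => ofT B Set.univ _ _ ∘ₗ F X Y ∘ₗ toT A Set.univ X Y) X

/-- components of `𝐦 G 𝐦⁻¹` (first `𝐦`, then `G`, then `𝐦⁻¹`) -/
def conj {o o' : A.Ob → B.Ob} (G : ∀ X Y, (plus A).T X Y →ₗ[k] (plus B).T (o X) (o' Y)) :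
    Fam (plus A) (plus B) o o' :=
  fun X Y => mInv B _ _ ∘ₗ G X Y ∘ₗ hat (mFun A) X Y

/-- `f` underlined: strict, with first component `f : T⁺A → T⁺B` -/
def underFun (f : FunData A B) : FunData (plus A) (plus B) := ⟨f.obj, under (hat f)⟩

/-- `f̄ = 𝐦 (f underlined) 𝐦⁻¹` -/
def barFun (f : FunData A B) : FunData (plus A) (plus B) := ⟨f.obj, conj (hat (underFun f))⟩

/-- `r` underlined: components `r₀`, `r : T⁺A → T⁺B`, `0`, `0`, … -/
def underTrans (f g : FunData A B) (d : ℤ) (r : Fam A B f.obj g.obj) :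
    Fam (plus A) (plus B) (underFun f).obj (underFun g).obj :=
  under (coder f g d r)

/-- `r̄ = 𝐦 (r underlined) 𝐦⁻¹` -/
def barTrans (f g : FunData A B) (d : ℤ) (r : Fam A B f.obj g.obj) :
    Fam (plus A) (plus B) (barFun f).obj (barFun g).obj :=
  conj (coder (underFun f) (underFun g) d (underTrans f g d r))

/-- `(r ⊗ p)R = 𝐦 ((r ⊗ p)H) 𝐦⁻¹ + 𝐦 (r ⊗ p | 𝐦⁻¹)M₂₀` (in the second summand `r`, `p` underlined), where `(r ⊗ p)H` has the
components `(r₀ ⊗ p₀)j₂`, `(r ⊗ p)θ`, `0`, … and `(ρ ⊗ π | λ)M₂₀ = (ρ ⊗ π)θ λ` -/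
def homR (f g h : FunData A B) (d e : ℤ) (r : Fam A B f.obj g.obj) (p : Fam A B g.obj h.obj) :
    Fam (plus A) (plus B) (barFun f).obj (barFun h).obj :=
  conj (coder (underFun f) (underFun h) (d + e) (under (theta f g h d e r p))) +
    conj (theta (underFun f) (underFun g) (underFun h) d e (underTrans f g d r) (underTrans g h e p))

/-- the embedding `sD(𝒜|S) ⊂ T⁺s𝒜` -/
def incl (A : GQuiver k) (S : Set A.Ob) (X Y : A.Ob) : (A.barQuiver S).hom X Y →ₗ[k] (plus A).hom X Y :=
  ofT A Set.univ X Y ∘ₗ toT A S X Y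

/-- the embedding as a strict functor; its `hat` is `TsD(𝒜|S) → T(T⁺s𝒜)` -/
def inclFun (A : GQuiver k) (S : Set A.Ob) : FunData (A.barQuiver S) (plus A) :=
  ⟨fun X => X, fun X Y => incl A S X Y ∘ₗ (A.barQuiver S).proj X Y⟩

/-- restriction of components to `TsD(𝒜|S) → sD(ℬ|S')`; meaningful if `Restricts` holds -/
def restr (S : Set A.Ob) (S' : Set B.Ob) {o o' : A.Ob → B.Ob} (F : Fam (plus A) (plus B) o o') :
    Fam (A.barQuiver S) (B.barQuiver S') o o' :=
  fun X Y => ofT B S' _ _ ∘ₗ toT B Set.univ _ _ ∘ₗ F X Y ∘ₗ hat (inclFun A S) X Y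

/-- the components map the image of `TsD(𝒜|S)` into `sD(ℬ|S')` -/
def Restricts (S : Set A.Ob) (S' : Set B.Ob) {o o' : A.Ob → B.Ob} (F : Fam (plus A) (plus B) o o') : Prop :=
  ∀ X Y (w : (A.barQuiver S).T X Y),
    incl B S' _ _ (restr S S' F X Y w) = F X Y (hat (inclFun A S) X Y w)

/-- `D(f)`: restriction of `f̄` -/
def DFunData (S : Set A.Ob) (S' : Set B.Ob) (f : FunData A B) : FunData (A.barQuiver S) (B.barQuiver S') :=
  ⟨f.obj, restr S S' (barFun f).comp⟩

/-- `D(r)`: restriction of `r̄` -/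
def DTrans (S : Set A.Ob) (S' : Set B.Ob) (f g : FunData A B) (d : ℤ) (r : Fam A B f.obj g.obj) :
    Fam (A.barQuiver S) (B.barQuiver S') (DFunData S S' f).obj (DFunData S S' g).obj :=
  restr S S' (barTrans f g d r)

/-- restriction of `(r ⊗ p)R` -/
def DhomR (S : Set A.Ob) (S' : Set B.Ob) (f g h : FunData A B) (d e : ℤ) (r : Fam A B f.obj g.obj)
    (p : Fam A B g.obj h.obj) :
    Fam (A.barQuiver S) (B.barQuiver S') (DFunData S S' f).obj (DFunData S S' h).obj :=
  restr S S' (homR f g h d e r p)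

/-! explicit -/

/-- projection of `TA` onto `TⁿA` -/
def lenProj (A : GQuiver k) (n : ℕ) (X Y : A.Ob) : A.T X Y →ₗ[k] A.T X Y :=
  lift (fun p => if p.length = n then A.inj p else 0)

/-- `HasShape A Y [k₁,…,kₙ] t`: `t = v₁ ⊗ ⋯ ⊗ vₙ ∈ Tⁿ(T⁺A)` with `vᵢ ∈ T^{kᵢ}A`, `kᵢ ≥ 1` -/
inductive HasShape (A : GQuiver k) (Y : A.Ob) : ∀ {X : A.Ob}, List ℕ → (plus A).T X Y → Prop
  | nil : HasShape A Y [] ((plus A).one Y)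
  | cons {X Z : A.Ob} {n : ℕ} {ns : List ℕ} {v : (plus A).hom X Z} {w : (plus A).T Z Y} (hn : 0 < n)
      (hv : lenProj A n X Z (toT A Set.univ X Z v) = toT A Set.univ X Z v) (hw : HasShape A Y ns w) :
      HasShape A Y (n :: ns) ((plus A).cons X Z Y v w)

/-- `r_n ⊗ W` -/
def block {o o' : A.Ob → B.Ob} (r : Fam A B o o') (n : ℕ) {Y : A.Ob} {y : B.Ob}
    (W : ∀ Z, A.T Z Y →ₗ[k] B.T (o' Z) y) (X : A.Ob) : A.T X Y →ₗ[k] B.T (o X) y :=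
  tconv (fun Z => r X Z ∘ₗ lenProj A n X Z) W

/-- `f_{a₁} ⊗ ⋯ ⊗ f_{aₙ} ⊗ W` -/
def blocks (f : FunData A B) {Y : A.Ob} {y : B.Ob} (W : ∀ Z, A.T Z Y →ₗ[k] B.T (f.obj Z) y) :
    List ℕ → ∀ X, A.T X Y →ₗ[k] B.T (f.obj X) y
  | [] => W
  | a :: as => block f.comp a (blocks f W as)

/-- sequences `(a₁,…,a_α; i; c₁,…,c_β; t; e₁,…,e_γ)` -/
structure Idx where
  a : List ℕ
  i : ℕ
  c : List ℕ
  t : ℕ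
  e : List ℕ

/-- all entries in order -/
def Idx.list (q : Idx) : List ℕ := q.a ++ [q.i] ++ q.c ++ [q.t] ++ q.e

/-- The index set `Q(k₁,…,kₙ)`: entries of `a`, `c`, `e` positive, and a partial sum `l₁ + ⋯ + l_j`, `j ≥ 1`, equals a partial sum
`k₁ + ⋯ + k_s`, `s ≥ 0`, exactly when both sums are complete. -/
def Q (ks : List ℕ) : Set Idx :=
  {q | (∀ x ∈ q.a, 0 < x) ∧ (∀ x ∈ q.c, 0 < x) ∧ (∀ x ∈ q.e, 0 < x) ∧
    ∀ j, 0 < j → j ≤ q.list.length → ∀ s, s ≤ ks.length →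
      ((q.list.take j).sum = (ks.take s).sum ↔ j = q.list.length ∧ s = ks.length)}

/-- `f_{a₁} ⊗ ⋯ ⊗ f_{a_α} ⊗ r_i ⊗ g_{c₁} ⊗ ⋯ ⊗ g_{c_β} ⊗ p_t ⊗ h_{e₁} ⊗ ⋯ ⊗ h_{e_γ}` -/
def explicitTerm (f g h : FunData A B) (d e : ℤ) (r : Fam A B f.obj g.obj) (p : Fam A B g.obj h.obj) (q : Idx)
    (X Y : A.Ob) : A.T X Y →ₗ[k] B.T (f.obj X) (h.obj Y) :=
  blocks f (block r q.i (fun V =>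
    blocks g (block p q.t (fun Z => blocks h (fun U => eps h.obj U) q.e Z ∘ₗ A.sgn e Z Y)) q.c V ∘ₗ A.sgn d V Y)) q.a X

end

/-- `𝒜̄ = (T⁺s𝒜, b̄)`, `b̄ = 𝐦 (b underlined) 𝐦⁻¹` -/
@[reducible] def barOps (A : Ops k) : Ops k where
  toGQuiver := plus A.toGQuiver
  b := conj (A := A.toGQuiver) (B := A.toGQuiver) (o := fun X => X) (o' := fun X => X)
    (coder (idFun (plus A.toGQuiver)) (idFun (plus A.toGQuiver)) 1
    (under (A := A.toGQuiver) (B := A.toGQuiver) (o := fun X => X) (o' := fun X => X) A.hatb))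

/-- `D(𝒜|S)`: the restriction of `b̄` to `sD(𝒜|S)` -/
@[reducible] def DOps (A : Ops k) (S : Set A.Ob) : Ops k where
  toGQuiver := A.toGQuiver.barQuiver S
  b := restr (A := A.toGQuiver) (B := A.toGQuiver) (o := fun X => X) (o' := fun X => X) S S (barOps A).b

end AInf

end

noncomputable section

universe u

namespace AInf

open GQuiver

variable {k : Type u} [CommRing k]

/-- The assignment `D` takes values in A∞-categories, A∞-functors and A∞-transformations. -/
structure DWellDefined (k : Type u) [CommRing k] : Prop where
  cat : ∀ P : AInfPair k, (DOps P.cat.toOps P.sub).IsAInf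
  fn : ∀ {P P' : AInfPair k} (f : PairFun P P'),
    IsAInfFun (A := DOps P.cat.toOps P.sub) (B := DOps P'.cat.toOps P'.sub)
      (DFunData P.sub P'.sub f.fn.toFunData)
  trans : ∀ {P P' : AInfPair k} (f g : PairFun P P') (n : ℤ) (r : Trans f.fn g.fn n),
    Homog n (DTrans P.sub P'.sub f.fn.toFunData g.fn.toFunData n r.1)

/-- `(𝒜,𝒜') ↦ D(𝒜|𝒜')`, `f ↦ D(f)`, `r ↦ D(r)` as a map from `𝒦A∞'` to `𝒦A∞` -/
def Dmap (h : DWellDefined k) : K2Map (KAInfPair k) (KAInf k) where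
  obj P := ⟨DOps P.cat.toOps P.sub, h.cat P⟩
  map {P P'} f := ⟨DFunData P.sub P'.sub f.fn.toFunData, h.fn f⟩
  map2 {P P' f g n} r := ⟨DTrans P.sub P'.sub f.fn.toFunData g.fn.toFunData (n - 1) r.1, h.trans f g _ r⟩

end AInf

end

universe u

noncomputable section

namespace AInf
open scoped TensorProduct DirectSum
open GQuiver

variable {k : Type u} [CommRing k]

section barQuiver
variable {A : GQuiver k} {S : Set A.Ob} {X Y : A.Ob}

/-- inclusion of a summand of `sD(𝒞|S)` -/
def barInj (A : GQuiver k) (S : Set A.Ob) {X Y : A.Ob} (p : Chain Y X) (hp : p.Good S) :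
    A.tens p →ₗ[k] (A.barQuiver S).hom X Y :=
  DirectSum.lof k {p : Chain Y X // p.Good S} (fun p => A.tens p.1) ⟨p, hp⟩

theorem bar_induction {motive : (A.barQuiver S).hom X Y → Prop} (zero : motive 0)
    (add : ∀ a b, motive a → motive b → motive (a + b))
    (inj : ∀ p hp t, motive (barInj A S p hp t)) (v : (A.barQuiver S).hom X Y) : motive v :=
  DirectSum.induction_on v zero (fun p t => inj p.1 p.2 t) add

@[simp] theorem toT_barInj (p : Chain Y X) (hp : p.Good S) (t : A.tens p) :
    toT A S X Y (barInj A S p hp t) = A.inj p t :=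
  DirectSum.toModule_lof (N := A.T X Y) k (ι := {p : Chain Y X // p.Good S})
    (M := fun p => A.tens p.1) (φ := fun p => A.inj p.1) ⟨p, hp⟩ t

theorem ofT_inj (p : Chain Y X) (hp : p.Good S) (t : A.tens p) :
    ofT A S X Y (A.inj p t) = barInj A S p hp t := by
  rw [ofT, lift_inj, dif_pos hp]
  rfl

theorem ofT_inj_of_not (p : Chain Y X) (hp : ¬ p.Good S) (t : A.tens p) :
    ofT A S X Y (A.inj p t) = 0 := by
  rw [ofT, lift_inj, dif_neg hp]
  rfl

@[simp] theorem ofT_toT (v : (A.barQuiver S).hom X Y) : ofT A S X Y (toT A S X Y v) = v := by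
  induction v using bar_induction with
  | zero => simp
  | add a b ha hb => rw [map_add, map_add, ha, hb]
  | inj p hp t => rw [toT_barInj, ofT_inj p hp]

theorem toT_injective : Function.Injective (toT A S X Y) :=
  Function.LeftInverse.injective ofT_toT

@[simp] theorem ofT_one (X : A.Ob) : ofT A S X X (A.one X) = 0 :=
  ofT_inj_of_not _ (by simp [Chain.Good]) _

theorem good_univ_cons {S : Type u} {Y : S} : ∀ {Z : S} (X : S) (p : Chain Y Z), (Chain.cons X p).Good Set.univ
  | _, _, .nil => trivial
  | _, _, .cons Z p => ⟨trivial, good_univ_cons Z p⟩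

theorem epsI_inj_cons {Z : A.Ob} (p : Chain Y Z) (t : A.tens (Chain.cons X p)) :
    epsI A X Y (A.inj _ t) = 0 := by
  obtain ⟨t, rfl⟩ := (A.tensCons X p).surjective t
  induction t using TensorProduct.induction_on with
  | zero => simp
  | tmul v t => rw [← cons_inj, epsI_cons]
  | add a b ha hb => rw [map_add, map_add, map_add, ha, hb, add_zero]

@[simp] theorem epsI_toT (v : (A.barQuiver S).hom X Y) : epsI A X Y (toT A S X Y v) = 0 := by
  induction v using bar_induction with
  | zero => simp
  | add a b ha hb => rw [map_add, map_add, ha, hb, add_zero]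
  | inj p hp t =>
    rw [toT_barInj]
    cases p with
    | nil => exact hp.elim
    | cons X p => exact epsI_inj_cons p t

@[simp] theorem toT_ofT_cons (X Z Y : A.Ob) (v : A.hom X Z) (w : A.T Z Y) :
    toT A Set.univ X Y (ofT A Set.univ X Y (A.cons X Z Y v w)) = A.cons X Z Y v w := by
  induction w using inj_induction with
  | zero => simp
  | add a b ha hb => simp only [map_add, ha, hb]
  | inj p t => rw [cons_inj, ofT_inj _ (good_univ_cons X p), toT_barInj]

theorem toT_ofT (t : A.T X Y) : toT A Set.univ X Y (ofT A Set.univ X Y t) = t - epsI A X Y t := by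
  refine induction_on (motive := fun X t =>
    toT A Set.univ X Y (ofT A Set.univ X Y t) = t - epsI A X Y t) ?_ ?_ ?_ ?_ t
  · simp
  · intro X a b ha hb
    simp only [map_add, ha, hb]; abel
  · intro c; rw [map_smul, map_smul, map_smul, ofT_one, epsI_one, map_zero, smul_zero, sub_self]
  · intro X Z v w _; rw [toT_ofT_cons, epsI_cons, sub_zero]

theorem toT_ofT_of_eps {t : A.T X Y} (h : epsI A X Y t = 0) :
    toT A Set.univ X Y (ofT A Set.univ X Y t) = t := by
  rw [toT_ofT, h, sub_zero]

theorem toT_incl (v : (A.barQuiver S).hom X Y) :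
    toT A Set.univ X Y (incl A S X Y v) = toT A S X Y v :=
  toT_ofT_of_eps (epsI_toT v)

theorem incl_injective : Function.Injective (incl A S X Y) := fun v v' h =>
  toT_injective (by rw [← toT_incl, h, toT_incl])

theorem incl_ofT_of_mem {v : (plus A).hom X Y} (h : toT A Set.univ X Y v ∈ LinearMap.range (toT A S X Y)) :
    incl A S X Y (ofT A S X Y (toT A Set.univ X Y v)) = v := by
  obtain ⟨y, hy⟩ := h
  apply toT_injective
  rw [toT_incl, ← hy, ofT_toT]

theorem toT_mem {v : (A.barQuiver S).hom X Y} {i : ℤ} (hv : v ∈ (A.barQuiver S).gr X Y i) :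
    toT A S X Y v ∈ A.Tgr X Y i := by
  have : (A.barQuiver S).gr X Y i ≤ (A.Tgr X Y i).comap (toT A S X Y) := by
    refine iSup_le fun p => ?_
    rintro _ ⟨t, ht, rfl⟩
    exact Submodule.mem_iSup_of_mem p.1 ⟨t, ht, (toT_barInj p.1 p.2 t).symm⟩
  exact this hv

theorem ofT_mem {t : A.T X Y} {i : ℤ} (ht : t ∈ A.Tgr X Y i) :
    ofT A S X Y t ∈ (A.barQuiver S).gr X Y i := by
  have : A.Tgr X Y i ≤ ((A.barQuiver S).gr X Y i).comap (ofT A S X Y) := by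
    refine iSup_le fun p => ?_
    rintro _ ⟨t, ht, rfl⟩
    rw [Submodule.mem_comap]
    by_cases hp : p.Good S
    · rw [ofT_inj p hp]
      exact Submodule.mem_iSup_of_mem ⟨p, hp⟩ ⟨t, ht, rfl⟩
    · rw [ofT_inj_of_not p hp]
      exact zero_mem _
  exact this ht

theorem gr_hom_ext {Q : GQuiver k} {X Y : Q.Ob} {M : Type u} [AddCommGroup M] [Module k M]
    {φ ψ : Q.hom X Y →ₗ[k] M} (h : ∀ e, ∀ v ∈ Q.gr X Y e, φ v = ψ v) : φ = ψ := by
  have h1 := ((isInternal_iff_delta _).mp (Q.isInternal X Y)).2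
  have h2 : (⨆ e, Q.gr X Y e) ≤ LinearMap.eqLocus φ ψ := iSup_le fun e v hv => h e v hv
  ext v
  exact h2 (h1 (Submodule.mem_top (x := v)))

theorem toT_sgnHom (d : ℤ) (v : (A.barQuiver S).hom X Y) :
    toT A S X Y ((A.barQuiver S).sgnHom d X Y v) = A.sgn d X Y (toT A S X Y v) := by
  have : toT A S X Y ∘ₗ (A.barQuiver S).sgnHom d X Y = A.sgn d X Y ∘ₗ toT A S X Y :=
    gr_hom_ext fun e v hv => by
      rw [LinearMap.comp_apply, LinearMap.comp_apply, sgnHom_of_mem _ hv, map_zsmul,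
        sgn_of_mem d (toT_mem hv)]
  exact LinearMap.congr_fun this v

end barQuiver

section concat
variable {A : GQuiver k} {X Y Z : A.Ob}

@[simp] theorem concat_one (Z Y : A.Ob) (b : A.T Z Y) : concat A Z Z Y (A.one Z) b = b := by
  simp [concat]

@[simp] theorem concat_cons (X W Z Y : A.Ob) (v : A.hom X W) (a : A.T W Z) (b : A.T Z Y) :
    concat A X Z Y (A.cons X W Z v a) b = A.cons X W Y v (concat A W Z Y a b) := by
  simp [concat]

@[simp] theorem concat_one_right (a : A.T X Y) : concat A X Y Y a (A.one Y) = a := by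
  refine induction_on (motive := fun X a => concat A X Y Y a (A.one Y) = a) ?_ ?_ ?_ ?_ a
  · simp
  · intro X a b ha hb; simp [ha, hb]
  · intro c; simp
  · intro X Z v w ih; simp [ih]

theorem concat_assoc {W : A.Ob} (a : A.T X Z) (b : A.T Z W) (c : A.T W Y) :
    concat A X W Y (concat A X Z W a b) c = concat A X Z Y a (concat A Z W Y b c) := by
  refine induction_on (motive := fun X a =>
    concat A X W Y (concat A X Z W a b) c = concat A X Z Y a (concat A Z W Y b c)) ?_ ?_ ?_ ?_ a
  · simp
  · intro X a b ha hb; simp [ha, hb]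
  · intro c; simp
  · intro X Z v w ih; simp [ih]

theorem concat_mem {a : A.T X Z} {b : A.T Z Y} {i j : ℤ} (ha : a ∈ A.Tgr X Z i) (hb : b ∈ A.Tgr Z Y j) :
    concat A X Z Y a b ∈ A.Tgr X Y (i + j) := by
  refine Tgr_le (fun X i => (A.Tgr X Y (i + j)).comap ((concat A X Z Y).flip b)) ?_ ?_ X i ha
  · simpa using hb
  · intro X W i' j' v hv w hw
    simp only [Submodule.mem_comap, LinearMap.flip_apply, concat_cons] at hw ⊢
    have := cons_mem hv hw
    rwa [← add_assoc] at this

theorem sgn_concat (d : ℤ) (a : A.T X Z) (b : A.T Z Y) :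
    A.sgn d X Y (concat A X Z Y a b) = concat A X Z Y (A.sgn d X Z a) (A.sgn d Z Y b) := by
  refine induction_on (motive := fun X a =>
    A.sgn d X Y (concat A X Z Y a b) = concat A X Z Y (A.sgn d X Z a) (A.sgn d Z Y b)) ?_ ?_ ?_ ?_ a
  · simp
  · intro X a b ha hb; simp [ha, hb]
  · intro c; simp
  · intro X Z v w ih; simp [ih]

@[simp] theorem mulAll_one (Y : A.Ob) : mulAll A Y Y ((plus A).one Y) = A.one Y := by
  simp [mulAll]

@[simp] theorem mulAll_cons (X Z Y : A.Ob) (v : (plus A).hom X Z) (w : (plus A).T Z Y) :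
    mulAll A X Y ((plus A).cons X Z Y v w) = concat A X Z Y (toT A Set.univ X Z v) (mulAll A Z Y w) :=
  fold_cons (Q := plus A) (M := fun X => A.T X Y) _ _ _ _ _ _

theorem mulAll_mem {w : (plus A).T X Y} {i : ℤ} (hw : w ∈ (plus A).Tgr X Y i) :
    mulAll A X Y w ∈ A.Tgr X Y i := by
  refine Tgr_le (A := plus A) (fun X i => (A.Tgr X Y i).comap (mulAll A X Y)) ?_ ?_ X i hw
  · simpa using one_mem Y
  · intro X Z i j v hv w hw
    rw [Submodule.mem_comap] at hw ⊢
    rw [mulAll_cons]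
    exact concat_mem (toT_mem hv) hw

theorem mulAll_sgn (d : ℤ) (w : (plus A).T X Y) :
    mulAll A X Y ((plus A).sgn d X Y w) = A.sgn d X Y (mulAll A X Y w) := by
  refine induction_on (Q := plus A) (motive := fun X w =>
    mulAll A X Y ((plus A).sgn d X Y w) = A.sgn d X Y (mulAll A X Y w)) ?_ ?_ ?_ ?_ w
  · simp
  · intro X a b ha hb; simp [ha, hb]
  · intro c; simp
  · intro X Z v w ih
    rw [sgn_cons, mulAll_cons, mulAll_cons, sgn_concat, ih, toT_sgnHom]

@[simp] theorem lenSgn_one (Y : A.Ob) : lenSgn A Y Y (A.one Y) = A.one Y := by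
  simp [lenSgn]

@[simp] theorem lenSgn_cons (X Z Y : A.Ob) (v : A.hom X Z) (w : A.T Z Y) :
    lenSgn A X Y (A.cons X Z Y v w) = - A.cons X Z Y v (lenSgn A Z Y w) := by
  simp [lenSgn]

theorem lenSgn_mem {w : A.T X Y} {i : ℤ} (hw : w ∈ A.Tgr X Y i) : lenSgn A X Y w ∈ A.Tgr X Y i := by
  refine Tgr_le (fun X i => (A.Tgr X Y i).comap (lenSgn A X Y)) ?_ ?_ X i hw
  · simpa using one_mem Y
  · intro X Z i j v hv w hw
    simp only [Submodule.mem_comap, lenSgn_cons] at hw ⊢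
    exact neg_mem (cons_mem hv hw)

/-- the product with signs `(-1)ⁿ` on `Tⁿ(T⁺A)`; minus its part in `T⁺A` consists of the components of `𝐦⁻¹` -/
def altMul (A : GQuiver k) (X Y : A.Ob) : (plus A).T X Y →ₗ[k] A.T X Y :=
  mulAll A X Y ∘ₗ lenSgn (plus A) X Y

@[simp] theorem altMul_one (Y : A.Ob) : altMul A Y Y ((plus A).one Y) = A.one Y := by
  simp [altMul]

@[simp] theorem altMul_cons (X Z Y : A.Ob) (v : (plus A).hom X Z) (w : (plus A).T Z Y) :
    altMul A X Y ((plus A).cons X Z Y v w) = - concat A X Z Y (toT A Set.univ X Z v) (altMul A Z Y w) := by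
  rw [altMul, LinearMap.comp_apply, lenSgn_cons, map_neg, mulAll_cons]
  rfl

theorem mInv_apply (w : (plus A).T X Y) : mInv A X Y w = - ofT A Set.univ X Y (altMul A X Y w) := rfl

theorem mFun_apply (w : (plus A).T X Y) : (mFun A).comp X Y w = ofT A Set.univ X Y (mulAll A X Y w) := rfl

@[simp] theorem epsI_concat_toT {S : Set A.Ob} (v : (A.barQuiver S).hom X Z) (b : A.T Z Y) :
    epsI A X Y (concat A X Z Y (toT A S X Z v) b) = 0 := by
  have key : ∀ a : A.T X Z, epsI A X Y (concat A X Z Y (a - epsI A X Z a) b) = 0 := by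
    intro a
    refine induction_on (motive := fun X a =>
      epsI A X Y (concat A X Z Y (a - epsI A X Z a) b) = 0) ?_ ?_ ?_ ?_ a
    · simp
    · intro X a b ha hb
      rw [map_add, add_sub_add_comm, map_add, LinearMap.add_apply, map_add, ha, hb, add_zero]
    · intro c; simp
    · intros; simp
  have := key (toT A S X Z v)
  rwa [epsI_toT, sub_zero] at this

end concat

/-- families of maps `TP(X,Y) → TB(X o, Y o')` -/
abbrev HomFam (P B : GQuiver k) (o o' : P.Ob → B.Ob) : Type u :=
  ∀ X Y, P.T X Y →ₗ[k] B.T (o X) (o' Y)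

section
variable {P B : GQuiver k} {o o' o'' o''' : P.Ob → B.Ob}

theorem elim₂_zero {X Y : P.Ob} {M : Type u} [AddCommGroup M] [Module k M] (t : P.T2 X Y) :
    elim₂ (fun Z => (0 : P.T X Z →ₗ[k] P.T Z Y →ₗ[k] M)) t = 0 := by
  induction t using induction₂ with
  | zero => rw [map_zero]
  | add a b ha hb => rw [map_add, ha, hb, add_zero]
  | tmul Z a b => rw [elim₂_tmul₂]; rfl

theorem elim₂_smul {X Y : P.Ob} {M : Type u} [AddCommGroup M] [Module k M] (c : k)
    (β : ∀ Z, P.T X Z →ₗ[k] P.T Z Y →ₗ[k] M) (t : P.T2 X Y) :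
    elim₂ (fun Z => c • β Z) t = c • elim₂ β t := by
  induction t using induction₂ with
  | zero => simp
  | add a b ha hb => simp only [map_add, ha, hb, smul_add]
  | tmul Z a b => simp

theorem elim₂_congr {X Y : P.Ob} {M : Type u} [AddCommGroup M] [Module k M]
    {β γ : ∀ Z, P.T X Z →ₗ[k] P.T Z Y →ₗ[k] M} (h : ∀ Z a b, β Z a b = γ Z a b) (t : P.T2 X Y) :
    elim₂ β t = elim₂ γ t := by
  congr 2
  funext Z
  ext a b
  exact h Z a b

/-- product of two families along a linear family of elements of `TP ⊗ TP` -/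
def mulAlong (D : ∀ X Y, P.T X Y →ₗ[k] P.T2 X Y) :
    HomFam P B o o' →ₗ[k] HomFam P B o' o'' →ₗ[k] HomFam P B o o'' :=
  LinearMap.mk₂ k (fun φ ψ X Y =>
      elim₂ (fun Z => (concat B (o X) (o' Z) (o'' Y)).compl₁₂ (φ X Z) (ψ Z Y)) ∘ₗ D X Y)
    (fun φ φ' ψ => by
      funext X Y; ext w
      simp only [Pi.add_apply, LinearMap.add_apply, LinearMap.comp_apply, ← elim₂_add]
      exact elim₂_congr (fun Z a b => by simp) _)
    (fun c φ ψ => by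
      funext X Y; ext w
      simp only [Pi.smul_apply, LinearMap.smul_apply, LinearMap.comp_apply, ← elim₂_smul]
      exact elim₂_congr (fun Z a b => by simp) _)
    (fun φ ψ ψ' => by
      funext X Y; ext w
      simp only [Pi.add_apply, LinearMap.add_apply, LinearMap.comp_apply, ← elim₂_add]
      exact elim₂_congr (fun Z a b => by simp) _)
    (fun c φ ψ => by
      funext X Y; ext w
      simp only [Pi.smul_apply, LinearMap.smul_apply, LinearMap.comp_apply, ← elim₂_smul]
      exact elim₂_congr (fun Z a b => by simp) _)

theorem mulAlong_apply (D : ∀ X Y, P.T X Y →ₗ[k] P.T2 X Y) (φ : HomFam P B o o') (ψ : HomFam P B o' o'')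
    (X Y : P.Ob) (w : P.T X Y) : mulAlong D φ ψ X Y w =
      elim₂ (fun Z => (concat B (o X) (o' Z) (o'' Y)).compl₁₂ (φ X Z) (ψ Z Y)) (D X Y w) := rfl

/-- convolution product, `w ↦ ∑ φ w₁ · ψ w₂` -/
def convMul : HomFam P B o o' →ₗ[k] HomFam P B o' o'' →ₗ[k] HomFam P B o o'' := mulAlong P.cut

infixl:70 " ⍟ " => convMul

theorem convMul_apply (φ : HomFam P B o o') (ψ : HomFam P B o' o'') (X Y : P.Ob) (w : P.T X Y) :
    (φ ⍟ ψ) X Y w = elim₂ (fun Z => (concat B (o X) (o' Z) (o'' Y)).compl₁₂ (φ X Z) (ψ Z Y)) (P.cut X Y w) := rfl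

/-- left multiplication by a family of elements of `TB` -/
def lactMul (c : ∀ X, B.T (o X) (o' X)) : HomFam P B o' o'' →ₗ[k] HomFam P B o o'' where
  toFun ψ X Y := concat B (o X) (o' X) (o'' Y) (c X) ∘ₗ ψ X Y
  map_add' ψ ψ' := by funext X Y; ext w; simp
  map_smul' c ψ := by funext X Y; ext w; simp

/-- the values on `1 ∈ T⁰` -/
def atOne (φ : HomFam P B o o') (X : P.Ob) : B.T (o X) (o' X) := φ X X (P.one X)

theorem convMul_one (φ : HomFam P B o o') (ψ : HomFam P B o' o'') (X : P.Ob) :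
    (φ ⍟ ψ) X X (P.one X) = concat B (o X) (o' X) (o'' X) (φ X X (P.one X)) (ψ X X (P.one X)) := by
  rw [convMul_apply, cut_one, elim₂_tmul₂]; rfl

theorem convMul_cons (φ : HomFam P B o o') (ψ : HomFam P B o' o'') (X Z Y : P.Ob) (v : P.hom X Z) (w : P.T Z Y) :
    (φ ⍟ ψ) X Y (P.cons X Z Y v w) = concat B (o X) (o' X) (o'' Y) (φ X X (P.one X)) (ψ X Y (P.cons X Z Y v w)) +
      elim₂ (fun W => (concat B (o X) (o' W) (o'' Y)).compl₁₂ (φ X W ∘ₗ P.cons X Z W v) (ψ W Y)) (P.cut Z Y w) := by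
  rw [convMul_apply, cut_sum_cons]; rfl

/-- the unit of the convolution product -/
def epsFam (o : P.Ob → B.Ob) : HomFam P B o o := fun _ _ => eps o _

@[simp] theorem epsFam_one (o : P.Ob → B.Ob) (Y : P.Ob) : epsFam o Y Y (P.one Y) = B.one (o Y) := eps_one o Y

@[simp] theorem epsFam_cons (o : P.Ob → B.Ob) (X Z Y : P.Ob) (v : P.hom X Z) (w : P.T Z Y) :
    epsFam (B := B) o X Y (P.cons X Z Y v w) = 0 := eps_cons o X Z Y v w

theorem homFam_ext {φ ψ : HomFam P B o o'} (h1 : ∀ Y, φ Y Y (P.one Y) = ψ Y Y (P.one Y))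
    (h2 : ∀ X Z Y v w, φ Z Y w = ψ Z Y w → φ X Y (P.cons X Z Y v w) = ψ X Y (P.cons X Z Y v w)) : φ = ψ := by
  funext X Y
  exact ext_on (M := fun X => B.T (o X) (o' Y)) (U := fun X => φ X Y) (V := fun X => ψ X Y) (h1 Y)
    (fun X Z v w => h2 X Z Y v w) X

@[simp] theorem epsFam_mul (φ : HomFam P B o o') : epsFam o ⍟ φ = φ := by
  funext X Y; ext w
  rw [convMul_apply, counit_left]
  · simp
  · intros; simp

@[simp] theorem mul_epsFam (φ : HomFam P B o o') : φ ⍟ epsFam o' = φ := by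
  funext X Y; ext w
  rw [convMul_apply, counit_right]
  · simp
  · intros; simp

/-- the trilinear map underlying a triple product -/
def triple (φ : HomFam P B o o') (ψ : HomFam P B o' o'') (χ : HomFam P B o'' o''') (X Y V W : P.Ob) :
    P.T X V →ₗ[k] P.T V W →ₗ[k] P.T W Y →ₗ[k] B.T (o X) (o''' Y) :=
  ((concat B (o X) (o' V) (o'' W)).compl₁₂ (φ X V) (ψ V W)).compr₂ ((concat B (o X) (o'' W) (o''' Y)).compl₂ (χ W Y))

theorem triple_apply (φ : HomFam P B o o') (ψ : HomFam P B o' o'') (χ : HomFam P B o'' o''') (X Y V W : P.Ob)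
    (a : P.T X V) (b : P.T V W) (c : P.T W Y) : triple φ ψ χ X Y V W a b c =
      concat B _ _ _ (concat B _ _ _ (φ X V a) (ψ V W b)) (χ W Y c) := rfl

theorem concat_mulAlong (D : ∀ X Y, P.T X Y →ₗ[k] P.T2 X Y) (φ : HomFam P B o o') (ψ : HomFam P B o' o'')
    (χ : HomFam P B o'' o''') (X Y V : P.Ob) (a : P.T X V) (b : P.T V Y) :
    concat B _ _ _ (φ X V a) (mulAlong D ψ χ V Y b) = elim₂ (fun W => triple φ ψ χ X Y V W a) (D V Y b) := by
  rw [mulAlong_apply, map_elim₂]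
  exact elim₂_congr (fun W b c => by simp [triple_apply, concat_assoc]) _

theorem mulAlong_concat (D : ∀ X Y, P.T X Y →ₗ[k] P.T2 X Y) (φ : HomFam P B o o') (ψ : HomFam P B o' o'')
    (χ : HomFam P B o'' o''') (X Y W : P.Ob) (a : P.T X W) (c : P.T W Y) :
    concat B _ _ _ (mulAlong D φ ψ X W a) (χ W Y c) = elim₂ (fun V => triple φ ψ χ X Y V W) (D X W a) c := by
  rw [mulAlong_apply]
  generalize D X W a = t
  induction t using induction₂ with
  | zero => simp
  | add a b ha hb => simp only [map_add, LinearMap.add_apply, ha, hb]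
  | tmul V a b => simp [triple_apply]

theorem convMul_assoc (φ : HomFam P B o o') (ψ : HomFam P B o' o'') (χ : HomFam P B o'' o''') :
    φ ⍟ ψ ⍟ χ = φ ⍟ (ψ ⍟ χ) := by
  funext X Y; ext w
  refine ((coassoc (triple φ ψ χ X Y) (fun V => (concat B _ _ _).compl₁₂ (φ X V) ((ψ ⍟ χ) V Y)) ?_ w).trans ?_).symm
  · intro V a b
    exact concat_mulAlong P.cut φ ψ χ X Y V a b
  · rw [convMul_apply]
    exact elim₂_congr (fun W a c => (mulAlong_concat P.cut φ ψ χ X Y W a c).symm) _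

/-- precomposition with the sign `w ↦ (-1)^{d |w|} w` -/
def sgnFam (d : ℤ) : HomFam P B o o' →ₗ[k] HomFam P B o o' where
  toFun φ X Y := φ X Y ∘ₗ P.sgn d X Y
  map_add' φ φ' := by funext X Y; ext w; simp
  map_smul' c φ := by funext X Y; ext w; simp

theorem sgnFam_apply (d : ℤ) (φ : HomFam P B o o') (X Y : P.Ob) (w : P.T X Y) :
    sgnFam d φ X Y w = φ X Y (P.sgn d X Y w) := rfl

theorem sgnFam_mul (d : ℤ) (φ : HomFam P B o o') (ψ : HomFam P B o' o'') :
    sgnFam d (φ ⍟ ψ) = sgnFam d φ ⍟ sgnFam d ψ := by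
  funext X Y; ext w
  rw [sgnFam_apply, convMul_apply, elim₂_cut_sgn]
  rfl

@[simp] theorem sgnFam_eps (d : ℤ) : sgnFam d (epsFam (B := B) (P := P) o) = epsFam o := by
  funext X Y; ext w
  exact eps_sgn o w

theorem sgnFam_sgnFam (d e : ℤ) (φ : HomFam P B o o') : sgnFam d (sgnFam e φ) = sgnFam (e + d) φ := by
  funext X Y; ext w
  rw [sgnFam_apply, sgnFam_apply, sgnFam_apply, sgn_sgn]

/-- components regarded as maps into `T¹B` -/
def single (r : Fam P B o o') : HomFam P B o o' := fun X Y => (B.cons _ _ _).flip (B.one _) ∘ₗ r X Y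

theorem single_apply (r : Fam P B o o') (X Y : P.Ob) (w : P.T X Y) :
    single r X Y w = B.cons _ _ _ (r X Y w) (B.one _) := rfl

theorem tconv_eq (r : Fam P B o o') (φ : HomFam P B o' o'') (X Y : P.Ob) :
    tconv (r X) (fun Z => φ Z Y) = (single r ⍟ φ) X Y := by
  ext w
  rw [convMul_apply]
  exact elim₂_congr (fun W a b => by simp [single_apply, consL]) _

theorem hat_eq_mul {f : FunData P B} (hf : f.Unital0) :
    (hat f : HomFam P B _ _) = epsFam f.obj + single f.comp ⍟ hat f := by
  funext X Y
  rw [hat_eq hf]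
  exact congrArg _ (tconv_eq f.comp (hat f) X Y)

theorem coder_eq_mul {f g : FunData P B} (hf : f.Unital0) (d : ℤ) (r : Fam P B f.obj g.obj) :
    (coder f g d r : HomFam P B _ _) = single r ⍟ sgnFam d (hat g) + single f.comp ⍟ coder f g d r := by
  funext X Y
  refine (lead_eq hf r d _ X).trans ?_
  exact congrArg₂ _ (tconv_eq r (sgnFam d (hat g)) X Y) (tconv_eq f.comp (coder f g d r) X Y)

theorem theta_eq_mul {f g h : FunData P B} (hf : f.Unital0) (d e : ℤ) (r : Fam P B f.obj g.obj)
    (p : Fam P B g.obj h.obj) :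
    (theta f g h d e r p : HomFam P B _ _) =
      single r ⍟ sgnFam d (coder g h e p) + single f.comp ⍟ theta f g h d e r p := by
  funext X Y
  refine (lead_eq hf r d _ X).trans ?_
  exact congrArg₂ _ (tconv_eq r (sgnFam d (coder g h e p)) X Y) (tconv_eq f.comp (theta f g h d e r p) X Y)

theorem hat_one {f : FunData P B} (hf : f.Unital0) (X : P.Ob) : hat f X X (P.one X) = B.one (f.obj X) := by
  rw [hat_eq_mul hf, Pi.add_apply, Pi.add_apply, LinearMap.add_apply, convMul_one, single_apply, hf X]
  simp

theorem coder_one {f g : FunData P B} (hf : f.Unital0) (hg : g.Unital0) (d : ℤ) (r : Fam P B f.obj g.obj)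
    (X : P.Ob) : coder f g d r X X (P.one X) = B.cons _ _ _ (r X X (P.one X)) (B.one _) := by
  rw [coder_eq_mul hf, Pi.add_apply, Pi.add_apply, LinearMap.add_apply, convMul_one, convMul_one,
    single_apply, single_apply, hf X, sgnFam_apply, sgn_one, hat_one hg]
  simp

theorem theta_one {f g h : FunData P B} (hf : f.Unital0) (hg : g.Unital0) (hh : h.Unital0) (d e : ℤ)
    (r : Fam P B f.obj g.obj) (p : Fam P B g.obj h.obj) (X : P.Ob) : theta f g h d e r p X X (P.one X) =
      B.cons _ _ _ (r X X (P.one X)) (B.cons _ _ _ (p X X (P.one X)) (B.one _)) := by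
  rw [theta_eq_mul hf, Pi.add_apply, Pi.add_apply, LinearMap.add_apply, convMul_one, convMul_one,
    single_apply, single_apply, hf X, sgnFam_apply, sgn_one, coder_one hg hh]
  simp

end

section generic
variable {A B C : GQuiver k} {f g h : FunData A B} {d e : ℤ} {r : Fam A B f.obj g.obj}
  {p : Fam A B g.obj h.obj}

theorem theta_unique {Θ : ∀ X Y, A.T X Y →ₗ[k] B.T (f.obj X) (h.obj Y)} (hf : f.Unital0) (hg : g.Unital0)
    (hh : h.Unital0) (h1 : ∀ X Y w, B.proj _ _ (Θ X Y w) = 0)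
    (h2 : ∀ X Y w, B.cut _ _ (Θ X Y w) = dconv (fun Z => hat f X Z) (fun Z => Θ Z Y) w +
      dconv (fun Z => coder f g d r X Z) (fun Z => coder g h e p Z Y ∘ₗ A.sgn d Z Y) w +
      dconv (fun Z => Θ X Z) (fun Z => hat h Z Y ∘ₗ A.sgn (d + e) Z Y) w)
    (h3 : ∀ X Y w, epsI B _ _ (Θ X Y w) = 0) (X Y : A.Ob) (w : A.T X Y) :
    Θ X Y w = theta f g h d e r p X Y w := by
  have key : ∀ X Y w, (Θ - theta f g h d e r p : ∀ X Y, _) X Y w =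
      coder f h (d + e) (0 : Fam A B f.obj h.obj) X Y w := by
    intro X Y w
    refine coder_unique (R := Θ - theta f g h d e r p) hf ?_ ?_ ?_ X Y w
    · intro X Y w
      rw [Pi.sub_apply, Pi.sub_apply, LinearMap.sub_apply, map_sub, h1, proj_theta hf hg]
      simp
    · intro X Y w
      rw [Pi.sub_apply, Pi.sub_apply, LinearMap.sub_apply, map_sub, h2, cut_theta hf hg hh]
      have e1 := dconv_sub_right (fun Z => hat f X Z) (fun Z => Θ Z Y) (fun Z => theta f g h d e r p Z Y) w
      have e2 := dconv_sub_left (fun Z => Θ X Z) (fun Z => theta f g h d e r p X Z)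
        (fun Z => hat h Z Y ∘ₗ A.sgn (d + e) Z Y) w
      refine Eq.trans ?_ (congrArg₂ _ e1.symm e2.symm)
      abel
    · intro X Y w
      rw [Pi.sub_apply, Pi.sub_apply, LinearMap.sub_apply, map_sub, h3, theta, eps_lead hf, sub_zero]
  have h0 : coder f h (d + e) (0 : Fam A B f.obj h.obj) X Y w = 0 := by
    have := lead_smul_left (y := h.obj Y) hf (0 : k) (0 : Fam A B f.obj h.obj) (d + e) (fun Z => hat h Z Y) X
    rw [zero_smul, zero_smul] at this
    exact LinearMap.congr_fun this w
  rw [← sub_eq_zero, ← h0]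
  exact key X Y w

/-- applying a cocategory homomorphism to `(r ⊗ p)θ` -/
theorem coder_hat_theta (hf : f.Unital0) (hg : g.Unital0) (hh : h.Unital0) {n : FunData B C} (hn : n.Unital0)
    (X Y : A.Ob) (w : A.T X Y) :
    coder (f.andThen n) (h.andThen n) (d + e) (fun X Y => n.comp _ _ ∘ₗ theta f g h d e r p X Y) X Y w =
      hat n _ _ (theta f g h d e r p X Y w) -
      theta (f.andThen n) (g.andThen n) (h.andThen n) d e (fun X Y => n.comp _ _ ∘ₗ coder f g d r X Y)
        (fun X Y => n.comp _ _ ∘ₗ coder g h e p X Y) X Y w := by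
  have cf := comp_unital hf hn
  have cg := comp_unital hg hn
  have ch := comp_unital hh hn
  rw [eq_sub_iff_add_eq, add_comm, ← eq_sub_iff_add_eq, eq_comm]
  refine theta_unique (f := f.andThen n) (g := g.andThen n) (h := h.andThen n)
    (Θ := fun X Y => hat n _ _ ∘ₗ theta f g h d e r p X Y -
      coder (f.andThen n) (h.andThen n) (d + e) (fun X Y => n.comp _ _ ∘ₗ theta f g h d e r p X Y) X Y)
    cf cg ch ?_ ?_ ?_ X Y w
  · intro X Y w
    simp only [LinearMap.sub_apply, LinearMap.comp_apply, map_sub]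
    rw [proj_hat hn, proj_coder cf ch]
    exact sub_self _
  · intro X Y w
    have h1 : ∀ {f : FunData A B} (_ : f.Unital0) X Y, hat (f.andThen n) X Y = hat n _ _ ∘ₗ hat f X Y :=
      fun hf X Y => LinearMap.ext (hat_comp hf hn)
    have h2 : ∀ {f g : FunData A B} (_ : f.Unital0) (_ : g.Unital0) (d : ℤ) (r : Fam A B f.obj g.obj) X Y,
        coder (f.andThen n) (g.andThen n) d (fun X Y => n.comp _ _ ∘ₗ coder f g d r X Y) X Y =
        hat n _ _ ∘ₗ coder f g d r X Y := fun hf hg d r X Y => LinearMap.ext (coder_whR hf hg hn)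
    have e1 : C.cut _ _ (hat n _ _ (theta f g h d e r p X Y w)) =
      dconv (fun Z => hat (f.andThen n) X Z) (fun Z => hat n _ _ ∘ₗ theta f g h d e r p Z Y) w +
      dconv (fun Z => coder (f.andThen n) (g.andThen n) d (fun X Y => n.comp _ _ ∘ₗ coder f g d r X Y) X Z)
        (fun Z => coder (g.andThen n) (h.andThen n) e (fun X Y => n.comp _ _ ∘ₗ coder g h e p X Y) Z Y ∘ₗ A.sgn d Z Y) w +
      dconv (fun Z => hat n _ _ ∘ₗ theta f g h d e r p X Z)
        (fun Z => hat (h.andThen n) Z Y ∘ₗ A.sgn (d + e) Z Y) w := by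
      rw [cut_hat hn, dconv_of_cut₃ (cut_theta hf hg hh w)]
      simp only [h1 hf, h1 hh, h2 hf hg, h2 hg hh]
      rfl
    rw [LinearMap.sub_apply, LinearMap.comp_apply, map_sub, e1, cut_coder cf ch]
    have e2 := dconv_sub_right (fun Z => hat (f.andThen n) X Z) (fun Z => hat n _ _ ∘ₗ theta f g h d e r p Z Y)
      (fun Z => coder (f.andThen n) (h.andThen n) (d + e) (fun X Y => n.comp _ _ ∘ₗ theta f g h d e r p X Y) Z Y) w
    have e3 := dconv_sub_left (fun Z => hat n _ _ ∘ₗ theta f g h d e r p X Z)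
      (fun Z => coder (f.andThen n) (h.andThen n) (d + e) (fun X Y => n.comp _ _ ∘ₗ theta f g h d e r p X Y) X Z)
      (fun Z => hat (h.andThen n) Z Y ∘ₗ A.sgn (d + e) Z Y) w
    refine Eq.trans ?_ (congrArg₂ (fun a b => a + _ + b) e2.symm e3.symm)
    abel
  · intro X Y w
    simp only [LinearMap.sub_apply, LinearMap.comp_apply, map_sub]
    rw [eps_hat hn, eps_epsI, theta, eps_lead hf, map_zero, zero_sub, neg_eq_zero]
    exact eps_lead cf _ _

/-- `(er ⊗ ep)θ = e (r ⊗ p)θ` -/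
theorem theta_whL {n : FunData C A} (hn : n.Unital0) (hn' : Homog 0 n.comp) (hf : f.Unital0) (hg : g.Unital0)
    (hh : h.Unital0) (X Y : C.Ob) (w : C.T X Y) :
    theta (n.andThen f) (n.andThen g) (n.andThen h) d e (fun X Y => r _ _ ∘ₗ hat n X Y)
      (fun X Y => p _ _ ∘ₗ hat n X Y) X Y w = theta f g h d e r p _ _ (hat n X Y w) := by
  symm
  refine theta_unique (f := n.andThen f) (g := n.andThen g) (h := n.andThen h)
    (Θ := fun X Y => theta f g h d e r p _ _ ∘ₗ hat n X Y) (comp_unital hn hf) (comp_unital hn hg)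
    (comp_unital hn hh) ?_ ?_ ?_ X Y w
  · intro X Y w
    exact proj_theta hf hg _
  · intro X Y w
    have h1 : ∀ {f : FunData A B} (_ : f.Unital0) X Y, hat (n.andThen f) X Y = hat f _ _ ∘ₗ hat n X Y :=
      fun hf X Y => LinearMap.ext (hat_comp hn hf)
    have h2 : ∀ {f g : FunData A B} (_ : f.Unital0) (_ : g.Unital0) (d : ℤ) (r : Fam A B f.obj g.obj) X Y,
        coder (n.andThen f) (n.andThen g) d (fun X Y => r _ _ ∘ₗ hat n X Y) X Y =
        coder f g d r _ _ ∘ₗ hat n X Y := fun hf hg d r X Y => LinearMap.ext (coder_whL hn hn' hf hg)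
    have hs : ∀ d Z, A.sgn d _ _ ∘ₗ hat n Z Y = hat n Z Y ∘ₗ C.sgn d Z Y := fun d Z =>
      LinearMap.ext fun w => sgn_hat hn' d w
    rw [LinearMap.comp_apply, cut_theta hf hg hh, dconv_of_cut₁ (cut_hat hn X w), dconv_of_cut₁ (cut_hat hn X w),
      dconv_of_cut₁ (cut_hat hn X w)]
    simp only [h1 hf, h1 hh, h2 hf hg, h2 hg hh, LinearMap.comp_assoc, hs]
  · intro X Y w
    exact eps_lead hf _ _

end generic

section inverse
variable {A : GQuiver k}

/-- `T(T⁺A) → TA`, the identity on `T¹`, zero elsewhere -/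
def projT (A : GQuiver k) : HomFam (plus A) A (fun X => X) (fun X => X) :=
  fun X Y => toT A Set.univ X Y ∘ₗ (plus A).proj X Y

theorem projT_one (Y : A.Ob) : projT A Y Y ((plus A).one Y) = 0 := by
  rw [projT, LinearMap.comp_apply, proj_one, map_zero]

theorem projT_cons (X Z Y : A.Ob) (v : (plus A).hom X Z) (w : (plus A).T Z Y) :
    projT A X Y ((plus A).cons X Z Y v w) =
      concat A X Z Y (toT A Set.univ X Z v) (epsFam (P := plus A) (B := A) (fun X => X) Z Y w) := by
  refine induction_on (Q := plus A) (motive := fun Z w => ∀ v, projT A X Y ((plus A).cons X Z Y v w) =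
      concat A X Z Y (toT A Set.univ X Z v) (epsFam (P := plus A) (B := A) (fun X => X) Z Y w)) ?_ ?_ ?_ ?_ w v
  · intro Z v; simp only [map_zero]
  · intro Z a b ha hb v; rw [map_add, map_add, map_add, map_add, ha, hb]
  · intro c v
    rw [map_smul, map_smul, map_smul, map_smul, epsFam_one, projT, LinearMap.comp_apply, proj_cons_one, concat_one_right]
  · intro Z W v' w _ v
    rw [epsFam_cons, map_zero, projT, LinearMap.comp_apply, proj_cons_cons, map_zero]

theorem convMul_cons_left {P B : GQuiver k} {o o' o'' : P.Ob → B.Ob} {φ χ : HomFam P B o o'}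
    (ψ : HomFam P B o' o'') {X Z : P.Ob} {v : P.hom X Z}
    {c : B.T (o X) (o Z)} (h : ∀ W a, φ X W (P.cons X Z W v a) = concat B (o X) (o Z) (o' W) c (χ Z W a))
    (Y : P.Ob) (w : P.T Z Y) :
    (φ ⍟ ψ) X Y (P.cons X Z Y v w) = concat B (o X) (o' X) (o'' Y) (φ X X (P.one X)) (ψ X Y (P.cons X Z Y v w)) +
      concat B (o X) (o Z) (o'' Y) c ((χ ⍟ ψ) Z Y w) := by
  rw [convMul_cons, convMul_apply, map_elim₂]
  congr 1
  exact elim₂_congr (fun W a b => by simp [h, concat_assoc]) _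

/-- the unit, as a map `T(T⁺A) → TA` -/
abbrev epsP (A : GQuiver k) : HomFam (plus A) A (fun X => X) (fun X => X) := epsFam (P := plus A) (B := A) (fun X => X)

/-- `mulAll` as a family -/
abbrev mulP (A : GQuiver k) : HomFam (plus A) A (fun X => X) (fun X => X) := mulAll A

/-- `altMul` as a family -/
abbrev altP (A : GQuiver k) : HomFam (plus A) A (fun X => X) (fun X => X) := altMul A

theorem sub_projT_mulAll : (epsP A - projT A) ⍟ mulP A = epsP A := by
  refine homFam_ext ?_ ?_
  · intro Y
    rw [convMul_one]
    simp only [Pi.sub_apply, LinearMap.sub_apply]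
    rw [projT_one, epsFam_one, sub_zero, mulAll_one, concat_one]
  · intro X Z Y v w _
    rw [convMul_cons_left (χ := epsP A) (c := - toT A Set.univ X Z v), epsFam_mul, epsFam_cons]
    · simp only [Pi.sub_apply, LinearMap.sub_apply]
      rw [projT_one, epsFam_one, sub_zero, mulAll_cons, concat_one, map_neg, LinearMap.neg_apply, add_neg_cancel]
    · intro W a
      simp only [Pi.sub_apply, LinearMap.sub_apply]
      rw [epsFam_cons, projT_cons, zero_sub, map_neg, LinearMap.neg_apply]

theorem add_projT_altMul : (epsP A + projT A) ⍟ altP A = epsP A := by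
  refine homFam_ext ?_ ?_
  · intro Y
    rw [convMul_one]
    simp only [Pi.add_apply, LinearMap.add_apply]
    rw [projT_one, epsFam_one, add_zero, altMul_one, concat_one]
  · intro X Z Y v w _
    rw [convMul_cons_left (χ := epsP A) (c := toT A Set.univ X Z v), epsFam_mul, epsFam_cons]
    · simp only [Pi.add_apply, LinearMap.add_apply]
      rw [projT_one, epsFam_one, add_zero, altMul_cons, concat_one, neg_add_cancel]
    · intro W a
      simp only [Pi.add_apply, LinearMap.add_apply]
      rw [epsFam_cons, projT_cons, zero_add]

/-- a multiplicative map precomposed with a cocategory homomorphism -/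
theorem fold_hat {P Q B : GQuiver k} {f : FunData P Q} (hf : f.Unital0) {q : Q.Ob → B.Ob} (M : HomFam Q B q q)
    (c : ∀ X Y, Q.hom X Y →ₗ[k] B.T (q X) (q Y)) (h1 : ∀ X, M X X (Q.one X) = B.one (q X))
    (h2 : ∀ X Z Y v w, M X Y (Q.cons X Z Y v w) = concat B _ _ _ (c X Z v) (M Z Y w)) :
    ((fun X Y => M _ _ ∘ₗ hat f X Y : HomFam P B (fun X => q (f.obj X)) (fun X => q (f.obj X)))) =
      epsFam (fun X => q (f.obj X)) + (fun X Y => c _ _ ∘ₗ f.comp X Y :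
        HomFam P B (fun X => q (f.obj X)) (fun X => q (f.obj X))) ⍟ (fun X Y => M _ _ ∘ₗ hat f X Y) := by
  funext X Y; ext w
  have h0 : ∀ w : P.T X Y, M _ _ (eps (B := Q) f.obj X w) = eps (B := B) (fun X => q (f.obj X)) X w := by
    intro w
    refine induction_on (motive := fun X w => M _ _ (eps (B := Q) f.obj X w) =
      eps (B := B) (fun X => q (f.obj X)) X w) ?_ ?_ ?_ ?_ w
    · simp
    · intro X a b ha hb; simp only [map_add, ha, hb]
    · intro a; simp [h1]
    · intros; simp
  conv_lhs => rw [LinearMap.comp_apply, hat_eq_mul hf, Pi.add_apply, Pi.add_apply, LinearMap.add_apply, map_add]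
  refine congrArg₂ _ (h0 w) ?_
  rw [convMul_apply, map_elim₂, convMul_apply]
  refine elim₂_congr (fun W a b => ?_) _
  simp only [LinearMap.compr₂_apply, LinearMap.compl₁₂_apply, single_apply, concat_cons, concat_one, h2,
    LinearMap.comp_apply]

/-- the functor with components of `𝐦⁻¹` -/
@[reducible] def nFun (A : GQuiver k) : FunData (plus A) (plus A) := ⟨fun X => X, mInv A⟩

theorem mFun_unital (A : GQuiver k) : (mFun A).Unital0 := fun X => by
  rw [mFun_apply, mulAll_one, ofT_one]; rfl

theorem nFun_unital (A : GQuiver k) : (nFun A).Unital0 := fun X => by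
  change mInv A X X ((plus A).one X) = 0
  rw [mInv_apply, altMul_one, ofT_one, neg_zero]

theorem epsI_mulAll {X Y : A.Ob} (w : (plus A).T X Y) :
    epsI A X Y (mulAll A X Y w) = eps (A := plus A) (B := A) (fun X => X) X w := by
  refine induction_on (Q := plus A) (motive := fun X w =>
    epsI A X Y (mulAll A X Y w) = eps (A := plus A) (B := A) (fun X => X) X w) ?_ ?_ ?_ ?_ w
  · simp only [map_zero, implies_true]
  · intro X a b ha hb; rw [map_add, map_add, map_add, ha, hb]
  · intro c; rw [map_smul, map_smul, map_smul, mulAll_one, epsI_one, eps_one]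
  · intro X Z v w _; rw [mulAll_cons, epsI_concat_toT, eps_cons]

theorem epsI_altMul {X Y : A.Ob} (w : (plus A).T X Y) :
    epsI A X Y (altMul A X Y w) = eps (A := plus A) (B := A) (fun X => X) X w := by
  refine induction_on (Q := plus A) (motive := fun X w =>
    epsI A X Y (altMul A X Y w) = eps (A := plus A) (B := A) (fun X => X) X w) ?_ ?_ ?_ ?_ w
  · simp only [map_zero, implies_true]
  · intro X a b ha hb; rw [map_add, map_add, map_add, ha, hb]
  · intro c; rw [map_smul, map_smul, map_smul, altMul_one, epsI_one, eps_one]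
  · intro X Z v w _; rw [altMul_cons, map_neg, epsI_concat_toT, eps_cons, neg_zero]

theorem toT_mInv {X Y : A.Ob} (w : (plus A).T X Y) : toT A Set.univ X Y (mInv A X Y w) =
    (epsP A - altP A) X Y w := by
  rw [mInv_apply, map_neg, toT_ofT, epsI_altMul, neg_sub]; rfl

theorem toT_mFun {X Y : A.Ob} (w : (plus A).T X Y) : toT A Set.univ X Y ((mFun A).comp X Y w) =
    (mulP A - epsP A) X Y w := by
  rw [mFun_apply, toT_ofT, epsI_mulAll]; rfl

theorem altMul_hat_mFun : (fun X Y => altMul A X Y ∘ₗ hat (mFun A) X Y :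
    HomFam (plus A) A (fun X => X) (fun X => X)) = epsP A - projT A := by
  have h := fold_hat (mFun_unital A) (B := A) (q := fun X => X) (altMul A) (fun X Y => - toT A Set.univ X Y)
    (altMul_one (A := A)) (fun X Z Y v w => by
      rw [altMul_cons, LinearMap.neg_apply, map_neg, LinearMap.neg_apply])
  have hK : (fun X Y => (- toT A Set.univ X Y) ∘ₗ (mFun A).comp X Y : HomFam (plus A) A (fun X => X) (fun X => X)) =
      epsP A - mulP A := by
    funext X Y; ext w
    exact (congrArg Neg.neg (toT_mFun w)).trans (neg_sub _ _)
  set N : HomFam (plus A) A (fun X => X) (fun X => X) := fun X Y => altMul A X Y ∘ₗ hat (mFun A) X Y with hN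
  have h' : N = epsP A + (epsP A - mulP A) ⍟ N := by
    rw [← hK]; exact h
  have h2 : mulP A ⍟ N = epsP A := by
    have h3 : N = epsP A + (N - mulP A ⍟ N) := by
      conv_lhs => rw [h']
      rw [map_sub, LinearMap.sub_apply, epsFam_mul]
    rw [add_sub, eq_sub_iff_add_eq, add_comm] at h3
    exact add_right_cancel h3
  have h3 := congrArg (fun t => (epsP A - projT A) ⍟ t) h2
  rwa [← convMul_assoc, sub_projT_mulAll, epsFam_mul, mul_epsFam] at h3

theorem mulAll_hat_nFun : (fun X Y => mulAll A X Y ∘ₗ hat (nFun A) X Y :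
    HomFam (plus A) A (fun X => X) (fun X => X)) = epsP A + projT A := by
  have h := fold_hat (nFun_unital A) (B := A) (q := fun X => X) (mulAll A) (fun X Y => toT A Set.univ X Y)
    (mulAll_one (A := A)) (fun X Z Y v w => by rw [mulAll_cons])
  have hK : (fun X Y => (toT A Set.univ X Y) ∘ₗ (nFun A).comp X Y : HomFam (plus A) A (fun X => X) (fun X => X)) =
      epsP A - altP A := by
    funext X Y; ext w
    exact toT_mInv w
  set N : HomFam (plus A) A (fun X => X) (fun X => X) := fun X Y => mulAll A X Y ∘ₗ hat (nFun A) X Y with hN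
  have h' : N = epsP A + (epsP A - altP A) ⍟ N := by
    rw [← hK]; exact h
  have h2 : altP A ⍟ N = epsP A := by
    have h3 : N = epsP A + (N - altP A ⍟ N) := by
      conv_lhs => rw [h']
      rw [map_sub, LinearMap.sub_apply, epsFam_mul]
    rw [add_sub, eq_sub_iff_add_eq, add_comm] at h3
    exact add_right_cancel h3
  have h3 := congrArg (fun t => (epsP A + projT A) ⍟ t) h2
  rwa [← convMul_assoc, add_projT_altMul, epsFam_mul, mul_epsFam] at h3

theorem ofT_eps {X Y : A.Ob} (w : (plus A).T X Y) :
    ofT A Set.univ X Y (eps (A := plus A) (B := A) (fun X => X) X w) = 0 := by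
  refine induction_on (Q := plus A) (motive := fun X w =>
    ofT A Set.univ X Y (eps (A := plus A) (B := A) (fun X => X) X w) = 0) ?_ ?_ ?_ ?_ w
  · simp only [map_zero, implies_true]
  · intro X a b ha hb; rw [map_add, map_add, ha, hb, add_zero]
  · intro c; rw [map_smul, map_smul, eps_one, ofT_one, smul_zero]
  · intro X Z v w _; rw [eps_cons, map_zero]

theorem mInv_hat_mFun {X Y : A.Ob} (w : (plus A).T X Y) :
    mInv A X Y (hat (mFun A) X Y w) = (plus A).proj X Y w := by
  have h := LinearMap.congr_fun (congrFun (congrFun (altMul_hat_mFun (A := A)) X) Y) w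
  refine (mInv_apply _).trans ?_
  refine (congrArg (fun t => - ofT A Set.univ X Y t) h).trans ?_
  change - ofT A Set.univ X Y (eps (A := plus A) (B := A) (fun X => X) X w - toT A Set.univ X Y ((plus A).proj X Y w)) = _
  rw [map_sub, ofT_eps, ofT_toT, zero_sub, neg_neg]

theorem mFun_hat_nFun {X Y : A.Ob} (w : (plus A).T X Y) :
    (mFun A).comp X Y (hat (nFun A) X Y w) = (plus A).proj X Y w := by
  have h := LinearMap.congr_fun (congrFun (congrFun (mulAll_hat_nFun (A := A)) X) Y) w
  refine (mFun_apply _).trans ?_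
  refine (congrArg (fun t => ofT A Set.univ X Y t) h).trans ?_
  change ofT A Set.univ X Y (eps (A := plus A) (B := A) (fun X => X) X w + toT A Set.univ X Y ((plus A).proj X Y w)) = _
  rw [map_add, ofT_eps, ofT_toT, zero_add]

theorem hat_congr {A B : GQuiver k} {o : A.Ob → B.Ob} {c c' : Fam A B o o} (h : ∀ X Y w, c X Y w = c' X Y w)
    (X Y : A.Ob) (w : A.T X Y) : hat ⟨o, c⟩ X Y w = hat ⟨o, c'⟩ X Y w := by
  obtain rfl : c = c' := by funext X Y; ext w; exact h X Y w
  rfl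

theorem coder_congr {A B : GQuiver k} {o o' : A.Ob → B.Ob} {c₁ c₂ : Fam A B o o} {c₁' c₂' : Fam A B o' o'}
    (h : c₁ = c₂) (h' : c₁' = c₂') {d : ℤ} {r : Fam A B o o'} (X Y : A.Ob) (w : A.T X Y) :
    coder ⟨o, c₁⟩ ⟨o', c₁'⟩ d r X Y w = coder ⟨o, c₂⟩ ⟨o', c₂'⟩ d r X Y w := by
  subst h h'; rfl

theorem theta_congr {A B : GQuiver k} {o o' o'' : A.Ob → B.Ob} {c₁ c₂ : Fam A B o o} {c₁' c₂' : Fam A B o' o'}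
    {c₁'' c₂'' : Fam A B o'' o''} (h : c₁ = c₂) (h' : c₁' = c₂') (h'' : c₁'' = c₂'') {d e : ℤ} {r : Fam A B o o'}
    {p : Fam A B o' o''} (X Y : A.Ob) (w : A.T X Y) :
    theta ⟨o, c₁⟩ ⟨o', c₁'⟩ ⟨o'', c₁''⟩ d e r p X Y w = theta ⟨o, c₂⟩ ⟨o', c₂'⟩ ⟨o'', c₂''⟩ d e r p X Y w := by
  subst h h' h''; rfl

theorem hat_mFun_hat_nFun {X Y : A.Ob} (w : (plus A).T X Y) : hat (mFun A) X Y (hat (nFun A) X Y w) = w := by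
  refine (hat_comp (nFun_unital A) (mFun_unital A) w).symm.trans ?_
  refine Eq.trans ?_ (hat_idFun w)
  exact hat_congr (A := plus A) (B := plus A) (o := fun X => X) (fun X Y w => mFun_hat_nFun w) X Y w

theorem mFun_homog (A : GQuiver k) : Homog 0 (mFun A).comp := by
  intro X Y e w hw
  rw [add_zero]
  exact ofT_mem (mulAll_mem hw)

theorem nFun_homog (A : GQuiver k) : Homog 0 (nFun A).comp := by
  intro X Y e w hw
  rw [add_zero]
  exact neg_mem (ofT_mem (mulAll_mem (lenSgn_mem hw)))

end inverse

section aInf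

theorem isAInf_of_b_hatb {A : Ops k} (h1 : ∀ X, A.b X X (A.one X) = 0)
    (h2 : Homog (A := A.toGQuiver) (B := A.toGQuiver) (o := fun X => X) (o' := fun X => X) 1 A.b)
    (h3 : ∀ X Y w, A.b X Y (A.hatb X Y w) = 0) : A.IsAInf where
  b_one := h1
  homog := h2
  sq X Y w := by
    have hs : ∀ {Z Y : A.Ob} (w : A.T Z Y), A.sgn 1 _ _ (A.hatb Z Y w) = - A.hatb Z Y (A.sgn 1 _ _ w) := fun w => by
      have h0 : Homog 0 (idFun A.toGQuiver).comp := fun _ _ _ _ hw => by rw [add_zero]; exact proj_mem hw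
      refine (sgn_coder h0 h0 h2 1 w).trans ?_
      rw [one_mul, Int.negOnePow_one]; simp; rfl
    have := coder_unique (f := idFun A.toGQuiver) (g := idFun A.toGQuiver) (r := 0) (d := 2)
      (R := fun X Y => A.hatb X Y ∘ₗ A.hatb X Y) (idFun_unital _) ?_ ?_ ?_ X Y w
    · refine this.trans ?_
      have := lead_smul_left (y := Y) (idFun_unital A.toGQuiver) (0 : k)
        (0 : Fam A.toGQuiver A.toGQuiver (fun X => X) (fun X => X)) 2 (fun Z => hat (idFun A.toGQuiver) Z Y) X
      rw [zero_smul, zero_smul] at this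
      exact LinearMap.congr_fun this w
    · intro X Y w
      exact (proj_hatb _).trans (h3 X Y w)
    · intro X Y w
      have hh : ∀ Z, hat (idFun A.toGQuiver) X Z = LinearMap.id := fun Z => LinearMap.ext hat_idFun
      have hh' : ∀ Z, hat (idFun A.toGQuiver) Z Y = LinearMap.id := fun Z => LinearMap.ext hat_idFun
      rw [LinearMap.comp_apply, cut_hatb, dconv_of_cut (cut_hatb w), dconv_of_cut (cut_hatb w)]
      simp only [hh, hh']
      have e1 : dconv (A := A.toGQuiver) (B := A.toGQuiver) (o := fun Z => Z) (fun Z => A.hatb X Z) (fun Z => A.sgn 1 Z Y ∘ₗ A.hatb Z Y) w =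
          - dconv (A := A.toGQuiver) (B := A.toGQuiver) (o := fun Z => Z) (fun Z => A.hatb X Z) (fun Z => A.hatb Z Y ∘ₗ A.sgn 1 Z Y) w := by
        have := dconv_zsmul_right (A := A.toGQuiver) (B := A.toGQuiver) (o := fun Z => Z) (fun Z => A.hatb X Z) (fun Z => A.hatb Z Y ∘ₗ A.sgn 1 Z Y) (-1)
        rw [neg_one_smul] at this
        rw [← LinearMap.neg_apply, ← this]
        congr 2
        funext Z; ext w
        rw [LinearMap.comp_apply, hs]; simp
      have e2 : (fun Z => A.sgn 1 Z Y ∘ₗ A.sgn 1 Z Y) = fun Z => A.sgn 2 Z Y := by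
        funext Z; ext w; exact sgn_sgn 1 1 w
      rw [e2]
      refine (congrArg (fun t => _ + _ + (t + _)) e1).trans ?_
      simp only [LinearMap.id_comp]
      have : ∀ {M : Type u} [AddCommGroup M] (a b c : M), a + b + (-b + c) = a + c := fun a b c => by abel
      exact this _ _ _
    · intro X Y w
      exact eps_hatb _

theorem isAInfFun_of_b_hat {A B : Ops k} {f : FunData A.toGQuiver B.toGQuiver} (h1 : f.Unital0)
    (h2 : Homog 0 f.comp) (h3 : ∀ X Y w, B.b _ _ (hat f X Y w) = f.comp X Y (A.hatb X Y w)) : IsAInfFun f where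
  comp_one := h1
  homog := h2
  comm X Y w := by
    have e1 : (f.andThen (idFun B.toGQuiver)).comp = f.comp := by
      funext X Y; ext w; exact proj_hat h1 w
    have e2 : ((idFun A.toGQuiver).andThen f).comp = f.comp := by
      funext X Y; ext w; exact congrArg (f.comp X Y) (hat_idFun w)
    have c1 := coder_whL (f := f) (g := idFun B.toGQuiver) (g' := idFun B.toGQuiver) (d := 1) (r := B.b) h1 h2
      (idFun_unital _) (idFun_unital _) w
    have c2 := coder_whR (f := idFun A.toGQuiver) (f' := idFun A.toGQuiver) (g := f) (d := 1) (r := A.b)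
      (idFun_unital _) (idFun_unital _) h1 w
    refine c1.symm.trans (Eq.trans ?_ c2)
    refine (coder_congr e1 e1 X Y w).trans (Eq.trans ?_ (coder_congr e2 e2 X Y w).symm)
    refine LinearMap.congr_fun (congrArg (fun r => coder ⟨f.obj, f.comp⟩ ⟨f.obj, f.comp⟩ 1 r X Y) ?_) w
    funext X Y; ext w
    exact h3 X Y w

end aInf

section coder
variable {A B : GQuiver k}

/-- `coder` as a linear map -/
def coderₗ {f g : FunData A B} (hf : f.Unital0) (d : ℤ) : Fam A B f.obj g.obj →ₗ[k] HomFam A B f.obj g.obj where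
  toFun r := coder f g d r
  map_add' r r' := by funext X Y; exact lead_add_left hf r r' d _ X
  map_smul' c r := by funext X Y; exact lead_smul_left hf c r d _ X

theorem fold_epsI {M : A.Ob → Type u} [∀ X, AddCommGroup (M X)] [∀ X, Module k (M X)] {Y : A.Ob} (z : M Y)
    {X : A.Ob} (w : A.T X Y) :
    A.fold z (fun _ _ => 0) X w = A.fold (M := M) z (fun _ _ => 0) X (epsI A X Y w) := by
  refine induction_on (motive := fun X w => A.fold z (fun _ _ => 0) X w =
    A.fold (M := M) z (fun _ _ => 0) X (epsI A X Y w)) ?_ ?_ ?_ ?_ w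
  · simp
  · intro X a b ha hb; rw [map_add, map_add, map_add, ha, hb]
  · intro c; simp
  · intro X Z v w _; simp

theorem fold_zero {M : A.Ob → Type u} [∀ X, AddCommGroup (M X)] [∀ X, Module k (M X)] {Y : A.Ob}
    {X : A.Ob} (w : A.T X Y) : A.fold (M := M) 0 (fun _ _ => 0) X w = 0 := by
  refine induction_on (motive := fun X w => A.fold (M := M) 0 (fun _ _ => 0) X w = 0) ?_ ?_ ?_ ?_ w
  · simp
  · intro X a b ha hb; rw [map_add, ha, hb, add_zero]
  · intro c; simp
  · intro X Z v w _; simp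

theorem map_fold {M N : A.Ob → Type u} [∀ X, AddCommGroup (M X)] [∀ X, Module k (M X)]
    [∀ X, AddCommGroup (N X)] [∀ X, Module k (N X)] {Y : A.Ob} (φ : ∀ X, M X →ₗ[k] N X) (z : M Y)
    {X : A.Ob} (w : A.T X Y) :
    φ X (A.fold z (fun _ _ => 0) X w) = A.fold (M := N) (φ Y z) (fun _ _ => 0) X w := by
  refine induction_on (motive := fun X w => φ X (A.fold z (fun _ _ => 0) X w) =
    A.fold (M := N) (φ Y z) (fun _ _ => 0) X w) ?_ ?_ ?_ ?_ w
  · simp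
  · intro X a b ha hb; rw [map_add, map_add, map_add, ha, hb]
  · intro c; simp
  · intro X Z v w _; simp

theorem low_eq {M : A.Ob → Type u} [∀ X, AddCommGroup (M X)] [∀ X, Module k (M X)] {Y : A.Ob}
    (z : M Y) (f : ∀ X, A.hom X Y →ₗ[k] M X) {X : A.Ob} (w : A.T X Y) :
    low z f X w = A.fold z (fun _ _ => 0) X w + f X (A.proj X Y w) := by
  refine induction_on (motive := fun X w => low z f X w = A.fold z (fun _ _ => 0) X w + f X (A.proj X Y w)) ?_ ?_ ?_ ?_ w
  · simp
  · intro X a b ha hb; simp only [map_add, ha, hb]; abel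
  · intro c; simp
  · intro X Z v w _
    refine induction_on (motive := fun Z w => ∀ v, low z f X (A.cons X Z Y v w) =
      A.fold z (fun _ _ => 0) X (A.cons X Z Y v w) + f X (A.proj X Y (A.cons X Z Y v w))) ?_ ?_ ?_ ?_ w v
    · simp
    · intro Z a b ha hb v; simp only [map_add, ha, hb]; abel
    · intro c v; simp
    · intros; simp

end coder

section under
variable {A B : GQuiver k} {o o' : A.Ob → B.Ob}

theorem under_apply (F : HomFam A B o o') {X Y : A.Ob} (w : (plus A).T X Y) : under F X Y w =
    (plus A).fold (M := fun X => (plus B).hom (o X) (o' Y)) (ofT B Set.univ _ _ (F Y Y (A.one Y))) (fun _ _ => 0) X w +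
      ofT B Set.univ _ _ (F X Y (toT A Set.univ X Y ((plus A).proj X Y w))) :=
  low_eq (A := plus A) (M := fun X => (plus B).hom (o X) (o' Y)) _ _ w

theorem under_one (F : HomFam A B o o') (X : A.Ob) :
    under F X X ((plus A).one X) = ofT B Set.univ _ _ (F X X (A.one X)) :=
  low_one (A := plus A) (M := fun Z => (plus B).hom (o Z) (o' X)) _ _

theorem under_of_one {F : HomFam A B o o'} (hF : ∀ X, ofT B Set.univ _ _ (F X X (A.one X)) = 0) {X Y : A.Ob}
    (w : (plus A).T X Y) :
    under F X Y w = ofT B Set.univ _ _ (F X Y (toT A Set.univ X Y ((plus A).proj X Y w))) := by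
  rw [under_apply, hF, fold_zero (A := plus A), zero_add]

/-- `under` as a linear map -/
def underₗ : HomFam A B o o' →ₗ[k] Fam (plus A) (plus B) o o' where
  toFun F := under F
  map_add' F F' := by
    funext X Y
    refine ext_on (Q := plus A) (M := fun X => (plus B).hom (o X) (o' Y)) (U := fun X => under (F + F') X Y)
      (V := fun X => under F X Y + under F' X Y) ?_ ?_ X
    · rw [LinearMap.add_apply, under_one, under_one, under_one]; exact map_add _ _ _
    · intro X Z v w _
      rw [LinearMap.add_apply, under_apply, under_apply, under_apply, fold_cons (Q := plus A), fold_cons (Q := plus A),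
        fold_cons (Q := plus A)]
      simp
  map_smul' c F := by
    funext X Y
    refine ext_on (Q := plus A) (M := fun X => (plus B).hom (o X) (o' Y)) (U := fun X => under (c • F) X Y)
      (V := fun X => c • under F X Y) ?_ ?_ X
    · rw [LinearMap.smul_apply, under_one, under_one]; exact LinearMap.map_smul _ _ _
    · intro X Z v w _
      rw [LinearMap.smul_apply, under_apply, under_apply, fold_cons (Q := plus A), fold_cons (Q := plus A)]
      simp

theorem under_mem {F : HomFam A B o o'} {d : ℤ}
    (hF : ∀ X Y e, ∀ w ∈ A.Tgr X Y e, F X Y w ∈ B.Tgr (o X) (o' Y) (e + d)) : Homog d (under F) := by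
  intro X Y e w hw
  refine low_mem (A := plus A) (M := fun X => (plus B).hom (o X) (o' Y)) (fun X e => (plus B).gr (o X) (o' Y) e) d ?_ ?_ hw
  · have := ofT_mem (S := Set.univ) (hF _ _ _ _ (GQuiver.one_mem (A := A) Y))
    rwa [zero_add] at this
  · intro X i v hv
    exact ofT_mem (hF _ _ _ _ (toT_mem hv))

theorem ofT_hat_one {f : FunData A B} (hf : f.Unital0) (X : A.Ob) :
    ofT B Set.univ _ _ (hat f X X (A.one X)) = 0 := by
  rw [hat_one hf, ofT_one]

theorem underFun_apply {f : FunData A B} (hf : f.Unital0) {X Y : A.Ob} (w : (plus A).T X Y) :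
    (underFun f).comp X Y w = ofT B Set.univ _ _ (hat f X Y (toT A Set.univ X Y ((plus A).proj X Y w))) :=
  under_of_one (ofT_hat_one hf) w

theorem underFun_unital {f : FunData A B} (hf : f.Unital0) : (underFun f).Unital0 := fun X =>
  (under_one (hat f) X).trans (ofT_hat_one hf X)

theorem underFun_homog {f : FunData A B} (hf : Homog 0 f.comp) : Homog 0 (underFun f).comp :=
  under_mem fun X Y e w hw => by rw [add_zero]; exact hat_mem hf hw

theorem epsI_hat_toT {f : FunData A B} (hf : f.Unital0) {S : Set A.Ob} {X Y : A.Ob} (v : (A.barQuiver S).hom X Y) :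
    epsI B _ _ (hat f X Y (toT A S X Y v)) = 0 := by
  rw [eps_hat hf, eps_epsI, epsI_toT, map_zero]

theorem toT_underFun {f : FunData A B} (hf : f.Unital0) {X Y : A.Ob} (w : (plus A).T X Y) :
    toT B Set.univ _ _ ((underFun f).comp X Y w) = hat f X Y (toT A Set.univ X Y ((plus A).proj X Y w)) := by
  rw [underFun_apply hf]
  exact toT_ofT_of_eps (epsI_hat_toT hf _)

theorem barFun_unital {f : FunData A B} (hf : f.Unital0) : (barFun f).Unital0 :=
  comp_unital (f := mFun A) (g := (underFun f).andThen (nFun B)) (mFun_unital A)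
    (comp_unital (underFun_unital hf) (nFun_unital B))

theorem hat_barFun {f : FunData A B} (hf : f.Unital0) {X Y : A.Ob} (w : (plus A).T X Y) :
    hat (barFun f) X Y w = hat (nFun B) _ _ (hat (underFun f) X Y (hat (mFun A) X Y w)) :=
  (hat_comp (f := mFun A) (g := (underFun f).andThen (nFun B)) (mFun_unital A)
    (comp_unital (underFun_unital hf) (nFun_unital B)) w).trans
    (hat_comp (f := underFun f) (g := nFun B) (underFun_unital hf) (nFun_unital B) _)

theorem conj_mem {o o' : A.Ob → B.Ob} {G : HomFam (plus A) (plus B) o o'} {d : ℤ}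
    (hG : ∀ X Y e, ∀ w ∈ (plus A).Tgr X Y e, G X Y w ∈ (plus B).Tgr (o X) (o' Y) (e + d)) : Homog d (conj G) := by
  intro X Y e w hw
  have := nFun_homog B _ _ _ _ (hG _ _ _ _ (hat_mem (mFun_homog A) hw))
  rwa [add_zero] at this

theorem barFun_homog {f : FunData A B} (hf : Homog 0 f.comp) : Homog 0 (barFun f).comp :=
  conj_mem (G := hat (underFun f)) fun X Y e w hw => by rw [add_zero]; exact hat_mem (underFun_homog hf) hw

theorem coder_conj {f g : FunData A B} (hf : f.Unital0) (hg : g.Unital0) {d : ℤ}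
    (G : Fam (plus A) (plus B) (underFun f).obj (underFun g).obj) {X Y : A.Ob} (w : (plus A).T X Y) :
    coder (barFun f) (barFun g) d (conj (coder (underFun f) (underFun g) d G)) X Y w =
      hat (nFun B) _ _ (coder (underFun f) (underFun g) d G X Y (hat (mFun A) X Y w)) := by
  have u := fun {f : FunData A B} (hf : f.Unital0) => comp_unital (underFun_unital hf) (nFun_unital B)
  have e1 := coder_whL (f := mFun A) (g := (underFun f).andThen (nFun B)) (g' := (underFun g).andThen (nFun B))
    (d := d) (r := fun X Y => (nFun B).comp _ _ ∘ₗ coder (underFun f) (underFun g) d G X Y)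
    (mFun_unital A) (mFun_homog A) (u hf) (u hg) w
  have e2 := coder_whR (f := underFun f) (f' := underFun g) (g := nFun B) (d := d) (r := G) (underFun_unital hf)
    (underFun_unital hg) (nFun_unital B) (hat (mFun A) X Y w)
  exact e1.trans e2

/-- the coderivation of the component `(r ⊗ p | 𝐦⁻¹)M₂₀` -/
theorem coder_conj_theta {f g h : FunData A B} (hf : f.Unital0) (hg : g.Unital0) (hh : h.Unital0) {d e : ℤ}
    (r : Fam (plus A) (plus B) (underFun f).obj (underFun g).obj)
    (p : Fam (plus A) (plus B) (underFun g).obj (underFun h).obj) {X Y : A.Ob} (w : (plus A).T X Y) :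
    coder (barFun f) (barFun h) (d + e) (conj (theta (underFun f) (underFun g) (underFun h) d e r p)) X Y w +
      theta (barFun f) (barFun g) (barFun h) d e (conj (coder (underFun f) (underFun g) d r))
        (conj (coder (underFun g) (underFun h) e p)) X Y w =
      hat (nFun B) _ _ (theta (underFun f) (underFun g) (underFun h) d e r p X Y (hat (mFun A) X Y w)) := by
  have u := fun {f : FunData A B} (hf : f.Unital0) => comp_unital (underFun_unital hf) (nFun_unital B)
  have e1 := coder_whL (f := mFun A) (g := (underFun f).andThen (nFun B)) (g' := (underFun h).andThen (nFun B))
    (d := d + e) (r := fun X Y => (nFun B).comp _ _ ∘ₗ theta (underFun f) (underFun g) (underFun h) d e r p X Y)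
    (mFun_unital A) (mFun_homog A) (u hf) (u hh) w
  have e2 := coder_hat_theta (f := underFun f) (g := underFun g) (h := underFun h) (n := nFun B) (d := d) (e := e)
    (r := r) (p := p) (underFun_unital hf)
    (underFun_unital hg) (underFun_unital hh) (nFun_unital B) _ _ (hat (mFun A) X Y w)
  have e3 := theta_whL (n := mFun A) (f := (underFun f).andThen (nFun B)) (g := (underFun g).andThen (nFun B))
    (h := (underFun h).andThen (nFun B)) (d := d) (e := e)
    (r := fun X Y => (nFun B).comp _ _ ∘ₗ coder (underFun f) (underFun g) d r X Y)
    (p := fun X Y => (nFun B).comp _ _ ∘ₗ coder (underFun g) (underFun h) e p X Y)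
    (mFun_unital A) (mFun_homog A) (u hf) (u hg) (u hh) X Y w
  exact (congrArg₂ (fun a b => a + b) (e1.trans e2) e3).trans (sub_add_cancel _ _)

end under

section underOps
variable {A B : Ops k}

/-- `T⁺s𝒜` with the differential `b` -/
@[reducible] def underOps (A : Ops k) : Ops k where
  toGQuiver := plus A.toGQuiver
  b := under (A := A.toGQuiver) (B := A.toGQuiver) (o := fun X => X) (o' := fun X => X) A.hatb

theorem hatb_one (hA : A.IsAInf) (X : A.Ob) : A.hatb X X (A.one X) = 0 := by
  refine (coder_one (idFun_unital _) (idFun_unital _) 1 A.b X).trans ?_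
  rw [hA.b_one, map_zero, LinearMap.zero_apply]

theorem underOps_b (hA : A.IsAInf) {X Y : A.Ob} (w : (plus A.toGQuiver).T X Y) : (underOps A).b X Y w =
    ofT A.toGQuiver Set.univ X Y (A.hatb X Y (toT A.toGQuiver Set.univ X Y ((plus A.toGQuiver).proj X Y w))) :=
  under_of_one (A := A.toGQuiver) (B := A.toGQuiver) (o := fun X => X) (o' := fun X => X) (F := A.hatb)
    (fun X => by rw [hatb_one hA, map_zero]) w

theorem toT_underOps_b (hA : A.IsAInf) {X Y : A.Ob} (w : (plus A.toGQuiver).T X Y) :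
    toT A.toGQuiver Set.univ X Y ((underOps A).b X Y w) =
      A.hatb X Y (toT A.toGQuiver Set.univ X Y ((plus A.toGQuiver).proj X Y w)) := by
  rw [underOps_b hA]
  exact toT_ofT_of_eps (eps_hatb _)

theorem underOps_homog (hA : A.IsAInf) :
    Homog (A := plus A.toGQuiver) (B := plus A.toGQuiver) (o := fun X => X) (o' := fun X => X) 1 (underOps A).b :=
  under_mem (A := A.toGQuiver) (B := A.toGQuiver) (o := fun X => X) (o' := fun X => X) fun _ _ _ _ hw => hatb_mem hA hw

theorem underOps_isAInf (hA : A.IsAInf) : (underOps A).IsAInf := by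
  refine isAInf_of_b_hatb ?_ (underOps_homog hA) ?_
  · intro X
    rw [underOps_b hA, proj_one, map_zero, map_zero, map_zero]
  · intro X Y w
    rw [underOps_b hA]
    have h1 : (plus A.toGQuiver).proj X Y ((underOps A).hatb X Y w) = (underOps A).b X Y w := proj_hatb (A := underOps A) w
    refine (congrArg (fun t => ofT A.toGQuiver Set.univ X Y (A.hatb X Y (toT A.toGQuiver Set.univ X Y t))) h1).trans ?_
    refine (congrArg (fun t => ofT A.toGQuiver Set.univ X Y (A.hatb X Y t)) (toT_underOps_b hA w)).trans ?_
    exact (congrArg _ (hA.sq X Y _)).trans (map_zero _)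

theorem underFun_isFun (hA : A.IsAInf) (hB : B.IsAInf) {f : FunData A.toGQuiver B.toGQuiver} (hf : IsAInfFun f) :
    IsAInfFun (A := underOps A) (B := underOps B) (underFun f) := by
  refine isAInfFun_of_b_hat (A := underOps A) (B := underOps B) (underFun_unital hf.comp_one) (underFun_homog hf.homog) ?_
  intro X Y w
  have h1 : (underOps B).b _ _ (hat (underFun f) X Y w) = _ := underOps_b hB _
  have h2 : (plus B.toGQuiver).proj _ _ (hat (underFun f) X Y w) = _ := proj_hat (underFun_unital hf.comp_one) w
  have h3 : (underFun f).comp X Y ((underOps A).hatb X Y w) = _ := underFun_apply hf.comp_one _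
  have h4 : (plus A.toGQuiver).proj X Y ((underOps A).hatb X Y w) = (underOps A).b X Y w := proj_hatb (A := underOps A) w
  refine (h1.trans (congrArg (fun t => ofT B.toGQuiver Set.univ _ _ (B.hatb _ _ (toT B.toGQuiver Set.univ _ _ t))) h2)).trans ?_
  refine Eq.trans ?_ (h3.trans (congrArg (fun t => ofT B.toGQuiver Set.univ _ _ (hat f X Y (toT A.toGQuiver Set.univ X Y t))) h4)).symm
  refine (congrArg (fun t => ofT B.toGQuiver Set.univ _ _ (B.hatb _ _ t)) (toT_underFun hf.comp_one w)).trans ?_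
  refine Eq.trans ?_ (congrArg (fun t => ofT B.toGQuiver Set.univ _ _ (hat f X Y t)) (toT_underOps_b hA w)).symm
  exact congrArg _ (hf.comm X Y _)

/-- the graded commutator with `b` -/
def commb {o o' : A.Ob → B.Ob} (d : ℤ) (F : HomFam A.toGQuiver B.toGQuiver o o') : HomFam A.toGQuiver B.toGQuiver o o' :=
  fun X Y => B.hatb _ _ ∘ₗ F X Y - (d.negOnePow : ℤ) • F X Y ∘ₗ A.hatb X Y

attribute [local irreducible] mInv ofT in
theorem B1_under (hA : A.IsAInf) (hB : B.IsAInf) {f g : FunData A.toGQuiver B.toGQuiver} (hf : f.Unital0)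
    (hg : g.Unital0) (d : ℤ) (F : HomFam A.toGQuiver B.toGQuiver f.obj g.obj)
    (hF : ∀ X Y w, epsI B.toGQuiver _ _ (F X Y w) = 0) :
    B1 (A := underOps A) (B := underOps B) (underFun f) (underFun g) d (under F) = under (commb d F) := by
  funext X Y
  refine LinearMap.ext fun w => ?_
  set M : A.Ob → Type u := fun X => (plus B.toGQuiver).hom (f.obj X) (g.obj Y)
  have hp : (plus B.toGQuiver).proj (f.obj X) (g.obj Y) (coder (underFun f) (underFun g) d (under F) X Y w) = under F X Y w :=
    proj_coder (underFun_unital hf) (underFun_unital hg) w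
  have e0 : B1 (A := underOps A) (B := underOps B) (underFun f) (underFun g) d (under F) X Y w =
    ((underOps B).b (f.obj X) (g.obj Y) (coder (underFun f) (underFun g) d (under F) X Y w) :
      (plus B.toGQuiver).hom (f.obj X) (g.obj Y)) - (d.negOnePow : ℤ) • under F X Y ((underOps A).hatb X Y w) := rfl
  have hb : (plus A.toGQuiver).proj X Y ((underOps A).hatb X Y w) = (underOps A).b X Y w := proj_hatb (A := underOps A) w
  have hbe : epsI (plus A.toGQuiver) X Y ((underOps A).hatb X Y w) = 0 := eps_hatb (A := underOps A) w
  have e2 : under F X Y ((underOps A).hatb X Y w) = ofT B.toGQuiver Set.univ _ _ (F X Y (A.hatb X Y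
      (toT A.toGQuiver Set.univ X Y ((plus A.toGQuiver).proj X Y w)))) := by
    rw [under_apply, fold_epsI (A := plus A.toGQuiver), hbe, map_zero, zero_add, hb, toT_underOps_b hA]
  have e1 : (underOps B).b (f.obj X) (g.obj Y) (coder (underFun f) (underFun g) d (under F) X Y w) =
      (plus A.toGQuiver).fold (M := M) (ofT B.toGQuiver Set.univ _ _ (B.hatb _ _ (F Y Y (A.one Y)))) (fun _ _ => 0) X w +
      ofT B.toGQuiver Set.univ _ _ (B.hatb _ _ (F X Y (toT A.toGQuiver Set.univ X Y ((plus A.toGQuiver).proj X Y w)))) := by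
    have h1 : (underOps B).b (f.obj X) (g.obj Y) (coder (underFun f) (underFun g) d (under F) X Y w) = _ := underOps_b hB _
    refine h1.trans ((congrArg (fun t => ofT B.toGQuiver Set.univ _ _ (B.hatb _ _ (toT B.toGQuiver Set.univ _ _ t)))
      (hp.trans (under_apply F w))).trans ?_)
    rw [map_add, map_add, map_add, toT_ofT_of_eps (hF X Y _)]
    refine congrArg (fun t => t + _) ?_
    refine (map_fold (A := plus A.toGQuiver) (M := M) (N := M) (fun X => ofT B.toGQuiver Set.univ _ _ ∘ₗ B.hatb _ _ ∘ₗ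
      toT B.toGQuiver Set.univ (f.obj X) (g.obj Y)) _ w).trans ?_
    rw [LinearMap.comp_apply, LinearMap.comp_apply, toT_ofT_of_eps (hF Y Y _)]
  have e3 : ∀ X (t : A.T X Y), commb d F X Y t = B.hatb _ _ (F X Y t) - (d.negOnePow : ℤ) • F X Y (A.hatb X Y t) :=
    fun _ _ => rfl
  have e4 := under_apply (commb d F) w
  rw [e3, e3, hatb_one hA, map_zero, smul_zero, sub_zero, map_sub, map_zsmul, ← add_sub_assoc] at e4
  exact (e0.trans (congrArg₂ (fun a b => a - (d.negOnePow : ℤ) • b) e1 e2)).trans e4.symm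

theorem B2_under (hB : B.IsAInf) {f g h : FunData A.toGQuiver B.toGQuiver} (hf : f.Unital0)
    (hg : g.Unital0) (d e : ℤ) (r : Fam (plus A.toGQuiver) (plus B.toGQuiver) (underFun f).obj (underFun g).obj)
    (p : Fam (plus A.toGQuiver) (plus B.toGQuiver) (underFun g).obj (underFun h).obj) :
    B2 (A := underOps A) (B := underOps B) (underFun f) (underFun g) (underFun h) d e r p = 0 := by
  funext X Y
  refine LinearMap.ext fun w => ?_
  have h1 : (underOps B).b _ _ (theta (underFun f) (underFun g) (underFun h) d e r p X Y w) = _ := underOps_b hB _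
  have h2 : (plus B.toGQuiver).proj _ _ (theta (underFun f) (underFun g) (underFun h) d e r p X Y w) = 0 :=
    proj_theta (underFun_unital hf) (underFun_unital hg) w
  refine h1.trans ((congrArg (fun t => ofT B.toGQuiver Set.univ _ _ (B.hatb _ _ (toT B.toGQuiver Set.univ _ _ t))) h2).trans ?_)
  rw [map_zero, map_zero, map_zero]; rfl

theorem underFun_idFun_comp (A : GQuiver k) : (underFun (idFun A)).comp = (idFun (plus A)).comp := by
  funext X Y
  refine LinearMap.ext fun w => ?_
  refine (underFun_apply (idFun_unital A) w).trans ?_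
  rw [hat_idFun]; exact ofT_toT _

theorem barFun_idFun_comp (A : GQuiver k) : (barFun (idFun A)).comp = (idFun (plus A)).comp := by
  funext X Y
  refine LinearMap.ext fun w => ?_
  have h : hat (underFun (idFun A)) X Y (hat (mFun A) X Y w) = hat (mFun A) X Y w :=
    (hat_congr (A := plus A) (B := plus A) (o := fun X => X)
      (fun X Y w => LinearMap.congr_fun (congrFun (congrFun (underFun_idFun_comp A) X) Y) w) X Y _).trans (hat_idFun _)
  exact (congrArg (mInv A X Y) h).trans (mInv_hat_mFun w)

theorem barOps_b_apply {X Y : A.Ob} (w : (plus A.toGQuiver).T X Y) :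
    (barOps A).b X Y w = mInv A.toGQuiver X Y ((underOps A).hatb X Y (hat (mFun A.toGQuiver) X Y w)) := rfl

theorem barOps_hatb {X Y : A.Ob} (w : (plus A.toGQuiver).T X Y) : (barOps A).hatb X Y w =
    hat (nFun A.toGQuiver) X Y ((underOps A).hatb X Y (hat (mFun A.toGQuiver) X Y w)) := by
  have h1 := coder_conj (f := idFun A.toGQuiver) (g := idFun A.toGQuiver) (d := 1) (idFun_unital _) (idFun_unital _)
    (underOps A).b w
  have hu := underFun_idFun_comp A.toGQuiver
  have hb := barFun_idFun_comp A.toGQuiver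
  have h2 : ∀ w, coder (underFun (idFun A.toGQuiver)) (underFun (idFun A.toGQuiver)) 1 (underOps A).b X Y w =
    (underOps A).hatb X Y w := fun w => coder_congr hu hu X Y w
  have h3 : ∀ X Y, coder (underFun (idFun A.toGQuiver)) (underFun (idFun A.toGQuiver)) 1 (underOps A).b X Y =
    (underOps A).hatb X Y := fun X Y => LinearMap.ext fun w => coder_congr hu hu X Y w
  have h4 : (conj (A := A.toGQuiver) (B := A.toGQuiver) (o := fun X => X) (o' := fun X => X)
    (coder (underFun (idFun A.toGQuiver)) (underFun (idFun A.toGQuiver)) 1 (underOps A).b)) = (barOps A).b := by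
    funext X Y
    refine LinearMap.ext fun w => ?_
    exact congrArg (mInv A.toGQuiver X Y) (LinearMap.congr_fun (h3 X Y) _)
  refine Eq.trans ?_ (h1.trans (congrArg (hat (nFun A.toGQuiver) X Y) (h2 _)))
  refine Eq.trans ?_ (LinearMap.congr_fun (congrArg (fun b => coder (barFun (idFun A.toGQuiver)) (barFun (idFun A.toGQuiver)) 1 b X Y) h4) w).symm
  exact (coder_congr hb hb X Y w).symm

attribute [local irreducible] mInv in
theorem barOps_isAInf (hA : A.IsAInf) : (barOps A).IsAInf where
  b_one X := by
    rw [barOps_b_apply, hat_one (mFun_unital _)]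
    have : (underOps A).hatb X X ((plus A.toGQuiver).one X) = 0 := hatb_one (underOps_isAInf hA) X
    exact (congrArg (mInv A.toGQuiver X X) this).trans (map_zero _)
  homog := conj_mem (A := A.toGQuiver) (B := A.toGQuiver) (o := fun X => X) (o' := fun X => X)
    (G := fun X Y => (underOps A).hatb X Y) fun _ _ _ _ hw => hatb_mem (underOps_isAInf hA) hw
  sq X Y w := by
    rw [barOps_hatb, barOps_hatb]
    refine (congrArg (fun t => hat (nFun A.toGQuiver) X Y ((underOps A).hatb X Y t)) (hat_mFun_hat_nFun _)).trans ?_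
    exact (congrArg (hat (nFun A.toGQuiver) X Y) ((underOps_isAInf hA).sq X Y _)).trans (map_zero _)

attribute [local irreducible] mInv ofT in
theorem barFun_isFun (hA : A.IsAInf) (hB : B.IsAInf) {f : FunData A.toGQuiver B.toGQuiver} (hf : IsAInfFun f) :
    IsAInfFun (A := barOps A) (B := barOps B) (barFun f) where
  comp_one := barFun_unital hf.comp_one
  homog := barFun_homog hf.homog
  comm X Y w := by
    refine (barOps_hatb _).trans ?_
    refine Eq.trans ?_ (hat_barFun hf.comp_one _).symm
    refine congrArg (hat (nFun B.toGQuiver) _ _) ?_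
    refine (congrArg (fun t => (underOps B).hatb _ _ (hat (mFun B.toGQuiver) _ _ t)) (hat_barFun hf.comp_one w)).trans ?_
    refine (congrArg (fun t => (underOps B).hatb _ _ t) (hat_mFun_hat_nFun _)).trans ?_
    refine ((underFun_isFun hA hB hf).comm X Y _).trans ?_
    refine congrArg (hat (underFun f) X Y) ?_
    refine Eq.trans ?_ (congrArg (fun t => hat (mFun A.toGQuiver) X Y t) (barOps_hatb w)).symm
    exact (hat_mFun_hat_nFun _).symm

end underOps

section trans
variable {A B : GQuiver k} {f g h : FunData A B} {d e : ℤ} {r : Fam A B f.obj g.obj} {p : Fam A B g.obj h.obj}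

theorem underTrans_homog (hf : Homog 0 f.comp) (hg : Homog 0 g.comp) (hr : Homog d r) :
    Homog d (underTrans f g d r) :=
  under_mem fun _ _ _ _ hw => coder_mem hf hg hr hw

theorem barTrans_homog (hf : Homog 0 f.comp) (hg : Homog 0 g.comp) (hr : Homog d r) : Homog d (barTrans f g d r) :=
  conj_mem (G := coder (underFun f) (underFun g) d (underTrans f g d r))
    fun _ _ _ _ hw => coder_mem (underFun_homog hf) (underFun_homog hg) (underTrans_homog hf hg hr) hw

theorem homR_homog (hf : Homog 0 f.comp) (hg : Homog 0 g.comp) (hh : Homog 0 h.comp) (hr : Homog d r)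
    (hp : Homog e p) : Homog (d + e) (homR f g h d e r p) := by
  have h1 : Homog (d + e) (conj (coder (underFun f) (underFun h) (d + e) (under (theta f g h d e r p)))) :=
    conj_mem (G := coder (underFun f) (underFun h) (d + e) (under (theta f g h d e r p)))
    fun _ _ _ _ hw => coder_mem (underFun_homog hf) (underFun_homog hh)
      (under_mem fun _ _ _ _ hw => theta_mem hf hg hh hr hp hw) hw
  have h2 : Homog (d + e) (conj (theta (underFun f) (underFun g) (underFun h) d e (underTrans f g d r) (underTrans g h e p))) :=
    conj_mem (G := theta (underFun f) (underFun g) (underFun h) d e (underTrans f g d r) (underTrans g h e p))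
    fun _ _ _ _ hw => theta_mem (underFun_homog hf) (underFun_homog hg) (underFun_homog hh)
      (underTrans_homog hf hg hr) (underTrans_homog hg hh hp) hw
  exact fun X Y i w hw => Submodule.add_mem _ (h1 X Y i w hw) (h2 X Y i w hw)

end trans

section homotopy
variable {A B : Ops k} {f g h : FunData A.toGQuiver B.toGQuiver} {d e : ℤ}
  {r : Fam A.toGQuiver B.toGQuiver f.obj g.obj} {p : Fam A.toGQuiver B.toGQuiver g.obj h.obj}

theorem commb_coder (hA : A.IsAInf) (hB : B.IsAInf) (hf : IsAInfFun f) (hg : IsAInfFun g) (hr : Homog d r) :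
    commb (A := A) (B := B) d (coder f g d r) = coder f g (d + 1) (B1 f g d r) := by
  funext X Y
  refine LinearMap.ext fun w => ?_
  exact (coder_B1 hA hB hf hg hr w).symm

theorem B1_underTrans (hA : A.IsAInf) (hB : B.IsAInf) (hf : IsAInfFun f) (hg : IsAInfFun g) (hr : Homog d r) :
    B1 (A := underOps A) (B := underOps B) (underFun f) (underFun g) d (underTrans f g d r) =
      underTrans f g (d + 1) (B1 f g d r) :=
  (B1_under hA hB hf.comp_one hg.comp_one d (coder f g d r) fun _ _ _ => eps_lead hf.comp_one _ _).trans
    (congrArg under (commb_coder hA hB hf hg hr))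

theorem commb_theta (hA : A.IsAInf) (hB : B.IsAInf) (hf : IsAInfFun f) (hg : IsAInfFun g) (hh : IsAInfFun h)
    (hr : Homog d r) (hp : Homog e p) : commb (A := A) (B := B) (d + e) (theta f g h d e r p) =
      coder f h (d + e + 1) (B2 f g h d e r p) + theta f g h d (e + 1) r (B1 g h e p) +
        (e.negOnePow : ℤ) • theta f g h (d + 1) e (B1 f g d r) p := by
  funext X Y
  refine LinearMap.ext fun w => ?_
  have := coder_B2 hA hB hf hg hh hr hp w
  simp only [Pi.add_apply, Pi.smul_apply, LinearMap.add_apply, LinearMap.smul_apply]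
  rw [this, commb]
  simp only [LinearMap.sub_apply, LinearMap.smul_apply, LinearMap.comp_apply]
  abel

/-- the map `T(T⁺s𝒜) → T(T⁺sℬ)` which `(r ⊗ p)R` is the conjugate of -/
def homRU (f g h : FunData A.toGQuiver B.toGQuiver) (d e : ℤ) (r : Fam A.toGQuiver B.toGQuiver f.obj g.obj)
    (p : Fam A.toGQuiver B.toGQuiver g.obj h.obj) :
    HomFam (plus A.toGQuiver) (plus B.toGQuiver) (underFun f).obj (underFun h).obj :=
  coder (underFun f) (underFun h) (d + e) (under (theta f g h d e r p)) +
    theta (underFun f) (underFun g) (underFun h) d e (underTrans f g d r) (underTrans g h e p)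

theorem commb_homRU (hA : A.IsAInf) (hB : B.IsAInf) (hf : IsAInfFun f) (hg : IsAInfFun g) (hh : IsAInfFun h)
    (hr : Homog d r) (hp : Homog e p) : commb (A := underOps A) (B := underOps B) (d + e) (homRU f g h d e r p) =
      coder (underFun f) (underFun h) (d + e + 1) (underTrans f h (d + e + 1) (B2 f g h d e r p)) +
      (homRU f g h d (e + 1) r (B1 g h e p) + (e.negOnePow : ℤ) • homRU f g h (d + 1) e (B1 f g d r) p) := by
  have uA := underOps_isAInf hA
  have uB := underOps_isAInf hB
  have uf := underFun_isFun hA hB hf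
  have ug := underFun_isFun hA hB hg
  have uh := underFun_isFun hA hB hh
  have k1 := commb_theta uA uB uf ug uh (underTrans_homog hf.homog hg.homog hr) (underTrans_homog hg.homog hh.homog hp)
  rw [B2_under hB hf.comp_one hg.comp_one, B1_underTrans hA hB hf hg hr, B1_underTrans hA hB hg hh hp] at k1
  have hθ : Homog (d + e) (under (theta f g h d e r p)) :=
    under_mem fun _ _ _ _ hw => theta_mem hf.homog hg.homog hh.homog hr hp hw
  have k2 := (commb_coder uA uB uf uh hθ).trans (congrArg (coder (underFun f) (underFun h) (d + e + 1))
    ((B1_under hA hB hf.comp_one hh.comp_one (d + e) (theta f g h d e r p) (fun _ _ _ => eps_lead hf.comp_one _ _)).trans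
      (congrArg under (commb_theta hA hB hf hg hh hr hp))))
  let H := HomFam (plus A.toGQuiver) (plus B.toGQuiver) f.obj h.obj
  let L : HomFam A.toGQuiver B.toGQuiver f.obj h.obj →ₗ[k] H :=
    (coderₗ (underFun_unital hf.comp_one) (g := underFun h) (d + e + 1)) ∘ₗ underₗ
  have k3 : ∀ a b c (n : ℤ), L (a + b + n • c) = L a + L b + n • L c := fun a b c n => by
    rw [map_add, map_add, map_zsmul]
  have k5 : commb (A := underOps A) (B := underOps B) (d + e) (homRU f g h d e r p) =
      commb (A := underOps A) (B := underOps B) (d + e) (coder (underFun f) (underFun h) (d + e) (under (theta f g h d e r p))) +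
      commb (A := underOps A) (B := underOps B) (d + e) (theta (underFun f) (underFun g) (underFun h) d e (underTrans f g d r) (underTrans g h e p)) := by
    funext X Y
    refine LinearMap.ext fun w => ?_
    simp only [commb, homRU, Pi.add_apply, LinearMap.add_apply, LinearMap.sub_apply, LinearMap.smul_apply,
      LinearMap.comp_apply, map_add, smul_add]
    abel
  let t1 : H := theta (underFun f) (underFun g) (underFun h) d (e + 1) (underTrans f g d r)
    (underTrans g h (e + 1) (B1 g h e p))
  let t2 : H := theta (underFun f) (underFun g) (underFun h) (d + 1) e (underTrans f g (d + 1) (B1 f g d r))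
    (underTrans g h e p)
  have k1' := k1.trans (congrArg (fun t : H => t + t1 + (e.negOnePow : ℤ) • t2)
    (map_zero (coderₗ (underFun_unital hf.comp_one) (g := underFun h) (d + e + 1))))
  have e1 : homRU f g h d (e + 1) r (B1 g h e p) = L (theta f g h d (e + 1) r (B1 g h e p)) + t1 := by
    unfold homRU
    rw [← add_assoc]; rfl
  have e2 : homRU f g h (d + 1) e (B1 f g d r) p = L (theta f g h (d + 1) e (B1 f g d r) p) + t2 := by
    unfold homRU
    rw [add_right_comm d 1 e]; rfl
  refine (k5.trans (congrArg₂ (fun a b : H => a + b) (k2.trans (k3 _ _ _ _)) k1')).trans ?_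
  rw [e1, e2]
  have k6 : ∀ a b c t t' : H, a + b + (e.negOnePow : ℤ) • c + (0 + t + (e.negOnePow : ℤ) • t') =
      a + ((b + t) + (e.negOnePow : ℤ) • (c + t')) := fun a b c t t' => by
    rw [smul_add]; abel
  exact k6 _ _ _ _ _

theorem homR_eq_conj : homR f g h d e r p = conj (homRU f g h d e r p) := by
  funext X Y
  refine LinearMap.ext fun w => ?_
  exact (map_add (mInv B.toGQuiver _ _) _ _).symm

attribute [local irreducible] mInv ofT in
theorem barTrans_B2_sub (hA : A.IsAInf) (hB : B.IsAInf) (hf : IsAInfFun f) (hg : IsAInfFun g) (hh : IsAInfFun h)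
    (hr : Homog d r) (hp : Homog e p) : barTrans f h (d + e + 1) (B2 f g h d e r p) -
      B2 (A := barOps A) (B := barOps B) (barFun f) (barFun g) (barFun h) d e (barTrans f g d r) (barTrans g h e p) =
    B1 (A := barOps A) (B := barOps B) (barFun f) (barFun h) (d + e) (homR f g h d e r p) -
      (homR f g h d (e + 1) r (B1 g h e p) + (e.negOnePow : ℤ) • homR f g h (d + 1) e (B1 f g d r) p) := by
  have hu : Homog (d + e) (under (theta f g h d e r p)) :=
    under_mem fun _ _ _ _ hw => theta_mem hf.homog hg.homog hh.homog hr hp hw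
  rw [sub_eq_sub_iff_add_eq_add]
  funext X Y
  refine LinearMap.ext fun w => ?_
  set N : (plus B.toGQuiver).T (f.obj X) (h.obj Y) →ₗ[k] (plus B.toGQuiver).hom (f.obj X) (h.obj Y) :=
    mInv B.toGQuiver (f.obj X) (h.obj Y) with hN
  let m : (plus A.toGQuiver).T X Y := hat (mFun A.toGQuiver) X Y w
  let U : (plus A.toGQuiver).T X Y →ₗ[k] (plus B.toGQuiver).T (f.obj X) (h.obj Y) := homRU f g h d e r p X Y
  let b' : (plus B.toGQuiver).T (f.obj X) (h.obj Y) →ₗ[k] (plus B.toGQuiver).T (f.obj X) (h.obj Y) :=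
    (underOps B).hatb (f.obj X) (h.obj Y)
  have c1 : ∀ t : (plus A.toGQuiver).T X Y, commb (A := underOps A) (B := underOps B) (d + e) (homRU f g h d e r p) X Y t =
    b' (U t) -
      ((d + e).negOnePow : ℤ) • U ((underOps A).hatb X Y t) := fun _ => rfl
  have c2 := congrArg N ((c1 m).symm.trans
    (LinearMap.congr_fun (congrFun (congrFun (commb_homRU hA hB hf hg hh hr hp) X) Y) m))
  have hc : coder (barFun f) (barFun h) (d + e) (homR f g h d e r p) X Y w +
      theta (barFun f) (barFun g) (barFun h) d e (barTrans f g d r) (barTrans g h e p) X Y w =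
      hat (nFun B.toGQuiver) (f.obj X) (h.obj Y) (U m) := by
    have k1 := coder_conj (d := d + e) hf.comp_one hh.comp_one (under (theta f g h d e r p)) w
    have k2 := coder_conj_theta (d := d) (e := e) hf.comp_one hg.comp_one hh.comp_one (underTrans f g d r) (underTrans g h e p) w
    have k3 : coder (barFun f) (barFun h) (d + e) (homR f g h d e r p) X Y w = _ := LinearMap.congr_fun (lead_add_left (barFun_unital hf.comp_one)
      (conj (coder (underFun f) (underFun h) (d + e) (under (theta f g h d e r p))))
      (conj (theta (underFun f) (underFun g) (underFun h) d e (underTrans f g d r) (underTrans g h e p))) (d + e)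
      (fun Z => hat (barFun h) Z Y) X) w
    refine (congrArg (fun t => t + theta (barFun f) (barFun g) (barFun h) d e (barTrans f g d r) (barTrans g h e p) X Y w) k3).trans ?_
    refine ((add_assoc _ _ _).trans (congrArg₂ (fun a b => a + b) k1 k2)).trans ?_
    exact (map_add (hat (nFun B.toGQuiver) (f.obj X) (h.obj Y)) _ _).symm
  have hL : B1 (A := barOps A) (B := barOps B) (barFun f) (barFun h) (d + e) (homR f g h d e r p) X Y w +
      B2 (A := barOps A) (B := barOps B) (barFun f) (barFun g) (barFun h) d e (barTrans f g d r) (barTrans g h e p) X Y w =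
      N (b' (U m) -
      ((d + e).negOnePow : ℤ) • U ((underOps A).hatb X Y m)) := by
    have k1 : (barOps B).b (f.obj X) (h.obj Y) (coder (barFun f) (barFun h) (d + e) (homR f g h d e r p) X Y w) +
      (barOps B).b (f.obj X) (h.obj Y) (theta (barFun f) (barFun g) (barFun h) d e (barTrans f g d r) (barTrans g h e p) X Y w) =
      N (b' (U m)) := by
      refine (map_add ((barOps B).b (f.obj X) (h.obj Y)) _ _).symm.trans ((congrArg ((barOps B).b (f.obj X) (h.obj Y)) hc).trans ?_)
      refine (barOps_b_apply _).trans ?_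
      exact congrArg (fun t => N (b' t)) (hat_mFun_hat_nFun _)
    have k2 : homR f g h d e r p X Y ((barOps A).hatb X Y w) = N (U ((underOps A).hatb X Y m)) := by
      have : homR f g h d e r p X Y ((barOps A).hatb X Y w) = _ :=
        LinearMap.congr_fun (congrFun (congrFun (homR_eq_conj (f := f) (g := g) (h := h) (d := d) (e := e) (r := r) (p := p)) X) Y) _
      refine this.trans ?_
      refine (congrArg (fun t => N (U (hat (mFun A.toGQuiver) X Y t))) (barOps_hatb w)).trans ?_
      exact congrArg (fun t => N (U t)) (hat_mFun_hat_nFun _)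
    refine Eq.trans ?_ (map_sub N _ _).symm
    rw [map_zsmul, ← k1, ← k2]
    have : ∀ {M : Type u} [AddCommGroup M] (a b c : M), a - b + c = a + c - b := fun a b c => by abel
    exact this _ _ _
  have e1 : homR f g h d (e + 1) r (B1 g h e p) X Y w = N (homRU f g h d (e + 1) r (B1 g h e p) X Y m) :=
    LinearMap.congr_fun (congrFun (congrFun homR_eq_conj X) Y) w
  have e2 : homR f g h (d + 1) e (B1 f g d r) p X Y w = N (homRU f g h (d + 1) e (B1 f g d r) p X Y m) :=
    LinearMap.congr_fun (congrFun (congrFun homR_eq_conj X) Y) w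
  have e3 : barTrans f h (d + e + 1) (B2 f g h d e r p) X Y w =
    N (coder (underFun f) (underFun h) (d + e + 1) (underTrans f h (d + e + 1) (B2 f g h d e r p)) X Y m) := rfl
  refine Eq.trans ?_ (hL.trans c2).symm
  refine Eq.trans ?_ (map_add N _ _).symm
  refine congrArg₂ (fun a b => a + b) e3 ?_
  refine Eq.trans ?_ (map_add N _ _).symm
  refine congrArg₂ (fun a b => a + b) e1 ?_
  refine Eq.trans ?_ (map_zsmul N _ _).symm
  exact congrArg (fun t => (e.negOnePow : ℤ) • t) e2

end homotopy

section icut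
variable {A : GQuiver k}

/-- the cuts inside the first letter of `v ⊗ w` -/
def letterCut (A : GQuiver k) (X Z Y : A.Ob) :
    (plus A).hom X Z →ₗ[k] (plus A).T Z Y →ₗ[k] (plus A).T2 X Y :=
  LinearMap.mk₂ k (fun v w => elim₂ (Q := A) (fun W => ((plus A).tmul₂ X W Y).compl₁₂
      (((plus A).cons X W W).flip ((plus A).one W) ∘ₗ ofT A Set.univ X W)
      (((plus A).cons W Z Y).flip w ∘ₗ ofT A Set.univ W Z)) (A.cut X Z (toT A Set.univ X Z v)))
    (fun v v' w => by rw [map_add, map_add, map_add])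
    (fun c v w => by rw [map_smul, map_smul, map_smul])
    (fun v w w' => by
      rw [← elim₂_add]
      exact elim₂_congr (fun Z a b => by
        simp only [LinearMap.compl₁₂_apply, LinearMap.comp_apply, LinearMap.flip_apply, map_add, LinearMap.add_apply]) _)
    (fun c v w => by
      rw [← elim₂_smul]
      exact elim₂_congr (fun Z a b => by
        simp only [LinearMap.compl₁₂_apply, LinearMap.comp_apply, LinearMap.flip_apply, map_smul, LinearMap.smul_apply]) _)

theorem letterCut_apply (X Z Y : A.Ob) (v : (plus A).hom X Z) (w : (plus A).T Z Y) : letterCut A X Z Y v w =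
    elim₂ (Q := A) (fun W => ((plus A).tmul₂ X W Y).compl₁₂
      (((plus A).cons X W W).flip ((plus A).one W) ∘ₗ ofT A Set.univ X W)
      (((plus A).cons W Z Y).flip w ∘ₗ ofT A Set.univ W Z)) (A.cut X Z (toT A Set.univ X Z v)) := rfl

/-- `w ↦ (w, icut w)` -/
def icutPair (A : GQuiver k) (X Y : A.Ob) : (plus A).T X Y →ₗ[k] (plus A).T X Y × (plus A).T2 X Y :=
  (plus A).fold (M := fun X => (plus A).T X Y × (plus A).T2 X Y) ((plus A).one Y, 0)
    (fun X Z => LinearMap.mk₂ k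
      (fun v q => ((plus A).cons X Z Y v q.1, letterCut A X Z Y v q.1 + (plus A).cons₂ X Z Y v q.2))
      (fun v v' q => by
        rw [map_add, map_add, map_add, LinearMap.add_apply, LinearMap.add_apply, LinearMap.add_apply,
          add_add_add_comm]; rfl)
      (fun c v q => by
        rw [map_smul, map_smul, map_smul, LinearMap.smul_apply, LinearMap.smul_apply, LinearMap.smul_apply,
          ← smul_add]; rfl)
      (fun v q q' => by
        rw [Prod.fst_add, Prod.snd_add, map_add, map_add, map_add, add_add_add_comm]; rfl)
      (fun c v q => by
        rw [Prod.smul_fst, Prod.smul_snd, map_smul, map_smul, map_smul, ← smul_add]; rfl)) X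

/-- the sum of all cuts of a tensor `v₁ ⊗ ⋯ ⊗ vₙ` inside its letters `vᵢ ∈ T⁺A` -/
def icut (A : GQuiver k) (X Y : A.Ob) : (plus A).T X Y →ₗ[k] (plus A).T2 X Y :=
  LinearMap.snd k _ _ ∘ₗ icutPair A X Y

theorem icutPair_fst {X Y : A.Ob} (w : (plus A).T X Y) : (icutPair A X Y w).1 = w := by
  refine induction_on (Q := plus A) (motive := fun X w => (icutPair A X Y w).1 = w) ?_ ?_ ?_ ?_ w
  · intro X; rw [map_zero]; rfl
  · intro X a b ha hb; rw [map_add, Prod.fst_add, ha, hb]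
  · intro c
    rw [map_smul, Prod.smul_fst]
    exact congrArg (fun q => c • Prod.fst q) (fold_one (Q := plus A) (M := fun X => (plus A).T X Y × (plus A).T2 X Y) _ _)
  · intro X Z v w ih
    refine (congrArg Prod.fst (fold_cons (Q := plus A) (M := fun X => (plus A).T X Y × (plus A).T2 X Y) _ _ X Z v w)).trans ?_
    exact congrArg ((plus A).cons X Z Y v) ih

theorem icut_one (Y : A.Ob) : icut A Y Y ((plus A).one Y) = 0 :=
  congrArg Prod.snd (fold_one (Q := plus A) (M := fun X => (plus A).T X Y × (plus A).T2 X Y) _ _)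

theorem icut_cons (X Z Y : A.Ob) (v : (plus A).hom X Z) (w : (plus A).T Z Y) :
    icut A X Y ((plus A).cons X Z Y v w) = letterCut A X Z Y v w + (plus A).cons₂ X Z Y v (icut A Z Y w) := by
  refine (congrArg Prod.snd (fold_cons (Q := plus A) (M := fun X => (plus A).T X Y × (plus A).T2 X Y) _ _ X Z v w)).trans ?_
  exact congrArg (fun t => letterCut A X Z Y v t + (plus A).cons₂ X Z Y v (icut A Z Y w)) (icutPair_fst w)

theorem elim₂_letterCut {X Z Y : A.Ob} {M : Type u} [AddCommGroup M] [Module k M]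
    (β : ∀ W, (plus A).T X W →ₗ[k] (plus A).T W Y →ₗ[k] M) (v : (plus A).hom X Z) (w : (plus A).T Z Y) :
    elim₂ (Q := plus A) β (letterCut A X Z Y v w) = elim₂ (Q := A) (fun W => (β W).compl₁₂
      (((plus A).cons X W W).flip ((plus A).one W) ∘ₗ ofT A Set.univ X W)
      (((plus A).cons W Z Y).flip w ∘ₗ ofT A Set.univ W Z)) (A.cut X Z (toT A Set.univ X Z v)) := by
  rw [letterCut_apply, map_elim₂]
  refine elim₂_congr (fun W a b => ?_) _
  exact elim₂_tmul₂ (Q := plus A) β W _ _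

theorem elim₂_icut_cons {X Z Y : A.Ob} {M : Type u} [AddCommGroup M] [Module k M]
    (β : ∀ W, (plus A).T X W →ₗ[k] (plus A).T W Y →ₗ[k] M) (v : (plus A).hom X Z) (w : (plus A).T Z Y) :
    elim₂ (Q := plus A) β (icut A X Y ((plus A).cons X Z Y v w)) = elim₂ (Q := A) (fun W => (β W).compl₁₂
      (((plus A).cons X W W).flip ((plus A).one W) ∘ₗ ofT A Set.univ X W)
      (((plus A).cons W Z Y).flip w ∘ₗ ofT A Set.univ W Z)) (A.cut X Z (toT A Set.univ X Z v)) +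
      elim₂ (Q := plus A) (fun W => (β W).comp ((plus A).cons X Z W v)) (icut A Z Y w) := by
  rw [icut_cons, map_add, elim₂_letterCut, elim₂_cons₂]

theorem elim₂_cut_concat {X Z Y : A.Ob} {M : Type u} [AddCommGroup M] [Module k M]
    (β : ∀ W, A.T X W →ₗ[k] A.T W Y →ₗ[k] M) (a : A.T X Z) (b : A.T Z Y) :
    elim₂ β (A.cut X Y (concat A X Z Y a b)) + β Z a b =
      elim₂ (fun W => (β W).compl₂ ((concat A W Z Y).flip b)) (A.cut X Z a) +
      elim₂ (fun W => (β W) ∘ₗ concat A X Z W a) (A.cut Z Y b) := by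
  revert β
  refine induction_on (motive := fun X a => ∀ (β : ∀ W, A.T X W →ₗ[k] A.T W Y →ₗ[k] M),
    elim₂ β (A.cut X Y (concat A X Z Y a b)) + β Z a b =
      elim₂ (fun W => (β W).compl₂ ((concat A W Z Y).flip b)) (A.cut X Z a) +
      elim₂ (fun W => (β W) ∘ₗ concat A X Z W a) (A.cut Z Y b)) ?_ ?_ ?_ ?_ a
  · intro X β
    simp [elim₂_zero]
  · intro X a a' ha ha' β
    have e : (fun W => β W ∘ₗ concat A X Z W (a + a')) = fun W => β W ∘ₗ concat A X Z W a + β W ∘ₗ concat A X Z W a' := by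
      funext W; rw [map_add, LinearMap.comp_add]
    rw [e, elim₂_add]
    simp only [map_add, LinearMap.add_apply]
    rw [add_add_add_comm, ha, ha']; abel
  · intro c β
    have e : (fun W => β W ∘ₗ concat A Z Z W (c • A.one Z)) = fun W => c • β W := by
      funext W; ext b b'; simp
    rw [e, elim₂_smul]
    simp [add_comm]
  · intro X V v a ih β
    have h := ih (fun W => (β W).comp (A.cons X V W v))
    rw [concat_cons, cut_sum_cons, cut_sum_cons, add_assoc]
    have e : (fun W => β W ∘ₗ concat A X Z W (A.cons X V Z v a)) =
        fun W => (β W).comp (A.cons X V W v) ∘ₗ concat A V Z W a := by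
      funext W; ext b b'; simp
    have e2 : (fun W => (β W).compl₂ ((concat A W Z Y).flip b) ∘ₗ A.cons X V W v) =
       fun W => ((β W).comp (A.cons X V W v)).compl₂ ((concat A W Z Y).flip b) := by
      funext W; ext b b'; simp
    rw [e, e2, add_assoc, ← h]
    simp

/-- the cuts of a product: between the factors and inside them -/
theorem elim₂_cut_mulAll {X Y : A.Ob} {M : Type u} [AddCommGroup M] [Module k M]
    (β : ∀ W, A.T X W →ₗ[k] A.T W Y →ₗ[k] M) (w : (plus A).T X Y) :
    elim₂ β (A.cut X Y (mulAll A X Y w)) =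
      elim₂ (Q := plus A) (fun W => (β W).compl₁₂ (mulAll A X W) (mulAll A W Y)) ((plus A).cut X Y w) +
      elim₂ (Q := plus A) (fun W => (β W).compl₁₂ (mulAll A X W) (mulAll A W Y)) (icut A X Y w) := by
  revert β
  refine induction_on (Q := plus A) (motive := fun X w => ∀ (β : ∀ W, A.T X W →ₗ[k] A.T W Y →ₗ[k] M),
    elim₂ β (A.cut X Y (mulAll A X Y w)) =
      elim₂ (Q := plus A) (fun W => (β W).compl₁₂ (mulAll A X W) (mulAll A W Y)) ((plus A).cut X Y w) +
      elim₂ (Q := plus A) (fun W => (β W).compl₁₂ (mulAll A X W) (mulAll A W Y)) (icut A X Y w)) ?_ ?_ ?_ ?_ w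
  · intro X β; simp only [map_zero, add_zero]
  · intro X a b ha hb β
    simp only [map_add, ha, hb]; abel
  · intro c β
    rw [map_smul, map_smul, map_smul, map_smul, map_smul, map_smul, map_smul, icut_one, mulAll_one, cut_one,
      cut_one, elim₂_tmul₂, elim₂_tmul₂, map_zero, smul_zero, add_zero, LinearMap.compl₁₂_apply, mulAll_one]
  · intro X Z v w ih β
    set a := toT A Set.univ X Z v with ha
    have ha0 : epsI A X Z a = 0 := epsI_toT v
    have h1 := elim₂_cut_concat β a (mulAll A Z Y w)
    rw [ih] at h1
    rw [mulAll_cons, elim₂_icut_cons (A := A) (fun W => (β W).compl₁₂ (mulAll A X W) (mulAll A W Y)) v w, cut_sum_cons]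
    have c1 : ∀ b : A.T Z Y, elim₂ (fun W => (β W).compl₂ ((concat A W Z Y).flip b) ∘ₗ epsI A X W) (A.cut X Z a) =
        β X (A.one X) (concat A X Z Y a b) := fun b => by
      rw [counit_left _ (by intros; simp)]; simp
    have c2 : ∀ b : A.T Z Y, elim₂ (fun W => (β W).compl₂ ((concat A W Z Y).flip b ∘ₗ epsI A W Z)) (A.cut X Z a) =
        β Z a b := fun b => by
      rw [counit_right _ (by intros; simp)]; simp
    have c3 : ∀ b : A.T Z Y, elim₂ (fun W => (β W).compl₂ ((concat A W Z Y).flip b ∘ₗ epsI A W Z) ∘ₗ epsI A X W) (A.cut X Z a) =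
        0 := fun b => by
      rw [counit_left _ (by intros; simp)]; simp [ha0]
    have c4 : elim₂ (Q := A) (fun W => ((β W).compl₁₂ (mulAll A X W) (mulAll A W Y)).compl₁₂
        (((plus A).cons X W W).flip ((plus A).one W) ∘ₗ ofT A Set.univ X W)
        (((plus A).cons W Z Y).flip w ∘ₗ ofT A Set.univ W Z)) (A.cut X Z a) +
        (elim₂ (fun W => (β W).compl₂ ((concat A W Z Y).flip (mulAll A Z Y w)) ∘ₗ epsI A X W) (A.cut X Z a) +
        elim₂ (fun W => (β W).compl₂ ((concat A W Z Y).flip (mulAll A Z Y w) ∘ₗ epsI A W Z)) (A.cut X Z a)) =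
        elim₂ (fun W => (β W).compl₂ ((concat A W Z Y).flip (mulAll A Z Y w))) (A.cut X Z a) +
        elim₂ (fun W => (β W).compl₂ ((concat A W Z Y).flip (mulAll A Z Y w) ∘ₗ epsI A W Z) ∘ₗ epsI A X W) (A.cut X Z a) := by
      rw [← elim₂_add, ← elim₂_add, ← elim₂_add]
      refine elim₂_congr (fun W s t => ?_) _
      simp only [LinearMap.add_apply, LinearMap.compl₁₂_apply, LinearMap.compl₂_apply, LinearMap.comp_apply,
        LinearMap.flip_apply]
      rw [mulAll_cons, mulAll_cons, mulAll_one, concat_one_right, toT_ofT, toT_ofT]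
      simp only [map_sub, LinearMap.sub_apply]
      abel
    rw [c1, c2, c3, add_zero] at c4
    rw [← c4] at h1
    have c5 : ∀ (D : (plus A).T2 Z Y), elim₂ (Q := plus A) (fun W => ((β W).compl₁₂ (mulAll A X W) (mulAll A W Y)).comp ((plus A).cons X Z W v)) D =
       elim₂ (Q := plus A) (fun W => ((β W) ∘ₗ concat A X Z W a).compl₁₂ (mulAll A Z W) (mulAll A W Y)) D := fun D => by
      refine elim₂_congr (fun W s t => ?_) _
      rw [LinearMap.comp_apply, LinearMap.compl₁₂_apply, mulAll_cons, LinearMap.compl₁₂_apply, LinearMap.comp_apply]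
    rw [c5, c5, LinearMap.compl₁₂_apply, mulAll_one, mulAll_cons]
    have := add_right_cancel (b := β Z a (mulAll A Z Y w)) (h1.trans (by abel :
      _ = β X (A.one X) (concat A X Z Y a (mulAll A Z Y w)) +
      elim₂ (Q := plus A) (fun W => ((β W) ∘ₗ concat A X Z W a).compl₁₂ (mulAll A Z W) (mulAll A W Y)) ((plus A).cut Z Y w) +
      (elim₂ (Q := A) (fun W => ((β W).compl₁₂ (mulAll A X W) (mulAll A W Y)).compl₁₂
        (((plus A).cons X W W).flip ((plus A).one W) ∘ₗ ofT A Set.univ X W)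
        (((plus A).cons W Z Y).flip w ∘ₗ ofT A Set.univ W Z)) (A.cut X Z a) +
      elim₂ (Q := plus A) (fun W => ((β W) ∘ₗ concat A X Z W a).compl₁₂ (mulAll A Z W) (mulAll A W Y)) (icut A Z Y w)) +
      β Z a (mulAll A Z Y w)))
    exact this

theorem elim₂_icut_zero {X Y : A.Ob} {M : Type u} [AddCommGroup M] [Module k M]
    (β : ∀ W, (plus A).T X W →ₗ[k] (plus A).T W Y →ₗ[k] M)
    (hβ : ∀ W a V v b, β W a ((plus A).cons W V Y v b) = 0) (w : (plus A).T X Y) :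
    elim₂ (Q := plus A) β (icut A X Y w) = 0 := by
  revert β
  refine induction_on (Q := plus A) (motive := fun X w => ∀ (β : ∀ W, (plus A).T X W →ₗ[k] (plus A).T W Y →ₗ[k] M)
    (hβ : ∀ W a V v b, β W a ((plus A).cons W V Y v b) = 0),
    elim₂ (Q := plus A) β (icut A X Y w) = 0) ?_ ?_ ?_ ?_ w
  · intro X β _; rw [map_zero, map_zero]
  · intro X a b ha hb β hβ; rw [map_add, map_add, ha β hβ, hb β hβ, add_zero]
  · intro c β _; rw [map_smul, map_smul, icut_one, map_zero, smul_zero]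
  · intro X Z v w ih β hβ
    rw [elim₂_icut_cons (A := A) β v w, ih (fun W => (β W).comp ((plus A).cons X Z W v)) (fun W a V u b => hβ W _ V u b), add_zero]
    refine (elim₂_congr (fun W a b => ?_) _).trans (elim₂_zero _)
    exact hβ W _ Z _ w

/-- the contribution of a fixed first letter, cut in two, and of a cut of the other letters -/
def letterMid {X Z Y : A.Ob} {M : Type u} [AddCommGroup M] [Module k M]
    (γ : ∀ V W, (plus A).T X V →ₗ[k] (plus A).T V W →ₗ[k] (plus A).T W Y →ₗ[k] M) (D : (plus A).T2 Z Y)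
    (V : A.Ob) : A.T X V →ₗ[k] A.T V Z →ₗ[k] M :=
  LinearMap.mk₂ k (fun a b => elim₂ (Q := plus A) (fun W =>
      (γ V W ((plus A).cons X V V (ofT A Set.univ X V a) ((plus A).one V))) ∘ₗ
        (plus A).cons V Z W (ofT A Set.univ V Z b)) D)
    (fun a a' b => by
      rw [← elim₂_add]
      exact elim₂_congr (fun W s t => by simp only [map_add, LinearMap.add_apply, LinearMap.comp_apply]) _)
    (fun c a b => by
      rw [← elim₂_smul]
      exact elim₂_congr (fun W s t => by simp only [map_smul, LinearMap.smul_apply, LinearMap.comp_apply]) _)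
    (fun a b b' => by
      rw [← elim₂_add]
      exact elim₂_congr (fun W s t => by simp only [map_add, LinearMap.add_apply, LinearMap.comp_apply]) _)
    (fun c a b => by
      rw [← elim₂_smul]
      exact elim₂_congr (fun W s t => by simp only [map_smul, LinearMap.smul_apply, LinearMap.comp_apply]) _)

theorem letterMid_apply {X Z Y : A.Ob} {M : Type u} [AddCommGroup M] [Module k M]
    (γ : ∀ V W, (plus A).T X V →ₗ[k] (plus A).T V W →ₗ[k] (plus A).T W Y →ₗ[k] M) (D : (plus A).T2 Z Y)
    (V : A.Ob) (a : A.T X V) (b : A.T V Z) : letterMid γ D V a b = elim₂ (Q := plus A) (fun W =>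
      (γ V W ((plus A).cons X V V (ofT A Set.univ X V a) ((plus A).one V))) ∘ₗ
        (plus A).cons V Z W (ofT A Set.univ V Z b)) D := rfl

/-- the cuts inside letters, followed by a cut between letters of the second part -/
theorem icut_cut {X Y : A.Ob} {M : Type u} [AddCommGroup M] [Module k M]
    (γ : ∀ V W, (plus A).T X V →ₗ[k] (plus A).T V W →ₗ[k] (plus A).T W Y →ₗ[k] M)
    (β : ∀ V, (plus A).T X V →ₗ[k] (plus A).T V Y →ₗ[k] M)
    (hβ : ∀ V a b, β V a b = elim₂ (Q := plus A) (fun W => γ V W a) ((plus A).cut V Y b))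
    (w : (plus A).T X Y) : elim₂ (Q := plus A) β (icut A X Y w) =
      elim₂ (Q := plus A) (fun W => elim₂ (Q := plus A) (fun V => γ V W) ∘ₗ icut A X W) ((plus A).cut X Y w) +
      elim₂ (Q := plus A) (fun V => (γ V V).flip ((plus A).one V)) (icut A X Y w) := by
  revert γ β
  refine induction_on (Q := plus A) (motive := fun X w => ∀
    (γ : ∀ V W, (plus A).T X V →ₗ[k] (plus A).T V W →ₗ[k] (plus A).T W Y →ₗ[k] M)
    (β : ∀ V, (plus A).T X V →ₗ[k] (plus A).T V Y →ₗ[k] M)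
    (_ : ∀ V a b, β V a b = elim₂ (Q := plus A) (fun W => γ V W a) ((plus A).cut V Y b)),
    elim₂ (Q := plus A) β (icut A X Y w) =
      elim₂ (Q := plus A) (fun W => elim₂ (Q := plus A) (fun V => γ V W) ∘ₗ icut A X W) ((plus A).cut X Y w) +
      elim₂ (Q := plus A) (fun V => (γ V V).flip ((plus A).one V)) (icut A X Y w)) ?_ ?_ ?_ ?_ w
  · intro X γ β _; simp only [map_zero, add_zero]
  · intro X a b ha hb γ β hβ
    simp only [map_add, ha γ β hβ, hb γ β hβ]; abel
  · intro c γ β _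
    rw [map_smul, map_smul, map_smul, map_smul, map_smul, icut_one, cut_one, elim₂_tmul₂, LinearMap.comp_apply,
      icut_one, map_zero, map_zero, map_zero, LinearMap.zero_apply, smul_zero, add_zero]
  · intro X Z v w ih γ β hβ
    have h := ih (fun V W => (γ V W).comp ((plus A).cons X Z V v)) (fun W => (β W).comp ((plus A).cons X Z W v))
      (fun V a b => hβ V _ b)
    rw [elim₂_icut_cons (A := A) β v w, elim₂_icut_cons (A := A) (fun V => (γ V V).flip ((plus A).one V)) v w, h, cut_sum_cons, LinearMap.comp_apply, icut_one, map_zero,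
      LinearMap.zero_apply, zero_add]
    have e1 : elim₂ (Q := plus A) (fun W => (elim₂ (Q := plus A) (fun V => γ V W) ∘ₗ icut A X W) ∘ₗ
        (plus A).cons X Z W v) ((plus A).cut Z Y w) =
        elim₂ (Q := A) (fun V => letterMid γ ((plus A).cut Z Y w) V)
          (A.cut X Z (toT A Set.univ X Z v)) +
        elim₂ (Q := plus A) (fun W => elim₂ (Q := plus A) (fun V => (γ V W).comp ((plus A).cons X Z V v)) ∘ₗ icut A Z W)
          ((plus A).cut Z Y w) := by
      generalize (plus A).cut Z Y w = D
      induction D using induction₂ with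
      | zero =>
        simp only [map_zero, add_zero]
        exact (((elim₂_congr (fun W a b => by rfl) _).trans (elim₂_zero _))).symm
      | add s t hs ht =>
        rw [map_add, hs, ht, map_add, add_add_add_comm, ← elim₂_add]
        refine congrArg (fun t => t + _) ?_
        exact elim₂_congr (fun W a b => by
          simp only [LinearMap.add_apply, letterMid_apply, map_add]) _
      | tmul W s t =>
        rw [elim₂_tmul₂, elim₂_tmul₂]
        simp only [LinearMap.comp_apply]
        rw [elim₂_icut_cons (A := A) (fun V => γ V W) v s, LinearMap.add_apply]
        refine congrArg (fun t => t + _) ?_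
        refine (map_elim₂ _ (LinearMap.applyₗ t : ((plus A).T W Y →ₗ[k] M) →ₗ[k] M) _).trans ?_
        refine elim₂_congr (fun V a b => ?_) _
        rw [letterMid_apply, elim₂_tmul₂]
        rfl
    rw [e1]
    have e2 : elim₂ (Q := A) (fun W => (β W).compl₁₂
        (((plus A).cons X W W).flip ((plus A).one W) ∘ₗ ofT A Set.univ X W)
        (((plus A).cons W Z Y).flip w ∘ₗ ofT A Set.univ W Z)) (A.cut X Z (toT A Set.univ X Z v)) =
        elim₂ (Q := A) (fun V => letterMid γ ((plus A).cut Z Y w) V)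
          (A.cut X Z (toT A Set.univ X Z v)) +
        elim₂ (Q := A) (fun W => ((γ W W).flip ((plus A).one W)).compl₁₂
        (((plus A).cons X W W).flip ((plus A).one W) ∘ₗ ofT A Set.univ X W)
        (((plus A).cons W Z Y).flip w ∘ₗ ofT A Set.univ W Z)) (A.cut X Z (toT A Set.univ X Z v)) := by
      rw [← elim₂_add]
      refine elim₂_congr (fun V a b => ?_) _
      rw [LinearMap.compl₁₂_apply, LinearMap.add_apply, LinearMap.add_apply, letterMid_apply,
        LinearMap.compl₁₂_apply, hβ]
      refine ((cut_sum_cons (Q := plus A) _ _ _)).trans (add_comm _ _)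
    rw [e2]
    have : ∀ {M : Type u} [AddCommGroup M] (a b c d : M), a + b + (c + d) = a + c + (b + d) := fun a b c d => by abel
    exact this _ _ _ _

end icut

section preMul
variable {A B : GQuiver k} {o o' o'' o''' : A.Ob → B.Ob}

/-- precomposition with the multiplication `T(T⁺A) → TA` -/
def preMul (A B : GQuiver k) (o o' : A.Ob → B.Ob) : HomFam A B o o' →ₗ[k] HomFam (plus A) B o o' where
  toFun Φ X Y := Φ X Y ∘ₗ mulAll A X Y
  map_add' Φ Ψ := by funext X Y; exact LinearMap.add_comp _ _ _
  map_smul' c Φ := by funext X Y; exact LinearMap.smul_comp _ _ _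

theorem preMul_apply (Φ : HomFam A B o o') (X Y : A.Ob) (w : (plus A).T X Y) :
    preMul A B o o' Φ X Y w = Φ X Y (mulAll A X Y w) := rfl

/-- convolution along the cuts inside letters -/
def icMul (A B : GQuiver k) (o o' o'' : A.Ob → B.Ob) :
    HomFam (plus A) B o o' →ₗ[k] HomFam (plus A) B o' o'' →ₗ[k] HomFam (plus A) B o o'' :=
  mulAlong (P := plus A) (icut A)

infixl:70 " ⊚ " => icMul _ _ _ _ _

theorem icMul_apply (φ : HomFam (plus A) B o o') (ψ : HomFam (plus A) B o' o'') (X Y : A.Ob) (w : (plus A).T X Y) :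
    (φ ⊚ ψ) X Y w = elim₂ (Q := plus A) (fun Z => (concat B (o X) (o' Z) (o'' Y)).compl₁₂ (φ X Z) (ψ Z Y))
      (icut A X Y w) := rfl

theorem preMul_convMul (φ : HomFam A B o o') (ψ : HomFam A B o' o'') : preMul A B o o'' (φ ⍟ ψ) =
    (preMul A B o o' φ ⍟ preMul A B o' o'' ψ : HomFam (plus A) B o o'') + preMul A B o o' φ ⊚ preMul A B o' o'' ψ := by
  funext X Y
  refine LinearMap.ext fun w => ?_
  exact elim₂_cut_mulAll (fun Z => (concat B (o X) (o' Z) (o'' Y)).compl₁₂ (φ X Z) (ψ Z Y)) w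

theorem icMul_convMul (φ : HomFam (plus A) B o o') (ψ : HomFam (plus A) B o' o'') (χ : HomFam (plus A) B o'' o''') :
    ((φ ⊚ ψ) ⍟ χ : HomFam (plus A) B o o''') = φ ⊚ (ψ ⍟ χ) - φ ⊚ lactMul (P := plus A) (atOne ψ) χ := by
  rw [eq_sub_iff_add_eq]
  funext X Y
  refine LinearMap.ext fun w => ?_
  have h := icut_cut (A := A) (triple φ ψ χ X Y) (fun V => (concat B _ _ _).compl₁₂ (φ X V) ((ψ ⍟ χ) V Y))
    (fun V a b => concat_mulAlong (P := plus A) (plus A).cut φ ψ χ X Y V a b) w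
  refine Eq.trans ?_ h.symm
  refine congrArg₂ (fun a b : B.T (o X) (o''' Y) => a + b) ?_ ?_
  · exact elim₂_congr (P := plus A) (fun W a c => mulAlong_concat (P := plus A) (icut A) φ ψ χ X Y W a c) _
  · refine elim₂_congr (P := plus A) (fun V a b => ?_) _
    exact (concat_assoc _ _ _).symm

theorem icMul_zero_of_cons (φ : HomFam (plus A) B o o') (ψ : HomFam (plus A) B o' o'')
    (h : ∀ X Z Y v w, ψ X Y ((plus A).cons X Z Y v w) = 0) : φ ⊚ ψ = 0 := by
  funext X Y
  refine LinearMap.ext fun w => ?_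
  exact elim₂_icut_zero (A := A) _ (fun W a V v b => (congrArg (concat B _ _ _ (φ X W a)) (h W V Y v b)).trans
    (map_zero _)) w

theorem icMul_eps (φ : HomFam (plus A) B o o') : φ ⊚ (epsFam (P := plus A) o' : HomFam (plus A) B o' o') = 0 :=
  icMul_zero_of_cons φ _ (fun X Z Y v w => epsFam_cons (P := plus A) o' X Z Y v w)

theorem icMul_lactMul_eps (φ : HomFam (plus A) B o o') (c : ∀ X, B.T (o' X) (o'' X)) :
    φ ⊚ (lactMul (P := plus A) c (epsFam (P := plus A) o'') : HomFam (plus A) B o' o'') = 0 :=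
  icMul_zero_of_cons φ _ (fun X Z Y v w =>
    (congrArg (concat B _ _ _ (c X)) (epsFam_cons (P := plus A) o'' X Z Y v w)).trans (map_zero _))

theorem preMul_eps : preMul A B o o (epsFam o) = epsFam (P := plus A) (B := B) o := by
  refine homFam_ext (P := plus A) (fun Y => ?_) (fun X Z Y v w _ => ?_)
  · rw [preMul_apply, mulAll_one, epsFam_one, epsFam_one]
  · rw [preMul_apply, epsFam_cons]
    refine (eps_epsI o _).trans ((congrArg (eps (B := B) o X) (epsI_mulAll _)).trans ?_)
    rw [eps_cons, map_zero]

theorem atOne_preMul (Φ : HomFam A B o o') : atOne (P := plus A) (preMul A B o o' Φ) = atOne Φ := by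
  funext X
  exact congrArg (Φ X X) (mulAll_one (A := A) X)

theorem sgnFam_preMul (d : ℤ) (Φ : HomFam A B o o') :
    sgnFam (P := plus A) d (preMul A B o o' Φ) = preMul A B o o' (sgnFam d Φ) := by
  funext X Y
  refine LinearMap.ext fun w => ?_
  exact congrArg (Φ X Y) (mulAll_sgn d w)

/-- If `F`, `F ⍟ ζ` satisfy recursions, then so does `ζ`. -/
theorem cancel_recursion {F s : HomFam (plus A) B o o} {ζ X₀ Xc : HomFam (plus A) B o o'}
    (hF1 : atOne (P := plus A) F = fun X => B.one (o X))
    (hF : F = epsFam (P := plus A) o + s ⍟ F + s ⊚ F)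
    (hX : F ⍟ ζ = X₀ + s ⍟ (F ⍟ ζ) + s ⊚ (F ⍟ ζ) - s ⊚ Xc) : ζ = X₀ + s ⊚ (ζ - Xc) := by
  have h1 : lactMul (P := plus A) (atOne F) ζ = ζ := by
    rw [hF1]
    funext X Y
    refine LinearMap.ext fun w => ?_
    exact concat_one _ _ _
  have h : F ⍟ ζ = ζ + s ⍟ (F ⍟ ζ) + (s ⊚ (F ⍟ ζ) - s ⊚ ζ) := by
    conv_lhs => rw [hF]
    rw [map_add, map_add, LinearMap.add_apply, LinearMap.add_apply, epsFam_mul, convMul_assoc, icMul_convMul, h1]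
  replace hX := h.symm.trans hX
  have : ∀ {M : Type u} [AddCommGroup M] (ζ a b c X₀ d : M), ζ + a + (b - c) = X₀ + a + b - d → ζ = X₀ + (c - d) := by
    intro M _ ζ a b c X₀ d h
    have h' : ζ + a + (b - c) - a - b + c = X₀ + a + b - d - a - b + c := congrArg (fun t => t - a - b + c) h
    rw [show ζ + a + (b - c) - a - b + c = ζ by abel] at h'
    rw [h']; abel
  have hs : s ⊚ (ζ - Xc) = s ⊚ ζ - s ⊚ Xc := map_sub (icMul A B o o o' s) ζ Xc
  rw [hs]
  exact this (M := HomFam (plus A) B o o') ζ (s ⍟ (F ⍟ ζ)) (s ⊚ (F ⍟ ζ)) (s ⊚ ζ) X₀ (s ⊚ Xc) hX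

theorem preMul_recursion {s : HomFam A B o o} {r : HomFam A B o o'} {Ψ : HomFam A B o' o''} {Φ : HomFam A B o o''}
    (hΦ : Φ = r ⍟ Ψ + s ⍟ Φ) (χ : HomFam (plus A) B o'' o''') :
    preMul A B o o'' Φ ⍟ χ =
      preMul A B o o' r ⍟ (preMul A B o' o'' Ψ ⍟ χ) + (preMul A B o o' r ⊚ (preMul A B o' o'' Ψ ⍟ χ) -
        preMul A B o o' r ⊚ lactMul (P := plus A) (atOne (P := A) Ψ) χ) +
      preMul A B o o s ⍟ (preMul A B o o'' Φ ⍟ χ) + preMul A B o o s ⊚ (preMul A B o o'' Φ ⍟ χ) -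
      preMul A B o o s ⊚ lactMul (P := plus A) (atOne (P := A) Φ) χ := by
  have h : preMul A B o o'' Φ = preMul A B o o' r ⍟ preMul A B o' o'' Ψ + preMul A B o o' r ⊚ preMul A B o' o'' Ψ +
    (preMul A B o o s ⍟ preMul A B o o'' Φ + preMul A B o o s ⊚ preMul A B o o'' Φ) := by
    conv_lhs => rw [hΦ]
    rw [map_add, preMul_convMul, preMul_convMul]
  conv_lhs => rw [h]
  rw [map_add, map_add, map_add, LinearMap.add_apply, LinearMap.add_apply, LinearMap.add_apply, convMul_assoc,
    convMul_assoc, icMul_convMul, icMul_convMul, atOne_preMul, atOne_preMul]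
  abel

end preMul

section alt
variable {P B : GQuiver k} {o o' o'' : P.Ob → B.Ob}

/-- components in `T⁺B` regarded as maps into `TB` -/
def postT (φ : Fam P (plus B) o o') : HomFam P B o o' := fun X Y => toT B Set.univ _ _ ∘ₗ φ X Y

/-- composition with `altMul` -/
def postAlt (P B : GQuiver k) (o o' : P.Ob → B.Ob) : HomFam P (plus B) o o' →ₗ[k] HomFam P B o o' where
  toFun Φ X Y := altMul B _ _ ∘ₗ Φ X Y
  map_add' Φ Ψ := by funext X Y; exact LinearMap.comp_add _ _ _
  map_smul' c Φ := by funext X Y; exact LinearMap.comp_smul _ _ _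

theorem postAlt_apply (Φ : HomFam P (plus B) o o') (X Y : P.Ob) (w : P.T X Y) :
    postAlt P B o o' Φ X Y w = altMul B _ _ (Φ X Y w) := rfl

theorem postAlt_eps : postAlt P B o o (epsFam (B := plus B) o) = epsFam o := by
  refine homFam_ext (fun Y => ?_) (fun X Z Y v w _ => ?_)
  · rw [postAlt_apply, epsFam_one, epsFam_one, altMul_one]
  · rw [postAlt_apply, epsFam_cons, epsFam_cons, map_zero]

theorem postAlt_single_mul (r : Fam P (plus B) o o') (χ : HomFam P (plus B) o' o'') :
    postAlt P B o o'' (convMul (B := plus B) (single (B := plus B) r) χ) = - (postT r ⍟ postAlt P B o' o'' χ) := by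
  funext X Y
  refine LinearMap.ext fun w => ?_
  have h : (- (postT r ⍟ postAlt P B o' o'' χ)) X Y w = - ((postT r ⍟ postAlt P B o' o'' χ) X Y w) := rfl
  rw [h, postAlt_apply, convMul_apply, convMul_apply]
  refine (map_elim₂ _ (altMul B (o X) (o'' Y)) _).trans ?_
  refine Eq.trans ?_ (map_elim₂ _ (-LinearMap.id : B.T (o X) (o'' Y) →ₗ[k] B.T (o X) (o'' Y)) _).symm
  refine elim₂_congr (fun W a b => ?_) _
  change altMul B (o X) (o'' Y) (concat (plus B) (o X) (o' W) (o'' Y)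
    ((plus B).cons (o X) (o' W) (o' W) (r X W a) ((plus B).one (o' W))) (χ W Y b)) =
    - concat B (o X) (o' W) (o'' Y) (toT B Set.univ (o X) (o' W) (r X W a)) (altMul B (o' W) (o'' Y) (χ W Y b))
  refine (congrArg (altMul B (o X) (o'' Y)) (concat_cons (A := plus B) _ _ _ _ _ _ _)).trans ?_
  refine (altMul_cons _ _ _ _ _).trans ?_
  refine congrArg (fun t => - concat B (o X) (o' W) (o'' Y) (toT B Set.univ (o X) (o' W) (r X W a)) (altMul B (o' W) (o'' Y) t)) ?_
  exact concat_one (A := plus B) _ _ _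

theorem postAlt_hat {u : FunData P (plus B)} (hu : u.Unital0) : postAlt P B u.obj u.obj (hat u) =
    epsFam (P := P) (B := B) u.obj - postT u.comp ⍟ postAlt P B u.obj u.obj (hat u) := by
  conv_lhs => rw [hat_eq_mul hu]
  rw [map_add, postAlt_eps, postAlt_single_mul, sub_eq_add_neg]

theorem postAlt_coder {u v : FunData P (plus B)} (hu : u.Unital0) (d : ℤ) (r : Fam P (plus B) u.obj v.obj) :
    postAlt P B u.obj v.obj (coder u v d r) =
    - (postT r ⍟ sgnFam d (postAlt P B v.obj v.obj (hat v))) - postT u.comp ⍟ postAlt P B u.obj v.obj (coder u v d r) := by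
  conv_lhs => rw [coder_eq_mul hu]
  rw [map_add, postAlt_single_mul, postAlt_single_mul, sub_eq_add_neg]
  rfl

theorem postAlt_theta {u v w : FunData P (plus B)} (hu : u.Unital0) (d e : ℤ) (r : Fam P (plus B) u.obj v.obj)
    (p : Fam P (plus B) v.obj w.obj) :
    postAlt P B u.obj w.obj (theta u v w d e r p) =
    - (postT r ⍟ sgnFam d (postAlt P B v.obj w.obj (coder v w e p))) -
      postT u.comp ⍟ postAlt P B u.obj w.obj (theta u v w d e r p) := by
  conv_lhs => rw [theta_eq_mul hu]
  rw [map_add, postAlt_single_mul, postAlt_single_mul, sub_eq_add_neg]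
  rfl
end alt

theorem eq_of_eq_sub_sub {M : Type u} [AddCommGroup M] {a b c : M} (h : a = b - (c - a)) : c = b := by
  have h' : a - a + c = b - (c - a) - a + c := congrArg (fun t => t - a + c) h
  rw [show a - a + c = c by abel] at h'
  rw [h']; abel

section recursions
variable {A B : GQuiver k} {f g h : FunData A B} {d e : ℤ}

/-- first `𝐦`, then the strict functor `f` underlined -/
@[reducible] def muFun (f : FunData A B) : FunData (plus A) (plus B) :=
  ⟨f.obj, fun X Y => (underFun f).comp X Y ∘ₗ hat (mFun A) X Y⟩

theorem muFun_unital (hf : f.Unital0) : (muFun f).Unital0 :=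
  comp_unital (mFun_unital A) (underFun_unital hf)

theorem hat_muFun (hf : f.Unital0) {X Y : A.Ob} (w : (plus A).T X Y) :
    hat (muFun f) X Y w = hat (underFun f) X Y (hat (mFun A) X Y w) :=
  hat_comp (f := mFun A) (g := underFun f) (mFun_unital A) (underFun_unital hf) w

theorem coder_muFun (hf : f.Unital0) (hg : g.Unital0) (r : Fam (plus A) (plus B) f.obj g.obj) {X Y : A.Ob}
    (w : (plus A).T X Y) : coder (muFun f) (muFun g) d (fun X Y => r X Y ∘ₗ hat (mFun A) X Y) X Y w =
      coder (underFun f) (underFun g) d r X Y (hat (mFun A) X Y w) :=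
  coder_whL (f := mFun A) (g := underFun f) (g' := underFun g) (d := d) (r := r) (mFun_unital A) (mFun_homog A)
    (underFun_unital hf) (underFun_unital hg) w

theorem theta_muFun (hf : f.Unital0) (hg : g.Unital0) (hh : h.Unital0) (r : Fam (plus A) (plus B) f.obj g.obj)
    (p : Fam (plus A) (plus B) g.obj h.obj) {X Y : A.Ob}
    (w : (plus A).T X Y) : theta (muFun f) (muFun g) (muFun h) d e (fun X Y => r X Y ∘ₗ hat (mFun A) X Y)
        (fun X Y => p X Y ∘ₗ hat (mFun A) X Y) X Y w =
      theta (underFun f) (underFun g) (underFun h) d e r p X Y (hat (mFun A) X Y w) :=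
  theta_whL (n := mFun A) (f := underFun f) (g := underFun g) (h := underFun h) (d := d) (e := e) (r := r) (p := p)
    (mFun_unital A) (mFun_homog A) (underFun_unital hf) (underFun_unital hg) (underFun_unital hh) X Y w

theorem toT_under_hat_mFun {o o' : A.Ob → B.Ob} {Φ : HomFam A B o o'} (hΦ : ∀ X Y w, epsI B _ _ (Φ X Y w) = 0)
    {X Y : A.Ob} (w : (plus A).T X Y) :
    toT B Set.univ _ _ (under Φ X Y (hat (mFun A) X Y w)) = Φ X Y (mulAll A X Y w) := by
  have h1 : (plus A).fold (M := fun X => B.T (o X) (o' Y)) (Φ Y Y (A.one Y)) (fun _ _ => 0) X (hat (mFun A) X Y w) =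
      Φ X Y (eps (A := plus A) (B := A) (fun X => X) X w) := by
    refine (fold_epsI (A := plus A) (M := fun X => B.T (o X) (o' Y)) _ _).trans ?_
    refine (congrArg _ (eps_hat (mFun_unital A) w)).trans ?_
    refine (fold_epsI (A := plus A) (M := fun X => B.T (o X) (o' Y)) _ w).symm.trans ?_
    exact (map_fold (A := plus A) (M := fun X => A.T X Y) (N := fun X => B.T (o X) (o' Y)) (fun X => Φ X Y) (A.one Y) w).symm
  have h2 : toT A Set.univ X Y ((plus A).proj X Y (hat (mFun A) X Y w)) =
      mulAll A X Y w - eps (A := plus A) (B := A) (fun X => X) X w :=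
    (congrArg _ (proj_hat (mFun_unital A) w)).trans (toT_mFun w)
  refine (congrArg _ (under_apply Φ _)).trans ((map_add _ _ _).trans ?_)
  rw [toT_ofT_of_eps (hΦ _ _ _), h2, map_sub]
  have h3 := map_fold (A := plus A) (M := fun X => (plus B).hom (o X) (o' Y)) (N := fun X => B.T (o X) (o' Y))
    (fun X => toT B Set.univ (o X) (o' Y)) (ofT B Set.univ _ _ (Φ Y Y (A.one Y))) (hat (mFun A) X Y w)
  rw [toT_ofT_of_eps (hΦ _ _ _)] at h3
  refine (congrArg (fun t => t + (Φ X Y (mulAll A X Y w) - Φ X Y (eps (A := plus A) (B := A) (fun X => X) X w)))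
    (h3.trans h1)).trans ?_
  abel

theorem postT_muFun (hf : f.Unital0) : postT (P := plus A) (muFun f).comp =
    preMul A B f.obj f.obj (hat f) - epsFam (P := plus A) f.obj := by
  funext X Y
  refine LinearMap.ext fun w => ?_
  refine (toT_underFun hf _).trans ?_
  have h2 : toT A Set.univ X Y ((plus A).proj X Y (hat (mFun A) X Y w)) =
      mulAll A X Y w - eps (A := plus A) (B := A) (fun X => X) X w :=
    (congrArg _ (proj_hat (mFun_unital A) w)).trans (toT_mFun w)
  refine (congrArg (hat f X Y) h2).trans ((map_sub (hat f X Y) _ _).trans ?_)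
  refine congrArg (fun t => hat f X Y (mulAll A X Y w) - t) ?_
  refine (map_fold (A := plus A) (M := fun X => A.T X Y) (N := fun X => B.T (f.obj X) (f.obj Y)) (fun X => hat f X Y)
    (A.one Y) w).trans ?_
  rw [hat_one hf]
  rfl

/-- `w ↦` the alternating product of the underlined `f` applied to `𝐦 w` -/
def altHat (f : FunData A B) : HomFam (plus A) B f.obj f.obj := postAlt (plus A) B f.obj f.obj (hat (muFun f))

theorem hat_convMul_altHat (hf : f.Unital0) :
    (preMul A B f.obj f.obj (hat f) ⍟ altHat f : HomFam (plus A) B f.obj f.obj) = epsFam (P := plus A) f.obj := by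
  have h := postAlt_hat (P := plus A) (u := muFun f) (muFun_unital hf)
  rw [postT_muFun hf, map_sub, LinearMap.sub_apply, epsFam_mul] at h
  exact eq_of_eq_sub_sub h

theorem hat_convMul_altCoder (hf : f.Unital0) (r : Fam (plus A) (plus B) f.obj g.obj) :
    (preMul A B f.obj f.obj (hat f) ⍟ postAlt (plus A) B f.obj g.obj (coder (muFun f) (muFun g) d r) :
      HomFam (plus A) B f.obj g.obj) = - (postT (P := plus A) r ⍟ sgnFam (P := plus A) d (altHat g)) := by
  have h := postAlt_coder (P := plus A) (u := muFun f) (v := muFun g) (muFun_unital hf) d r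
  rw [postT_muFun hf, map_sub, LinearMap.sub_apply, epsFam_mul] at h
  exact eq_of_eq_sub_sub h

theorem hat_convMul_altTheta (hf : f.Unital0) (r : Fam (plus A) (plus B) f.obj g.obj)
    (p : Fam (plus A) (plus B) g.obj h.obj) :
    (preMul A B f.obj f.obj (hat f) ⍟ postAlt (plus A) B f.obj h.obj (theta (muFun f) (muFun g) (muFun h) d e r p) :
      HomFam (plus A) B f.obj h.obj) = - (postT (P := plus A) r ⍟ sgnFam (P := plus A) d
        (postAlt (plus A) B g.obj h.obj (coder (muFun g) (muFun h) e p))) := by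
  have h := postAlt_theta (P := plus A) (u := muFun f) (v := muFun g) (w := muFun h) (muFun_unital hf) d e r p
  rw [postT_muFun hf, map_sub, LinearMap.sub_apply, epsFam_mul] at h
  exact eq_of_eq_sub_sub h


theorem postT_conj {o o' : A.Ob → B.Ob} (Φ : HomFam (plus A) (plus B) o o')
    (hΦ : ∀ X Y w, epsI (plus B) _ _ (Φ X Y w) = 0) {X Y : A.Ob} (w : (plus A).T X Y) :
    toT B Set.univ _ _ (conj Φ X Y w) = - altMul B _ _ (Φ X Y (hat (mFun A) X Y w)) := by
  refine (toT_mInv _).trans ?_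
  refine (congrArg (fun t => t - altMul B _ _ (Φ X Y (hat (mFun A) X Y w)))
    ((eps_epsI (B := plus B) (C := B) (fun x => x) (Φ X Y (hat (mFun A) X Y w))).trans
      ((congrArg _ (hΦ X Y (hat (mFun A) X Y w))).trans (map_zero _)))).trans ?_
  exact zero_sub _

/-- `f̄` regarded as a map to `TB` -/
def barE (f : FunData A B) : HomFam (plus A) B f.obj f.obj := postT (P := plus A) (barFun f).comp

/-- `r̄` regarded as a map to `TB` -/
def barP (f g : FunData A B) (d : ℤ) (r : Fam A B f.obj g.obj) : HomFam (plus A) B f.obj g.obj :=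
  postT (P := plus A) (barTrans f g d r)

/-- `(r ⊗ p)R` regarded as a map to `TB` -/
def homRT (f g h : FunData A B) (d e : ℤ) (r : Fam A B f.obj g.obj) (p : Fam A B g.obj h.obj) :
    HomFam (plus A) B f.obj h.obj := postT (P := plus A) (homR f g h d e r p)

theorem barE_eq (hf : f.Unital0) : barE f = epsFam (P := plus A) f.obj - altHat f := by
  funext X Y
  refine LinearMap.ext fun w => ?_
  refine (toT_mInv _).trans ?_
  refine congrArg₂ (fun a b : B.T (f.obj X) (f.obj Y) => a - b) ?_ ?_
  · refine (eps_epsI (B := plus B) (C := B) (fun x => x) _).trans ?_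
    have k : epsI (plus B) (f.obj X) (f.obj Y) (hat (underFun f) X Y (hat (mFun A) X Y w)) =
        eps (A := plus A) (B := plus B) f.obj X w :=
      (congrArg (epsI (plus B) (f.obj X) (f.obj Y)) (hat_muFun hf w).symm).trans (eps_hat (muFun_unital hf) w)
    refine (congrArg (fun t : (plus B).T (f.obj X) (f.obj Y) => eps (A := plus B) (B := B) (fun x => x) (f.obj X) t) k).trans ?_
    refine induction_on (Q := plus A) (motive := fun X w => eps (A := plus B) (B := B) (fun x => x) (f.obj X)
      (eps (A := plus A) (B := plus B) f.obj X w) = epsFam (P := plus A) f.obj X Y w) ?_ ?_ ?_ ?_ w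
    · intro X; simp only [map_zero]
    · intro X a b ha hb; rw [map_add, map_add, map_add, ha, hb]
    · intro c; rw [map_smul, map_smul, map_smul, eps_one, eps_one, epsFam_one]
    · intro X Z v w _; rw [eps_cons, map_zero, epsFam_cons]
  · exact congrArg (altMul B (f.obj X) (f.obj Y)) (hat_muFun hf w).symm

theorem postT_conj_coder (hf : f.Unital0) (hg : g.Unital0) (r : Fam (plus A) (plus B) f.obj g.obj) :
    postT (P := plus A) (o := f.obj) (o' := g.obj) (conj (coder (underFun f) (underFun g) d r)) =
    - postAlt (plus A) B f.obj g.obj (coder (muFun f) (muFun g) d (fun X Y => r X Y ∘ₗ hat (mFun A) X Y)) := by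
  funext X Y
  refine LinearMap.ext fun w => ?_
  refine (postT_conj _ (fun X Y w => eps_lead (underFun_unital hf) _ w) w).trans ?_
  exact congrArg (fun t => - altMul B (f.obj X) (g.obj Y) t) (coder_muFun hf hg r w).symm

theorem postT_conj_theta (hf : f.Unital0) (hg : g.Unital0) (hh : h.Unital0) (r : Fam (plus A) (plus B) f.obj g.obj)
    (p : Fam (plus A) (plus B) g.obj h.obj) :
    postT (P := plus A) (o := f.obj) (o' := h.obj) (conj (theta (underFun f) (underFun g) (underFun h) d e r p)) =
    - postAlt (plus A) B f.obj h.obj (theta (muFun f) (muFun g) (muFun h) d e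
        (fun X Y => r X Y ∘ₗ hat (mFun A) X Y) (fun X Y => p X Y ∘ₗ hat (mFun A) X Y)) := by
  funext X Y
  refine LinearMap.ext fun w => ?_
  refine (postT_conj _ (fun X Y w => eps_lead (g := underFun g) (underFun_unital hf) _ w) w).trans ?_
  exact congrArg (fun t => - altMul B (f.obj X) (h.obj Y) t) (theta_muFun hf hg hh r p w).symm

theorem postT_add {P : GQuiver k} {o o' : P.Ob → B.Ob} (φ ψ : Fam P (plus B) o o') :
    postT (φ + ψ) = postT φ + postT ψ := by
  funext X Y
  exact LinearMap.comp_add _ _ _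

theorem barP_eq (hf : f.Unital0) (hg : g.Unital0) (r : Fam A B f.obj g.obj) : barP f g d r =
    - postAlt (plus A) B f.obj g.obj (coder (muFun f) (muFun g) d (fun X Y => underTrans f g d r X Y ∘ₗ hat (mFun A) X Y)) :=
  postT_conj_coder hf hg (underTrans f g d r)

theorem homRT_eq (hf : f.Unital0) (hg : g.Unital0) (hh : h.Unital0) (r : Fam A B f.obj g.obj) (p : Fam A B g.obj h.obj) :
    homRT f g h d e r p = - postAlt (plus A) B f.obj h.obj (coder (muFun f) (muFun h) (d + e)
        (fun X Y => under (theta f g h d e r p) X Y ∘ₗ hat (mFun A) X Y)) -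
      postAlt (plus A) B f.obj h.obj (theta (muFun f) (muFun g) (muFun h) d e
        (fun X Y => underTrans f g d r X Y ∘ₗ hat (mFun A) X Y) (fun X Y => underTrans g h e p X Y ∘ₗ hat (mFun A) X Y)) := by
  refine (postT_add (P := plus A) (o := f.obj) (o' := h.obj) _ _).trans ?_
  refine (congrArg₂ (fun a b : HomFam (plus A) B f.obj h.obj => a + b)
    (postT_conj_coder hf hh (under (theta f g h d e r p)))
    (postT_conj_theta hf hg hh (underTrans f g d r) (underTrans g h e p))).trans ?_
  exact (sub_eq_add_neg _ _).symm

theorem postT_underTrans (hf : f.Unital0) (r : Fam A B f.obj g.obj) :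
    postT (P := plus A) (o := f.obj) (o' := g.obj) (fun X Y => underTrans f g d r X Y ∘ₗ hat (mFun A) X Y) =
      preMul A B f.obj g.obj (coder f g d r) := by
  funext X Y
  refine LinearMap.ext fun w => ?_
  exact toT_under_hat_mFun (Φ := coder f g d r) (fun X Y w => eps_lead hf _ w) w

theorem postT_underTheta (hf : f.Unital0) (r : Fam A B f.obj g.obj) (p : Fam A B g.obj h.obj) :
    postT (P := plus A) (o := f.obj) (o' := h.obj) (fun X Y => under (theta f g h d e r p) X Y ∘ₗ hat (mFun A) X Y) =
      preMul A B f.obj h.obj (theta f g h d e r p) := by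
  funext X Y
  refine LinearMap.ext fun w => ?_
  exact toT_under_hat_mFun (Φ := theta f g h d e r p) (fun X Y w => eps_lead (g := g) hf _ w) w

theorem hat_convMul_barP (hf : f.Unital0) (hg : g.Unital0) (r : Fam A B f.obj g.obj) :
    (preMul A B f.obj f.obj (hat f) ⍟ barP f g d r : HomFam (plus A) B f.obj g.obj) =
      preMul A B f.obj g.obj (coder f g d r) ⍟ sgnFam (P := plus A) d (altHat g) := by
  rw [barP_eq hf hg, map_neg, hat_convMul_altCoder hf, neg_neg, postT_underTrans hf]

theorem hat_convMul_homRT (hf : f.Unital0) (hg : g.Unital0) (hh : h.Unital0) (r : Fam A B f.obj g.obj)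
    (p : Fam A B g.obj h.obj) :
    (preMul A B f.obj f.obj (hat f) ⍟ homRT f g h d e r p : HomFam (plus A) B f.obj h.obj) =
      preMul A B f.obj h.obj (theta f g h d e r p) ⍟ sgnFam (P := plus A) (d + e) (altHat h) -
      preMul A B f.obj g.obj (coder f g d r) ⍟ sgnFam (P := plus A) d (barP g h e p) := by
  rw [homRT_eq hf hg hh, map_sub, map_neg, hat_convMul_altCoder hf, hat_convMul_altTheta hf, neg_neg, postT_underTrans hf,
    postT_underTheta hf, barP_eq hg hh, map_neg, map_neg]

theorem hat_preMul_eq (hf : f.Unital0) : preMul A B f.obj f.obj (hat f) = epsFam (P := plus A) f.obj +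
    preMul A B f.obj f.obj (single f.comp) ⍟ preMul A B f.obj f.obj (hat f) +
    preMul A B f.obj f.obj (single f.comp) ⊚ preMul A B f.obj f.obj (hat f) := by
  conv_lhs => rw [hat_eq_mul hf]
  rw [map_add, preMul_eps, preMul_convMul, add_assoc]

end recursions

section recursions
variable {A B : GQuiver k} {f g h : FunData A B} {d e : ℤ}

theorem altHat_eq (hf : f.Unital0) : altHat f = epsFam (P := plus A) f.obj - barE f := by
  rw [barE_eq hf, sub_sub_cancel]

theorem atOne_hat (hf : f.Unital0) : atOne (P := plus A) (preMul A B f.obj f.obj (hat f)) = fun X => B.one (f.obj X) := by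
  funext X
  refine (congrFun (atOne_preMul (hat f)) X).trans ?_
  exact hat_one hf X

theorem lactMul_one {P : GQuiver k} {o o' : P.Ob → B.Ob} (φ : HomFam P B o o') :
    lactMul (fun X => B.one (o X)) φ = φ := by
  funext X Y
  refine LinearMap.ext fun w => ?_
  exact concat_one _ _ _

theorem barE_recursion (hf : f.Unital0) : barE f = preMul A B f.obj f.obj (single f.comp) +
    preMul A B f.obj f.obj (single f.comp) ⊚ barE f := by
  have h := cancel_recursion (A := A) (ζ := altHat f)
    (X₀ := epsFam (P := plus A) f.obj - preMul A B f.obj f.obj (single f.comp)) (Xc := 0) (atOne_hat hf) (hat_preMul_eq hf)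
    (by rw [hat_convMul_altHat hf, mul_epsFam, icMul_eps, map_zero, sub_zero, add_zero, sub_add_cancel])
  rw [sub_zero] at h
  have h1 : preMul A B f.obj f.obj (single f.comp) ⊚ altHat f = - (preMul A B f.obj f.obj (single f.comp) ⊚ barE f) := by
    rw [altHat_eq hf, map_sub, icMul_eps, zero_sub]
  rw [h1] at h
  rw [barE_eq hf]
  conv_lhs => rw [h]
  have : ∀ {M : Type u} [AddCommGroup M] (a b c : M), a - (a - b + -c) = b + c := fun a b c => by abel
  rw [this, barE_eq hf]

theorem atOne_coder (hf : f.Unital0) (hg : g.Unital0) (r : Fam A B f.obj g.obj) :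
    atOne (coder f g d r) = atOne (single r) := by
  funext X
  exact coder_one hf hg d r X

theorem atOne_sgnFam {P : GQuiver k} {o o' : P.Ob → B.Ob} (φ : HomFam P B o o') : atOne (sgnFam d φ) = atOne φ := by
  funext X
  exact congrArg (φ X X) (P.sgn_one d X)

theorem sgnFam_altHat (hf : f.Unital0) : sgnFam (P := plus A) d (altHat f) =
    epsFam (P := plus A) f.obj - sgnFam (P := plus A) d (barE f) := by
  rw [altHat_eq hf, map_sub, sgnFam_eps]

theorem lactMul_icMul_altHat {o' o'' : A.Ob → B.Ob} (hf : f.Unital0) (φ : HomFam (plus A) B o' o'')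
    (c : ∀ X, B.T (o'' X) (f.obj X)) :
    φ ⊚ (lactMul (P := plus A) c (sgnFam (P := plus A) d (altHat f)) : HomFam (plus A) B o'' f.obj) =
      - (φ ⊚ lactMul (P := plus A) c (sgnFam (P := plus A) d (barE f))) := by
  rw [sgnFam_altHat hf, map_sub, map_sub, icMul_lactMul_eps, zero_sub]

theorem barP_recursion (hf : f.Unital0) (hg : g.Unital0) (r : Fam A B f.obj g.obj) : barP f g d r =
    preMul A B f.obj g.obj (single r) + preMul A B f.obj g.obj (single r) ⊚ sgnFam (P := plus A) d (barE g) +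
    preMul A B f.obj f.obj (single f.comp) ⊚ (barP f g d r +
      lactMul (P := plus A) (atOne (P := A) (single r)) (sgnFam (P := plus A) d (barE g))) := by
  have h0 : preMul A B g.obj g.obj (sgnFam d (hat g)) ⍟ sgnFam (P := plus A) d (altHat g) =
      epsFam (P := plus A) g.obj := by
    rw [← sgnFam_preMul, ← sgnFam_mul, hat_convMul_altHat hg, sgnFam_eps]
  have hX := preMul_recursion (coder_eq_mul hf d r) (sgnFam (P := plus A) d (altHat g))
  rw [h0, mul_epsFam, ← hat_convMul_barP hf hg, icMul_eps, atOne_sgnFam, atOne_coder hf hg] at hX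
  have h := cancel_recursion (atOne_hat hf) (hat_preMul_eq hf) hX
  have h1 : atOne (hat g) = fun X => B.one (g.obj X) := funext fun X => hat_one hg X
  rw [h1, lactMul_one, map_sub, lactMul_icMul_altHat hg, sgnFam_altHat hg, map_sub, icMul_eps] at h
  refine h.trans ?_
  rw [map_add]
  have : ∀ {M : Type u} [AddCommGroup M] (a b c d : M), a + (0 - (0 - b)) + (c - -d) = a + b + (c + d) :=
    fun a b c d => by abel
  exact this _ _ _ _

/-- the factor `π + p₀ f̄` that completes `r` to `r ⊗ p` -/
def barPE (f g : FunData A B) (d e : ℤ) (r : Fam A B f.obj g.obj) : HomFam (plus A) B f.obj g.obj :=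
  sgnFam (P := plus A) d (barP f g e r) +
    lactMul (P := plus A) (atOne (P := A) (single r)) (sgnFam (P := plus A) (d + e) (barE g))

theorem lactMul_lactMul {P : GQuiver k} {o o' o'' o''' : P.Ob → B.Ob} (c : ∀ X, B.T (o X) (o' X))
    (c' : ∀ X, B.T (o' X) (o'' X)) (φ : HomFam P B o'' o''') :
    lactMul (fun X => concat B _ _ _ (c X) (c' X)) φ = lactMul c (lactMul c' φ) := by
  funext X Y
  refine LinearMap.ext fun w => ?_
  exact concat_assoc _ _ _

set_option maxHeartbeats 1000000 in
theorem homRT_recursion (hf : f.Unital0) (hg : g.Unital0) (hh : h.Unital0) (r : Fam A B f.obj g.obj)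
    (p : Fam A B g.obj h.obj) : homRT f g h d e r p =
    preMul A B f.obj g.obj (single r) ⊚ barPE g h d e p +
    preMul A B f.obj f.obj (single f.comp) ⊚ (homRT f g h d e r p +
      lactMul (P := plus A) (atOne (P := A) (single r)) (barPE g h d e p)) := by
  have h1 := preMul_recursion (theta_eq_mul (g := g) (h := h) hf d e r p) (sgnFam (P := plus A) (d + e) (altHat h))
  have h2 := preMul_recursion (coder_eq_mul hf d r) (sgnFam (P := plus A) d (barP g h e p))
  have h3 : preMul A B g.obj h.obj (sgnFam d (coder g h e p)) ⍟ sgnFam (P := plus A) (d + e) (altHat h) =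
      preMul A B g.obj g.obj (sgnFam d (hat g)) ⍟ sgnFam (P := plus A) d (barP g h e p) := by
    rw [← sgnFam_preMul, ← sgnFam_preMul, ← sgnFam_mul, hat_convMul_barP hg hh, sgnFam_mul, sgnFam_sgnFam, add_comm d e]
  have hX := hat_convMul_homRT (d := d) (e := e) hf hg hh r p
  have e1 : atOne (theta f g h d e r p) = fun X => concat B _ _ _ (atOne (P := A) (single r) X) (atOne (P := A) (single p) X) := by
    funext X
    refine (theta_one hf hg hh d e r p X).trans ?_
    refine Eq.trans ?_ (concat_cons _ _ _ _ _ _ _).symm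
    exact congrArg _ (concat_one _ _ _).symm
  have e2 : atOne (hat g) = fun X => B.one (g.obj X) := funext fun X => hat_one hg X
  rw [h3, atOne_sgnFam, atOne_coder hg hh, e1, lactMul_lactMul] at h1
  rw [atOne_sgnFam, e2, lactMul_one, atOne_coder hf hg] at h2
  set X1 := preMul A B f.obj h.obj (theta f g h d e r p) ⍟ sgnFam (P := plus A) (d + e) (altHat h) with hX1
  set X2 := preMul A B f.obj g.obj (coder f g d r) ⍟ sgnFam (P := plus A) d (barP g h e p) with hX2
  have hX' : preMul A B f.obj f.obj (hat f) ⍟ homRT f g h d e r p =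
      preMul A B f.obj g.obj (single r) ⊚ (sgnFam (P := plus A) d (barP g h e p) -
        lactMul (P := plus A) (atOne (P := A) (single p)) (sgnFam (P := plus A) (d + e) (altHat h))) +
      preMul A B f.obj f.obj (single f.comp) ⍟ (preMul A B f.obj f.obj (hat f) ⍟ homRT f g h d e r p) +
      preMul A B f.obj f.obj (single f.comp) ⊚ (preMul A B f.obj f.obj (hat f) ⍟ homRT f g h d e r p) -
      preMul A B f.obj f.obj (single f.comp) ⊚
        (lactMul (P := plus A) (atOne (P := A) (single r)) (lactMul (P := plus A) (atOne (P := A) (single p))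
          (sgnFam (P := plus A) (d + e) (altHat h)) - sgnFam (P := plus A) d (barP g h e p))) := by
    rw [hX]
    conv_lhs => rw [h1, h2]
    rw [map_sub, map_sub, map_sub, map_sub, map_sub]
    have : ∀ {M : Type u} [AddCommGroup M] (a b c d e f g h i j : M),
       a + (b - c) + d + e - f - (a + (b - g) + h + i - j) = g - c + (d - h) + (e - i) - (f - j) :=
      fun a b c d e f g h i j => by abel
    exact this _ _ _ _ _ _ _ _ _ _
  refine (cancel_recursion (atOne_hat hf) (hat_preMul_eq hf) hX').trans ?_
  have e3 : lactMul (P := plus A) (atOne (P := A) (single p)) (sgnFam (P := plus A) (d + e) (altHat h)) =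
      lactMul (P := plus A) (atOne (P := A) (single p)) (epsFam (P := plus A) h.obj) -
      lactMul (P := plus A) (atOne (P := A) (single p)) (sgnFam (P := plus A) (d + e) (barE h)) := by
    rw [sgnFam_altHat hh, map_sub]
  have e4 : sgnFam (P := plus A) d (barP g h e p) -
      lactMul (P := plus A) (atOne (P := A) (single p)) (sgnFam (P := plus A) (d + e) (altHat h)) =
      barPE g h d e p - lactMul (P := plus A) (atOne (P := A) (single p)) (epsFam (P := plus A) h.obj) := by
    rw [e3, barPE]; abel
  rw [← neg_sub (sgnFam (P := plus A) d (barP g h e p)), e4, map_sub, icMul_lactMul_eps, sub_zero, map_neg,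
    sub_neg_eq_add, map_sub, ← add_sub_assoc, map_sub]
  have e5 : preMul A B f.obj f.obj (single f.comp) ⊚ (lactMul (P := plus A) (atOne (P := A) (single r))
      (lactMul (P := plus A) (atOne (P := A) (single p)) (epsFam (P := plus A) h.obj))) = 0 := by
    rw [← lactMul_lactMul, icMul_lactMul_eps]
  rw [e5, sub_zero]

theorem homRT_one (hf : f.Unital0) (hg : g.Unital0) (hh : h.Unital0) (r : Fam A B f.obj g.obj)
    (p : Fam A B g.obj h.obj) (X : A.Ob) : homRT f g h d e r p X X ((plus A).one X) = 0 := by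
  refine (LinearMap.congr_fun (congrFun (congrFun (homRT_recursion (d := d) (e := e) hf hg hh r p) X) X)
    ((plus A).one X)).trans ?_
  have h1 : ∀ {o o' o'' : A.Ob → B.Ob} (φ : HomFam (plus A) B o o') (ψ : HomFam (plus A) B o' o''),
      (φ ⊚ ψ) X X ((plus A).one X) = 0 := by
    intro o o' o'' φ ψ
    rw [icMul_apply, icut_one, map_zero]
  exact (congrArg₂ (fun a b : B.T (f.obj X) (h.obj X) => a + b) (h1 _ _) (h1 _ _)).trans (add_zero _)

end recursions

/-- `q` is obtained from `p` by leaving out some of the first objects -/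
inductive Chain.IsTail {S : Type u} {Y : S} : ∀ {W X : S}, Chain Y W → Chain Y X → Prop
  | refl {X : S} (p : Chain Y X) : IsTail p p
  | cons {W X Z : S} {q : Chain Y W} {p : Chain Y Z} (h : IsTail q p) : IsTail q (Chain.cons X p)

theorem Chain.IsTail.length_le {S : Type u} {Y : S} {W X : S} {q : Chain Y W} {p : Chain Y X} (h : q.IsTail p) :
    q.length ≤ p.length := by
  induction h with
  | refl p => exact le_rfl
  | cons h ih => exact ih.trans (Nat.le_succ _)

theorem Chain.IsTail.good {S : Type u} {Y : S} {T : Set S} {W X : S} {q : Chain Y W} {p : Chain Y X} (h : q.IsTail p)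
    (h0 : 0 < q.length) (hl : q.length < p.length) (hp : p.Good T) : W ∈ T ∧ q.Good T := by
  induction h with
  | refl p => exact absurd hl (lt_irrefl _)
  | cons h ih =>
    rename_i p
    cases p with
    | nil => exact absurd (h0.trans_le h.length_le) (lt_irrefl 0)
    | cons Z p =>
      cases h with
      | refl => exact hp
      | cons h => exact ih h0 (h.length_le.trans_lt (Nat.lt_succ_self _)) hp.2

theorem Chain.Good.length_pos {S : Type u} {Y X : S} {T : Set S} {p : Chain Y X} (h : p.Good T) : 0 < p.length := by
  cases p with
  | nil => exact h.elim
  | cons X p => exact Nat.succ_pos _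

theorem Chain.good_univ_of_pos {S : Type u} {Y X : S} {p : Chain Y X} (h : 0 < p.length) : p.Good Set.univ := by
  cases p with
  | nil => exact absurd h (lt_irrefl 0)
  | cons X p => exact good_univ_cons X p

section cut
variable {A : GQuiver k} {M : Type u} [AddCommGroup M] [Module k M]

theorem inj_nil (Y : A.Ob) (a : A.tens (Chain.nil (Y := Y))) : ∃ c : k, A.inj Chain.nil a = c • A.one Y := by
  obtain ⟨c, rfl⟩ := (A.tensNil Y).surjective a
  refine ⟨c, ?_⟩
  rw [GQuiver.one, ← map_smul, ← map_smul, smul_eq_mul, mul_one]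

theorem elim₂_cut_inj_mem (N : Submodule k M) {X Y : A.Ob} (p : Chain Y X) (s : A.tens p)
    (β : ∀ W, A.T X W →ₗ[k] A.T W Y →ₗ[k] M)
    (hβ : ∀ W (q : Chain W X) (q' : Chain Y W) a b, q'.IsTail p → q.length + q'.length = p.length →
      β W (A.inj q a) (A.inj q' b) ∈ N) :
    elim₂ β (A.cut X Y (A.inj p s)) ∈ N := by
  induction p with
  | nil =>
    obtain ⟨c, hc⟩ := inj_nil Y s
    rw [hc, map_smul, map_smul, cut_one, elim₂_tmul₂]
    exact N.smul_mem c (hβ Y _ _ _ _ (.refl _) rfl)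
  | @cons X Z p ih =>
    obtain ⟨s, rfl⟩ := (A.tensCons X p).surjective s
    induction s using TensorProduct.induction_on with
    | zero => rw [map_zero, map_zero, map_zero, map_zero]; exact N.zero_mem
    | add a b ha hb => rw [map_add, map_add, map_add, map_add]; exact N.add_mem ha hb
    | tmul v s =>
      rw [← A.cons_inj, cut_sum_cons]
      refine N.add_mem ?_ (ih s (fun W => (β W).comp (A.cons X Z W v)) ?_)
      · rw [A.cons_inj]
        exact hβ X .nil _ _ _ (.refl _) (zero_add _)
      · intro W q q' a b ht hl
        rw [LinearMap.comp_apply, A.cons_inj]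
        refine hβ W (.cons X q) q' _ b ht.cons ?_
        change q.length + 1 + q'.length = p.length + 1
        omega

theorem sgn_inj (d : ℤ) {X Y : A.Ob} (p : Chain Y X) (s : A.tens p) :
    A.sgn d X Y (A.inj p s) ∈ LinearMap.range (A.inj p) := by
  induction p with
  | nil =>
    obtain ⟨c, hc⟩ := inj_nil Y s
    rw [hc, map_smul, sgn_one]
    exact ⟨s, hc⟩
  | @cons X Z p ih =>
    obtain ⟨s, rfl⟩ := (A.tensCons X p).surjective s
    induction s using TensorProduct.induction_on with
    | zero => rw [map_zero, map_zero, map_zero]; exact Submodule.zero_mem _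
    | add a b ha hb => rw [map_add, map_add, map_add]; exact Submodule.add_mem _ ha hb
    | tmul v s =>
      obtain ⟨s', hs'⟩ := ih s
      rw [← A.cons_inj, sgn_cons, ← hs', A.cons_inj]
      exact ⟨_, rfl⟩

end cut

section Word
variable {A : GQuiver k} {S : Set A.Ob} {Y : A.Ob}

/-- products of elementary tensors: `t = v₁ ⊗ ⋯ ⊗ vₙ`, each `vᵢ` supported on one chain of objects, inner objects in `S`,
of length `kᵢ` -/
inductive Word (A : GQuiver k) (S : Set A.Ob) (Y : A.Ob) : ∀ {X : A.Ob}, List ℕ → (plus A).T X Y → Prop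
  | one : Word A S Y [] ((plus A).one Y)
  | cons {X Z : A.Ob} {ks : List ℕ} {w : (plus A).T Z Y} (p : Chain Z X) (hp : p.Good S) (s : A.tens p)
      (hw : Word A S Y ks w) : Word A S Y (p.length :: ks) ((plus A).cons X Z Y (ofT A Set.univ X Z (A.inj p s)) w)

/-- a proper part of the first letter, and all other letters, of a final segment -/
inductive Trunc : List ℕ → List ℕ → Prop
  | here {i j : ℕ} {ks : List ℕ} (h0 : 0 < j) (h : j < i) : Trunc (j :: ks) (i :: ks)
  | there {i : ℕ} {l ks : List ℕ} (h : Trunc l ks) : Trunc l (i :: ks)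

theorem Trunc.sum_lt {l ks : List ℕ} (h : Trunc l ks) : l.sum < ks.sum := by
  induction h with
  | here h0 h => simpa using h
  | there h ih => simp; omega

theorem Trunc.ne_nil {l ks : List ℕ} (h : Trunc l ks) : l ≠ [] := by
  induction h with
  | here h0 h => simp
  | there h ih => exact ih

theorem Word.pos {ks : List ℕ} {X : A.Ob} {t : (plus A).T X Y} (ht : Word A S Y ks t) : ∀ i ∈ ks, 0 < i := by
  induction ht with
  | one => simp
  | cons p hp s hw ih =>
    intro i hi
    rcases List.mem_cons.1 hi with rfl | hi
    · exact hp.length_pos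
    · exact ih i hi

theorem sgnHom_ofT (d : ℤ) {X Z : A.Ob} (x : A.T X Z) :
    (plus A).sgnHom d X Z (ofT A Set.univ X Z x) = ofT A Set.univ X Z (A.sgn d X Z x) := by
  have h := toT_sgnHom d (ofT A Set.univ X Z x)
  rw [toT_ofT, map_sub] at h
  have h2 := congrArg (ofT A Set.univ X Z) h
  have h3 : ∀ (y : A.T X Z), ofT A Set.univ X Z (A.sgn d X Z (epsI A X Z y)) = 0 := by
    intro y
    refine induction_on (motive := fun X y => ofT A Set.univ X Z (A.sgn d X Z (epsI A X Z y)) = 0) ?_ ?_ ?_ ?_ y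
    · intro X; simp only [map_zero]
    · intro X a b ha hb; simp only [map_add, ha, hb, add_zero]
    · intro c; rw [map_smul, map_smul, map_smul, epsI_one, sgn_one, ofT_one, smul_zero]
    · intro X Z v w _; rw [epsI_cons, map_zero, map_zero]
  rw [map_sub, h3, sub_zero, ofT_toT] at h2
  exact h2

theorem Word.sgn (d : ℤ) {ks : List ℕ} {X : A.Ob} {t : (plus A).T X Y} (ht : Word A S Y ks t) :
    Word A S Y ks ((plus A).sgn d X Y t) := by
  induction ht with
  | one =>
    rw [sgn_one]; exact .one
  | @cons X Z ks w p hp s hw ih =>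
    rw [sgn_cons]
    obtain ⟨s', hs'⟩ := sgn_inj d p s
    have : (plus A).sgnHom d X Z (ofT A Set.univ X Z (A.inj p s)) = ofT A Set.univ X Z (A.inj p s') := by
      rw [sgnHom_ofT, hs']
    rw [this]
    exact .cons p hp s' ih

theorem elim₂_icut_mem {M : Type u} [AddCommGroup M] [Module k M] (N : Submodule k M) {ks : List ℕ} {X : A.Ob}
    {t : (plus A).T X Y} (ht : Word A S Y ks t) (β : ∀ W, (plus A).T X W →ₗ[k] (plus A).T W Y →ₗ[k] M)
    (hβ : ∀ W a l t', W ∈ S → Trunc l ks → Word A S Y l t' → β W a t' ∈ N) :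
    elim₂ (Q := plus A) β (icut A X Y t) ∈ N := by
  induction ht with
  | one => rw [icut_one, map_zero]; exact N.zero_mem
  | @cons X Z ks w p hp s hw ih =>
    rw [elim₂_icut_cons (A := A) β]
    refine N.add_mem ?_ (ih (fun W => (β W).comp ((plus A).cons X Z W (ofT A Set.univ X Z (A.inj p s)))) ?_)
    · have : toT A Set.univ X Z (ofT A Set.univ X Z (A.inj p s)) = A.inj p s := by
        rw [ofT_inj p (Chain.good_univ_of_pos hp.length_pos), toT_barInj]
      rw [this]
      refine elim₂_cut_inj_mem N p s _ ?_
      intro W q q' a b ht hl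
      rw [LinearMap.compl₁₂_apply]
      rcases Nat.eq_zero_or_pos q.length with h0 | h0
      · cases q with
        | cons X q => exact absurd h0 (Nat.succ_ne_zero _)
        | nil =>
          obtain ⟨c, hc⟩ := inj_nil X a
          have : (((plus A).cons X X X).flip ((plus A).one X) ∘ₗ ofT A Set.univ X X) (A.inj .nil a) = 0 := by
            rw [hc, map_smul, LinearMap.comp_apply, ofT_one, map_zero, smul_zero]
          rw [this, map_zero, LinearMap.zero_apply]; exact N.zero_mem
      rcases Nat.eq_zero_or_pos q'.length with h0' | h0'
      · cases q' with
        | cons X q' => exact absurd h0' (Nat.succ_ne_zero _)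
        | nil =>
          obtain ⟨c, hc⟩ := inj_nil _ b
          have : (((plus A).cons Z Z Y).flip w ∘ₗ ofT A Set.univ Z Z) (A.inj .nil b) = 0 := by
            rw [hc, map_smul, LinearMap.comp_apply, ofT_one, map_zero, smul_zero]
          rw [this, map_zero]; exact N.zero_mem
      have hg := ht.good h0' (by omega) hp
      exact hβ W _ (q'.length :: ks) _ hg.1 (.here h0' (by omega)) (.cons q' hg.2 b hw)
    · intro W a l t' hW hl ht'
      exact hβ W _ l t' hW hl.there ht'

end Word

section restricts
variable {A B : GQuiver k} {f g h : FunData A B} {d e : ℤ} {S : Set A.Ob} {S' : Set B.Ob}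

theorem inj_mem_range_toT {x y : B.Ob} (p : Chain y x) (hp : p.Good S') (s : B.tens p) :
    B.inj p s ∈ LinearMap.range (toT B S' x y) := ⟨barInj B S' p hp s, toT_barInj p hp s⟩

theorem cons_one_mem_range_toT {x y : B.Ob} (v : B.hom x y) : B.cons x y y v (B.one y) ∈ LinearMap.range (toT B S' x y) := by
  rw [GQuiver.one, B.cons_inj]
  have h : (Chain.cons x (Chain.nil (Y := y))).Good S' := trivial
  exact inj_mem_range_toT _ h _

theorem cons_mem_range_toT {x y z : B.Ob} (hz : z ∈ S') (v : B.hom x z) {t : B.T z y}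
    (ht : t ∈ LinearMap.range (toT B S' z y)) : B.cons x z y v t ∈ LinearMap.range (toT B S' x y) := by
  obtain ⟨u, rfl⟩ := ht
  induction u using bar_induction with
  | zero => rw [map_zero, map_zero]; exact Submodule.zero_mem _
  | add a b ha hb => rw [map_add, map_add]; exact Submodule.add_mem _ ha hb
  | inj p hp s =>
    rw [toT_barInj, B.cons_inj]
    refine inj_mem_range_toT _ ?_ _
    cases p with
    | nil => exact hp.elim
    | cons z p => exact ⟨hz, hp⟩

theorem icMul_single_mem {o o' o'' : A.Ob → B.Ob} (ho : ∀ W ∈ S, o' W ∈ S') (r : Fam A B o o')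
    (ψ : HomFam (plus A) B o' o'') {X Y : A.Ob} {ks : List ℕ} {t : (plus A).T X Y} (ht : Word A S Y ks t)
    (hψ : ∀ W ∈ S, ∀ l t', Trunc l ks → Word A S Y l t' → ψ W Y t' ∈ LinearMap.range (toT B S' (o' W) (o'' Y))) :
    (preMul A B o o' (single r) ⊚ ψ) X Y t ∈ LinearMap.range (toT B S' (o X) (o'' Y)) := by
  rw [icMul_apply]
  refine elim₂_icut_mem _ ht _ ?_
  intro W a l t' hW hl ht'
  rw [LinearMap.compl₁₂_apply, preMul_apply, single_apply, concat_cons, concat_one]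
  exact cons_mem_range_toT (ho W hW) _ (hψ W hW l t' hl ht')

theorem preMul_single_mem {o o' : A.Ob → B.Ob} (r : Fam A B o o') {X Y : A.Ob} (t : (plus A).T X Y) :
    preMul A B o o' (single r) X Y t ∈ LinearMap.range (toT B S' (o X) (o' Y)) := by
  rw [preMul_apply, single_apply]
  exact cons_one_mem_range_toT _

theorem lactMul_single_mem {o o' o'' : A.Ob → B.Ob} (r : Fam A B o o') (ψ : HomFam (plus A) B o' o'')
    {X Y : A.Ob} (hX : o' X ∈ S') {t : (plus A).T X Y} (ht : ψ X Y t ∈ LinearMap.range (toT B S' (o' X) (o'' Y))) :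
    lactMul (P := plus A) (atOne (P := A) (single r)) ψ X Y t ∈ LinearMap.range (toT B S' (o X) (o'' Y)) := by
  have : lactMul (P := plus A) (atOne (P := A) (single r)) ψ X Y t =
      B.cons (o X) (o' X) (o'' Y) (r X X (A.one X)) (ψ X Y t) := by
    refine (concat_cons (o X) (o' X) (o' X) (o'' Y) (r X X (A.one X)) (B.one (o' X)) (ψ X Y t)).trans ?_
    exact congrArg (B.cons (o X) (o' X) (o'' Y) (r X X (A.one X))) (concat_one (o' X) (o'' Y) (ψ X Y t))
  rw [this]
  exact cons_mem_range_toT hX _ ht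

theorem barE_mem (hf : f.Unital0) (hfS : ∀ X ∈ S, f.obj X ∈ S') {X Y : A.Ob} {ks : List ℕ} {t : (plus A).T X Y}
    (ht : Word A S Y ks t) : barE f X Y t ∈ LinearMap.range (toT B S' (f.obj X) (f.obj Y)) := by
  induction hn : ks.sum using Nat.strong_induction_on generalizing ks X with
  | _ n ih =>
    subst hn
    have key := LinearMap.congr_fun (congrFun (congrFun (barE_recursion hf) X) Y) t
    refine (congrArg (· ∈ LinearMap.range (toT B S' (f.obj X) (f.obj Y))) key).mpr ?_
    exact Submodule.add_mem _ (preMul_single_mem f.comp t)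
      (icMul_single_mem hfS f.comp (barE f) ht (fun W _ l t' hl ht' => ih _ hl.sum_lt ht' rfl))

theorem barP_mem (hf : f.Unital0) (hg : g.Unital0) (hfS : ∀ X ∈ S, f.obj X ∈ S') (hgS : ∀ X ∈ S, g.obj X ∈ S')
    (r : Fam A B f.obj g.obj) {X Y : A.Ob} {ks : List ℕ} {t : (plus A).T X Y}
    (ht : Word A S Y ks t) : barP f g d r X Y t ∈ LinearMap.range (toT B S' (f.obj X) (g.obj Y)) := by
  have hE : ∀ W l t', Word A S Y l t' → sgnFam (P := plus A) d (barE g) W Y t' ∈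
      LinearMap.range (toT B S' (g.obj W) (g.obj Y)) := fun W l t' ht' => barE_mem hg hgS (ht'.sgn d)
  induction hn : ks.sum using Nat.strong_induction_on generalizing ks X with
  | _ n ih =>
    subst hn
    have key := LinearMap.congr_fun (congrFun (congrFun (barP_recursion (d := d) hf hg r) X) Y) t
    refine (congrArg (· ∈ LinearMap.range (toT B S' (f.obj X) (g.obj Y))) key).mpr ?_
    refine Submodule.add_mem _ (Submodule.add_mem _ (preMul_single_mem r t)
      (icMul_single_mem hgS r _ ht (fun W _ l t' _ ht' => hE W l t' ht'))) ?_
    refine icMul_single_mem hfS f.comp _ ht (fun W hW l t' hl ht' => ?_)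
    exact Submodule.add_mem _ (ih _ hl.sum_lt ht' rfl) (lactMul_single_mem r _ (hgS W hW) (hE W l t' ht'))

theorem homRT_mem (hf : f.Unital0) (hg : g.Unital0) (hh : h.Unital0) (hfS : ∀ X ∈ S, f.obj X ∈ S')
    (hgS : ∀ X ∈ S, g.obj X ∈ S') (hhS : ∀ X ∈ S, h.obj X ∈ S')
    (r : Fam A B f.obj g.obj) (p : Fam A B g.obj h.obj) {X Y : A.Ob} {ks : List ℕ} {t : (plus A).T X Y}
    (ht : Word A S Y ks t) : homRT f g h d e r p X Y t ∈ LinearMap.range (toT B S' (f.obj X) (h.obj Y)) := by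
  have hE : ∀ W ∈ S, ∀ l t', Word A S Y l t' → barPE g h d e p W Y t' ∈
      LinearMap.range (toT B S' (g.obj W) (h.obj Y)) := fun W hW l t' ht' =>
    (LinearMap.range (toT B S' (g.obj W) (h.obj Y))).add_mem
      (barP_mem (d := e) hg hh hgS hhS p (ht'.sgn d) :
        barP g h e p W Y ((plus A).sgn d W Y t') ∈ LinearMap.range (toT B S' (g.obj W) (h.obj Y)))
      (lactMul_single_mem p (sgnFam (P := plus A) (d + e) (barE h)) (hhS W hW) (barE_mem hh hhS (ht'.sgn (d + e))))
  induction hn : ks.sum using Nat.strong_induction_on generalizing ks X with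
  | _ n ih =>
    subst hn
    have key := LinearMap.congr_fun (congrFun (congrFun (homRT_recursion (d := d) (e := e) hf hg hh r p) X) Y) t
    refine (congrArg (· ∈ LinearMap.range (toT B S' (f.obj X) (h.obj Y))) key).mpr ?_
    refine Submodule.add_mem _ (icMul_single_mem hgS r _ ht (fun W hW l t' _ ht' => hE W hW l t' ht')) ?_
    refine icMul_single_mem hfS f.comp _ ht (fun W hW l t' hl ht' => ?_)
    exact Submodule.add_mem _ (ih _ hl.sum_lt ht' rfl) (lactMul_single_mem r _ (hgS W hW) (hE W hW l t' ht'))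

theorem inclFun_unital (A : GQuiver k) (S : Set A.Ob) : (inclFun A S).Unital0 := fun X => by
  change incl A S X X ((A.barQuiver S).proj X X ((A.barQuiver S).one X)) = 0
  rw [proj_one, map_zero]

theorem inclFun_homog (A : GQuiver k) (S : Set A.Ob) : Homog 0 (inclFun A S).comp := by
  intro X Y e w hw
  rw [add_zero]
  exact ofT_mem (toT_mem (proj_mem hw))

theorem hat_strict_cons {P B : GQuiver k} {o : P.Ob → B.Ob} (c : ∀ X Y, P.hom X Y →ₗ[k] B.hom (o X) (o Y)) {X Z Y : P.Ob}
    (v : P.hom X Z) (w : P.T Z Y) : hat ⟨o, fun X Y => c X Y ∘ₗ P.proj X Y⟩ X Y (P.cons X Z Y v w) =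
      B.cons (o X) (o Z) (o Y) (c X Z v) (hat ⟨o, fun X Y => c X Y ∘ₗ P.proj X Y⟩ Z Y w) := by
  have hu : (FunData.mk (B := B) o (fun X Y => c X Y ∘ₗ P.proj X Y)).Unital0 := fun X => by
    change c X X (P.proj X X (P.one X)) = 0
    rw [proj_one, map_zero]
  conv_lhs => rw [hat_eq_mul hu]
  rw [Pi.add_apply, Pi.add_apply, LinearMap.add_apply, epsFam_cons, zero_add, convMul_cons, single_apply, hu X, map_zero,
    LinearMap.zero_apply, map_zero, LinearMap.zero_apply, zero_add, counit_left]
  · rw [LinearMap.compl₁₂_apply, LinearMap.comp_apply, single_apply, concat_cons, concat_one, LinearMap.comp_apply,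
      proj_cons_one]
  · intro W Z' v' a b
    rw [LinearMap.compl₁₂_apply, LinearMap.comp_apply, single_apply, LinearMap.comp_apply, proj_cons_cons, map_zero,
      map_zero, LinearMap.zero_apply, map_zero, LinearMap.zero_apply]

/-- the embedding `TsD(𝒜|S) → T(T⁺s𝒜)` -/
def inclT (A : GQuiver k) (S : Set A.Ob) (X Y : A.Ob) : (A.barQuiver S).T X Y →ₗ[k] (plus A).T X Y :=
  hat (inclFun A S) X Y

theorem inclT_one (Y : A.Ob) : inclT A S Y Y ((A.barQuiver S).one Y) = (plus A).one Y :=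
  hat_one (inclFun_unital A S) Y

theorem inclT_cons {X Z Y : A.Ob} (v : (A.barQuiver S).hom X Z) (w : (A.barQuiver S).T Z Y) :
    inclT A S X Y ((A.barQuiver S).cons X Z Y v w) =
      (plus A).cons X Z Y (incl A S X Z v) (inclT A S Z Y w) :=
  hat_strict_cons (P := A.barQuiver S) (B := plus A) (o := fun X => X) (incl A S) v w

/-- `TsD(𝒜|S)` is spanned by words -/
theorem inclT_mem_span {X Y : A.Ob} (w : (A.barQuiver S).T X Y) : inclT A S X Y w ∈
    Submodule.span k {t : (plus A).T X Y | ∃ ks, Word A S Y ks t} := by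
  refine induction_on (Q := A.barQuiver S) (motive := fun X w => inclT A S X Y w ∈
    Submodule.span k {t : (plus A).T X Y | ∃ ks, Word A S Y ks t}) ?_ ?_ ?_ ?_ w
  · intro X; rw [map_zero]; exact Submodule.zero_mem _
  · intro X a b ha hb; rw [map_add]; exact Submodule.add_mem _ ha hb
  · intro c
    rw [map_smul, inclT_one]
    exact Submodule.smul_mem _ _ (Submodule.subset_span ⟨[], Word.one⟩)
  · intro X Z v w ih
    rw [inclT_cons]
    generalize inclT A S Z Y w = t at ih
    induction ih using Submodule.span_induction with
    | zero => rw [map_zero]; exact Submodule.zero_mem _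
    | add a b _ _ ha hb => rw [map_add]; exact Submodule.add_mem _ ha hb
    | smul c a _ ha => rw [map_smul]; exact Submodule.smul_mem _ _ ha
    | mem t ht =>
      obtain ⟨ks, ht⟩ := ht
      induction v using bar_induction with
      | zero => rw [map_zero, map_zero, LinearMap.zero_apply]; exact Submodule.zero_mem _
      | add a b ha hb => rw [map_add, map_add, LinearMap.add_apply]; exact Submodule.add_mem _ ha hb
      | inj p hp s =>
        rw [incl, LinearMap.comp_apply, toT_barInj]
        exact Submodule.subset_span ⟨_, Word.cons (A := A) p hp s ht⟩

theorem restricts_of_word {o o' : A.Ob → B.Ob} {F : Fam (plus A) (plus B) o o'}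
    (hF : ∀ X Y ks (t : (plus A).T X Y), Word A S Y ks t →
      toT B Set.univ _ _ (F X Y t) ∈ LinearMap.range (toT B S' (o X) (o' Y))) : Restricts S S' F := by
  intro X Y w
  refine incl_ofT_of_mem ?_
  have ht := inclT_mem_span w
  change toT B Set.univ (o X) (o' Y) (F X Y (inclT A S X Y w)) ∈ _
  generalize inclT A S X Y w = t at ht
  induction ht using Submodule.span_induction with
  | zero => rw [map_zero, map_zero]; exact Submodule.zero_mem _
  | add a b _ _ ha hb => rw [map_add, map_add]; exact Submodule.add_mem _ ha hb
  | smul c a _ ha => rw [map_smul, map_smul]; exact Submodule.smul_mem _ _ ha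
  | mem t ht =>
    obtain ⟨ks, ht⟩ := ht
    exact hF X Y ks t ht

theorem barFun_restricts (hf : f.Unital0) (hfS : ∀ X ∈ S, f.obj X ∈ S') : Restricts S S' (barFun f).comp :=
  restricts_of_word fun _ _ _ _ ht => barE_mem hf hfS ht

theorem barTrans_restricts (hf : f.Unital0) (hg : g.Unital0) (hfS : ∀ X ∈ S, f.obj X ∈ S') (hgS : ∀ X ∈ S, g.obj X ∈ S')
    (r : Fam A B f.obj g.obj) : Restricts S S' (barTrans f g d r) :=
  restricts_of_word fun _ _ _ _ ht => barP_mem hf hg hfS hgS r ht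

theorem homR_restricts (hf : f.Unital0) (hg : g.Unital0) (hh : h.Unital0) (hfS : ∀ X ∈ S, f.obj X ∈ S')
    (hgS : ∀ X ∈ S, g.obj X ∈ S') (hhS : ∀ X ∈ S, h.obj X ∈ S')
    (r : Fam A B f.obj g.obj) (p : Fam A B g.obj h.obj) : Restricts S S' (homR f g h d e r p) :=
  restricts_of_word fun _ _ _ _ ht => homRT_mem hf hg hh hfS hgS hhS r p ht

end restricts

section ops
variable {A : Ops k}

theorem barTrans_idFun : (barTrans (idFun A.toGQuiver) (idFun A.toGQuiver) 1 A.b : Fam (plus A.toGQuiver) (plus A.toGQuiver)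
    (fun X => X) (fun X => X)) = (barOps A).b := by
  have h := underFun_idFun_comp A.toGQuiver
  funext X Y
  refine LinearMap.ext fun w => ?_
  exact congrArg (mInv A.toGQuiver X Y) (coder_congr (A := plus A.toGQuiver) (B := plus A.toGQuiver) (o := fun X => X)
    (o' := fun X => X) h h X Y _)

theorem barOps_restricts (S : Set A.Ob) : Restricts (A := A.toGQuiver) (B := A.toGQuiver)
    (o := fun X => X) (o' := fun X => X) S S (barOps A).b := by
  have := barTrans_restricts (d := 1) (S := S) (S' := S) (idFun_unital A.toGQuiver) (idFun_unital A.toGQuiver)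
    (fun X h => h) (fun X h => h) A.b
  rw [← barTrans_idFun]
  exact this

end ops

theorem hat_congr_comp {A B : GQuiver k} {o : A.Ob → B.Ob} {c c' : Fam A B o o} (h : c = c') (X Y : A.Ob) (w : A.T X Y) :
    hat ⟨o, c⟩ X Y w = hat ⟨o, c'⟩ X Y w := by subst h; rfl

section restr
variable {A B : GQuiver k} {S : Set A.Ob} {S' : Set B.Ob}

/-- restriction of a functor to the D-subquivers -/
@[reducible] def restrFun (S : Set A.Ob) (S' : Set B.Ob) (F : FunData (plus A) (plus B)) :
    FunData (A.barQuiver S) (B.barQuiver S') := ⟨F.obj, restr S S' F.comp⟩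

variable {F G H : FunData (plus A) (plus B)} {d e : ℤ}

theorem restr_apply {o o' : A.Ob → B.Ob} (r : Fam (plus A) (plus B) o o') {X Y : A.Ob} (w : (A.barQuiver S).T X Y) :
    restr S S' r X Y w = ofT B S' _ _ (toT B Set.univ _ _ (r X Y (inclT A S X Y w))) := rfl

theorem incl_restr {o o' : A.Ob → B.Ob} {r : Fam (plus A) (plus B) o o'} (hr : Restricts S S' r) {X Y : A.Ob}
    (w : (A.barQuiver S).T X Y) : incl B S' _ _ (restr S S' r X Y w) = r X Y (inclT A S X Y w) := hr X Y w

theorem inclT_mem {X Y : A.Ob} {i : ℤ} {w : (A.barQuiver S).T X Y} (hw : w ∈ (A.barQuiver S).Tgr X Y i) :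
    inclT A S X Y w ∈ (plus A).Tgr X Y i := hat_mem (inclFun_homog A S) hw

theorem restr_homog {o o' : A.Ob → B.Ob} {r : Fam (plus A) (plus B) o o'} (hr : Homog d r) : Homog d (restr S S' r) :=
  fun X Y e _ hw => ofT_mem (toT_mem (hr X Y e _ (inclT_mem hw)))

theorem restrFun_unital (hF : F.Unital0) : (restrFun S S' F).Unital0 := fun X => by
  refine (restr_apply F.comp _).trans ?_
  rw [inclT_one]
  refine (congrArg (fun t => ofT B S' _ _ (toT B Set.univ _ _ t)) (hF X)).trans ?_
  rw [map_zero, map_zero]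

theorem restrFun_andThen (hr : Restricts S S' F.comp) (hF : F.Unital0) :
    ((restrFun S S' F).andThen (inclFun B S')).comp = ((inclFun A S).andThen F).comp := by
  funext X Y
  refine LinearMap.ext fun w => ?_
  exact (congrArg (incl B S' _ _) (proj_hat (restrFun_unital hF) w)).trans (incl_restr hr w)

theorem inclT_hat_restrFun (hr : Restricts S S' F.comp) (hF : F.Unital0) {X Y : A.Ob} (w : (A.barQuiver S).T X Y) :
    inclT B S' _ _ (hat (restrFun S S' F) X Y w) = hat F X Y (inclT A S X Y w) := by
  refine (hat_comp (f := restrFun S S' F) (g := inclFun B S') (restrFun_unital hF) (inclFun_unital B S') w).symm.trans ?_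
  refine Eq.trans ?_ (hat_comp (f := inclFun A S) (g := F) (inclFun_unital A S) hF w)
  exact hat_congr_comp (A := A.barQuiver S) (B := plus B) (o := F.obj) (restrFun_andThen hr hF) X Y w

theorem incl_coder_restr (hF : F.Unital0) (hG : G.Unital0) {r : Fam (plus A) (plus B) F.obj G.obj}
    (hr : Restricts S S' r) :
    (fun X Y => (inclFun B S').comp (F.obj X) (G.obj Y) ∘ₗ coder (restrFun S S' F) (restrFun S S' G) d (restr S S' r) X Y :
      Fam (A.barQuiver S) (plus B) F.obj G.obj) = fun X Y => r X Y ∘ₗ hat (inclFun A S) X Y := by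
  funext X Y
  refine LinearMap.ext fun w => ?_
  have h := proj_coder (f := restrFun S S' F) (g := restrFun S S' G) (d := d) (r := restr S S' r)
    (restrFun_unital hF) (restrFun_unital hG) w
  exact (congrArg (incl B S' (F.obj X) (G.obj Y)) h).trans (incl_restr hr w)

theorem inclT_coder_restr (hrF : Restricts S S' F.comp) (hrG : Restricts S S' G.comp) (hF : F.Unital0) (hG : G.Unital0)
    {r : Fam (plus A) (plus B) F.obj G.obj} (hr : Restricts S S' r) {X Y : A.Ob} (w : (A.barQuiver S).T X Y) :
    inclT B S' _ _ (coder (restrFun S S' F) (restrFun S S' G) d (restr S S' r) X Y w) =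
      coder F G d r X Y (inclT A S X Y w) := by
  refine (coder_whR (f := restrFun S S' F) (f' := restrFun S S' G) (g := inclFun B S') (d := d) (r := restr S S' r)
    (restrFun_unital hF) (restrFun_unital hG) (inclFun_unital B S') w).symm.trans ?_
  refine Eq.trans ?_ (coder_whL (f := inclFun A S) (g := F) (g' := G) (d := d) (r := r) (inclFun_unital A S)
    (inclFun_homog A S) hF hG w)
  have e1 := incl_coder_restr (d := d) hF hG hr
  have e2 := restrFun_andThen hrF hF
  have e3 := restrFun_andThen hrG hG
  have := coder_congr (A := A.barQuiver S) (B := plus B) (o := F.obj) (o' := G.obj) e2 e3 (d := d)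
    (r := fun X Y => r X Y ∘ₗ hat (inclFun A S) X Y) X Y w
  refine Eq.trans ?_ this
  exact congrArg (fun r : Fam (A.barQuiver S) (plus B) F.obj G.obj => coder (A := A.barQuiver S) (B := plus B)
    ((restrFun S S' F).andThen (inclFun B S')) ((restrFun S S' G).andThen (inclFun B S')) d r X Y w) e1

theorem inclT_theta_restr (hrF : Restricts S S' F.comp) (hrG : Restricts S S' G.comp) (hrH : Restricts S S' H.comp)
    (hF : F.Unital0) (hG : G.Unital0) (hH : H.Unital0)
    {r : Fam (plus A) (plus B) F.obj G.obj} (hr : Restricts S S' r)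
    {p : Fam (plus A) (plus B) G.obj H.obj} (hp : Restricts S S' p) {X Y : A.Ob} (w : (A.barQuiver S).T X Y) :
    inclT B S' _ _ (theta (restrFun S S' F) (restrFun S S' G) (restrFun S S' H) d e (restr S S' r) (restr S S' p) X Y w) =
      theta F G H d e r p X Y (inclT A S X Y w) := by
  have h1 := coder_hat_theta (f := restrFun S S' F) (g := restrFun S S' G) (h := restrFun S S' H) (n := inclFun B S')
    (d := d) (e := e) (r := restr S S' r) (p := restr S S' p)
    (restrFun_unital hF) (restrFun_unital hG) (restrFun_unital hH) (inclFun_unital B S') X Y w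
  have h0 : (fun X Y => (inclFun B S').comp (F.obj X) (H.obj Y) ∘ₗ theta (restrFun S S' F) (restrFun S S' G) (restrFun S S' H) d e
      (restr S S' r) (restr S S' p) X Y : Fam (A.barQuiver S) (plus B) F.obj H.obj) = 0 := by
    funext X Y
    refine LinearMap.ext fun w => ?_
    have h := proj_theta (f := restrFun S S' F) (g := restrFun S S' G) (h := restrFun S S' H) (d := d) (e := e)
      (r := restr S S' r) (p := restr S S' p) (restrFun_unital hF) (restrFun_unital hG) w
    exact (congrArg (incl B S' (F.obj X) (H.obj Y)) h).trans (map_zero _)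
  have h2 : coder ((restrFun S S' F).andThen (inclFun B S')) ((restrFun S S' H).andThen (inclFun B S')) (d + e)
      (0 : Fam (A.barQuiver S) (plus B) F.obj H.obj) X Y w = 0 := by
    exact LinearMap.congr_fun (congrFun (congrFun (map_zero (coderₗ (f := (restrFun S S' F).andThen (inclFun B S'))
      (g := (restrFun S S' H).andThen (inclFun B S')) (comp_unital (restrFun_unital hF) (inclFun_unital B S')) (d + e))) X) Y) w
  have h3 := (congrArg (fun r : Fam (A.barQuiver S) (plus B) F.obj H.obj => coder (A := A.barQuiver S) (B := plus B)
    ((restrFun S S' F).andThen (inclFun B S')) ((restrFun S S' H).andThen (inclFun B S')) (d + e) r X Y w) h0).symm.trans h1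
  have h4 := sub_eq_zero.1 (h3.symm.trans h2)
  refine h4.trans ?_
  refine Eq.trans ?_ (theta_whL (n := inclFun A S) (f := F) (g := G) (h := H) (d := d) (e := e) (r := r) (p := p)
    (inclFun_unital A S) (inclFun_homog A S) hF hG hH X Y w)
  have e1 := incl_coder_restr (d := d) hF hG hr
  have e2 := incl_coder_restr (d := e) hG hH hp
  have := theta_congr (A := A.barQuiver S) (B := plus B) (o := F.obj) (o' := G.obj) (o'' := H.obj)
    (restrFun_andThen hrF hF) (restrFun_andThen hrG hG) (restrFun_andThen hrH hH) (d := d) (e := e)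
    (r := fun X Y => r X Y ∘ₗ hat (inclFun A S) X Y) (p := fun X Y => p X Y ∘ₗ hat (inclFun A S) X Y) X Y w
  refine Eq.trans ?_ this
  exact congrArg₂ (fun (r : Fam (A.barQuiver S) (plus B) F.obj G.obj) (p : Fam (A.barQuiver S) (plus B) G.obj H.obj) =>
    theta (A := A.barQuiver S) (B := plus B) ((restrFun S S' F).andThen (inclFun B S'))
      ((restrFun S S' G).andThen (inclFun B S')) ((restrFun S S' H).andThen (inclFun B S')) d e r p X Y w) e1 e2

end restr

section DOps
variable {A B : Ops k} {S : Set A.Ob} {S' : Set B.Ob}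

theorem inclT_hatb {X Y : A.Ob} (w : (A.toGQuiver.barQuiver S).T X Y) :
    inclT A.toGQuiver S X Y ((DOps A S).hatb X Y w) = (barOps A).hatb X Y (inclT A.toGQuiver S X Y w) := by
  have hb : Restricts (A := A.toGQuiver) (B := A.toGQuiver) (o := fun X => X) (o' := fun X => X) S S (barOps A).b :=
    barOps_restricts S
  refine (coder_whR (f := idFun (A.toGQuiver.barQuiver S)) (f' := idFun (A.toGQuiver.barQuiver S))
    (g := inclFun A.toGQuiver S) (d := 1) (r := (DOps A S).b)
    (idFun_unital _) (idFun_unital _) (inclFun_unital A.toGQuiver S) w).symm.trans ?_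
  refine Eq.trans ?_ (coder_whL (f := inclFun A.toGQuiver S) (g := idFun (plus A.toGQuiver)) (g' := idFun (plus A.toGQuiver))
    (d := 1) (r := (barOps A).b) (inclFun_unital A.toGQuiver S) (inclFun_homog A.toGQuiver S) (idFun_unital _)
    (idFun_unital _) w)
  have e2 : ((idFun (A.toGQuiver.barQuiver S)).andThen (inclFun A.toGQuiver S)).comp =
      ((inclFun A.toGQuiver S).andThen (idFun (plus A.toGQuiver))).comp := by
    funext X Y
    refine LinearMap.ext fun w => ?_
    refine (congrArg ((inclFun A.toGQuiver S).comp X Y) (hat_idFun w)).trans ?_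
    exact (proj_hat (inclFun_unital A.toGQuiver S) w).symm
  have e1 : (fun X Y => (inclFun A.toGQuiver S).comp X Y ∘ₗ (DOps A S).hatb X Y :
      Fam (A.toGQuiver.barQuiver S) (plus A.toGQuiver) (fun X => X) (fun X => X)) =
      fun X Y => (barOps A).b X Y ∘ₗ hat (inclFun A.toGQuiver S) X Y := by
    funext X Y
    refine LinearMap.ext fun w => ?_
    exact (congrArg (incl A.toGQuiver S X Y) (proj_hatb (A := DOps A S) w)).trans (incl_restr hb w)
  have := coder_congr (A := A.toGQuiver.barQuiver S) (B := plus A.toGQuiver) (o := fun X => X) (o' := fun X => X) e2 e2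
    (d := 1) (r := fun X Y => (barOps A).b X Y ∘ₗ hat (inclFun A.toGQuiver S) X Y) X Y w
  refine Eq.trans ?_ this
  exact congrArg (fun r : Fam (A.toGQuiver.barQuiver S) (plus A.toGQuiver) (fun X => X) (fun X => X) =>
    (coder (A := A.toGQuiver.barQuiver S) (B := plus A.toGQuiver)
    ((idFun (A.toGQuiver.barQuiver S)).andThen (inclFun A.toGQuiver S))
    ((idFun (A.toGQuiver.barQuiver S)).andThen (inclFun A.toGQuiver S)) 1 r X Y w : (plus A.toGQuiver).T X Y)) e1

theorem incl_DOps_b {X Y : A.Ob} (w : (A.toGQuiver.barQuiver S).T X Y) :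
    incl A.toGQuiver S X Y ((DOps A S).b X Y w) = (barOps A).b X Y (inclT A.toGQuiver S X Y w) :=
  incl_restr (barOps_restricts S) w

attribute [local irreducible] mInv ofT in
theorem DOps_isAInf (hA : A.IsAInf) (S : Set A.Ob) : (DOps A S).IsAInf := by
  have hb := barOps_isAInf hA
  refine isAInf_of_b_hatb ?_ (restr_homog (S := S) (S' := S) hb.homog) ?_
  · intro X
    refine incl_injective (A := A.toGQuiver) (S := S) ((incl_DOps_b _).trans ?_)
    rw [map_zero, inclT_one]
    exact hb.b_one X
  · intro X Y w
    refine incl_injective (A := A.toGQuiver) (S := S) ((incl_DOps_b _).trans ?_)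
    rw [inclT_hatb, map_zero]
    refine (proj_hatb _).symm.trans ?_
    rw [hb.sq, map_zero]

attribute [local irreducible] mInv ofT in
theorem DFunData_isFun (hA : A.IsAInf) (hB : B.IsAInf) {f : FunData A.toGQuiver B.toGQuiver} (hf : IsAInfFun f)
    (hfS : ∀ X ∈ S, f.obj X ∈ S') : IsAInfFun (A := DOps A S) (B := DOps B S') (DFunData S S' f) := by
  have hF := barFun_isFun hA hB hf
  have hr := barFun_restricts hf.comp_one hfS
  refine isAInfFun_of_b_hat (A := DOps A S) (B := DOps B S') (restrFun_unital hF.comp_one) (restr_homog hF.homog) ?_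
  intro X Y w
  refine incl_injective (A := B.toGQuiver) (S := S') ((incl_DOps_b _).trans ?_)
  refine (congrArg ((barOps B).b (f.obj X) (f.obj Y)) (inclT_hat_restrFun hr hF.comp_one w)).trans ?_
  refine Eq.trans ?_ (incl_restr hr _).symm
  rw [inclT_hatb]
  refine (proj_hatb (A := barOps B) _).symm.trans ?_
  refine (congrArg ((plus B.toGQuiver).proj (f.obj X) (f.obj Y)) (hF.comm X Y _)).trans ?_
  exact proj_hat hF.comp_one _

end DOps

section incl
variable {A B : GQuiver k} {S : Set A.Ob} {S' : Set B.Ob} {o o' : A.Ob → B.Ob}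

/-- `ψ` extends `φ` -/
def IsLift (φ : Fam (A.barQuiver S) (B.barQuiver S') o o') (ψ : Fam (plus A) (plus B) o o') : Prop :=
  ∀ X Y w, incl B S' (o X) (o' Y) (φ X Y w) = ψ X Y (inclT A S X Y w)

theorem IsLift.eq {φ φ' : Fam (A.barQuiver S) (B.barQuiver S') o o'} {ψ : Fam (plus A) (plus B) o o'} (hφ : IsLift φ ψ)
    (hφ' : IsLift φ' ψ) : φ = φ' :=
  funext fun X => funext fun Y => LinearMap.ext fun w => incl_injective ((hφ X Y w).trans (hφ' X Y w).symm)

theorem IsLift.eq_of_eq {φ φ' : Fam (A.barQuiver S) (B.barQuiver S') o o'} {ψ ψ' : Fam (plus A) (plus B) o o'}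
    (hφ : IsLift φ ψ) (hφ' : IsLift φ' ψ') (h : ψ = ψ') : φ = φ' := by subst h; exact hφ.eq hφ'

theorem IsLift.add {φ φ' : Fam (A.barQuiver S) (B.barQuiver S') o o'} {ψ ψ' : Fam (plus A) (plus B) o o'} (hφ : IsLift φ ψ)
    (hφ' : IsLift φ' ψ') : IsLift (φ + φ') (ψ + ψ') := fun X Y w =>
  (map_add (incl B S' (o X) (o' Y)) _ _).trans (congrArg₂ (fun a b => a + b) (hφ X Y w) (hφ' X Y w))

theorem IsLift.sub {φ φ' : Fam (A.barQuiver S) (B.barQuiver S') o o'} {ψ ψ' : Fam (plus A) (plus B) o o'} (hφ : IsLift φ ψ)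
    (hφ' : IsLift φ' ψ') : IsLift (φ - φ') (ψ - ψ') := fun X Y w =>
  (map_sub (incl B S' (o X) (o' Y)) _ _).trans (congrArg₂ (fun a b => a - b) (hφ X Y w) (hφ' X Y w))

theorem IsLift.zsmul {φ : Fam (A.barQuiver S) (B.barQuiver S') o o'} {ψ : Fam (plus A) (plus B) o o'} (hφ : IsLift φ ψ)
    (n : ℤ) : IsLift (n • φ) (n • ψ) := fun X Y w =>
  (map_zsmul (incl B S' (o X) (o' Y)) _ _).trans (congrArg (fun a => n • a) (hφ X Y w))

theorem isLift_restr {ψ : Fam (plus A) (plus B) o o'} (hψ : Restricts S S' ψ) : IsLift (restr S S' ψ) ψ := hψ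

end incl

section DB
variable {A B : Ops k} {S : Set A.Ob} {S' : Set B.Ob}

section
variable {F G H : FunData (plus A.toGQuiver) (plus B.toGQuiver)} {d e : ℤ}

theorem isLift_B1 (hrF : Restricts S S' F.comp) (hrG : Restricts S S' G.comp) (hF : F.Unital0) (hG : G.Unital0)
    {r : Fam (plus A.toGQuiver) (plus B.toGQuiver) F.obj G.obj} (hr : Restricts S S' r) :
    IsLift (S := S) (S' := S') (B1 (A := DOps A S) (B := DOps B S') (restrFun S S' F) (restrFun S S' G) d (restr S S' r))
      (B1 (A := barOps A) (B := barOps B) F G d r) := by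
  intro X Y w
  have h1 : incl B.toGQuiver S' (F.obj X) (G.obj Y) ((DOps B S').b (F.obj X) (G.obj Y)
      (coder (restrFun S S' F) (restrFun S S' G) d (restr S S' r) X Y w)) =
      (barOps B).b (F.obj X) (G.obj Y) (coder F G d r X Y (inclT A.toGQuiver S X Y w)) :=
    (incl_DOps_b _).trans (congrArg _ (inclT_coder_restr hrF hrG hF hG hr w))
  have h2 : incl B.toGQuiver S' (F.obj X) (G.obj Y) (restr S S' r X Y ((DOps A S).hatb X Y w)) =
      r X Y ((barOps A).hatb X Y (inclT A.toGQuiver S X Y w)) :=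
    (incl_restr hr _).trans (congrArg _ (inclT_hatb w))
  refine (map_sub (incl B.toGQuiver S' (F.obj X) (G.obj Y)) _ _).trans ?_
  refine congrArg₂ (fun a b => a - b) h1 ?_
  exact (map_zsmul (incl B.toGQuiver S' (F.obj X) (G.obj Y)) _ _).trans (congrArg _ h2)

theorem isLift_B2 (hrF : Restricts S S' F.comp) (hrG : Restricts S S' G.comp) (hrH : Restricts S S' H.comp)
    (hF : F.Unital0) (hG : G.Unital0) (hH : H.Unital0)
    {r : Fam (plus A.toGQuiver) (plus B.toGQuiver) F.obj G.obj} (hr : Restricts S S' r)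
    {p : Fam (plus A.toGQuiver) (plus B.toGQuiver) G.obj H.obj} (hp : Restricts S S' p) :
    IsLift (S := S) (S' := S') (B2 (A := DOps A S) (B := DOps B S') (restrFun S S' F) (restrFun S S' G) (restrFun S S' H)
        d e (restr S S' r) (restr S S' p))
      (B2 (A := barOps A) (B := barOps B) F G H d e r p) := fun _ _ w =>
  (incl_DOps_b _).trans (congrArg _ (inclT_theta_restr hrF hrG hrH hF hG hH hr hp w))

end

variable {f g h : FunData A.toGQuiver B.toGQuiver} {d e : ℤ}
  {r : Fam A.toGQuiver B.toGQuiver f.obj g.obj} {p : Fam A.toGQuiver B.toGQuiver g.obj h.obj}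

theorem barTrans_B1 (hA : A.IsAInf) (hB : B.IsAInf) (hf : IsAInfFun f) (hg : IsAInfFun g) (hr : Homog d r) :
    B1 (A := barOps A) (B := barOps B) (barFun f) (barFun g) d (barTrans f g d r) =
      barTrans f g (d + 1) (B1 f g d r) := by
  funext X Y
  refine LinearMap.ext fun w => ?_
  have h1 : (barOps B).b (f.obj X) (g.obj Y) (coder (barFun f) (barFun g) d (barTrans f g d r) X Y w) =
      mInv B.toGQuiver _ _ ((underOps B).hatb _ _ (coder (underFun f) (underFun g) d (underTrans f g d r) X Y
        (hat (mFun A.toGQuiver) X Y w))) := by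
    refine (congrArg ((barOps B).b (f.obj X) (g.obj Y)) (coder_conj hf.comp_one hg.comp_one _ w)).trans ?_
    refine (barOps_b_apply _).trans ?_
    exact congrArg (fun t => mInv B.toGQuiver _ _ ((underOps B).hatb _ _ t)) (hat_mFun_hat_nFun _)
  have h2 : barTrans f g d r X Y ((barOps A).hatb X Y w) =
      mInv B.toGQuiver _ _ (coder (underFun f) (underFun g) d (underTrans f g d r) X Y
        ((underOps A).hatb X Y (hat (mFun A.toGQuiver) X Y w))) := by
    refine (congrArg (barTrans f g d r X Y) (barOps_hatb w)).trans ?_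
    exact congrArg (fun t => mInv B.toGQuiver _ _ (coder (underFun f) (underFun g) d (underTrans f g d r) X Y t))
      (hat_mFun_hat_nFun _)
  refine (congrArg₂ (fun a b : (plus B.toGQuiver).hom (f.obj X) (g.obj Y) => a - (d.negOnePow : ℤ) • b) h1 h2).trans ?_
  have h3 := LinearMap.congr_fun (congrFun (congrFun (commb_coder (underOps_isAInf hA) (underOps_isAInf hB)
    (underFun_isFun hA hB hf) (underFun_isFun hA hB hg) (underTrans_homog hf.homog hg.homog hr)) X) Y)
    (hat (mFun A.toGQuiver) X Y w)
  rw [B1_underTrans hA hB hf hg hr] at h3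
  refine Eq.trans ?_ (congrArg (mInv B.toGQuiver (f.obj X) (g.obj Y)) h3)
  refine Eq.trans ?_ (map_sub (mInv B.toGQuiver (f.obj X) (g.obj Y)) _ _).symm
  exact congrArg _ (map_zsmul (mInv B.toGQuiver (f.obj X) (g.obj Y)) _ _).symm

theorem DTrans_homog (hf : IsAInfFun f) (hg : IsAInfFun g) (hr : Homog d r) : Homog d (DTrans S S' f g d r) :=
  restr_homog (S := S) (S' := S') (barTrans_homog hf.homog hg.homog hr)

theorem DhomR_homog (hf : IsAInfFun f) (hg : IsAInfFun g) (hh : IsAInfFun h) (hr : Homog d r) (hp : Homog e p) :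
    Homog (d + e) (DhomR S S' f g h d e r p) :=
  restr_homog (S := S) (S' := S') (homR_homog hf.homog hg.homog hh.homog hr hp)

theorem DTrans_B1 (hA : A.IsAInf) (hB : B.IsAInf) (hf : IsAInfFun f) (hg : IsAInfFun g) (hfS : ∀ X ∈ S, f.obj X ∈ S')
    (hgS : ∀ X ∈ S, g.obj X ∈ S') (hr : Homog d r) :
    B1 (A := DOps A S) (B := DOps B S') (DFunData S S' f) (DFunData S S' g) d (DTrans S S' f g d r) =
      DTrans S S' f g (d + 1) (B1 f g d r) := by
  have l1 := isLift_B1 (F := barFun f) (G := barFun g) (d := d) (r := barTrans f g d r) (barFun_restricts hf.comp_one hfS) (barFun_restricts hg.comp_one hgS) (barFun_unital hf.comp_one)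
      (barFun_unital hg.comp_one) (barTrans_restricts hf.comp_one hg.comp_one hfS hgS r)
  rw [barTrans_B1 hA hB hf hg hr] at l1
  exact l1.eq (isLift_restr (barTrans_restricts hf.comp_one hg.comp_one hfS hgS (B1 f g d r)))

attribute [local irreducible] mInv ofT in
theorem DTrans_B2_sub (hA : A.IsAInf) (hB : B.IsAInf) (hf : IsAInfFun f) (hg : IsAInfFun g) (hh : IsAInfFun h)
    (hfS : ∀ X ∈ S, f.obj X ∈ S') (hgS : ∀ X ∈ S, g.obj X ∈ S') (hhS : ∀ X ∈ S, h.obj X ∈ S')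
    (hr : Homog d r) (hp : Homog e p) :
    DTrans S S' f h (d + e + 1) (B2 f g h d e r p) -
        B2 (A := DOps A S) (B := DOps B S') (DFunData S S' f) (DFunData S S' g) (DFunData S S' h) d e
          (DTrans S S' f g d r) (DTrans S S' g h e p) =
      B1 (A := DOps A S) (B := DOps B S') (DFunData S S' f) (DFunData S S' h) (d + e) (DhomR S S' f g h d e r p) -
        (DhomR S S' f g h d (e + 1) r (B1 g h e p) +
          (e.negOnePow : ℤ) • DhomR S S' f g h (d + 1) e (B1 f g d r) p) := by
  have rf := barFun_restricts hf.comp_one hfS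
  have rg := barFun_restricts hg.comp_one hgS
  have rh := barFun_restricts hh.comp_one hhS
  have uf := barFun_unital hf.comp_one
  have ug := barFun_unital hg.comp_one
  have uh := barFun_unital hh.comp_one
  have t1 : IsLift (S := S) (S' := S') (DTrans S S' f h (d + e + 1) (B2 f g h d e r p)) _ :=
    isLift_restr (barTrans_restricts hf.comp_one hh.comp_one hfS hhS (B2 f g h d e r p))
  have t2 := isLift_B2 (F := barFun f) (G := barFun g) (H := barFun h) (d := d) (e := e) (r := barTrans f g d r)
    (p := barTrans g h e p) rf rg rh uf ug uh (barTrans_restricts hf.comp_one hg.comp_one hfS hgS r)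
    (barTrans_restricts hg.comp_one hh.comp_one hgS hhS p)
  have t3 := isLift_B1 (F := barFun f) (G := barFun h) (d := d + e) (r := homR f g h d e r p) rf rh uf uh
    (homR_restricts hf.comp_one hg.comp_one hh.comp_one hfS hgS hhS r p)
  have t4 : IsLift (S := S) (S' := S') (DhomR S S' f g h d (e + 1) r (B1 g h e p)) _ :=
    isLift_restr (homR_restricts hf.comp_one hg.comp_one hh.comp_one hfS hgS hhS r (B1 g h e p))
  have t5 : IsLift (S := S) (S' := S') (DhomR S S' f g h (d + 1) e (B1 f g d r) p) _ :=
    isLift_restr (homR_restricts hf.comp_one hg.comp_one hh.comp_one hfS hgS hhS (B1 f g d r) p)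
  have t12 := t1.sub t2
  have t345 := t3.sub (t4.add (t5.zsmul (e.negOnePow : ℤ)))
  refine Eq.trans ?_ ((t12.eq_of_eq t345 (barTrans_B2_sub hA hB hf hg hh hr hp)).trans ?_)
  · rfl
  · rfl

end DB

theorem dWellDefined (k : Type u) [CommRing k] : DWellDefined k where
  cat P := DOps_isAInf P.cat.isAInf P.sub
  fn {P P'} f := DFunData_isFun P.cat.isAInf P'.cat.isAInf f.fn.isFun f.maps
  trans f g _ r := DTrans_homog f.fn.isFun g.fn.isFun r.2

section natural
variable {A B C : GQuiver k}

theorem underFun_andThen_comp {f : FunData A B} {g : FunData B C} (hf : f.Unital0) (hg : g.Unital0) :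
    (underFun (f.andThen g)).comp = ((underFun f).andThen (underFun g)).comp := by
  funext X Y
  refine LinearMap.ext fun w => ?_
  refine (underFun_apply (comp_unital hf hg) w).trans ?_
  have h1 : (plus B).proj (f.obj X) (f.obj Y) (hat (underFun f) X Y w) = _ := proj_hat (underFun_unital hf) w
  refine Eq.trans ?_ (underFun_apply hg (hat (underFun f) X Y w)).symm
  rw [hat_comp hf hg]
  refine congrArg (fun t => ofT C Set.univ _ _ (hat g (f.obj X) (f.obj Y) t)) ?_
  exact (toT_underFun hf w).symm.trans (congrArg (toT B Set.univ _ _) h1.symm)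

theorem barFun_andThen {f : FunData A B} {g : FunData B C} (hf : f.Unital0) (hg : g.Unital0) {X Y : A.Ob}
    (w : (plus A).T X Y) :
    (barFun (f.andThen g)).comp X Y w = (barFun g).comp (f.obj X) (f.obj Y) (hat (barFun f) X Y w) := by
  have h1 : (barFun g).comp (f.obj X) (f.obj Y) (hat (barFun f) X Y w) = mInv C _ _ (hat (underFun g) _ _
      (hat (underFun f) X Y (hat (mFun A) X Y w))) := by
    refine (congrArg ((barFun g).comp (f.obj X) (f.obj Y)) (hat_barFun hf w)).trans ?_
    exact congrArg (fun t => mInv C _ _ (hat (underFun g) (f.obj X) (f.obj Y) t)) (hat_mFun_hat_nFun _)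
  refine Eq.trans ?_ h1.symm
  refine congrArg (mInv C (g.obj (f.obj X)) (g.obj (f.obj Y))) ?_
  refine Eq.trans ?_ (hat_comp (f := underFun f) (g := underFun g) (underFun_unital hf) (underFun_unital hg) _)
  exact hat_congr_comp (A := plus A) (B := plus C) (o := fun X => g.obj (f.obj X)) (underFun_andThen_comp hf hg) X Y _

theorem post_under {o o' : A.Ob → B.Ob} {q q' : B.Ob → C.Ob} (G : HomFam B C q q') {F : HomFam A B o o'}
    (hF : ∀ X Y w, epsI B _ _ (F X Y w) = 0) {X Y : A.Ob} (w : (plus A).T X Y) :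
    ofT C Set.univ _ _ (G _ _ (toT B Set.univ _ _ (under F X Y w))) =
      under (o := fun X => q (o X)) (o' := fun X => q' (o' X)) (fun X Y => G _ _ ∘ₗ F X Y) X Y w := by
  rw [under_apply, under_apply, map_add, map_add, map_add, toT_ofT_of_eps (hF X Y _)]
  refine congrArg (fun t => t + _) ?_
  refine (map_fold (A := plus A) (M := fun X => (plus B).hom (o X) (o' Y)) (N := fun X => (plus C).hom (q (o X)) (q' (o' Y)))
    (fun X => ofT C Set.univ _ _ ∘ₗ G _ _ ∘ₗ toT B Set.univ (o X) (o' Y)) _ w).trans ?_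
  rw [LinearMap.comp_apply, LinearMap.comp_apply, toT_ofT_of_eps (hF Y Y _)]
  rfl

theorem fold_eps {o : A.Ob → B.Ob} {M : B.Ob → Type u} [∀ X, AddCommGroup (M X)] [∀ X, Module k (M X)] {Y : A.Ob}
    (z : M (o Y)) {X : A.Ob} (w : A.T X Y) :
    B.fold z (fun _ _ => 0) (o X) (eps o X w) = A.fold (M := fun X => M (o X)) z (fun _ _ => 0) X w := by
  refine induction_on (motive := fun X w => B.fold z (fun _ _ => 0) (o X) (eps o X w) =
    A.fold (M := fun X => M (o X)) z (fun _ _ => 0) X w) ?_ ?_ ?_ ?_ w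
  · simp
  · intro X a b ha hb; rw [map_add, map_add, map_add, ha, hb]
  · intro c; simp
  · intro X Z v w _; simp

theorem under_hat {f : FunData A B} (hf : f.Unital0) {o o' : B.Ob → C.Ob} (F : HomFam B C o o') {X Y : A.Ob}
    (w : (plus A).T X Y) : under F (f.obj X) (f.obj Y) (hat (underFun f) X Y w) =
      under (o := fun X => o (f.obj X)) (o' := fun X => o' (f.obj X)) (fun X Y => F _ _ ∘ₗ hat f X Y) X Y w := by
  have h1 : (plus B).proj (f.obj X) (f.obj Y) (hat (underFun f) X Y w) = _ := proj_hat (underFun_unital hf) w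
  have h2 : epsI (plus B) (f.obj X) (f.obj Y) (hat (underFun f) X Y w) = eps (A := plus A) (B := plus B) f.obj X w :=
    eps_hat (underFun_unital hf) w
  refine (under_apply F _).trans (Eq.trans ?_ (under_apply (o := fun X => o (f.obj X)) (o' := fun X => o' (f.obj X))
    (fun X Y => F _ _ ∘ₗ hat f X Y) w).symm)
  refine congrArg₂ (fun a b => a + b) ?_ ?_
  · refine (fold_epsI (A := plus B) (M := fun X => (plus C).hom (o X) (o' (f.obj Y))) _ _).trans ?_
    rw [h2]
    refine (fold_eps (A := plus A) (B := plus B) (o := f.obj) (M := fun X => (plus C).hom (o X) (o' (f.obj Y))) _ w).trans ?_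
    rw [LinearMap.comp_apply, hat_one hf]
  · refine congrArg (fun t => ofT C Set.univ _ _ (F (f.obj X) (f.obj Y) t)) ?_
    exact (congrArg (toT B Set.univ _ _) h1).trans (toT_underFun hf w)

variable {d : ℤ}

theorem barTrans_whR {f g : FunData A B} {h : FunData B C} (hf : f.Unital0) (hg : g.Unital0) (hh : h.Unital0)
    (r : Fam A B f.obj g.obj) {X Y : A.Ob} (w : (plus A).T X Y) :
    barTrans (f.andThen h) (g.andThen h) d (fun X Y => h.comp _ _ ∘ₗ coder f g d r X Y) X Y w =
      (barFun h).comp (f.obj X) (g.obj Y) (coder (barFun f) (barFun g) d (barTrans f g d r) X Y w) := by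
  have h1 : (barFun h).comp (f.obj X) (g.obj Y) (coder (barFun f) (barFun g) d (barTrans f g d r) X Y w) =
      mInv C _ _ (hat (underFun h) _ _ (coder (underFun f) (underFun g) d (underTrans f g d r) X Y (hat (mFun A) X Y w))) := by
    refine (congrArg ((barFun h).comp (f.obj X) (g.obj Y)) (coder_conj hf hg _ w)).trans ?_
    exact congrArg (fun t => mInv C _ _ (hat (underFun h) (f.obj X) (g.obj Y) t)) (hat_mFun_hat_nFun _)
  refine Eq.trans ?_ h1.symm
  refine congrArg (mInv C (h.obj (f.obj X)) (h.obj (g.obj Y))) ?_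
  refine Eq.trans ?_ (coder_whR (f := underFun f) (f' := underFun g) (g := underFun h) (d := d) (r := underTrans f g d r)
    (underFun_unital hf) (underFun_unital hg) (underFun_unital hh) _)
  have e1 : underTrans (f.andThen h) (g.andThen h) d (fun X Y => h.comp _ _ ∘ₗ coder f g d r X Y) =
      fun X Y => (underFun h).comp (f.obj X) (g.obj Y) ∘ₗ coder (underFun f) (underFun g) d (underTrans f g d r) X Y := by
    funext X Y
    refine LinearMap.ext fun w => ?_
    have hp : (plus B).proj (f.obj X) (g.obj Y) (coder (underFun f) (underFun g) d (underTrans f g d r) X Y w) = _ :=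
      proj_coder (underFun_unital hf) (underFun_unital hg) w
    refine Eq.trans ?_ (underFun_apply hh (coder (underFun f) (underFun g) d (underTrans f g d r) X Y w)).symm
    refine Eq.trans ?_ (congrArg (fun t => ofT C Set.univ _ _ (hat h (f.obj X) (g.obj Y) (toT B Set.univ _ _ t))) hp.symm)
    refine Eq.trans ?_ (post_under (hat h) (F := coder f g d r) (fun _ _ _ => eps_lead hf _ _) w).symm
    have : coder (f.andThen h) (g.andThen h) d (fun X Y => h.comp _ _ ∘ₗ coder f g d r X Y) =
        fun X Y => hat h (f.obj X) (g.obj Y) ∘ₗ coder f g d r X Y := by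
      funext X Y
      exact LinearMap.ext fun w => coder_whR (f := f) (f' := g) (g := h) (d := d) (r := r) hf hg hh w
    exact LinearMap.congr_fun (congrFun (congrFun (congrArg under this) X) Y) w
  refine (coder_congr (A := plus A) (B := plus C) (o := fun X => h.obj (f.obj X)) (o' := fun X => h.obj (g.obj X))
    (underFun_andThen_comp hf hh) (underFun_andThen_comp hg hh) X Y _).trans ?_
  exact congrArg (fun r : Fam (plus A) (plus C) (fun X => h.obj (f.obj X)) (fun X => h.obj (g.obj X)) =>
    coder (A := plus A) (B := plus C) ((underFun f).andThen (underFun h)) ((underFun g).andThen (underFun h)) d r X Y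
      (hat (mFun A) X Y w)) e1

theorem barTrans_whL {e : FunData A B} {f g : FunData B C} (he : e.Unital0) (he' : Homog 0 e.comp) (hf : f.Unital0)
    (hg : g.Unital0) (r : Fam B C f.obj g.obj) {X Y : A.Ob} (w : (plus A).T X Y) :
    barTrans (e.andThen f) (e.andThen g) d (fun X Y => r _ _ ∘ₗ hat e X Y) X Y w =
      barTrans f g d r (e.obj X) (e.obj Y) (hat (barFun e) X Y w) := by
  have h1 : barTrans f g d r (e.obj X) (e.obj Y) (hat (barFun e) X Y w) =
      mInv C _ _ (coder (underFun f) (underFun g) d (underTrans f g d r) _ _ (hat (underFun e) X Y (hat (mFun A) X Y w))) := by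
    refine (congrArg (barTrans f g d r (e.obj X) (e.obj Y)) (hat_barFun he w)).trans ?_
    exact congrArg (fun t => mInv C _ _ (coder (underFun f) (underFun g) d (underTrans f g d r) (e.obj X) (e.obj Y) t))
      (hat_mFun_hat_nFun _)
  refine Eq.trans ?_ h1.symm
  refine congrArg (mInv C (f.obj (e.obj X)) (g.obj (e.obj Y))) ?_
  refine Eq.trans ?_ (coder_whL (f := underFun e) (g := underFun f) (g' := underFun g) (d := d) (r := underTrans f g d r)
    (underFun_unital he) (underFun_homog he') (underFun_unital hf) (underFun_unital hg) _)
  have e1 : underTrans (e.andThen f) (e.andThen g) d (fun X Y => r _ _ ∘ₗ hat e X Y) =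
      fun X Y => underTrans f g d r (e.obj X) (e.obj Y) ∘ₗ hat (underFun e) X Y := by
    funext X Y
    refine LinearMap.ext fun w => ?_
    refine Eq.trans ?_ (under_hat he (coder f g d r) w).symm
    have : coder (e.andThen f) (e.andThen g) d (fun X Y => r _ _ ∘ₗ hat e X Y) =
        fun X Y => coder f g d r (e.obj X) (e.obj Y) ∘ₗ hat e X Y := by
      funext X Y
      exact LinearMap.ext fun w => coder_whL (f := e) (g := f) (g' := g) (d := d) (r := r) he he' hf hg w
    exact LinearMap.congr_fun (congrFun (congrFun (congrArg under this) X) Y) w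
  refine (coder_congr (A := plus A) (B := plus C) (o := fun X => f.obj (e.obj X)) (o' := fun X => g.obj (e.obj X))
    (underFun_andThen_comp he hf) (underFun_andThen_comp he hg) X Y _).trans ?_
  exact congrArg (fun r : Fam (plus A) (plus C) (fun X => f.obj (e.obj X)) (fun X => g.obj (e.obj X)) =>
    coder (A := plus A) (B := plus C) ((underFun e).andThen (underFun f)) ((underFun e).andThen (underFun g)) d r X Y
      (hat (mFun A) X Y w)) e1

end natural

section linear
variable {A B : GQuiver k} {f g h : FunData A B}

/-- `conj` as a linear map -/
def conjₗ {o o' : A.Ob → B.Ob} : HomFam (plus A) (plus B) o o' →ₗ[k] Fam (plus A) (plus B) o o' where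
  toFun G := conj G
  map_add' G G' := by
    funext X Y
    exact LinearMap.ext fun w => map_add (mInv B (o X) (o' Y)) _ _
  map_smul' c G := by
    funext X Y
    exact LinearMap.ext fun w => map_smul (mInv B (o X) (o' Y)) _ _

/-- `restr` as a linear map -/
def restrₗ (S : Set A.Ob) (S' : Set B.Ob) {o o' : A.Ob → B.Ob} :
    Fam (plus A) (plus B) o o' →ₗ[k] Fam (A.barQuiver S) (B.barQuiver S') o o' where
  toFun G := restr S S' G
  map_add' G G' := by
    funext X Y
    exact LinearMap.ext fun w => map_add (ofT B S' (o X) (o' Y) ∘ₗ toT B Set.univ (o X) (o' Y)) _ _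
  map_smul' c G := by
    funext X Y
    exact LinearMap.ext fun w => map_smul (ofT B S' (o X) (o' Y) ∘ₗ toT B Set.univ (o X) (o' Y)) _ _

/-- `theta` as a bilinear map -/
def thetaₗ (hf : f.Unital0) (hg : g.Unital0) (d e : ℤ) :
    Fam A B f.obj g.obj →ₗ[k] Fam A B g.obj h.obj →ₗ[k] HomFam A B f.obj h.obj :=
  LinearMap.mk₂ k (theta f g h d e)
    (fun r r' p => by funext X Y; exact lead_add_left hf _ _ _ _ _)
    (fun c r p => by funext X Y; exact lead_smul_left hf _ _ _ _ _)
    (fun r p p' => by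
      funext X Y
      refine Eq.trans ?_ (lead_add_right hf _ _ _ _ _)
      have := map_add (coderₗ (f := g) (g := h) hg e) p p'
      have h2 : coder g h e (p + p') = coder g h e p + coder g h e p' := this
      simp only [theta, h2, Pi.add_apply])
    (fun c r p => by
      funext X Y
      refine Eq.trans ?_ (lead_smul_right hf _ _ _ _ _)
      have := map_smul (coderₗ (f := g) (g := h) hg e) c p
      have h2 : coder g h e (c • p) = c • coder g h e p := this
      simp only [theta, h2, Pi.smul_apply])

/-- `underTrans` as a linear map -/
def underTransₗ (hf : f.Unital0) (d : ℤ) :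
    Fam A B f.obj g.obj →ₗ[k] Fam (plus A) (plus B) (underFun f).obj (underFun g).obj :=
  underₗ ∘ₗ coderₗ (g := g) hf d

/-- `DTrans` as a linear map -/
def DTransₗ (S : Set A.Ob) (S' : Set B.Ob) (hf : f.Unital0) (d : ℤ) :
    Fam A B f.obj g.obj →ₗ[k] Fam (A.barQuiver S) (B.barQuiver S') f.obj g.obj :=
  restrₗ S S' ∘ₗ conjₗ ∘ₗ coderₗ (f := underFun f) (g := underFun g) (underFun_unital hf) d ∘ₗ underTransₗ hf d

theorem DTransₗ_apply (S : Set A.Ob) (S' : Set B.Ob) (hf : f.Unital0) (d : ℤ) (r : Fam A B f.obj g.obj) :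
    DTransₗ S S' hf d r = DTrans S S' f g d r := rfl

/-- `DhomR` as a bilinear map -/
def DhomRₗ (S : Set A.Ob) (S' : Set B.Ob) (hf : f.Unital0) (hg : g.Unital0) (d e : ℤ) :
    Fam A B f.obj g.obj →ₗ[k] Fam A B g.obj h.obj →ₗ[k] Fam (A.barQuiver S) (B.barQuiver S') f.obj h.obj :=
  ((thetaₗ hf hg d e).compr₂
      (conjₗ ∘ₗ coderₗ (f := underFun f) (g := underFun h) (underFun_unital hf) (d + e) ∘ₗ underₗ) +
    ((thetaₗ (f := underFun f) (g := underFun g) (h := underFun h) (underFun_unital hf) (underFun_unital hg) d e).compl₁₂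
      (underTransₗ hf d) (underTransₗ hg e)).compr₂ conjₗ).compr₂ (restrₗ S S')

theorem DhomRₗ_apply (S : Set A.Ob) (S' : Set B.Ob) (hf : f.Unital0) (hg : g.Unital0) (d e : ℤ)
    (r : Fam A B f.obj g.obj) (p : Fam A B g.obj h.obj) :
    DhomRₗ S S' hf hg d e r p = DhomR S S' f g h d e r p := rfl

end linear

section functor

/-- the category, functor and transformation parts of `D` -/
abbrev DFunctor (k : Type u) [CommRing k] : K2Map (KAInfPair k) (KAInf k) := Dmap (dWellDefined k)

theorem AInfFun.ext_comp {A B : AInfCat k} {o : A.Ob → B.Ob} {c c' : Fam A.toGQuiver B.toGQuiver o o}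
    (h : c = c') (h1 : IsAInfFun (A := A.toOps) (B := B.toOps) ⟨o, c⟩) (h2 : IsAInfFun (A := A.toOps) (B := B.toOps) ⟨o, c'⟩) :
    (⟨⟨o, c⟩, h1⟩ : AInfFun A B) = ⟨⟨o, c'⟩, h2⟩ := by subst h; rfl

variable {P P' P'' : AInfPair k}

theorem DFunctor_id (P : AInfPair k) : (DFunctor k).map ((KAInfPair k).id P) = (KAInf k).id ((DFunctor k).obj P) := by
  refine AInfFun.ext_comp (A := (DFunctor k).obj P) (B := (DFunctor k).obj P) (o := fun X => X) ?_ _ _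
  have h1 : IsLift (A := P.cat.toGQuiver) (B := P.cat.toGQuiver) (S := P.sub) (S' := P.sub) (o := fun X => X) (o' := fun X => X)
      (restr P.sub P.sub (barFun (idFun P.cat.toGQuiver)).comp) _ :=
    isLift_restr (barFun_restricts (idFun_unital _) fun _ h => h)
  exact h1.eq fun X Y w => (proj_hat (inclFun_unital P.cat.toGQuiver P.sub) w).symm.trans
    (LinearMap.congr_fun (congrFun (congrFun (barFun_idFun_comp P.cat.toGQuiver) X) Y) _).symm

theorem DFunctor_comp (f : PairFun P P') (g : PairFun P' P'') : (DFunctor k).map ((KAInfPair k).comp f g) =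
    (KAInf k).comp ((DFunctor k).map f) ((DFunctor k).map g) := by
  refine AInfFun.ext_comp (A := (DFunctor k).obj P) (B := (DFunctor k).obj P'') (o := fun X => g.fn.obj (f.fn.obj X)) ?_ _ _
  have hf := f.fn.isFun.comp_one
  have hg := g.fn.isFun.comp_one
  have h1 : IsLift (S := P.sub) (S' := P''.sub) (restr P.sub P''.sub (barFun (f.fn.toFunData.andThen g.fn.toFunData)).comp) _ :=
    isLift_restr (barFun_restricts (comp_unital hf hg) fun X h => g.maps _ (f.maps X h))
  refine h1.eq fun X Y w => ?_
  refine (incl_restr (barFun_restricts hg g.maps) _).trans ?_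
  refine Eq.trans ?_ (barFun_andThen hf hg _).symm
  exact congrArg ((barFun g.fn.toFunData).comp (f.fn.obj X) (f.fn.obj Y))
    (inclT_hat_restrFun (barFun_restricts hf f.maps) (barFun_unital hf) w)

theorem Trans.cast_eq {A B : AInfCat k} {f f' g g' : AInfFun A B} (hf : f = f') (hg : g = g') {n : ℤ}
    (x : Trans f g n) (y : Trans f' g' n) (h : HEq x.1 y.1) (e : (Trans f g n : Type u) = Trans f' g' n) :
    cast e x = y := by
  subst hf hg
  exact Subtype.ext (eq_of_heq h)

theorem DTrans_whR {f g : PairFun P P'} (h : PairFun P' P'') {n : ℤ} (x : Trans f.fn g.fn n) :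
    DTrans P.sub P''.sub (f.fn.toFunData.andThen h.fn.toFunData) (g.fn.toFunData.andThen h.fn.toFunData) n
        (whR f.fn.toFunData g.fn.toFunData h.fn.toFunData n x.1) =
      whR (A := DOps P.cat.toOps P.sub) (B := DOps P'.cat.toOps P'.sub) (C := DOps P''.cat.toOps P''.sub)
        (DFunData P.sub P'.sub f.fn.toFunData) (DFunData P.sub P'.sub g.fn.toFunData)
        (DFunData P'.sub P''.sub h.fn.toFunData) n (DTrans P.sub P'.sub f.fn.toFunData g.fn.toFunData n x.1) := by
  have hf := f.fn.isFun.comp_one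
  have hg := g.fn.isFun.comp_one
  have hh := h.fn.isFun.comp_one
  have h1 := isLift_restr (S := P.sub) (S' := P''.sub) (barTrans_restricts (d := n) (comp_unital hf hh) (comp_unital hg hh)
    (fun X hX => h.maps _ (f.maps X hX)) (fun X hX => h.maps _ (g.maps X hX))
    (whR f.fn.toFunData g.fn.toFunData h.fn.toFunData n x.1))
  refine h1.eq fun X Y w => ?_
  refine (incl_restr (barFun_restricts hh h.maps) _).trans ?_
  refine Eq.trans ?_ (barTrans_whR hf hg hh x.1 _).symm
  exact congrArg ((barFun h.fn.toFunData).comp (f.fn.obj X) (g.fn.obj Y))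
    (inclT_coder_restr (barFun_restricts hf f.maps) (barFun_restricts hg g.maps) (barFun_unital hf) (barFun_unital hg)
      (barTrans_restricts hf hg f.maps g.maps x.1) w)

theorem DTrans_whL (e : PairFun P P') {f g : PairFun P' P''} {n : ℤ} (x : Trans f.fn g.fn n) :
    DTrans P.sub P''.sub (e.fn.toFunData.andThen f.fn.toFunData) (e.fn.toFunData.andThen g.fn.toFunData) n
        (whL e.fn.toFunData f.fn.toFunData g.fn.toFunData x.1) =
      whL (A := DOps P.cat.toOps P.sub) (B := DOps P'.cat.toOps P'.sub) (C := DOps P''.cat.toOps P''.sub)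
        (DFunData P.sub P'.sub e.fn.toFunData) (DFunData P'.sub P''.sub f.fn.toFunData)
        (DFunData P'.sub P''.sub g.fn.toFunData) (DTrans P'.sub P''.sub f.fn.toFunData g.fn.toFunData n x.1) := by
  have he := e.fn.isFun.comp_one
  have hf := f.fn.isFun.comp_one
  have hg := g.fn.isFun.comp_one
  have h1 := isLift_restr (S := P.sub) (S' := P''.sub) (barTrans_restricts (d := n) (comp_unital he hf) (comp_unital he hg)
    (fun X hX => f.maps _ (e.maps X hX)) (fun X hX => g.maps _ (e.maps X hX))
    (whL e.fn.toFunData f.fn.toFunData g.fn.toFunData x.1))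
  refine h1.eq fun X Y w => ?_
  refine (incl_restr (barTrans_restricts hf hg f.maps g.maps x.1) _).trans ?_
  refine Eq.trans ?_ (barTrans_whL he e.fn.isFun.homog hf hg x.1 _).symm
  exact congrArg (barTrans f.fn.toFunData g.fn.toFunData n x.1 (e.fn.obj X) (e.fn.obj Y))
    (inclT_hat_restrFun (barFun_restricts he e.maps) (barFun_unital he) w)

end functor

section bilinear
variable {A B : GQuiver k} {f g h : FunData A B} (S : Set A.Ob) (S' : Set B.Ob)

theorem DTrans_add (hf : f.Unital0) (d : ℤ) (r r' : Fam A B f.obj g.obj) :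
    DTrans S S' f g d (r + r') = DTrans S S' f g d r + DTrans S S' f g d r' := map_add (DTransₗ S S' (g := g) hf d) r r'

theorem DTrans_smul (hf : f.Unital0) (d : ℤ) (c : k) (r : Fam A B f.obj g.obj) :
    DTrans S S' f g d (c • r) = c • DTrans S S' f g d r := map_smul (DTransₗ S S' (g := g) hf d) c r

variable (n : ℤ)

attribute [local irreducible] DhomR in
theorem zsmul_DhomR_add_left (hf : f.Unital0) (hg : g.Unital0) (d e : ℤ) (r r' : Fam A B f.obj g.obj)
    (p : Fam A B g.obj h.obj) : n • DhomR S S' f g h d e (r + r') p =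
      n • DhomR S S' f g h d e r p + n • DhomR S S' f g h d e r' p := by
  have := LinearMap.map_add₂ (DhomRₗ (h := h) S S' hf hg d e) r r' p
  rw [DhomRₗ_apply, DhomRₗ_apply, DhomRₗ_apply] at this
  exact (congrArg (fun t => n • t) this).trans (smul_add _ _ _)

attribute [local irreducible] DhomR in
theorem zsmul_DhomR_smul_left (hf : f.Unital0) (hg : g.Unital0) (d e : ℤ) (c : k) (r : Fam A B f.obj g.obj)
    (p : Fam A B g.obj h.obj) : n • DhomR S S' f g h d e (c • r) p = c • n • DhomR S S' f g h d e r p := by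
  have := LinearMap.map_smul₂ (DhomRₗ (h := h) S S' hf hg d e) c r p
  rw [DhomRₗ_apply, DhomRₗ_apply] at this
  have comm : ∀ {M : Type u} [AddCommGroup M] [Module k M] (x : M), n • c • x = c • n • x := fun x => smul_comm _ _ _
  exact (congrArg (fun t => n • t) this).trans (comm _)

attribute [local irreducible] DhomR in
theorem zsmul_DhomR_add_right (hf : f.Unital0) (hg : g.Unital0) (d e : ℤ) (r : Fam A B f.obj g.obj)
    (p p' : Fam A B g.obj h.obj) : n • DhomR S S' f g h d e r (p + p') =
      n • DhomR S S' f g h d e r p + n • DhomR S S' f g h d e r p' := by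
  have := map_add (DhomRₗ (h := h) S S' hf hg d e r) p p'
  rw [DhomRₗ_apply, DhomRₗ_apply, DhomRₗ_apply] at this
  exact (congrArg (fun t => n • t) this).trans (smul_add _ _ _)

attribute [local irreducible] DhomR in
theorem zsmul_DhomR_smul_right (hf : f.Unital0) (hg : g.Unital0) (d e : ℤ) (c : k) (r : Fam A B f.obj g.obj)
    (p : Fam A B g.obj h.obj) : n • DhomR S S' f g h d e r (c • p) = c • n • DhomR S S' f g h d e r p := by
  have := map_smul (DhomRₗ (h := h) S S' hf hg d e r) c p
  rw [DhomRₗ_apply, DhomRₗ_apply] at this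
  have comm : ∀ {M : Type u} [AddCommGroup M] [Module k M] (x : M), n • c • x = c • n • x := fun x => smul_comm _ _ _
  exact (congrArg (fun t => n • t) this).trans (comm _)

end bilinear

section
variable {A B : Ops k} {S : Set A.Ob} {S' : Set B.Ob} {f g h : FunData A.toGQuiver B.toGQuiver}

theorem DTrans_zsmul (hf : f.Unital0) (d n : ℤ) (r : Fam A.toGQuiver B.toGQuiver f.obj g.obj) :
    DTrans S S' f g d (n • r) = n • DTrans S S' f g d r := by
  have := map_zsmul (DTransₗ S S' (g := g) hf d) n r
  rwa [DTransₗ_apply, DTransₗ_apply] at this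

theorem B1_zsmul (hf : f.Unital0) (d n : ℤ) (r : Fam A.toGQuiver B.toGQuiver f.obj g.obj) :
    B1 f g d (n • r) = n • B1 f g d r := map_zsmul (B1ₗ (g := g) hf d) n r

theorem DTrans_m_sub (hA : A.IsAInf) (hB : B.IsAInf) (hf : IsAInfFun f) (hg : IsAInfFun g) (hh : IsAInfFun h)
    (hfS : ∀ X ∈ S, f.obj X ∈ S') (hgS : ∀ X ∈ S, g.obj X ∈ S') (hhS : ∀ X ∈ S, h.obj X ∈ S') (i j : ℤ)
    {r : Fam A.toGQuiver B.toGQuiver f.obj g.obj} {p : Fam A.toGQuiver B.toGQuiver g.obj h.obj}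
    (hr : Homog (i - 1) r) (hp : Homog (j - 1) p) :
    DTrans S S' f h (i + j - 1 + 1 - 1) ((j.negOnePow : ℤ) • B2 f g h (i - 1) (j - 1) r p) -
      (j.negOnePow : ℤ) • B2 (A := DOps A S) (B := DOps B S') (DFunData S S' f) (DFunData S S' g)
        (DFunData S S' h) (i - 1) (j - 1) (DTrans S S' f g (i - 1) r) (DTrans S S' g h (j - 1) p) =
    B1 (A := DOps A S) (B := DOps B S') (DFunData S S' f) (DFunData S S' h) (i + j - 1 - 1)
        ((j.negOnePow : ℤ) • DhomR S S' f g h (i - 1) (j - 1) r p) +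
      (((j + 1).negOnePow : ℤ) • DhomR S S' f g h (i - 1) (j + 1 - 1) r (B1 g h (j - 1) p) +
        (j.negOnePow : ℤ) • (j.negOnePow : ℤ) • DhomR S S' f g h (i + 1 - 1) (j - 1) (B1 f g (i - 1) r) p) := by
  have alg : ∀ {M : Type u} [AddCommGroup M] (a1 a2 a3 a4 a5 : M), a1 - a2 = a3 - (a4 + ((j - 1).negOnePow : ℤ) • a5) →
      (j.negOnePow : ℤ) • a1 - (j.negOnePow : ℤ) • a2 = (j.negOnePow : ℤ) • a3 +
        (((j + 1).negOnePow : ℤ) • a4 + (j.negOnePow : ℤ) • (j.negOnePow : ℤ) • a5) := by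
    intro M _ a1 a2 a3 a4 a5 h
    rw [← smul_sub, h, Int.negOnePow_succ, Int.negOnePow_sub, Int.negOnePow_one, mul_neg_one]
    simp only [Units.val_neg, neg_smul, smul_sub, smul_neg, smul_add]
    abel
  have key := DTrans_B2_sub hA hB hf hg hh hfS hgS hhS hr hp
  have e1 : i - 1 + (j - 1) + 1 = i + j - 1 + 1 - 1 := by ring
  have e2 : j - 1 + 1 = j + 1 - 1 := by ring
  have e3 : i - 1 + 1 = i + 1 - 1 := by ring
  have e4 : i - 1 + (j - 1) = i + j - 1 - 1 := by ring
  rw [e1, e2, e3, e4] at key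
  have hF : (DFunData S S' f).Unital0 := restrFun_unital (barFun_unital hf.comp_one)
  have t3 := B1_zsmul (A := DOps A S) (B := DOps B S') (f := DFunData S S' f) (g := DFunData S S' h) hF (i + j - 1 - 1)
    (j.negOnePow : ℤ) (DhomR S S' f g h (i - 1) (j - 1) r p)
  refine (congrArg (fun t => t - _) (DTrans_zsmul hf.comp_one _ _ _)).trans ?_
  refine Eq.trans ?_ (congrArg (fun t => t + _) t3.symm)
  exact alg _ _ _ _ _ key

end

section functor

attribute [local irreducible] B1 B2 DTrans DhomR whL whR

variable {P P' P'' : AInfPair k}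

/-- the homotopy for the vertical composition, on transformations -/
def DhomT (f g h : PairFun P P') {i j l : ℤ} (hl : i + j = l + 1) : Trans f.fn g.fn (i - 1) →ₗ[k]
    Trans g.fn h.fn (j - 1) →ₗ[k] Trans ((DFunctor k).map f) ((DFunctor k).map h) (l - 1) :=
  LinearMap.mk₂ k (fun r p => ⟨(j.negOnePow : ℤ) • DhomR P.sub P'.sub f.fn.toFunData g.fn.toFunData h.fn.toFunData
      (i - 1) (j - 1) r.1 p.1, by
      have h1 := DhomR_homog (S := P.sub) (S' := P'.sub) f.fn.isFun g.fn.isFun h.fn.isFun r.2 p.2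
      have e : i - 1 + (j - 1) = l - 1 := by omega
      rw [e] at h1
      have h2 : _ ∈ Trans ((DFunctor k).map f) ((DFunctor k).map h) (l - 1) := h1
      exact zsmul_mem h2 _⟩)
    (fun r r' p => Subtype.ext (zsmul_DhomR_add_left P.sub P'.sub _ f.fn.isFun.comp_one g.fn.isFun.comp_one (i - 1) (j - 1) r.1 r'.1 p.1))
    (fun c r p => Subtype.ext (zsmul_DhomR_smul_left P.sub P'.sub _ f.fn.isFun.comp_one g.fn.isFun.comp_one (i - 1) (j - 1) c r.1 p.1))
    (fun r p p' => Subtype.ext (zsmul_DhomR_add_right P.sub P'.sub _ f.fn.isFun.comp_one g.fn.isFun.comp_one (i - 1) (j - 1) r.1 p.1 p'.1))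
    (fun c r p => Subtype.ext (zsmul_DhomR_smul_right P.sub P'.sub _ f.fn.isFun.comp_one g.fn.isFun.comp_one (i - 1) (j - 1) c r.1 p.1))

/-- the homotopy for the vertical composition -/
def DhomK {P P' : (KAInfPair k).Obj} (f g h : (KAInfPair k).Hom P P') {i j l : ℤ} (hl : i + j = l + 1) :
    (KAInfPair k).Hom2 f g i →ₗ[k] (KAInfPair k).Hom2 g h j →ₗ[k]
      (KAInf k).Hom2 ((DFunctor k).map f) ((DFunctor k).map h) l :=
  DhomT f g h hl

theorem DFunctor_d {f g : PairFun P P'} {n n' : ℤ} (hn : n + 1 = n') (x : Trans f.fn g.fn (n - 1)) :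
    (DFunctor k).map2 ((KAInfPair k).d (f := f) (g := g) hn x) = (KAInf k).d hn ((DFunctor k).map2 (f := f) (g := g) (n := n) x) := by
  subst hn
  refine Subtype.ext ?_
  have := DTrans_B1 P.cat.isAInf P'.cat.isAInf f.fn.isFun g.fn.isFun f.maps g.maps x.2
  have e : n - 1 + 1 = n + 1 - 1 := by ring
  rw [e] at this
  exact this.symm

theorem DFunctor_m {P P' : (KAInfPair k).Obj} (f g h : (KAInfPair k).Hom P P') {i i' j j' l l' : ℤ} (hi : i + 1 = i') (hj : j + 1 = j') (hl : l + 1 = l')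
    (h0 : i + j = l') (h1 : i' + j = l' + 1) (h2 : i + j' = l' + 1) (x : (KAInfPair k).Hom2 f g i)
    (y : (KAInfPair k).Hom2 g h j) :
    (DFunctor k).map2 ((KAInfPair k).m (f := f) (g := g) (h := h) h0 x y) -
        (KAInf k).m h0 ((DFunctor k).map2 x) ((DFunctor k).map2 y) =
      (KAInf k).d (f := (DFunctor k).map f) (g := (DFunctor k).map h) hl (DhomK f g h (h0.trans hl.symm) x y) +
        (DhomK f g h h2 x ((KAInfPair k).d (f := g) (g := h) hj y) +
          (j.negOnePow : ℤ) • DhomK f g h h1 ((KAInfPair k).d (f := f) (g := g) hi x) y) := by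
  subst hi hj hl
  obtain rfl : l = i + j - 1 := by omega
  exact Subtype.ext (DTrans_m_sub P.cat.isAInf P'.cat.isAInf f.fn.isFun g.fn.isFun h.fn.isFun f.maps g.maps h.maps i j
    x.2 y.2)

theorem DFunctor_isStrict (k : Type u) [CommRing k] : (DFunctor k).IsStrict where
  map_id := DFunctor_id
  map_comp := DFunctor_comp
  map2_add {P P' f g n} x y := Subtype.ext (DTrans_add P.sub P'.sub f.fn.isFun.comp_one (n - 1) x.1 y.1)
  map2_smul {P P' f g n} c x := Subtype.ext (DTrans_smul P.sub P'.sub f.fn.isFun.comp_one (n - 1) c x.1)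
  map2_d := DFunctor_d
  map2_m f g h := ⟨DhomK f g h, DFunctor_m f g h⟩
  map2_actR {P P' P''} f g h := ⟨fun _ => 0, fun {n n' n''} hn hn' x => by
    have : K2Cat.cast2 (DFunctor_comp f h) (DFunctor_comp g h) ((DFunctor k).map2 ((KAInfPair k).actR h x)) =
      (KAInf k).actR ((DFunctor k).map h) ((DFunctor k).map2 x) :=
      Trans.cast_eq (DFunctor_comp f h) (DFunctor_comp g h) _ _ (heq_of_eq (DTrans_whR h (f := f) (g := g) (n := n' - 1) x)) _
    refine (sub_eq_zero.2 this).trans ?_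
    exact ((congrArg₂ (fun a b => a + b) (map_zero _) rfl).trans (add_zero _)).symm⟩
  map2_actL {P P' P''} e f g := ⟨fun _ => 0, fun {n n' n''} hn hn' x => by
    have : K2Cat.cast2 (DFunctor_comp e f) (DFunctor_comp e g) ((DFunctor k).map2 ((KAInfPair k).actL e x)) =
      (KAInf k).actL ((DFunctor k).map e) ((DFunctor k).map2 x) :=
      Trans.cast_eq (DFunctor_comp e f) (DFunctor_comp e g) _ _ (heq_of_eq (DTrans_whL e (f := f) (g := g) (n := n' - 1) x)) _
    refine (sub_eq_zero.2 this).trans ?_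
    exact ((congrArg₂ (fun a b => a + b) (map_zero _) rfl).trans (add_zero _)).symm⟩

end functor

section H0

theorem K2Cat.cast2_val {C : K2Cat k} {P Q : C.Obj} {f f' g g' : C.Hom P Q} (hf : f = f') (hg : g = g')
    (x : C.Z0 f g) : TwoCat.cast2 (C := C.H0) hf hg ((C.Bd0 f g).mkQ x) =
      (C.Bd0 f' g').mkQ ⟨C.cast2 hf hg x.1, by subst hf hg; exact x.2⟩ := by
  subst hf hg; rfl

variable {C D : K2Cat k} {F : K2Map C D} {P Q R : C.Obj}

theorem K2Map.IsStrict.H0_m (hF : F.IsStrict) {f g h : C.Hom P Q} (x : C.Z0 f g) (y : C.Z0 g h) :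
    F.map2 (C.m (add_zero 0) x.1 y.1) - D.m (add_zero 0) (F.map2 x.1) (F.map2 y.1) ∈
      LinearMap.range (D.d (f := F.map f) (g := F.map h) (show (-1:ℤ) + 1 = 0 by norm_num)) := by
  obtain ⟨K, hK⟩ := hF.map2_m f g h
  have := hK (i := 0) (i' := 1) (j := 0) (j' := 1) (l := -1) (l' := 0) (by norm_num) (by norm_num) (by norm_num)
    (add_zero 0) (by norm_num) (by norm_num) x.1 y.1
  refine ⟨_, (this.trans (add_eq_left.2 ?_)).symm⟩
  rw [K2Cat.mem_Z0.mp x.2, K2Cat.mem_Z0.mp y.2]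
  simp

theorem K2Map.IsStrict.H0_actR (hF : F.IsStrict) {f g : C.Hom P Q} (h : C.Hom Q R) (x : C.Z0 f g) :
    K2Cat.cast2 (hF.map_comp f h) (hF.map_comp g h) (F.map2 (C.actR h x.1)) - D.actR (F.map h) (F.map2 x.1) ∈
      LinearMap.range (D.d (f := D.comp (F.map f) (F.map h)) (g := D.comp (F.map g) (F.map h))
        (show (-1:ℤ) + 1 = 0 by norm_num)) := by
  obtain ⟨K, hK⟩ := hF.map2_actR f g h
  have := hK (n := -1) (n' := 0) (n'' := 1) (by norm_num) (by norm_num) x.1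
  refine ⟨_, (this.trans (add_eq_left.2 ?_)).symm⟩
  rw [K2Cat.mem_Z0.mp x.2, map_zero]

theorem K2Map.IsStrict.H0_actL (hF : F.IsStrict) (e : C.Hom R P) {f g : C.Hom P Q} (x : C.Z0 f g) :
    K2Cat.cast2 (hF.map_comp e f) (hF.map_comp e g) (F.map2 (C.actL e x.1)) - D.actL (F.map e) (F.map2 x.1) ∈
      LinearMap.range (D.d (f := D.comp (F.map e) (F.map f)) (g := D.comp (F.map e) (F.map g))
        (show (-1:ℤ) + 1 = 0 by norm_num)) := by
  obtain ⟨K, hK⟩ := hF.map2_actL e f g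
  have := hK (n := -1) (n' := 0) (n'' := 1) (by norm_num) (by norm_num) x.1
  refine ⟨_, (this.trans (add_eq_left.2 ?_)).symm⟩
  rw [K2Cat.mem_Z0.mp x.2, map_zero]

theorem K2Map.H0_isStrict (hF : F.IsStrict) : (K2Map.H0 hF).IsStrict where
  map_id := hF.map_id
  map_comp := hF.map_comp
  map2_add x y := map_add _ x y
  map2_smul c x := map_smul _ c x
  map2_m {P Q f g h} x y := by
    obtain ⟨x, rfl⟩ := Submodule.mkQ_surjective _ x
    obtain ⟨y, rfl⟩ := Submodule.mkQ_surjective _ y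
    exact (Submodule.Quotient.eq _).2 (hF.H0_m x y)
  map2_actR {P Q R f g} h x := by
    obtain ⟨x, rfl⟩ := Submodule.mkQ_surjective _ x
    exact (K2Cat.cast2_val (hF.map_comp f h) (hF.map_comp g h) (K2Map.zmap hF _ _ (K2Cat.zR h x))).trans
      ((Submodule.Quotient.eq _).2 (hF.H0_actR h x))
  map2_actL {P Q R f g} e x := by
    obtain ⟨x, rfl⟩ := Submodule.mkQ_surjective _ x
    exact (K2Cat.cast2_val (hF.map_comp e f) (hF.map_comp e g) (K2Map.zmap hF _ _ (K2Cat.zL e x))).trans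
      ((Submodule.Quotient.eq _).2 (hF.H0_actL e x))

end H0

section compat

/-- below the sum of `ks`, the elements of `J` are the sums of the final segments of `ks` -/
def Compat (J : Set ℕ) : List ℕ → Prop
  | [] => 0 ∈ J
  | i :: ks => Compat J ks ∧ ks.sum ∈ J ∧ ∀ j, ks.sum < j → j < i + ks.sum → j ∉ J

theorem Compat.zero_mem {J : Set ℕ} : ∀ {ks : List ℕ}, Compat J ks → 0 ∈ J
  | [], h => h
  | _ :: _, h => h.1.zero_mem

theorem Compat.trunc {J : Set ℕ} {l ks : List ℕ} (h : Trunc l ks) (hJ : Compat J ks) : l.sum ∉ J ∧ Compat J l := by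
  induction h with
  | @here i j ks h0 h =>
    refine ⟨hJ.2.2 _ ?_ ?_, hJ.1, hJ.2.1, fun n h1 h2 => hJ.2.2 n h1 (by omega)⟩
    · rw [List.sum_cons]; omega
    · rw [List.sum_cons]; omega
  | there h ih => exact ih hJ.1

/-- sums of final segments -/
def tailSums (ks : List ℕ) : Set ℕ := {n | ∃ s, n = (ks.drop s).sum}

theorem sum_drop_le (ks : List ℕ) {s t : ℕ} (h : s ≤ t) : (ks.drop t).sum ≤ (ks.drop s).sum := by
  obtain ⟨u, rfl⟩ := Nat.exists_eq_add_of_le h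
  rw [← List.drop_drop]
  exact (List.drop_sublist u _).sum_le_sum fun _ _ => Nat.zero_le _

theorem compat_tailSums (ks : List ℕ) : Compat (tailSums ks) ks := by
  suffices H : ∀ n l, ks.drop n = l → Compat (tailSums ks) l from H 0 ks rfl
  intro n l
  induction l generalizing n with
  | nil => exact fun h => ⟨n, by rw [h]; rfl⟩
  | cons i l ih =>
    intro h
    have h1 : ks.drop (n + 1) = l := by rw [← List.drop_drop, h]; rfl
    refine ⟨ih _ h1, ⟨n + 1, by rw [h1]⟩, ?_⟩
    rintro j hj hj' ⟨s, rfl⟩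
    rcases Nat.lt_or_ge n s with hs | hs
    · have := sum_drop_le ks (show n + 1 ≤ s from hs)
      rw [h1] at this; omega
    · have := sum_drop_le ks hs
      rw [h, List.sum_cons] at this; omega

end compat

section index
variable (J : Set ℕ)

/-- `(e₁,…,e_γ)`, positive, with sum `m`, such that no sum of a proper final segment lies in `J` unless it is empty -/
inductive IdxE : ℕ → List ℕ → Prop
  | nil : IdxE 0 []
  | cons {j a : ℕ} {l : List ℕ} (ha : 0 < a) (hj : j = 0 ∨ j ∉ J) (h : IdxE j l) : IdxE (a + j) (a :: l)

/-- the same for `(c₁,…,c_β; t; e₁,…,e_γ)` -/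
inductive IdxP : ℕ → List ℕ × ℕ × List ℕ → Prop
  | nil {j t : ℕ} {e : List ℕ} (hj : j = 0 ∨ j ∉ J) (h : IdxE J j e) : IdxP (t + j) ([], t, e)
  | cons {j a t : ℕ} {c e : List ℕ} (ha : 0 < a) (hj : j ∉ J) (h : IdxP j (c, t, e)) : IdxP (a + j) (a :: c, t, e)

/-- the same for `(a₁,…,a_α; i; c₁,…,c_β; t; e₁,…,e_γ)` -/
inductive IdxT : ℕ → Idx → Prop
  | nil {j i t : ℕ} {c e : List ℕ} (hj : j ∉ J) (h : IdxP J j (c, t, e)) : IdxT (i + j) ⟨[], i, c, t, e⟩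
  | cons {j a i t : ℕ} {as c e : List ℕ} (ha : 0 < a) (hj : j ∉ J) (h : IdxT j ⟨as, i, c, t, e⟩) :
      IdxT (a + j) ⟨a :: as, i, c, t, e⟩

/-- no sum of a nonempty proper final segment lies in `J` -/
def Avoids : List ℕ → Prop
  | [] => True
  | _ :: l => (l ≠ [] → l.sum ∉ J) ∧ Avoids l

variable {J}

theorem avoids_iff {l : List ℕ} : Avoids J l ↔ ∀ n, 0 < n → n < l.length → (l.drop n).sum ∉ J := by
  induction l with
  | nil => simp [Avoids]
  | cons a l ih =>
    rw [Avoids, ih]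
    constructor
    · rintro ⟨h1, h2⟩ n h0 hn
      obtain ⟨n, rfl⟩ := Nat.exists_eq_succ_of_ne_zero h0.ne'
      rw [List.drop_succ_cons]
      rcases Nat.eq_zero_or_pos n with rfl | hn0
      · exact h1 (by rintro rfl; simp at hn)
      · exact h2 n hn0 (by simpa using hn)
    · intro H
      refine ⟨fun hl => H 1 one_pos ?_, fun n h0 hn => ?_⟩
      · simpa using List.length_pos_of_ne_nil hl
      · exact H (n + 1) n.succ_pos (by simpa using hn)

theorem idxE_iff {m : ℕ} {l : List ℕ} : IdxE J m l ↔ (∀ x ∈ l, 0 < x) ∧ l.sum = m ∧ Avoids J l := by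
  constructor
  · intro h
    induction h with
    | nil => simp [Avoids]
    | @cons j a l ha hj h ih =>
      refine ⟨?_, ?_, ?_, ih.2.2⟩
      · rintro x (_ | ⟨_, hx⟩)
        · exact ha
        · exact ih.1 x hx
      · rw [List.sum_cons, ih.2.1]
      · intro hl
        rw [ih.2.1]
        rcases hj with rfl | hj
        · obtain ⟨x, hx⟩ := List.exists_mem_of_ne_nil l hl
          have h1 := List.le_sum_of_mem hx
          have h2 := ih.1 x hx
          have h3 := ih.2.1
          omega
        · exact hj
  · rintro ⟨h1, rfl, h2⟩
    induction l with
    | nil => exact .nil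
    | cons a l ih =>
      rw [List.sum_cons]
      refine .cons (h1 a (by simp)) ?_ (ih (fun x hx => h1 x (by simp [hx])) h2.2)
      by_cases hl : l = []
      · left; simp [hl]
      · right; exact h2.1 hl

theorem idxP_iff {m : ℕ} {c e : List ℕ} {t : ℕ} : IdxP J m (c, t, e) ↔
    ((∀ x ∈ c, 0 < x) ∧ ∀ x ∈ e, 0 < x) ∧ (c ++ t :: e).sum = m ∧ Avoids J (c ++ t :: e) := by
  constructor
  · intro h
    generalize hq : (c, t, e) = q at h
    induction h generalizing c with
    | @nil j t e hj h =>
      obtain ⟨rfl, rfl, rfl⟩ : c = [] ∧ _ ∧ _ := by simpa using hq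
      have h' := idxE_iff.1 h
      refine ⟨⟨by simp, h'.1⟩, by simp [h'.2.1], ?_, h'.2.2⟩
      intro he
      rw [h'.2.1]
      rcases hj with rfl | hj
      · obtain ⟨x, hx⟩ := List.exists_mem_of_ne_nil _ he
        have h1 := List.le_sum_of_mem hx
        have h2 := h'.1 x hx
        have h3 := h'.2.1
        omega
      · exact hj
    | @cons j a t c e ha hj h ih =>
      obtain ⟨h1, h2⟩ := Prod.mk.inj hq
      obtain ⟨h2, h3⟩ := Prod.mk.inj h2
      subst h1 h2 h3
      have h' := ih rfl
      refine ⟨⟨?_, h'.1.2⟩, by rw [List.cons_append, List.sum_cons, h'.2.1], ?_, h'.2.2⟩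
      · rintro x (_ | ⟨_, hx⟩)
        · exact ha
        · exact h'.1.1 x hx
      · intro _
        change (c ++ t :: e).sum ∉ J
        rw [h'.2.1]; exact hj
  · rintro ⟨⟨hc, he⟩, rfl, h2⟩
    induction c with
    | nil =>
      rw [List.nil_append, List.sum_cons]
      refine .nil ?_ (idxE_iff.2 ⟨he, rfl, h2.2⟩)
      by_cases hl : e = []
      · left; simp [hl]
      · right; exact h2.1 hl
    | cons a c ih =>
      rw [List.cons_append, List.sum_cons]
      exact .cons (hc a (by simp)) (h2.1 (by simp)) (ih (fun x hx => hc x (by simp [hx])) h2.2)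

theorem idxT_iff {m : ℕ} {a c e : List ℕ} {i t : ℕ} : IdxT J m ⟨a, i, c, t, e⟩ ↔
    ((∀ x ∈ a, 0 < x) ∧ (∀ x ∈ c, 0 < x) ∧ ∀ x ∈ e, 0 < x) ∧ (a ++ i :: (c ++ t :: e)).sum = m ∧
      Avoids J (a ++ i :: (c ++ t :: e)) := by
  constructor
  · intro h
    generalize hq : Idx.mk a i c t e = q at h
    induction h generalizing a with
    | @nil j i t c e hj h =>
      injection hq with h1 h2 h3 h4 h5
      subst h1 h2 h3 h4 h5
      have h' := idxP_iff.1 h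
      refine ⟨⟨by simp, h'.1⟩, by rw [List.nil_append, List.sum_cons, h'.2.1], ?_, h'.2.2⟩
      intro _
      rw [h'.2.1]; exact hj
    | @cons j b i t as c e ha hj h ih =>
      injection hq with h1 h2 h3 h4 h5
      subst h1 h2 h3 h4 h5
      have h' := ih rfl
      refine ⟨⟨?_, h'.1.2⟩, by rw [List.cons_append, List.sum_cons, h'.2.1], ?_, h'.2.2⟩
      · rintro x (_ | ⟨_, hx⟩)
        · exact ha
        · exact h'.1.1 x hx
      · intro _
        change (as ++ i :: (c ++ t :: e)).sum ∉ J
        rw [h'.2.1]; exact hj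
  · rintro ⟨⟨ha, hce⟩, rfl, h2⟩
    induction a with
    | nil =>
      rw [List.nil_append, List.sum_cons]
      exact .nil (h2.1 (by simp)) (idxP_iff.2 ⟨hce, rfl, h2.2⟩)
    | cons b a ih =>
      rw [List.cons_append, List.sum_cons]
      exact .cons (ha b (by simp)) (h2.1 (by simp)) (ih (fun x hx => ha x (by simp [hx])) h2.2)

theorem mem_Q_iff {ks : List ℕ} (hks : ∀ i ∈ ks, 0 < i) (q : Idx) : q ∈ Q ks ↔ IdxT (tailSums ks) ks.sum q := by
  obtain ⟨a, i, c, t, e⟩ := q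
  rw [idxT_iff, avoids_iff]
  have hl : Idx.list ⟨a, i, c, t, e⟩ = a ++ i :: (c ++ t :: e) := by simp [Idx.list]
  set L := a ++ i :: (c ++ t :: e) with hL
  have hsplit : ∀ (l : List ℕ) n, (l.take n).sum + (l.drop n).sum = l.sum := fun l n => by
    rw [← List.sum_append, List.take_append_drop]
  have hpos : ∀ s, s < ks.length → 0 < (ks.drop s).sum := by
    intro s hs
    have h1 : ks[s] ∈ ks.drop s := by
      have := List.drop_eq_getElem_cons hs
      exact this ▸ List.mem_cons_self
    exact (hks _ (List.getElem_mem hs)).trans_le (List.le_sum_of_mem h1)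
  have hLpos : 0 < L.length := by simp [hL]
  constructor
  · rintro ⟨ha, hc, he, H⟩
    rw [hl] at H
    have htot : L.sum = ks.sum := by
      have := (H L.length hLpos le_rfl ks.length le_rfl).2 ⟨rfl, rfl⟩
      rwa [List.take_length, List.take_length] at this
    refine ⟨⟨ha, hc, he⟩, htot, ?_⟩
    rintro n h0 hn ⟨s, hs⟩
    have hs' : (L.take n).sum = (ks.take (min s ks.length)).sum := by
      have h1 := hsplit L n
      have h2 := hsplit ks s
      rw [List.take_eq_take_min] at h2
      omega
    exact absurd ((H n h0 hn.le _ (min_le_right _ _)).1 hs').1 hn.ne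
  · rintro ⟨⟨ha, hc, he⟩, htot, H⟩
    refine ⟨ha, hc, he, ?_⟩
    rw [hl]
    intro j hj hjl s hs
    have h1 := hsplit L j
    have h2 := hsplit ks s
    constructor
    · intro hsum
      have h3 : (L.drop j).sum = (ks.drop s).sum := by omega
      have hj' : j = L.length := by
        by_contra hne
        exact H j hj (lt_of_le_of_ne hjl hne) ⟨s, h3⟩
      refine ⟨hj', ?_⟩
      by_contra hne
      have := hpos s (lt_of_le_of_ne hs hne)
      rw [hj', List.drop_length] at h3
      simp at h3
      omega
    · rintro ⟨rfl, rfl⟩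
      rw [List.take_length, List.take_length, htot]

end index

section finsum

theorem finsum_mem_step {ι κ M N : Type*} [AddCommMonoid M] [AddCommMonoid N] (I : Finset ℕ) (V : ℕ → Set ι)
    (hV : ∀ j ∈ I, (V j).Finite) (c : ℕ → ι → κ)
    (hc : ∀ j ∈ I, ∀ j' ∈ I, ∀ x x', c j x = c j' x' → j = j' ∧ x = x') (F : κ → N) (G : ι → M) (L : ℕ → M →+ N)
    (hF : ∀ j ∈ I, ∀ x ∈ V j, F (c j x) = L j (G x)) :
    (⋃ j ∈ I, c j '' V j).Finite ∧ ∑ᶠ q ∈ ⋃ j ∈ I, c j '' V j, F q = ∑ j ∈ I, L j (∑ᶠ x ∈ V j, G x) := by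
  have hfin : ∀ j ∈ I, (c j '' V j).Finite := fun j hj => (hV j hj).image _
  refine ⟨I.finite_toSet.biUnion hfin, ?_⟩
  have hd : (I : Set ℕ).PairwiseDisjoint fun j => c j '' V j := by
    intro j hj j' hj' hne
    refine Set.disjoint_left.2 ?_
    rintro _ ⟨x, _, rfl⟩ ⟨x', _, h⟩
    exact hne (hc j hj j' hj' x x' h.symm).1
  have h1 := finsum_mem_biUnion (f := F) hd I.finite_toSet hfin
  refine h1.trans ?_
  rw [finsum_mem_coe_finset]
  refine Finset.sum_congr rfl fun j hj => ?_
  rw [finsum_mem_image fun x _ x' _ h => (hc j hj j hj x x' h).2, (L j).map_finsum_mem _ (hV j hj)]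
  exact finsum_mem_congr rfl fun x hx => hF j hj x hx

end finsum

section sets
variable {J : Set ℕ}

theorem setOf_idxE_zero : {l | IdxE J 0 l} = {[]} := by
  ext l
  constructor
  · intro h
    change IdxE J 0 l at h
    generalize hm : 0 = m at h
    cases h with
    | nil => rfl
    | cons ha hj h => omega
  · rintro rfl
    exact IdxE.nil

open Classical in
theorem setOf_idxE {m : ℕ} (hm : 0 < m) : {l | IdxE J m l} =
    ⋃ j ∈ (Finset.range m).filter (fun j => j = 0 ∨ j ∉ J), (fun l => (m - j) :: l) '' {l | IdxE J j l} := by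
  ext l
  simp only [Set.mem_iUnion, Finset.mem_filter, Finset.mem_range, Set.mem_image, exists_prop]
  constructor
  · intro h
    change IdxE J m l at h
    cases h with
    | nil => exact absurd hm (lt_irrefl 0)
    | @cons j a l ha hj h => exact ⟨j, ⟨by omega, hj⟩, l, h, by rw [Nat.add_sub_cancel]⟩
  · rintro ⟨j, ⟨hjm, hj⟩, l, h, rfl⟩
    have := IdxE.cons (a := m - j) (by omega) hj h
    rwa [Nat.sub_add_cancel hjm.le] at this

open Classical in
theorem setOf_idxP (m : ℕ) : {q | IdxP J m q} =
    (⋃ j ∈ (Finset.range (m + 1)).filter (fun j => j = 0 ∨ j ∉ J), (fun e => ([], m - j, e)) '' {e | IdxE J j e}) ∪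
    ⋃ j ∈ (Finset.range m).filter (fun j => j ∉ J), (fun q => ((m - j) :: q.1, q.2)) '' {q | IdxP J j q} := by
  ext q
  simp only [Set.mem_union, Set.mem_iUnion, Finset.mem_filter, Finset.mem_range, Set.mem_image, exists_prop]
  constructor
  · intro h
    change IdxP J m q at h
    cases h with
    | @nil j t e hj h => exact .inl ⟨j, ⟨by omega, hj⟩, e, h, by rw [Nat.add_sub_cancel]⟩
    | @cons j a t c e ha hj h => exact .inr ⟨j, ⟨by omega, hj⟩, (c, t, e), h, by rw [Nat.add_sub_cancel]⟩
  · rintro (⟨j, ⟨hjm, hj⟩, e, h, rfl⟩ | ⟨j, ⟨hjm, hj⟩, ⟨c, t, e⟩, h, rfl⟩)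
    · have := IdxP.nil (t := m - j) hj h
      rwa [Nat.sub_add_cancel (Nat.le_of_lt_succ hjm)] at this
    · have := IdxP.cons (a := m - j) (by omega) hj h
      rwa [Nat.sub_add_cancel hjm.le] at this

open Classical in
theorem setOf_idxT (m : ℕ) : {q | IdxT J m q} =
    (⋃ j ∈ (Finset.range (m + 1)).filter (fun j => j ∉ J),
      (fun q => Idx.mk [] (m - j) q.1 q.2.1 q.2.2) '' {q | IdxP J j q}) ∪
    ⋃ j ∈ (Finset.range m).filter (fun j => j ∉ J), (fun q => Idx.mk ((m - j) :: q.a) q.i q.c q.t q.e) '' {q | IdxT J j q} := by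
  ext q
  simp only [Set.mem_union, Set.mem_iUnion, Finset.mem_filter, Finset.mem_range, Set.mem_image, exists_prop]
  constructor
  · intro h
    change IdxT J m q at h
    cases h with
    | @nil j i t c e hj h => exact .inl ⟨j, ⟨by omega, hj⟩, (c, t, e), h, by rw [Nat.add_sub_cancel]⟩
    | @cons j a i t as c e ha hj h => exact .inr ⟨j, ⟨by omega, hj⟩, ⟨as, i, c, t, e⟩, h, by rw [Nat.add_sub_cancel]⟩
  · rintro (⟨j, ⟨hjm, hj⟩, ⟨c, t, e⟩, h, rfl⟩ | ⟨j, ⟨hjm, hj⟩, ⟨as, i, c, t, e⟩, h, rfl⟩)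
    · have := IdxT.nil (i := m - j) hj h
      rwa [Nat.sub_add_cancel (Nat.le_of_lt_succ hjm)] at this
    · have := IdxT.cons (a := m - j) (by omega) hj h
      rwa [Nat.sub_add_cancel hjm.le] at this

end sets

section finsum
variable {J : Set ℕ} {N : Type*} [AddCommMonoid N]

open Classical in
theorem finsum_idxE (F : List ℕ → N) (L : ℕ → N →+ N) (hF : ∀ a l, F (a :: l) = L a (F l)) {m : ℕ} (hm : 0 < m)
    (hfin : ∀ j < m, {l | IdxE J j l}.Finite) :
    {l | IdxE J m l}.Finite ∧ ∑ᶠ l ∈ {l | IdxE J m l}, F l =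
      ∑ j ∈ (Finset.range m).filter (fun j => j = 0 ∨ j ∉ J), L (m - j) (∑ᶠ l ∈ {l | IdxE J j l}, F l) := by
  rw [setOf_idxE hm]
  refine finsum_mem_step _ (fun j => {l | IdxE J j l}) (fun j hj => hfin j ?_) (fun j l => (m - j) :: l) ?_ F F
    (fun j => L (m - j)) (fun j _ l _ => hF _ l)
  · exact Finset.mem_range.1 (Finset.mem_filter.1 hj).1
  · intro j hj j' hj' l l' h
    have h1 := Finset.mem_range.1 (Finset.mem_filter.1 hj).1
    have h2 := Finset.mem_range.1 (Finset.mem_filter.1 hj').1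
    obtain ⟨h3, h4⟩ := List.cons.inj h
    exact ⟨by omega, h4⟩

theorem finite_idxE (m : ℕ) : {l | IdxE J m l}.Finite := by
  induction m using Nat.strong_induction_on with
  | _ m ih =>
    rcases Nat.eq_zero_or_pos m with rfl | hm
    · rw [setOf_idxE_zero]; exact Set.finite_singleton _
    · exact (finsum_idxE (N := ℕ) (fun _ => 0) (fun _ => 0) (fun _ _ => rfl) hm ih).1

open Classical in
theorem finsum_idxP {N' : Type*} [AddCommMonoid N'] (F : List ℕ × ℕ × List ℕ → N) (L : ℕ → N →+ N) (G : List ℕ → N')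
    (L' : ℕ → N' →+ N) (hF' : ∀ t e, F ([], t, e) = L' t (G e)) (hF : ∀ a c q, F (a :: c, q) = L a (F (c, q))) {m : ℕ}
    (hfin : ∀ j < m, {q | IdxP J j q}.Finite) :
    {q | IdxP J m q}.Finite ∧ ∑ᶠ q ∈ {q | IdxP J m q}, F q =
      (∑ j ∈ (Finset.range (m + 1)).filter (fun j => j = 0 ∨ j ∉ J), L' (m - j) (∑ᶠ l ∈ {l | IdxE J j l}, G l)) +
      ∑ j ∈ (Finset.range m).filter (fun j => j ∉ J), L (m - j) (∑ᶠ q ∈ {q | IdxP J j q}, F q) := by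
  rw [setOf_idxP]
  have h1 := finsum_mem_step ((Finset.range (m + 1)).filter (fun j => j = 0 ∨ j ∉ J)) (fun j => {l | IdxE J j l})
    (fun j _ => finite_idxE j) (fun j e => (([], m - j, e) : List ℕ × ℕ × List ℕ)) ?_ F G (fun j => L' (m - j))
    (fun j _ l _ => hF' _ l)
  have h2 := finsum_mem_step ((Finset.range m).filter (fun j => j ∉ J)) (fun j => {q | IdxP J j q}) (fun j hj => hfin j ?_)
    (fun j q => (((m - j) :: q.1, q.2) : List ℕ × ℕ × List ℕ)) ?_ F F (fun j => L (m - j))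
    (fun j _ q _ => hF _ _ _)
  · refine ⟨h1.1.union h2.1, ?_⟩
    rw [finsum_mem_union ?_ h1.1 h2.1, h1.2, h2.2]
    refine Set.disjoint_left.2 ?_
    intro q hq hq'
    simp only [Set.mem_iUnion, Set.mem_image] at hq hq'
    obtain ⟨_, _, _, _, rfl⟩ := hq
    obtain ⟨_, _, _, _, h⟩ := hq'
    exact absurd (congrArg Prod.fst h) (List.cons_ne_nil _ _)
  · exact Finset.mem_range.1 (Finset.mem_filter.1 hj).1
  · intro j hj j' hj' l l' h
    have h1 := Finset.mem_range.1 (Finset.mem_filter.1 hj).1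
    have h2 := Finset.mem_range.1 (Finset.mem_filter.1 hj').1
    obtain ⟨h3, h4⟩ := Prod.mk.inj h
    obtain ⟨h3, h5⟩ := List.cons.inj h3
    exact ⟨by omega, Prod.ext h5 h4⟩
  · intro j hj j' hj' l l' h
    have h1 := Finset.mem_range.1 (Finset.mem_filter.1 hj).1
    have h2 := Finset.mem_range.1 (Finset.mem_filter.1 hj').1
    obtain ⟨_, h3⟩ := Prod.mk.inj h
    obtain ⟨h3, h4⟩ := Prod.mk.inj h3
    exact ⟨by omega, h4⟩

theorem finite_idxP (m : ℕ) : {q | IdxP J m q}.Finite := by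
  induction m using Nat.strong_induction_on with
  | _ m ih => exact (finsum_idxP (N := ℕ) (N' := ℕ) (fun _ => 0) (fun _ => 0) (fun _ => 0) (fun _ => 0)
      (fun _ _ => rfl) (fun _ _ _ => rfl) ih).1

open Classical in
theorem finsum_idxT {N' : Type*} [AddCommMonoid N'] (F : Idx → N) (L : ℕ → N →+ N) (G : List ℕ × ℕ × List ℕ → N')
    (L' : ℕ → N' →+ N) (hF' : ∀ i q, F ⟨[], i, q.1, q.2.1, q.2.2⟩ = L' i (G q))
    (hF : ∀ b q, F ⟨b :: q.a, q.i, q.c, q.t, q.e⟩ = L b (F q)) {m : ℕ}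
    (hfin : ∀ j < m, {q | IdxT J j q}.Finite) :
    {q | IdxT J m q}.Finite ∧ ∑ᶠ q ∈ {q | IdxT J m q}, F q =
      (∑ j ∈ (Finset.range (m + 1)).filter (fun j => j ∉ J), L' (m - j) (∑ᶠ l ∈ {l | IdxP J j l}, G l)) +
      ∑ j ∈ (Finset.range m).filter (fun j => j ∉ J), L (m - j) (∑ᶠ q ∈ {q | IdxT J j q}, F q) := by
  rw [setOf_idxT]
  have h1 := finsum_mem_step ((Finset.range (m + 1)).filter (fun j => j ∉ J)) (fun j => {l | IdxP J j l})
    (fun j _ => finite_idxP j) (fun j q => Idx.mk [] (m - j) q.1 q.2.1 q.2.2) ?_ F G (fun j => L' (m - j))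
    (fun j _ l _ => hF' _ l)
  have h2 := finsum_mem_step ((Finset.range m).filter (fun j => j ∉ J)) (fun j => {q | IdxT J j q}) (fun j hj => hfin j ?_)
    (fun j q => Idx.mk ((m - j) :: q.a) q.i q.c q.t q.e) ?_ F F (fun j => L (m - j))
    (fun j _ q _ => hF _ _)
  · refine ⟨h1.1.union h2.1, ?_⟩
    rw [finsum_mem_union ?_ h1.1 h2.1, h1.2, h2.2]
    refine Set.disjoint_left.2 ?_
    intro q hq hq'
    simp only [Set.mem_iUnion, Set.mem_image] at hq hq'
    obtain ⟨_, _, _, _, rfl⟩ := hq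
    obtain ⟨_, _, _, _, h⟩ := hq'
    exact absurd (congrArg Idx.a h) (List.cons_ne_nil _ _)
  · exact Finset.mem_range.1 (Finset.mem_filter.1 hj).1
  · rintro j hj j' hj' ⟨a, i, c, t, e⟩ ⟨a', i', c', t', e'⟩ h
    have h1 := Finset.mem_range.1 (Finset.mem_filter.1 hj).1
    have h2 := Finset.mem_range.1 (Finset.mem_filter.1 hj').1
    injection h with h3 h4 h5 h6 h7
    obtain ⟨h3, h8⟩ := List.cons.inj h3
    exact ⟨by omega, by simp only at h8 h4 h5 h6 h7; rw [h8, h4, h5, h6, h7]⟩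
  · intro j hj j' hj' l l' h
    have h1 := Finset.mem_range.1 (Finset.mem_filter.1 hj).1
    have h2 := Finset.mem_range.1 (Finset.mem_filter.1 hj').1
    injection h with h3 h4 h5 h6 h7
    exact ⟨by omega, Prod.ext h5 (Prod.ext h6 h7)⟩

theorem finite_idxT (m : ℕ) : {q | IdxT J m q}.Finite := by
  induction m using Nat.strong_induction_on with
  | _ m ih => exact (finsum_idxT (N := ℕ) (N' := ℕ) (fun _ => 0) (fun _ => 0) (fun _ => 0) (fun _ => 0)
      (fun _ _ => rfl) (fun _ _ => rfl) ih).1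

end finsum

section length
variable {A B : GQuiver k} {o o' o'' : A.Ob → B.Ob}

/-- `T^m A` -/
def Tlen (A : GQuiver k) (m : ℕ) (X Y : A.Ob) : Submodule k (A.T X Y) :=
  Submodule.span k {x | ∃ (p : Chain Y X) (s : A.tens p), p.length = m ∧ A.inj p s = x}

theorem inj_mem_Tlen {X Y : A.Ob} (p : Chain Y X) (s : A.tens p) : A.inj p s ∈ Tlen A p.length X Y :=
  Submodule.subset_span ⟨p, s, rfl, rfl⟩

theorem Tlen_le {m : ℕ} {X Y : A.Ob} {N : Submodule k (A.T X Y)}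
    (h : ∀ (p : Chain Y X) (s : A.tens p), p.length = m → A.inj p s ∈ N) : Tlen A m X Y ≤ N := by
  refine Submodule.span_le.2 ?_
  rintro _ ⟨p, s, hp, rfl⟩
  exact h p s hp

theorem eqOn_Tlen {M : Type u} [AddCommGroup M] [Module k M] {m : ℕ} {X Y : A.Ob} {φ ψ : A.T X Y →ₗ[k] M}
    (h : ∀ (p : Chain Y X) (s : A.tens p), p.length = m → φ (A.inj p s) = ψ (A.inj p s)) {x : A.T X Y}
    (hx : x ∈ Tlen A m X Y) : φ x = ψ x :=
  Tlen_le (N := LinearMap.eqLocus φ ψ) h hx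

theorem cons_mem_Tlen {m : ℕ} {X Z Y : A.Ob} (v : A.hom X Z) {y : A.T Z Y} (hy : y ∈ Tlen A m Z Y) :
    A.cons X Z Y v y ∈ Tlen A (m + 1) X Y := by
  refine Tlen_le (N := (Tlen A (m + 1) X Y).comap (A.cons X Z Y v)) ?_ hy
  rintro p s rfl
  rw [Submodule.mem_comap, A.cons_inj, show p.length + 1 = (Chain.cons X p).length from rfl]
  exact inj_mem_Tlen _ _

theorem concat_inj_mem_Tlen {n : ℕ} {X Z Y : A.Ob} (p : Chain Z X) (s : A.tens p) {y : A.T Z Y}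
    (hy : y ∈ Tlen A n Z Y) : concat A X Z Y (A.inj p s) y ∈ Tlen A (p.length + n) X Y := by
  induction p with
  | nil =>
    obtain ⟨c, hc⟩ := inj_nil _ s
    rw [hc, map_smul, LinearMap.smul_apply, concat_one, show (Chain.nil (Y := Z)).length + n = n from zero_add n]
    exact Submodule.smul_mem _ c hy
  | @cons X V p ih =>
    obtain ⟨s, rfl⟩ := (A.tensCons X p).surjective s
    rw [show (Chain.cons X p).length + n = p.length + n + 1 from Nat.add_right_comm _ _ _]
    induction s using TensorProduct.induction_on with
    | zero => rw [map_zero, map_zero, map_zero, LinearMap.zero_apply]; exact Submodule.zero_mem _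
    | add a b ha hb => rw [map_add, map_add, map_add, LinearMap.add_apply]; exact Submodule.add_mem _ ha hb
    | tmul v s =>
      rw [← A.cons_inj, concat_cons]
      exact cons_mem_Tlen v (ih s)

theorem concat_mem_Tlen {m n : ℕ} {X Z Y : A.Ob} {x : A.T X Z} {y : A.T Z Y} (hx : x ∈ Tlen A m X Z)
    (hy : y ∈ Tlen A n Z Y) : concat A X Z Y x y ∈ Tlen A (m + n) X Y := by
  refine Tlen_le (N := (Tlen A (m + n) X Y).comap ((concat A X Z Y).flip y)) ?_ hx
  rintro p s rfl
  exact concat_inj_mem_Tlen p s hy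

theorem Word.mulAll_mem {S : Set A.Ob} {ks : List ℕ} {X Y : A.Ob} {t : (plus A).T X Y} (ht : Word A S Y ks t) :
    mulAll A X Y t ∈ Tlen A ks.sum X Y := by
  induction ht with
  | one =>
    rw [mulAll_one]
    exact inj_mem_Tlen Chain.nil _
  | cons p hp s hw ih =>
    rw [mulAll_cons, ofT_inj p (Chain.good_univ_of_pos hp.length_pos), toT_barInj, List.sum_cons]
    exact concat_mem_Tlen (inj_mem_Tlen p s) ih

/-- the family that is `W m` on `T^m A` -/
def byLen (W : ℕ → HomFam A B o o') : HomFam A B o o' := fun X Y => lift fun p => W p.length X Y ∘ₗ A.inj p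

theorem byLen_inj (W : ℕ → HomFam A B o o') {X Y : A.Ob} (p : Chain Y X) (s : A.tens p) :
    byLen W X Y (A.inj p s) = W p.length X Y (A.inj p s) :=
  A.lift_inj _ p s

theorem byLen_apply (W : ℕ → HomFam A B o o') {m : ℕ} {X Y : A.Ob} {x : A.T X Y} (hx : x ∈ Tlen A m X Y) :
    byLen W X Y x = W m X Y x := by
  refine eqOn_Tlen (fun p s hp => ?_) hx
  rw [byLen_inj, hp]

/-- `r_n`, as a family of maps into `T¹B` -/
def blk (r : Fam A B o o') (n : ℕ) : HomFam A B o o' := single fun X Y => r X Y ∘ₗ lenProj A n X Y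

theorem blk_inj (r : Fam A B o o') (n : ℕ) {X Y : A.Ob} (p : Chain Y X) (s : A.tens p) :
    blk r n X Y (A.inj p s) = if p.length = n then single r X Y (A.inj p s) else 0 := by
  rw [blk, single_apply, LinearMap.comp_apply, lenProj, lift_inj]
  split_ifs with h
  · rfl
  · rw [LinearMap.zero_apply, map_zero, map_zero, LinearMap.zero_apply]

theorem blk_apply (r : Fam A B o o') {n : ℕ} {X Y : A.Ob} {x : A.T X Y} (hx : x ∈ Tlen A n X Y) :
    blk r n X Y x = single r X Y x := by
  refine eqOn_Tlen (fun p s hp => ?_) hx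
  rw [blk_inj, if_pos hp]

theorem blk_zero {f : FunData A B} (hf : f.Unital0) : blk f.comp 0 = 0 := by
  funext X Y
  refine LinearMap.ext fun x => ?_
  refine inj_induction (motive := fun x => blk f.comp 0 X Y x = 0) (map_zero _) ?_ ?_ x
  · intro a b ha hb; rw [map_add, ha, hb, add_zero]
  · intro p s
    rw [blk_inj]
    split_ifs with h
    · cases p with
      | cons X p => exact absurd h (Nat.succ_ne_zero _)
      | nil =>
        obtain ⟨c, hc⟩ := inj_nil X s
        rw [hc, map_smul, single_apply, hf X, map_zero, LinearMap.zero_apply, smul_zero]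
    · rfl

theorem elim₂_sum {ι : Type*} {X Y : A.Ob} {M : Type u} [AddCommGroup M] [Module k M] (I : Finset ι)
    (β : ι → ∀ Z, A.T X Z →ₗ[k] A.T Z Y →ₗ[k] M) (t : A.T2 X Y) :
    elim₂ (fun Z => ∑ i ∈ I, β i Z) t = ∑ i ∈ I, elim₂ (β i) t := by
  classical
  induction I using Finset.induction_on with
  | empty => exact elim₂_zero t
  | insert i I hi ih => simp only [Finset.sum_insert hi, elim₂_add, ih]

theorem elim₂_cut_inj_congr {X Y : A.Ob} {M : Type u} [AddCommGroup M] [Module k M] (p : Chain Y X) (s : A.tens p)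
    {β γ : ∀ W, A.T X W →ₗ[k] A.T W Y →ₗ[k] M}
    (h : ∀ W (q : Chain W X) (q' : Chain Y W) a b, q.length + q'.length = p.length →
      β W (A.inj q a) (A.inj q' b) = γ W (A.inj q a) (A.inj q' b)) :
    elim₂ β (A.cut X Y (A.inj p s)) = elim₂ γ (A.cut X Y (A.inj p s)) := by
  have h1 := elim₂_cut_inj_mem ⊥ p s (fun W => β W + (-1 : k) • γ W) (fun W q q' a b _ hl => by
    rw [Submodule.mem_bot, LinearMap.add_apply, LinearMap.add_apply, h W q q' a b hl, LinearMap.smul_apply,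
      LinearMap.smul_apply, neg_one_smul, add_neg_cancel])
  have h2 := elim₂_smul (-1 : k) γ (A.cut X Y (A.inj p s))
  have h3 := elim₂_add β (fun W => (-1 : k) • γ W) (A.cut X Y (A.inj p s))
  rw [h2, neg_one_smul, ← sub_eq_add_neg] at h3
  exact sub_eq_zero.1 (h3.symm.trans ((Submodule.mem_bot k).1 h1))

theorem convMul_byLen (φ : Fam A B o o') (W : ℕ → HomFam A B o' o'') {m : ℕ} {X Y : A.Ob} {x : A.T X Y}
    (hx : x ∈ Tlen A m X Y) : (single φ ⍟ byLen W) X Y x = ∑ j ∈ Finset.range (m + 1), (blk φ (m - j) ⍟ W j) X Y x := by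
  have h : ∀ x, (∑ j ∈ Finset.range (m + 1), (blk φ (m - j) ⍟ W j) X Y) x =
      ∑ j ∈ Finset.range (m + 1), (blk φ (m - j) ⍟ W j) X Y x := fun x => LinearMap.sum_apply _ _ _
  rw [← h]
  refine eqOn_Tlen (fun p s hp => ?_) hx
  rw [h, convMul_apply]
  simp only [convMul_apply]
  rw [← elim₂_sum]
  refine elim₂_cut_inj_congr p s fun V q q' a b hl => ?_
  rw [LinearMap.sum_apply, LinearMap.sum_apply, Finset.sum_eq_single q'.length]
  · rw [LinearMap.compl₁₂_apply, LinearMap.compl₁₂_apply, byLen_inj, blk_inj, if_pos (by omega)]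
  · intro j hj hne
    have := Finset.mem_range.1 hj
    rw [LinearMap.compl₁₂_apply, blk_inj, if_neg (by omega), map_zero, LinearMap.zero_apply]
  · intro hn
    exact absurd (Finset.mem_range.2 (by omega)) hn

open Classical in
/-- `W` with the terms at `J` removed -/
def off (J : Set ℕ) (W : ℕ → HomFam A B o o') (j : ℕ) : HomFam A B o o' := if j ∈ J then 0 else W j

theorem off_of_mem {J : Set ℕ} (W : ℕ → HomFam A B o o') {j : ℕ} (h : j ∈ J) : off J W j = 0 := if_pos h

theorem off_of_notMem {J : Set ℕ} (W : ℕ → HomFam A B o o') {j : ℕ} (h : j ∉ J) : off J W j = W j := if_neg h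

open Classical in
theorem convMul_byLen_off (J : Set ℕ) (φ : Fam A B o o') (W : ℕ → HomFam A B o' o'') {m : ℕ} {X Y : A.Ob} {x : A.T X Y}
    (hx : x ∈ Tlen A m X Y) : (single φ ⍟ byLen (off J W)) X Y x =
      (∑ j ∈ (Finset.range (m + 1)).filter (fun j => j ∉ J), blk φ (m - j) ⍟ W j) X Y x := by
  rw [convMul_byLen φ _ hx, Finset.sum_filter, Finset.sum_apply, Finset.sum_apply, LinearMap.sum_apply]
  refine Finset.sum_congr rfl fun j _ => ?_
  split_ifs with h
  · rw [off_of_mem W h, map_zero]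
  · rw [off_of_notMem W h]

open Classical in
theorem convMul_byLen_off_unital (J : Set ℕ) {f : FunData A B} (hf : f.Unital0) {o'' : A.Ob → B.Ob}
    (W : ℕ → HomFam A B f.obj o'') {m : ℕ} {X Y : A.Ob} {x : A.T X Y} (hx : x ∈ Tlen A m X Y) :
    (single f.comp ⍟ byLen (off J W)) X Y x =
      (∑ j ∈ (Finset.range m).filter (fun j => j ∉ J), blk f.comp (m - j) ⍟ W j) X Y x := by
  rw [convMul_byLen_off J _ _ hx, Finset.sum_filter, Finset.sum_range_succ, Nat.sub_self, blk_zero hf, map_zero,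
    LinearMap.zero_apply, ite_self, add_zero, Finset.sum_filter]

end length

section words
variable {A B : GQuiver k} {o o' o'' : A.Ob → B.Ob} {S : Set A.Ob} {J : Set ℕ}

theorem elim₂_cut_word {M : Type u} [AddCommGroup M] [Module k M] {ks : List ℕ} {X Y : A.Ob}
    {t : (plus A).T X Y} (ht : Word A S Y ks t) (hJ : Compat J ks) (β : ∀ W, (plus A).T X W →ₗ[k] (plus A).T W Y →ₗ[k] M)
    (hβ : ∀ W a l t', l.sum ∈ J → Word A S Y l t' → β W a t' = 0) :
    elim₂ (Q := plus A) β ((plus A).cut X Y t) = β X ((plus A).one X) t := by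
  induction ht with
  | one => rw [cut_one, elim₂_tmul₂]
  | @cons X Z ks w p hp s hw ih =>
    rw [cut_sum_cons, ih hJ.1 (fun W => (β W).comp ((plus A).cons X Z W (ofT A Set.univ X Z (A.inj p s))))
      (fun W a l t' hl ht' => hβ W _ l t' hl ht')]
    have : β Z ((plus A).cons X Z Z (ofT A Set.univ X Z (A.inj p s)) ((plus A).one Z)) w = 0 := hβ Z _ ks w hJ.2.1 hw
    rw [LinearMap.comp_apply, this, add_zero]

theorem icMul_word {ks : List ℕ} {X Y : A.Ob} {t : (plus A).T X Y} (ht : Word A S Y ks t) (hJ : Compat J ks)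
    (φ : Fam A B o o') (W : ℕ → HomFam A B o' o'') (ψ : HomFam (plus A) B o' o'')
    (hψ : ∀ X l t', Trunc l ks → Word A S Y l t' → ψ X Y t' = W l.sum X Y (mulAll A X Y t')) :
    (preMul A B o o' (single φ) ⊚ ψ) X Y t = (single φ ⍟ byLen (off J W)) X Y (mulAll A X Y t) -
      concat B (o X) (o' X) (o'' Y) (single φ X X (A.one X)) (off J W ks.sum X Y (mulAll A X Y t)) := by
  rw [eq_sub_iff_add_eq]
  refine Eq.trans ?_ (LinearMap.congr_fun (congrFun (congrFun (preMul_convMul (single φ) (byLen (off J W))) X) Y) t).symm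
  refine Eq.trans ?_ (add_comm _ _)
  refine congrArg₂ (fun a b : B.T (o X) (o'' Y) => a + b) ?_ ?_
  · rw [icMul_apply, icMul_apply]
    have h1 := elim₂_icut_mem ⊥ ht (fun Z => ((concat B (o X) (o' Z) (o'' Y)).compl₁₂
      (preMul A B o o' (single φ) X Z) (ψ Z Y)) + (-1 : k) • ((concat B (o X) (o' Z) (o'' Y)).compl₁₂
      (preMul A B o o' (single φ) X Z) (preMul A B o' o'' (byLen (off J W)) Z Y))) ?_
    · have h2 := elim₂_smul (P := plus A) (-1 : k) (fun Z => ((concat B (o X) (o' Z) (o'' Y)).compl₁₂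
        (preMul A B o o' (single φ) X Z) (preMul A B o' o'' (byLen (off J W)) Z Y))) (icut A X Y t)
      have h3 := elim₂_add (Q := plus A) (fun Z => ((concat B (o X) (o' Z) (o'' Y)).compl₁₂
        (preMul A B o o' (single φ) X Z) (ψ Z Y))) (fun Z => (-1 : k) • ((concat B (o X) (o' Z) (o'' Y)).compl₁₂
        (preMul A B o o' (single φ) X Z) (preMul A B o' o'' (byLen (off J W)) Z Y))) (icut A X Y t)
      rw [h2, neg_one_smul, ← sub_eq_add_neg] at h3
      exact sub_eq_zero.1 (h3.symm.trans ((Submodule.mem_bot k).1 h1))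
    · intro Z a l t' _ hl ht'
      have h4 : ψ Z Y t' = preMul A B o' o'' (byLen (off J W)) Z Y t' := by
        rw [hψ Z l t' hl ht', preMul_apply, byLen_apply _ ht'.mulAll_mem, off_of_notMem W (hJ.trunc hl).1]
      rw [Submodule.mem_bot, LinearMap.add_apply, LinearMap.add_apply, LinearMap.smul_apply,
        LinearMap.smul_apply, LinearMap.compl₁₂_apply, LinearMap.compl₁₂_apply, h4, neg_one_smul, add_neg_cancel]
  · rw [convMul_apply]
    rw [elim₂_cut_word (A := A) ht hJ _ ?_]
    · rw [LinearMap.compl₁₂_apply, preMul_apply, preMul_apply, byLen_apply _ ht.mulAll_mem]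
      rw [mulAll_one]
    · intro Z a l t' hl ht'
      have h5 : preMul A B o' o'' (byLen (off J W)) Z Y t' = 0 := by
        rw [preMul_apply, byLen_apply _ ht'.mulAll_mem, off_of_mem W hl]; rfl
      rw [LinearMap.compl₁₂_apply, h5, map_zero]

end words

section terms
variable {A B : GQuiver k} {f g h : FunData A B} {d e : ℤ} {o : A.Ob → B.Ob}

/-- `f_{a₁} ⊗ ⋯ ⊗ f_{aₙ} ⊗ ψ` -/
def blks (f : FunData A B) (as : List ℕ) (ψ : HomFam A B f.obj o) : HomFam A B f.obj o :=
  as.foldr (fun a χ => blk f.comp a ⍟ χ) ψ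

theorem block_eq {o o' o'' : A.Ob → B.Ob} (r : Fam A B o o') (n : ℕ) (ψ : HomFam A B o' o'') (X Y : A.Ob) :
    block r n (fun Z => ψ Z Y) X = (blk r n ⍟ ψ) X Y :=
  tconv_eq (fun X Y => r X Y ∘ₗ lenProj A n X Y) ψ X Y

theorem blocks_eq (f : FunData A B) (ψ : HomFam A B f.obj o) (as : List ℕ) (X Y : A.Ob) :
    blocks f (fun Z => ψ Z Y) as X = blks f as ψ X Y := by
  induction as generalizing X with
  | nil => rfl
  | cons a as ih =>
    rw [blocks, show blocks f (fun Z => ψ Z Y) as = fun Z => blks f as ψ Z Y from funext ih]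
    exact block_eq f.comp a _ X Y

/-- `h_{e₁} ⊗ ⋯ ⊗ h_{e_γ}` -/
def termE (h : FunData A B) (l : List ℕ) : HomFam A B h.obj h.obj := blks h l (epsFam h.obj)

/-- `g_{c₁} ⊗ ⋯ ⊗ g_{c_β} ⊗ p_t ⊗ h_{e₁} ⊗ ⋯ ⊗ h_{e_γ}` -/
def termP (g h : FunData A B) (e : ℤ) (p : Fam A B g.obj h.obj) (q : List ℕ × ℕ × List ℕ) : HomFam A B g.obj h.obj :=
  blks g q.1 (blk p q.2.1 ⍟ sgnFam e (termE h q.2.2))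

/-- `f_{a₁} ⊗ ⋯ ⊗ f_{a_α} ⊗ r_i ⊗ g_{c₁} ⊗ ⋯ ⊗ g_{c_β} ⊗ p_t ⊗ h_{e₁} ⊗ ⋯ ⊗ h_{e_γ}` -/
def termT (f g h : FunData A B) (d e : ℤ) (r : Fam A B f.obj g.obj) (p : Fam A B g.obj h.obj) (q : Idx) :
    HomFam A B f.obj h.obj :=
  blks f q.a (blk r q.i ⍟ sgnFam d (termP g h e p (q.c, q.t, q.e)))

theorem explicitTerm_eq (r : Fam A B f.obj g.obj) (p : Fam A B g.obj h.obj) (q : Idx) (X Y : A.Ob) :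
    explicitTerm f g h d e r p q X Y = termT f g h d e r p q X Y := by
  have h1 : (fun Z => blocks h (fun U => eps h.obj U) q.e Z ∘ₗ A.sgn e Z Y) =
      fun Z => sgnFam e (termE h q.e) Z Y :=
    funext fun Z => congrArg (fun φ => φ ∘ₗ A.sgn e Z Y) (blocks_eq h (epsFam h.obj) q.e Z Y)
  have h2 : (fun V => blocks g (block p q.t (fun Z => blocks h (fun U => eps h.obj U) q.e Z ∘ₗ A.sgn e Z Y)) q.c V ∘ₗ
      A.sgn d V Y) = fun V => sgnFam d (termP g h e p (q.c, q.t, q.e)) V Y := by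
    funext V
    rw [h1, show block p q.t (fun Z => sgnFam e (termE h q.e) Z Y) =
      fun V => (blk p q.t ⍟ sgnFam e (termE h q.e)) V Y from funext fun V => block_eq p q.t _ V Y]
    exact congrArg (fun φ => φ ∘ₗ A.sgn d V Y) (blocks_eq g _ q.c V Y)
  rw [explicitTerm, h2, show block r q.i (fun V => sgnFam d (termP g h e p (q.c, q.t, q.e)) V Y) =
      fun V => (blk r q.i ⍟ sgnFam d (termP g h e p (q.c, q.t, q.e))) V Y from funext fun V => block_eq r q.i _ V Y]
  exact blocks_eq f _ q.a X Y

variable (J : Set ℕ)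

def sumE (h : FunData A B) (m : ℕ) : HomFam A B h.obj h.obj := ∑ᶠ l ∈ {l | IdxE J m l}, termE h l

def sumP (g h : FunData A B) (e : ℤ) (p : Fam A B g.obj h.obj) (m : ℕ) : HomFam A B g.obj h.obj :=
  ∑ᶠ q ∈ {q | IdxP J m q}, termP g h e p q

def sumT (f g h : FunData A B) (d e : ℤ) (r : Fam A B f.obj g.obj) (p : Fam A B g.obj h.obj) (m : ℕ) :
    HomFam A B f.obj h.obj := ∑ᶠ q ∈ {q | IdxT J m q}, termT f g h d e r p q

variable {J}

theorem sumE_zero (h : FunData A B) : sumE J h 0 = epsFam h.obj := by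
  rw [sumE, setOf_idxE_zero, finsum_mem_singleton]
  rfl

open Classical in
theorem sum_filter_eq_zero_or {M : Type*} [AddCommMonoid M] (h0 : 0 ∈ J) (G : ℕ → M) {m : ℕ} (hm : 0 < m) :
    ∑ j ∈ (Finset.range m).filter (fun j => j = 0 ∨ j ∉ J), G j =
      G 0 + ∑ j ∈ (Finset.range m).filter (fun j => j ∉ J), G j := by
  have h1 : (Finset.range m).filter (fun j => j = 0 ∨ j ∉ J) = insert 0 ((Finset.range m).filter (fun j => j ∉ J)) := by
    ext j
    simp only [Finset.mem_filter, Finset.mem_insert, Finset.mem_range]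
    constructor
    · rintro ⟨h1, rfl | h2⟩
      · exact .inl rfl
      · exact .inr ⟨h1, h2⟩
    · rintro (rfl | ⟨h1, h2⟩)
      · exact ⟨hm, .inl rfl⟩
      · exact ⟨h1, .inr h2⟩
  rw [h1, Finset.sum_insert]
  simp [h0]

theorem sumE_rec (hh : h.Unital0) (h0 : 0 ∈ J) {m : ℕ} (hm : 0 < m) {X Y : A.Ob} {x : A.T X Y} (hx : x ∈ Tlen A m X Y) :
    sumE J h m X Y x = single h.comp X Y x + (single h.comp ⍟ byLen (off J (sumE J h))) X Y x := by
  classical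
  have h1 := (finsum_idxE (J := J) (termE h) (fun a => (convMul (blk h.comp a)).toAddMonoidHom) (fun _ _ => rfl) hm
    (fun j _ => finite_idxE j)).2
  rw [sum_filter_eq_zero_or h0 _ hm] at h1
  rw [convMul_byLen_off_unital J hh _ hx, ← blk_apply h.comp hx, ← LinearMap.add_apply, ← Pi.add_apply, ← Pi.add_apply]
  refine LinearMap.congr_fun (congrFun (congrFun (h1.trans ?_) X) Y) x
  refine congrArg₂ (fun a b : HomFam A B h.obj h.obj => a + b) ?_ rfl
  exact (congrArg (convMul (blk h.comp (m - 0))) (sumE_zero h)).trans (mul_epsFam _)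

theorem sumP_rec (hg : g.Unital0) (h0 : 0 ∈ J) (p : Fam A B g.obj h.obj) {m : ℕ} {X Y : A.Ob} {x : A.T X Y}
    (hx : x ∈ Tlen A m X Y) : sumP J g h e p m X Y x = single p X Y x +
      (single p ⍟ byLen (off J fun j => sgnFam e (sumE J h j))) X Y x +
      (single g.comp ⍟ byLen (off J (sumP J g h e p))) X Y x := by
  classical
  have h1 := (finsum_idxP (J := J) (m := m) (termP g h e p) (fun a => (convMul (blk g.comp a)).toAddMonoidHom) (termE h)
    (fun t => ((convMul (blk p t)) ∘ₗ (sgnFam e)).toAddMonoidHom) (fun _ _ => rfl) (fun _ _ _ => rfl)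
    (fun j _ => finite_idxP j)).2
  rw [sum_filter_eq_zero_or h0 _ m.succ_pos] at h1
  rw [convMul_byLen_off_unital J hg _ hx, convMul_byLen_off J _ _ hx, ← blk_apply p hx, ← LinearMap.add_apply,
    ← LinearMap.add_apply, ← Pi.add_apply, ← Pi.add_apply, ← Pi.add_apply, ← Pi.add_apply]
  refine LinearMap.congr_fun (congrFun (congrFun (h1.trans ?_) X) Y) x
  refine congrArg₂ (fun a b : HomFam A B g.obj h.obj => a + b) (congrArg₂ (fun a b : HomFam A B g.obj h.obj => a + b) ?_ rfl) rfl
  exact (congrArg (fun ψ => blk p (m - 0) ⍟ sgnFam e ψ) (sumE_zero h)).trans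
    ((congrArg (convMul (blk p m)) (sgnFam_eps e)).trans (mul_epsFam _))

theorem sumT_rec (hf : f.Unital0) (r : Fam A B f.obj g.obj) (p : Fam A B g.obj h.obj) {m : ℕ} {X Y : A.Ob} {x : A.T X Y}
    (hx : x ∈ Tlen A m X Y) : sumT J f g h d e r p m X Y x =
      (single r ⍟ byLen (off J fun j => sgnFam d (sumP J g h e p j))) X Y x +
      (single f.comp ⍟ byLen (off J (sumT J f g h d e r p))) X Y x := by
  classical
  have h1 := (finsum_idxT (J := J) (m := m) (termT f g h d e r p) (fun a => (convMul (blk f.comp a)).toAddMonoidHom)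
    (termP g h e p) (fun t => ((convMul (blk r t)) ∘ₗ (sgnFam d)).toAddMonoidHom) (fun _ _ => rfl) (fun _ _ => rfl)
    (fun j _ => finite_idxT j)).2
  rw [convMul_byLen_off_unital J hf _ hx, convMul_byLen_off J _ _ hx, ← LinearMap.add_apply, ← Pi.add_apply, ← Pi.add_apply]
  exact LinearMap.congr_fun (congrFun (congrFun h1 X) Y) x

end terms

section shape
variable {A : GQuiver k}

theorem lenProj_mem_Tlen (n : ℕ) {X Y : A.Ob} (x : A.T X Y) : lenProj A n X Y x ∈ Tlen A n X Y := by
  refine inj_induction (motive := fun x => lenProj A n X Y x ∈ Tlen A n X Y) ?_ ?_ ?_ x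
  · rw [map_zero]; exact Submodule.zero_mem _
  · intro a b ha hb; rw [map_add]; exact Submodule.add_mem _ ha hb
  · intro p s
    rw [lenProj, lift_inj]
    split_ifs with h
    · rw [← h]; exact inj_mem_Tlen p s
    · exact Submodule.zero_mem _

theorem HasShape.pos {X Y : A.Ob} {ks : List ℕ} {t : (plus A).T X Y} (ht : HasShape A Y ks t) : ∀ i ∈ ks, 0 < i := by
  induction ht with
  | nil => simp
  | cons hn hv hw ih =>
    intro i hi
    rcases List.mem_cons.1 hi with rfl | hi
    · exact hn
    · exact ih i hi

theorem HasShape.mem_span_word {X Y : A.Ob} {ks : List ℕ} {t : (plus A).T X Y} (ht : HasShape A Y ks t) :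
    t ∈ Submodule.span k {t : (plus A).T X Y | Word A Set.univ Y ks t} := by
  induction ht with
  | nil => exact Submodule.subset_span .one
  | @cons X Z n ns v w hn hv hw ih =>
    have h1 : ∀ (p : Chain Z X) (s : A.tens p), p.length = n → (plus A).cons X Z Y (ofT A Set.univ X Z (A.inj p s)) w ∈
        Submodule.span k {t : (plus A).T X Y | Word A Set.univ Y (n :: ns) t} := by
      rintro p s rfl
      refine (Submodule.span_le (p := (Submodule.span k {t : (plus A).T X Y | Word A Set.univ Y (p.length :: ns) t}).comap
        ((plus A).cons X Z Y (ofT A Set.univ X Z (A.inj p s))))).2 ?_ ih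
      intro w' hw'
      exact Submodule.subset_span (.cons p (Chain.good_univ_of_pos hn) s hw')
    have h2 := Tlen_le (A := A) (N := (Submodule.span k {t : (plus A).T X Y | Word A Set.univ Y (n :: ns) t}).comap
      (((plus A).cons X Z Y).flip w ∘ₗ ofT A Set.univ X Z)) h1 (hv ▸ lenProj_mem_Tlen n (toT A Set.univ X Z v))
    have h3 : ofT A Set.univ X Z (toT A Set.univ X Z v) = v := ofT_toT v
    have h4 : (plus A).cons X Z Y (ofT A Set.univ X Z (toT A Set.univ X Z v)) w ∈
      Submodule.span k {t : (plus A).T X Y | Word A Set.univ Y (n :: ns) t} := h2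
    rwa [h3] at h4

end shape

section explicit
variable {A B : GQuiver k} {f g h : FunData A B} {d e : ℤ} {J : Set ℕ} {S : Set A.Ob}

theorem Word.sum_pos {X Y : A.Ob} {ks : List ℕ} {t : (plus A).T X Y} (ht : Word A S Y ks t) (hks : ks ≠ []) :
    0 < ks.sum := by
  obtain ⟨i, hi⟩ := List.exists_mem_of_ne_nil ks hks
  exact (ht.pos i hi).trans_le (List.le_sum_of_mem hi)

theorem barE_word (hh : h.Unital0) {Y : A.Ob} {ks : List ℕ} (hks : ks ≠ []) (hJ : Compat J ks) {X : A.Ob}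
    {t : (plus A).T X Y} (ht : Word A S Y ks t) : barE h X Y t = sumE J h ks.sum X Y (mulAll A X Y t) := by
  induction hn : ks.sum using Nat.strong_induction_on generalizing ks X t with
  | _ n ih =>
    subst hn
    have h1 := LinearMap.congr_fun (congrFun (congrFun (barE_recursion hh) X) Y) t
    have h2 := icMul_word ht hJ h.comp (sumE J h) (barE h)
      (fun X l t' hl ht' => ih _ hl.sum_lt hl.ne_nil (hJ.trunc hl).2 ht' rfl)
    have h3 : single h.comp X X (A.one X) = 0 := by
      rw [single_apply, hh X, map_zero, LinearMap.zero_apply]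
    rw [h3, map_zero, LinearMap.zero_apply, sub_zero] at h2
    rw [sumE_rec hh hJ.zero_mem (ht.sum_pos hks) ht.mulAll_mem]
    exact h1.trans (congrArg (fun b : B.T (h.obj X) (h.obj Y) => single h.comp X Y (mulAll A X Y t) + b) h2)

theorem sgn_barE_word (hh : h.Unital0) (e : ℤ) {Y : A.Ob} {ks : List ℕ} (hks : ks ≠ []) (hJ : Compat J ks) {X : A.Ob}
    {t : (plus A).T X Y} (ht : Word A S Y ks t) :
    sgnFam (P := plus A) e (barE h) X Y t = sgnFam e (sumE J h ks.sum) X Y (mulAll A X Y t) :=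
  (barE_word hh hks hJ (ht.sgn e)).trans (congrArg (sumE J h ks.sum X Y) (mulAll_sgn e t))

/-- the map that completes `p̄` on words whose length is not in `J` -/
def barPC (g h : FunData A B) (e : ℤ) (p : Fam A B g.obj h.obj) : HomFam (plus A) B g.obj h.obj :=
  barP g h e p + lactMul (P := plus A) (atOne (P := A) (single p)) (sgnFam (P := plus A) e (barE h))

theorem barPE_eq (p : Fam A B g.obj h.obj) : barPE g h d e p = sgnFam (P := plus A) d (barPC g h e p) := by
  rw [barPC, map_add, barPE, add_comm d e, ← sgnFam_sgnFam]
  rfl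

theorem barPC_word (hg : g.Unital0) (hh : h.Unital0) (p : Fam A B g.obj h.obj) {Y : A.Ob} {ks : List ℕ} (hks : ks ≠ [])
    (hJ : Compat J ks) (hK : ks.sum ∉ J) {X : A.Ob} {t : (plus A).T X Y} (ht : Word A S Y ks t) :
    barPC g h e p X Y t = sumP J g h e p ks.sum X Y (mulAll A X Y t) := by
  induction hn : ks.sum using Nat.strong_induction_on generalizing ks X t with
  | _ n ih =>
    subst hn
    have h1 := LinearMap.congr_fun (congrFun (congrFun (barP_recursion (d := e) hg hh p) X) Y) t
    have h2 := icMul_word ht hJ p (fun j => sgnFam e (sumE J h j)) (sgnFam (P := plus A) e (barE h))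
      (fun X l t' hl ht' => sgn_barE_word hh e hl.ne_nil (hJ.trunc hl).2 ht')
    have h3 := icMul_word ht hJ g.comp (sumP J g h e p) (barPC g h e p)
      (fun X l t' hl ht' => ih _ hl.sum_lt hl.ne_nil (hJ.trunc hl).2 (hJ.trunc hl).1 ht' rfl)
    have h4 : single g.comp X X (A.one X) = 0 := by
      rw [single_apply, hg X, map_zero, LinearMap.zero_apply]
    rw [h4, map_zero, LinearMap.zero_apply, sub_zero] at h3
    rw [off_of_notMem _ hK, ← sgn_barE_word hh e hks hJ ht] at h2
    rw [sumP_rec hg hJ.zero_mem p ht.mulAll_mem, ← h3, ← sub_add_cancel ((single p ⍟ _) X Y _) _, ← h2]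
    have h5 : ∀ {M : Type u} [AddCommGroup M] {P a b c d : M}, P = a + b + c → P + d = a + (b + d) + c := by
      rintro M _ P a b c d rfl
      abel
    exact h5 h1

theorem barPE_word (hg : g.Unital0) (hh : h.Unital0) (p : Fam A B g.obj h.obj) {Y : A.Ob} {ks : List ℕ} (hks : ks ≠ [])
    (hJ : Compat J ks) (hK : ks.sum ∉ J) {X : A.Ob} {t : (plus A).T X Y} (ht : Word A S Y ks t) :
    barPE g h d e p X Y t = sgnFam d (sumP J g h e p ks.sum) X Y (mulAll A X Y t) := by
  have h1 := barPC_word (e := e) hg hh p hks hJ hK (ht.sgn d)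
  rw [mulAll_sgn] at h1
  exact (LinearMap.congr_fun (congrFun (congrFun (barPE_eq p) X) Y) t).trans h1

theorem homRT_word (hf : f.Unital0) (hg : g.Unital0) (hh : h.Unital0) (r : Fam A B f.obj g.obj)
    (p : Fam A B g.obj h.obj) {Y : A.Ob} {ks : List ℕ} (hks : ks ≠ []) (hJ : Compat J ks) {X : A.Ob}
    {t : (plus A).T X Y} (ht : Word A S Y ks t) :
    (ks.sum ∉ J → (homRT f g h d e r p + lactMul (P := plus A) (atOne (P := A) (single r)) (barPE g h d e p) :
      HomFam (plus A) B f.obj h.obj) X Y t = sumT J f g h d e r p ks.sum X Y (mulAll A X Y t)) ∧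
    (ks.sum ∈ J → homRT f g h d e r p X Y t = sumT J f g h d e r p ks.sum X Y (mulAll A X Y t)) := by
  induction hn : ks.sum using Nat.strong_induction_on generalizing ks X t with
  | _ n ih =>
    subst hn
    have h1 := LinearMap.congr_fun (congrFun (congrFun (homRT_recursion (d := d) (e := e) hf hg hh r p) X) Y) t
    have h2 := icMul_word ht hJ r (fun j => sgnFam d (sumP J g h e p j)) (barPE g h d e p)
      (fun X l t' hl ht' => barPE_word hg hh p hl.ne_nil (hJ.trunc hl).2 (hJ.trunc hl).1 ht')
    have h3 := icMul_word ht hJ f.comp (sumT J f g h d e r p)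
      (homRT f g h d e r p + lactMul (P := plus A) (atOne (P := A) (single r)) (barPE g h d e p))
      (fun X l t' hl ht' => (ih _ hl.sum_lt hl.ne_nil (hJ.trunc hl).2 ht' rfl).1 (hJ.trunc hl).1)
    have h4 : single f.comp X X (A.one X) = 0 := by
      rw [single_apply, hf X, map_zero, LinearMap.zero_apply]
    rw [h4, map_zero, LinearMap.zero_apply, sub_zero] at h3
    rw [sumT_rec hf r p ht.mulAll_mem, ← h3]
    constructor
    · intro hK
      rw [off_of_notMem _ hK, ← barPE_word hg hh p hks hJ hK ht] at h2
      rw [← sub_add_cancel ((single r ⍟ _) X Y _) _, ← h2]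
      have h5 : ∀ {M : Type u} [AddCommGroup M] {P b c d : M}, P = b + c → P + d = b + d + c := by
        rintro M _ P b c d rfl
        abel
      exact h5 h1
    · intro hK
      have h6 : concat B (f.obj X) (g.obj X) (h.obj Y) (single r X X (A.one X))
          (off J (fun j => sgnFam d (sumP J g h e p j)) ks.sum X Y (mulAll A X Y t)) = 0 := by
        rw [off_of_mem _ hK]; exact map_zero _
      rw [h6, sub_zero] at h2
      rw [← h2]
      exact h1

theorem homR_one (hf : f.Unital0) (hg : g.Unital0) (hh : h.Unital0) {r : Fam A B f.obj g.obj} {p : Fam A B g.obj h.obj}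
    (X : A.Ob) : homR f g h d e r p X X ((plus A).one X) = 0 :=
  toT_injective ((homRT_one hf hg hh r p X).trans (map_zero _).symm)

theorem homR_hasShape (hf : f.Unital0) (hg : g.Unital0) (hh : h.Unital0) {r : Fam A B f.obj g.obj}
    {p : Fam A B g.obj h.obj} {X Y : A.Ob} {ks : List ℕ} {t : (plus A).T X Y} (hks : ks ≠ []) (ht : HasShape A Y ks t) :
    homR f g h d e r p X Y t = ofT B Set.univ _ _ (∑ᶠ q ∈ Q ks, explicitTerm f g h d e r p q X Y (mulAll A X Y t)) := by
  have hQ : Q ks = {q | IdxT (tailSums ks) ks.sum q} := Set.ext fun q => mem_Q_iff ht.pos q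
  have h1 : ∑ᶠ q ∈ Q ks, explicitTerm f g h d e r p q X Y (mulAll A X Y t) =
      sumT (tailSums ks) f g h d e r p ks.sum X Y (mulAll A X Y t) := by
    rw [hQ, sumT]
    let ev : HomFam A B f.obj h.obj →+ B.T (f.obj X) (h.obj Y) :=
      { toFun := fun ψ => ψ X Y (mulAll A X Y t), map_zero' := rfl, map_add' := fun _ _ => rfl }
    refine Eq.trans ?_ (ev.map_finsum_mem (termT f g h d e r p) (finite_idxT ks.sum)).symm
    exact finsum_mem_congr rfl fun q _ => by rw [explicitTerm_eq]; rfl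
  have h2 : t ∈ LinearMap.eqLocus (homRT f g h d e r p X Y)
      (sumT (tailSums ks) f g h d e r p ks.sum X Y ∘ₗ mulAll A X Y) := by
    refine Submodule.span_le.2 ?_ ht.mem_span_word
    intro t' ht'
    exact (homRT_word hf hg hh r p hks (compat_tailSums ks) ht').2 ⟨0, rfl⟩
  rw [h1, ← ofT_toT (homR f g h d e r p X Y t)]
  exact congrArg _ h2

end explicit

end AInf

end

theorem mainTheorem5 (k : Type u) [CommRing k] :
    -- the bar construction: categories, functors and transformations restrict to the D-subquivers
    (∀ A : AInf.AInfCat k, (AInf.barOps A.toOps).IsAInf ∧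
      ∀ S : Set A.Ob, AInf.Restricts (A := A.toGQuiver) (B := A.toGQuiver)
        (o := fun X => X) (o' := fun X => X) S S (AInf.barOps A.toOps).b) ∧
    (∀ (A B : AInf.AInfCat k) (f : AInf.AInfFun A B),
      AInf.IsAInfFun (A := AInf.barOps A.toOps) (B := AInf.barOps B.toOps)
        (AInf.barFun f.toFunData) ∧
      ∀ (S : Set A.Ob) (S' : Set B.Ob), (∀ X ∈ S, f.obj X ∈ S') →
        AInf.Restricts S S' (AInf.barFun f.toFunData).comp) ∧
    (∀ (A B : AInf.AInfCat k) (f g : AInf.AInfFun A B) (d : ℤ) (r : AInf.Trans f g d),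
      AInf.Homog d (AInf.barTrans f.toFunData g.toFunData d r.1) ∧
      ∀ (S : Set A.Ob) (S' : Set B.Ob), (∀ X ∈ S, f.obj X ∈ S') → (∀ X ∈ S, g.obj X ∈ S') →
        AInf.Restricts S S' (AInf.barTrans f.toFunData g.toFunData d r.1)) ∧
    -- D is a strict 𝒦-2-functor, and a strict 2-functor after taking H⁰
    (∃ hD : AInf.DWellDefined k, ∃ hF : (AInf.Dmap hD).IsStrict, (AInf.K2Map.H0 hF).IsStrict) ∧
    -- the homotopy R
    (∀ (A B : AInf.AInfCat k) (f g h : AInf.AInfFun A B) (d e : ℤ)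
      (r : AInf.Trans f g d) (p : AInf.Trans g h e),
      let F := f.toFunData
      let G := g.toFunData
      let H := h.toFunData
      let R := AInf.homR F G H d e r.1 p.1
      let rp := AInf.B2 (A := A.toOps) (B := B.toOps) F G H d e r.1 p.1
      let dr := AInf.B1 (A := A.toOps) (B := B.toOps) F G d r.1
      let dp := AInf.B1 (A := A.toOps) (B := B.toOps) G H e p.1
      -- the components of R
      (∀ X : A.Ob, R X X ((AInf.plus A.toGQuiver).one X) = 0) ∧
      (∀ (X Y : A.Ob) (ks : List ℕ) (t : (AInf.plus A.toGQuiver).T X Y), ks ≠ [] →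
        AInf.HasShape A.toGQuiver Y ks t →
        R X Y t = AInf.ofT B.toGQuiver Set.univ _ _
          (∑ᶠ q ∈ AInf.Q ks,
            AInf.explicitTerm F G H d e r.1 p.1 q X Y (AInf.mulAll A.toGQuiver X Y t))) ∧
      AInf.Homog (d + e) R ∧
      -- R is the homotopy between the two ways of composing
      AInf.barTrans F H (d + e + 1) rp -
          AInf.B2 (A := AInf.barOps A.toOps) (B := AInf.barOps B.toOps)
            (AInf.barFun F) (AInf.barFun G) (AInf.barFun H) d e
            (AInf.barTrans F G d r.1) (AInf.barTrans G H e p.1) =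
        AInf.B1 (A := AInf.barOps A.toOps) (B := AInf.barOps B.toOps)
            (AInf.barFun F) (AInf.barFun H) (d + e) R -
          (AInf.homR F G H d (e + 1) r.1 dp +
            (e.negOnePow : ℤ) • AInf.homR F G H (d + 1) e dr p.1) ∧
      -- R restricts to the D-subcategories, where it is again the homotopy
      (∀ (S : Set A.Ob) (S' : Set B.Ob), (∀ X ∈ S, f.obj X ∈ S') → (∀ X ∈ S, g.obj X ∈ S') →
        (∀ X ∈ S, h.obj X ∈ S') →
        AInf.Restricts S S' R ∧
        AInf.Homog (d + e) (AInf.DhomR S S' F G H d e r.1 p.1) ∧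
        AInf.DTrans S S' F H (d + e + 1) rp -
            AInf.B2 (A := AInf.DOps A.toOps S) (B := AInf.DOps B.toOps S')
              (AInf.DFunData S S' F) (AInf.DFunData S S' G) (AInf.DFunData S S' H) d e
              (AInf.DTrans S S' F G d r.1) (AInf.DTrans S S' G H e p.1) =
          AInf.B1 (A := AInf.DOps A.toOps S) (B := AInf.DOps B.toOps S')
              (AInf.DFunData S S' F) (AInf.DFunData S S' H) (d + e)
              (AInf.DhomR S S' F G H d e r.1 p.1) -
            (AInf.DhomR S S' F G H d (e + 1) r.1 dp +
              (e.negOnePow : ℤ) • AInf.DhomR S S' F G H (d + 1) e dr p.1))) := by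
  refine ⟨?_, ?_, ?_, ?_, ?_⟩
  · exact fun A => ⟨AInf.barOps_isAInf A.isAInf, fun S => AInf.barOps_restricts S⟩
  · exact fun A B f => ⟨AInf.barFun_isFun A.isAInf B.isAInf f.isFun, fun S S' hS => AInf.barFun_restricts f.isFun.comp_one hS⟩
  · exact fun A B f g d r => ⟨AInf.barTrans_homog f.isFun.homog g.isFun.homog r.2,
      fun S S' hf hg => AInf.barTrans_restricts f.isFun.comp_one g.isFun.comp_one hf hg r.1⟩
  · exact ⟨AInf.dWellDefined k, AInf.DFunctor_isStrict k, AInf.K2Map.H0_isStrict _⟩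
  intro A B f g h d e r p
  have hf := f.isFun.comp_one
  have hg := g.isFun.comp_one
  have hh := h.isFun.comp_one
  refine ⟨?_, ?_, ?_, ?_, ?_⟩
  · exact AInf.homR_one hf hg hh
  · exact fun X Y ks t hks ht => AInf.homR_hasShape hf hg hh hks ht
  · exact AInf.homR_homog f.isFun.homog g.isFun.homog h.isFun.homog r.2 p.2
  · exact AInf.barTrans_B2_sub A.isAInf B.isAInf f.isFun g.isFun h.isFun r.2 p.2
  intro S S' hfS hgS hhS
  refine ⟨?_, ?_, ?_⟩
  · exact AInf.homR_restricts hf hg hh hfS hgS hhS r.1 p.1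
  · exact AInf.DhomR_homog f.isFun g.isFun h.isFun r.2 p.2
  · exact AInf.DTrans_B2_sub A.isAInf B.isAInf f.isFun g.isFun h.isFun hfS hgS hhS r.2 p.2
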